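/- Let $n\ge 2$ and let $\mathcal G=(\mathcal G_{i\bar j})$ be a constant positive definite Hermitian matrix, with $\mathcal G^{i\bar j}$ the raised coefficients ($\mathcal G^{i\bar j}\mathcal G_{k\bar j}=\delta^i_k$) and $\omega_{\mathcal G}=\sqrt{-1}\,\mathcal G_{i\bar j}\,dz^i\wedge\overline{dz^j}$. Subscripts denote derivatives $\partial/\partial z^i$, $\partial/\partial\overline{z^j}$. **Definitions.** Let $\Omega\subset\mathbb C^n$ be bounded and open. A smooth real function $\Psi$ is *strongly $\mathfrak q\mathbb C$-convex* on $\Omega$ if at every ${\bf p}\in\Omega$ one has $\nabla\Psi({\bf p})\ne0$ and the second order Taylor expansion at ${\bf p}$ of $\Psi$ restricted to the complex tangent plane of its level set is strongly convex, i.e. $\Psi_{i\bar j}v^i\overline{v^j}+\mathrm{Re}(\Psi_{ij}v^iv^j)>0$ at ${\bf p}$ for all $v\neq0$ with $\Psi_i({\bf p})v^i=0$. The *robustness of $\mathfrak q\mathbb C$-convexity* of $\Phi$ is greater than $\delta$ if $\Phi-q$ is strongly $\mathfrak q\mathbb C$-convex on $\Omega$ for every pluriharmonic polynomial $q$ of degree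 at most $2$ with $|\nabla q|_{\mathcal G}=(\mathcal G^{i\bar j}q_i\overline{q_j})^{1/2}\le\delta$ on $\Omega$. For a function $\Phi$ with invertible complex Hessian $(\Phi_{i\bar j})$ let $\Phi^{i\bar j}$ be defined by $\Phi^{i\bar j}\Phi_{k\bar j}=\delta^i_k$ and put $$L^{p\bar q}=\varepsilon^2\Phi^{p\bar v}\mathcal G_{u\bar v}\Phi^{u\bar q},\quad S=\varepsilon\,\Phi_i\Phi_{\bar j}\Phi^{i\bar j},\quad W=\Phi_{i\bar j}\mathcal G^{i\bar j},\quad V=\Phi_{ij}\mathcal G^{j\bar k}\,\overline{\Phi_{kl}}\,\mathcal G^{i\bar l},\quad |z|^2_{\mathcal G}=\mathcal G_{i\bar j}z^i\overline{z^j}.$$ In complex linear coordinates $(z^1,\dots,z^{n-1},\tau)$ on $\mathbb C^n$, where $\Phi_\tau\ne0$, put, for $\alpha,\beta\in\{1,\dots,n-1\}$, $$\mathcal A_{\alpha\bar\beta}=\Phi_{\alpha\bar\beta}-\frac{\Phi_\alpha}{\Phi_\tau}\Phi_{\tau\bar\beta}-\frac{\Phi_{\bar\beta}}{\Phi_{\bar\tau}}\Phi_{\alpha\bar\tau}+\frac{\Phi_\alpha\Phi_{\bar\beta}}{|\Phi_\tau|^2}\Phi_{\tau\bar\tau},\qquad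 \mathcal B_{\alpha\beta}=\Phi_{\alpha\beta}-\frac{\Phi_\alpha}{\Phi_\tau}\Phi_{\tau\beta}-\frac{\Phi_\beta}{\Phi_\tau}\Phi_{\alpha\tau}+\frac{\Phi_\alpha\Phi_\beta}{(\Phi_\tau)^2}\Phi_{\tau\tau},$$ and $\mathcal K=\mathcal B\,\overline{\mathcal A^{-1}}\;\overline{\mathcal B}\,\mathcal A^{-1}$. **Proposition 3.1.** For every $\delta>0$ and all constants $D$, $C_2$ there is $\varepsilon_0>0$, depending only on $n,\mathcal G,\delta,D,C_2$, with the following property. Let $0<\varepsilon<\varepsilon_0$, let $\Omega\subset\mathbb C^n$ be a bounded open set of diameter at most $D$, and let $\Phi$ be a smooth real function on $\Omega$ whose first and second derivatives are bounded in norm by $C_2$, which satisfies $$(\sqrt{-1}\,\partial\bar\partial\Phi)^n=\varepsilon\,(\sqrt{-1}\,\partial\bar\partial\Phi)^{n-1}\wedge\omega_{\mathcal G}\quad\text{in }\Omega,$$ and whose robustness of $\mathfrak q\mathbb C$-convexity is greater than $\delta$. Then at every point of $\Omega$ the matrix $(\Phi_{i\bar j})$ is positive definite, $S>0$, and $$L^{p\bar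 q}\Big(-\log S+\sqrt\varepsilon\,\big[W+|z|^2_{\mathcal G}\big]\Big)_{p\bar q}\ \ge\ 0 ;$$ and, for any complex linear coordinates $(z^\alpha,\tau)$, at every point of $\Omega$ with $\Phi_\tau\neq0$ the matrix $\mathcal A$ is positive definite, $I-\mathcal K$ is invertible, and $$L^{p\bar q}\Big(\mathrm{tr}\,[I-\mathcal K]^{-1}+\sqrt\varepsilon\,\big(W+|z|^2_{\mathcal G}\big)+\varepsilon^{3/4}\,V\Big)_{p\bar q}\ \ge\ 0 .$$ -/

import Mathlib

open scoped ComplexOrder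

noncomputable section

/-! ## Wirtinger calculus on `ℂⁿ` -/

/-- `ℂⁿ` with its Euclidean norm. -/
abbrev Cn (n : ℕ) := EuclideanSpace ℂ (Fin n)

/-- The derivative of type `(1,0)` along `v`: `∂_v f = (D f(v) - i D f(i v)) / 2`.
For `v = e_k` this is `∂f/∂z^k`; if `w` are linear coordinates with coordinate basis `t`,
it is `∂f/∂w^a` for `v = t a`. -/
def dHol {n : ℕ} (v : Cn n) (f : Cn n → ℂ) (z : Cn n) : ℂ :=
  (fderiv ℝ f z v - Complex.I * fderiv ℝ f z (Complex.I • v)) / 2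

/-- The derivative of type `(0,1)` along `v`; for `v = e_k` this is `∂f/∂z̄^k`. -/
def dAnti {n : ℕ} (v : Cn n) (f : Cn n → ℂ) (z : Cn n) : ℂ :=
  (fderiv ℝ f z v + Complex.I * fderiv ℝ f z (Complex.I • v)) / 2

/-- A real function, viewed as a complex-valued one. -/
def toC {n : ℕ} (f : Cn n → ℝ) : Cn n → ℂ := fun z => (f z : ℂ)

/-- The standard coordinate vectors of `ℂⁿ`. -/
def stdFrame (n : ℕ) : Fin n → Cn n := fun i => EuclideanSpace.single i 1

/-- `(Φ_a)_a` in the linear coordinates with coordinate vectors `t`. -/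
def grad {n : ℕ} (t : Fin n → Cn n) (Φ : Cn n → ℝ) (z : Cn n) : Fin n → ℂ :=
  fun a => dHol (t a) (toC Φ) z

/-- The complex Hessian `(Φ_{a b̄})` in the linear coordinates with coordinate vectors `t`. -/
def mixedHess {n : ℕ} (t : Fin n → Cn n) (Φ : Cn n → ℝ) (z : Cn n) :
    Matrix (Fin n) (Fin n) ℂ :=
  Matrix.of fun a b => dHol (t a) (dAnti (t b) (toC Φ)) z

/-- The holomorphic Hessian `(Φ_{a b})` in the linear coordinates with coordinate vectors `t`. -/
def holHess {n : ℕ} (t : Fin n → Cn n) (Φ : Cn n → ℝ) (z : Cn n) :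
    Matrix (Fin n) (Fin n) ℂ :=
  Matrix.of fun a b => dHol (t a) (dHol (t b) (toC Φ)) z

/-- Raised indices: for a Hermitian matrix `M = (M_{i j̄})`, `upper M i j` is `M^{i j̄}`,
determined by `∑ j, M^{i j̄} M_{k j̄} = δ_{i k}`. -/
def upper {n : ℕ} (M : Matrix (Fin n) (Fin n) ℂ) (i j : Fin n) : ℂ := M⁻¹ j i

/-! ## The Hessian quotient equation -/

/-- The exterior algebra over `ℂ` generated by `dz^1, …, dz^n, dz̄^1, …, dz̄^n`. -/
abbrev Forms (n : ℕ) := ExteriorAlgebra ℂ (Fin n ⊕ Fin n → ℂ)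

/-- The covector `dz^i`. -/
def dz {n : ℕ} (i : Fin n) : Forms n := ExteriorAlgebra.ι ℂ (Pi.single (Sum.inl i) 1)

/-- The covector `dz̄^i`. -/
def dzbar {n : ℕ} (i : Fin n) : Forms n := ExteriorAlgebra.ι ℂ (Pi.single (Sum.inr i) 1)

/-- The form `i ∑ M_{i j̄} dz^i ∧ dz̄^j`. For `M = (Φ_{i j̄})` it is `i∂∂̄Φ` and for a constant
metric `G` it is `ω_G`. -/
def formOf {n : ℕ} (M : Matrix (Fin n) (Fin n) ℂ) : Forms n :=
  Complex.I • ∑ i, ∑ j, M i j • (dz i * dzbar j)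

/-- `(i∂∂̄Φ)^n = ε (i∂∂̄Φ)^(n-1) ∧ ω_G` at every point of `Ω`. -/
def SolvesHessianQuotient {n : ℕ} (G : Matrix (Fin n) (Fin n) ℂ) (ε : ℝ) (Ω : Set (Cn n))
    (Φ : Cn n → ℝ) : Prop :=
  ∀ z ∈ Ω, formOf (mixedHess (stdFrame n) Φ z) ^ n =
    (ε : ℂ) • (formOf (mixedHess (stdFrame n) Φ z) ^ (n - 1) * formOf G)

/-! ## Quasi-`ℂ`-convexity and its robustness -/

/-- `Ψ` is strongly quasi-`ℂ`-convex at `p`: the gradient does not vanish, and the second order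
Taylor expansion of the restriction of `Ψ` to the complex tangent plane
`{p + v | ∑ Ψ_i(p) v^i = 0}` of the level set through `p`, whose quadratic part is
`Ψ_{i j̄} v^i v̄^j + Re (Ψ_{i j} v^i v^j)`, is strongly convex. -/
def StronglyQCConvexAt {n : ℕ} (Ψ : Cn n → ℝ) (p : Cn n) : Prop :=
  grad (stdFrame n) Ψ p ≠ 0 ∧
  ∀ v : Cn n, v ≠ 0 → ∑ i, grad (stdFrame n) Ψ p i * v i = 0 →
    0 < (∑ i, ∑ j, mixedHess (stdFrame n) Ψ p i j * v i * star (v j)).re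
      + (∑ i, ∑ j, holHess (stdFrame n) Ψ p i j * v i * v j).re

/-- `|∇f|_G² = G^{i j̄} f_i f_{j̄}` at `z`. -/
def gradNormSq {n : ℕ} (G : Matrix (Fin n) (Fin n) ℂ) (f : Cn n → ℝ) (z : Cn n) : ℝ :=
  (∑ i, ∑ j, upper G i j * grad (stdFrame n) f z i * star (grad (stdFrame n) f z j)).re

/-- Pluriharmonic polynomials of degree at most two: real parts of holomorphic ones. -/
def IsPluriharmonicQuadratic {n : ℕ} (q : Cn n → ℝ) : Prop :=
  ∃ (B : Matrix (Fin n) (Fin n) ℂ) (b : Fin n → ℂ) (c : ℂ),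
    ∀ z, q z = ((∑ i, ∑ j, B i j * z i * z j) + (∑ i, b i * z i) + c).re

/-- The robustness of quasi-`ℂ`-convexity of `Φ` on `Ω` is greater than `δ`: `Φ - q` is strongly
quasi-`ℂ`-convex on `Ω` for all pluriharmonic quadratic polynomials `q` with `|∇q|_G ≤ δ`
on `Ω`. -/
def RobustnessGT {n : ℕ} (G : Matrix (Fin n) (Fin n) ℂ) (Ω : Set (Cn n)) (Φ : Cn n → ℝ)
    (δ : ℝ) : Prop :=
  ∀ q : Cn n → ℝ, IsPluriharmonicQuadratic q →
    (∀ z ∈ Ω, Real.sqrt (gradNormSq G q z) ≤ δ) →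
      ∀ p ∈ Ω, StronglyQCConvexAt (fun z => Φ z - q z) p

/-! ## The linearized operator and the auxiliary functions

The sums of which real parts are taken below are real (for Hermitian `G`), by Hermitian
symmetry. -/

/-- `L^{p q̄} = ε² Φ^{p v̄} G_{u v̄} Φ^{u q̄}`. -/
def Lcoef {n : ℕ} (G : Matrix (Fin n) (Fin n) ℂ) (ε : ℝ) (Φ : Cn n → ℝ) (z : Cn n)
    (p q : Fin n) : ℂ :=
  (ε : ℂ) ^ 2 * ∑ u, ∑ v, upper (mixedHess (stdFrame n) Φ z) p v * G u v *
    upper (mixedHess (stdFrame n) Φ z) u q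

/-- The linearized operator, `L^{p q̄} f_{p q̄}`. -/
def Lop {n : ℕ} (G : Matrix (Fin n) (Fin n) ℂ) (ε : ℝ) (Φ : Cn n → ℝ) (f : Cn n → ℝ)
    (z : Cn n) : ℝ :=
  (∑ p, ∑ q, Lcoef G ε Φ z p q * mixedHess (stdFrame n) f z p q).re

/-- `S = ε Φ_i Φ_{j̄} Φ^{i j̄}`. -/
def Sfun {n : ℕ} (ε : ℝ) (Φ : Cn n → ℝ) (z : Cn n) : ℝ :=
  ((ε : ℂ) * ∑ i, ∑ j, grad (stdFrame n) Φ z i * star (grad (stdFrame n) Φ z j) *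
    upper (mixedHess (stdFrame n) Φ z) i j).re

/-- `W = Φ_{i j̄} G^{i j̄}`. -/
def Wfun {n : ℕ} (G : Matrix (Fin n) (Fin n) ℂ) (Φ : Cn n → ℝ) (z : Cn n) : ℝ :=
  (∑ i, ∑ j, mixedHess (stdFrame n) Φ z i j * upper G i j).re

/-- `V = Φ_{i j} G^{j k̄} conj(Φ_{k l}) G^{i l̄}`. -/
def Vfun {n : ℕ} (G : Matrix (Fin n) (Fin n) ℂ) (Φ : Cn n → ℝ) (z : Cn n) : ℝ :=
  (∑ i, ∑ j, ∑ k, ∑ l, holHess (stdFrame n) Φ z i j * upper G j k *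
    star (holHess (stdFrame n) Φ z k l) * upper G i l).re

/-- `|z|_G² = G_{i j̄} z^i z̄^j`. -/
def normSqG {n : ℕ} (G : Matrix (Fin n) (Fin n) ℂ) (z : Cn n) : ℝ :=
  (∑ i, ∑ j, G i j * z i * star (z j)).re

/-- `𝓐_{α β̄}` in the linear coordinates `(z^α, τ)` with coordinate vectors `t`, where `τ` is the
last coordinate. -/
def Amat {m : ℕ} (t : Fin (m + 1) → Cn (m + 1)) (Φ : Cn (m + 1) → ℝ) (z : Cn (m + 1)) :
    Matrix (Fin m) (Fin m) ℂ :=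
  let d := grad t Φ z
  let H := mixedHess t Φ z
  let τ := Fin.last m
  Matrix.of fun α β =>
    H α.castSucc β.castSucc
      - d α.castSucc / d τ * H τ β.castSucc
      - star (d β.castSucc) / star (d τ) * H α.castSucc τ
      + d α.castSucc * star (d β.castSucc) / (d τ * star (d τ)) * H τ τ

/-- `𝓑_{α β}` in the linear coordinates `(z^α, τ)` with coordinate vectors `t`. -/
def Bmat {m : ℕ} (t : Fin (m + 1) → Cn (m + 1)) (Φ : Cn (m + 1) → ℝ) (z : Cn (m + 1)) :
    Matrix (Fin m) (Fin m) ℂ :=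
  let d := grad t Φ z
  let P := holHess t Φ z
  let τ := Fin.last m
  Matrix.of fun α β =>
    P α.castSucc β.castSucc
      - d α.castSucc / d τ * P τ β.castSucc
      - d β.castSucc / d τ * P α.castSucc τ
      + d α.castSucc * d β.castSucc / (d τ) ^ 2 * P τ τ

/-- `𝓚 = 𝓑 conj(𝓐⁻¹) conj(𝓑) 𝓐⁻¹`. -/
def Kmat {m : ℕ} (t : Fin (m + 1) → Cn (m + 1)) (Φ : Cn (m + 1) → ℝ) (z : Cn (m + 1)) :
    Matrix (Fin m) (Fin m) ℂ :=
  Bmat t Φ z * ((Amat t Φ z)⁻¹).map star * (Bmat t Φ z).map star * (Amat t Φ z)⁻¹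

/-- `tr (I - 𝓚)⁻¹`. -/
def traceInv {m : ℕ} (t : Fin (m + 1) → Cn (m + 1)) (Φ : Cn (m + 1) → ℝ) (z : Cn (m + 1)) : ℝ :=
  ((1 - Kmat t Φ z)⁻¹).trace.re

end

noncomputable section
open scoped ContDiff

/-! ## First order complex derivations with constant coefficients -/

/-! Write n = m + 1, H = (Φ_{i j̄}), P = (Φ_{i j}) and G = N*N. Reading off the top degree
coefficient turns the equation into n det H = ε tr(adj H · G) (`det_eq_of_formOf_eq`), that is
tr(H⁻¹G) = n/ε wherever H is invertible.

Robustness is tested against two kinds of pluriharmonic q: a linear one, which shows that |∇Φ| is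
bounded below, and q = Re (w·(z-p))² up to a constant, which shows H(v, v̄) ≥ c|v|² + |P(v, v)| on
the complex tangent plane (`pointwise_of_robustness`). Thus H is uniformly positive in n - 1
directions, and the equation forces the remaining eigenvalue to be positive and of order ε.
`exists_adapted_frame` makes this precise: at each point there is a frame in which the gradient
points along the last vector τ, H = diag(1, …, 1, ε), and all other data are bounded independently
of ε. In that frame 𝓐 = I, and 𝓑 is the tangential block of P, a symmetric matrix of norm strictly
below 1. The pointwise assertions on H, S, 𝓐 and 𝓚 follow.

For the differential inequalities, L is a sum of ∂_ξ ∂̄_ξ over the rows ξ of εNH⁻¹ (`Lop_eq_sum`);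
in the adapted frame these directions carry the weights ε on tangential components and 1 on τ. Put α
= ∂_ξ H, β = ∂̄_ξ P, h = diag(1, …, 1, ε⁻¹). Differentiating the equation once gives ∑ Φ_{a ξ ξ̄} =
0. Differentiating it twice gives ∑ ∂_ξ∂̄_ξ H = ∑ (α h α* + β h β*) and ∑ ∂_ξ∂̄_ξ P = ∑ (α h β + β h
αᵀ). Let Y be the total h-weighted size of the α and β (`thirdEnergy`) and Z = ∑ |∂_ξ P|²
(`holEnergy`). Then L|z|² is bounded below, LW ≥ cY and LV ≥ cZ - CY. The decisive gain is
`norm_deriv_last_le`: the once differentiated equation forces the last columns of α and β to be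
O(ε√Y), so the entry ε⁻¹ of h only produces errors O(εY).

For -log S (`neg_log_jet_bound`), completing the square with w = ∂_ξ∇Φ - α h ∇Φ leaves one term of
order one, |w_τ|². It is cancelled by the gradient term |∂_ξ S|²/S of the logarithm; the β-terms
have a favourable sign, and the rest is O(ε(1 + Y)).

For tr(I - 𝓚)⁻¹, congruence invariance allows the use of the adapted frame and of a holomorphic
gauge killing the first derivative of 𝓐 at the point. The twice differentiated equation then shows
that, after summing over ξ, the mixed derivative of 𝓐 is ∑ bb* and that of 𝓑 is zero, where b = ∂̄_ξ
𝓑, up to O(ε(1 + Y + Z)) (`JetSizes.mixed_error_le`, `JetSizes.hol_error_le`). With these values the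
second variation of the trace is a sum of squares (`leading_part_nonneg`, resting on
`resolvent_square_identity`).

Finally √ε(W + |z|²) contributes at least c√ε(1 + Y) and ε^{3/4}V at least ε^{3/4}(cZ - CY). Since
√ε ≫ ε^{3/4} ≫ ε, both kinds of error are absorbed for small ε (`absorb_energies_nonneg`). -/

/-- The derivation along the complexified tangent vector `X.1 + i X.2`. -/
def cderiv {n : ℕ} (X : Cn n × Cn n) (f : Cn n → ℂ) (z : Cn n) : ℂ :=
  fderiv ℝ f z X.1 + Complex.I * fderiv ℝ f z X.2

/-- The `(1,0)`-part of `v`. -/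
def holVec {n : ℕ} (v : Cn n) : Cn n × Cn n := ((1 / 2 : ℝ) • v, -((1 / 2 : ℝ) • (Complex.I • v)))

/-- The `(0,1)`-part of `v`. -/
def antiVec {n : ℕ} (v : Cn n) : Cn n × Cn n := ((1 / 2 : ℝ) • v, (1 / 2 : ℝ) • (Complex.I • v))

/-- The complex conjugate of a complexified tangent vector. -/
def conjVec {n : ℕ} (X : Cn n × Cn n) : Cn n × Cn n := (X.1, -X.2)

section
variable {n : ℕ} {X Y : Cn n × Cn n} {f g : Cn n → ℂ} {p z : Cn n}

lemma conjVec_holVec (v : Cn n) : conjVec (holVec v) = antiVec v := by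
  simp [conjVec, holVec, antiVec]

lemma conjVec_antiVec (v : Cn n) : conjVec (antiVec v) = holVec v := by
  simp [conjVec, holVec, antiVec]

lemma dHol_eq (v : Cn n) (f : Cn n → ℂ) : dHol v f = cderiv (holVec v) f := by
  funext z
  simp only [dHol, cderiv, holVec, map_neg, map_smul, Complex.real_smul]
  push_cast
  ring

lemma dAnti_eq (v : Cn n) (f : Cn n → ℂ) : dAnti v f = cderiv (antiVec v) f := by
  funext z
  simp only [dAnti, cderiv, antiVec, map_smul, Complex.real_smul]
  push_cast
  ring

lemma cderiv_congr (h : f =ᶠ[nhds z] g) : cderiv X f z = cderiv X g z := by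
  simp [cderiv, h.fderiv_eq]

lemma cderiv_eventuallyEq (h : f =ᶠ[nhds z] g) : cderiv X f =ᶠ[nhds z] cderiv X g := by
  filter_upwards [h.eventuallyEq_nhds] with w hw using cderiv_congr hw

lemma cderiv_const (c : ℂ) : cderiv X (fun _ => c) = fun _ => (0 : ℂ) := by
  funext z; simp [cderiv]

lemma cderiv_add (hf : DifferentiableAt ℝ f z) (hg : DifferentiableAt ℝ g z) :
    cderiv X (fun z => f z + g z) z = cderiv X f z + cderiv X g z := by
  simp only [cderiv, fderiv_fun_add hf hg, add_apply]; ring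

lemma cderiv_mul (hf : DifferentiableAt ℝ f z) (hg : DifferentiableAt ℝ g z) :
    cderiv X (fun z => f z * g z) z = cderiv X f z * g z + f z * cderiv X g z := by
  simp only [cderiv, fderiv_fun_mul hf hg, add_apply,
    smul_apply, smul_eq_mul]; ring

lemma cderiv_star (hf : DifferentiableAt ℝ f z) :
    cderiv X (fun z => star (f z)) z = star (cderiv (conjVec X) f z) := by
  have : HasFDerivAt (fun z => star (f z))
      ((Complex.conjCLE : ℂ →L[ℝ] ℂ).comp (fderiv ℝ f z)) z :=
    (Complex.conjCLE : ℂ →L[ℝ] ℂ).hasFDerivAt.comp z hf.hasFDerivAt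
  rw [cderiv, this.fderiv]
  simp [cderiv, conjVec]

lemma ContDiffAt.cderiv {k l : WithTop ℕ∞} (hf : ContDiffAt ℝ k f z) (h : l + 1 ≤ k) :
    ContDiffAt ℝ l (cderiv X f) z := by
  have h1 : ContDiffAt ℝ l (fderiv ℝ f) z := hf.fderiv_right h
  have h2 (v : Cn n) : ContDiffAt ℝ l (fun z => fderiv ℝ f z v) z :=
    h1.clm_apply contDiffAt_const
  exact (h2 X.1).add (contDiffAt_const.mul (h2 X.2))

lemma ContDiffOn.cderiv {Ω : Set (Cn n)} (hΩ : IsOpen Ω) (hf : ContDiffOn ℝ ∞ f Ω) :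
    ContDiffOn ℝ ∞ (cderiv X f) Ω := fun z hz =>
  ((hf.contDiffAt (hΩ.mem_nhds hz)).cderiv (by simp)).contDiffWithinAt

lemma cderiv_comm (hf : ContDiffAt ℝ 2 f z) :
    cderiv X (cderiv Y f) z = cderiv Y (cderiv X f) z := by
  have hs : IsSymmSndFDerivAt ℝ f z := hf.isSymmSndFDerivAt (by simp)
  have h1 : DifferentiableAt ℝ (fderiv ℝ f) z :=
    (hf.fderiv_right (m := 1) (by norm_num)).differentiableAt (by simp)
  have h2 (v u : Cn n) : fderiv ℝ (fun z => fderiv ℝ f z v) z u = fderiv ℝ (fderiv ℝ f) z u v := by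
    have := (h1.hasFDerivAt.clm_apply (hasFDerivAt_const v z)).fderiv
    rw [this]; simp
  have h3 (v : Cn n) : DifferentiableAt ℝ (fun z => fderiv ℝ f z v) z :=
    h1.clm_apply (differentiableAt_const v)
  have key (A B : Cn n × Cn n) : cderiv A (cderiv B f) z =
      fderiv ℝ (fderiv ℝ f) z A.1 B.1 + Complex.I * fderiv ℝ (fderiv ℝ f) z A.1 B.2
      + Complex.I * (fderiv ℝ (fderiv ℝ f) z A.2 B.1
        + Complex.I * fderiv ℝ (fderiv ℝ f) z A.2 B.2) := by
    have : fderiv ℝ (cderiv B f) z = fderiv ℝ (fun z => fderiv ℝ f z B.1) z +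
        Complex.I • fderiv ℝ (fun z => fderiv ℝ f z B.2) z := by
      have : cderiv B f = fun z => fderiv ℝ f z B.1 + Complex.I * fderiv ℝ f z B.2 := rfl
      rw [this, fderiv_fun_add (h3 _) ((h3 _).const_mul _), fderiv_const_mul (h3 _)]
    rw [cderiv, this]
    simp [h2]
  rw [key, key, hs.eq X.1 Y.1, hs.eq X.1 Y.2, hs.eq X.2 Y.1, hs.eq X.2 Y.2]
  ring

lemma cderiv_add_vec (X Y : Cn n × Cn n) (f : Cn n → ℂ) :
    cderiv (X + Y) f = fun z => cderiv X f z + cderiv Y f z := by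
  funext z; simp [cderiv]; ring

lemma cderiv_holVec_smul (c : ℂ) (v : Cn n) (f : Cn n → ℂ) :
    cderiv (holVec (c • v)) f = fun z => c * cderiv (holVec v) f z := by
  funext z
  have e : c • v = c.re • v + c.im • (Complex.I • v) := by
    conv_lhs => rw [← Complex.re_add_im c]
    rw [add_smul, mul_smul]; rfl
  have e2 : Complex.I • (c • v) = c.re • (Complex.I • v) - c.im • v := by
    rw [e, smul_add, smul_comm Complex.I c.re, smul_comm Complex.I c.im, smul_smul Complex.I,
      Complex.I_mul_I, neg_one_smul, smul_neg, sub_eq_add_neg]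
  simp only [cderiv, holVec, e2]
  simp only [e, map_neg, map_smul, map_add, map_sub, Complex.real_smul]
  conv_rhs => rw [← Complex.re_add_im c]
  push_cast
  linear_combination (c.im * ((1 / 2 : ℂ)) * (fderiv ℝ f z) (Complex.I • v)) * Complex.I_sq

lemma cderiv_antiVec_smul (c : ℂ) (v : Cn n) (f : Cn n → ℂ) :
    cderiv (antiVec (c • v)) f = fun z => star c * cderiv (antiVec v) f z := by
  funext z
  have e : c • v = c.re • v + c.im • (Complex.I • v) := by
    conv_lhs => rw [← Complex.re_add_im c]
    rw [add_smul, mul_smul]; rfl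
  have e2 : Complex.I • (c • v) = c.re • (Complex.I • v) - c.im • v := by
    rw [e, smul_add, smul_comm Complex.I c.re, smul_comm Complex.I c.im, smul_smul Complex.I,
      Complex.I_mul_I, neg_one_smul, smul_neg, sub_eq_add_neg]
  have e3 : star c = c.re - c.im * Complex.I := by
    apply Complex.ext <;> simp
  simp only [cderiv, antiVec, e2, e3]
  simp only [e, map_smul, map_add, map_sub, Complex.real_smul]
  push_cast
  linear_combination (c.im * ((1 / 2 : ℂ)) * (fderiv ℝ f z) (Complex.I • v)) * Complex.I_sq

lemma holVec_add (v w : Cn n) : holVec (v + w) = holVec v + holVec w := by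
  simp [holVec, smul_add, add_comm]

lemma antiVec_add (v w : Cn n) : antiVec (v + w) = antiVec v + antiVec w := by
  simp [antiVec, smul_add]

lemma dHol_sum {ι : Type*} (s : Finset ι) (c : ι → ℂ) (v : ι → Cn n) (f : Cn n → ℂ) :
    dHol (∑ i ∈ s, c i • v i) f = fun z => ∑ i ∈ s, c i * dHol (v i) f z := by
  classical
  induction s using Finset.induction_on with
  | empty => funext z; simp [dHol]
  | insert i s hi ih =>
    funext z
    rw [Finset.sum_insert hi, Finset.sum_insert hi, dHol_eq, holVec_add, cderiv_add_vec,
      ← dHol_eq, ← dHol_eq, ih, dHol_eq, cderiv_holVec_smul, ← dHol_eq]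

lemma dAnti_sum {ι : Type*} (s : Finset ι) (c : ι → ℂ) (v : ι → Cn n) (f : Cn n → ℂ) :
    dAnti (∑ i ∈ s, c i • v i) f = fun z => ∑ i ∈ s, star (c i) * dAnti (v i) f z := by
  classical
  induction s using Finset.induction_on with
  | empty => funext z; simp [dAnti]
  | insert i s hi ih =>
    funext z
    rw [Finset.sum_insert hi, Finset.sum_insert hi, dAnti_eq, antiVec_add, cderiv_add_vec,
      ← dAnti_eq, ← dAnti_eq, ih, dAnti_eq, cderiv_antiVec_smul, ← dAnti_eq]

lemma cderiv_sum {ι : Type*} (s : Finset ι) {f : ι → Cn n → ℂ}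
    (hf : ∀ i ∈ s, DifferentiableAt ℝ (f i) z) :
    cderiv X (fun z => ∑ i ∈ s, f i z) z = ∑ i ∈ s, cderiv X (f i) z := by
  classical
  simp only [cderiv, fderiv_fun_sum hf, sum_apply, Finset.mul_sum,
    Finset.sum_add_distrib]

lemma cderiv_const_mul (c : ℂ) (hf : DifferentiableAt ℝ f z) :
    cderiv X (fun z => c * f z) z = c * cderiv X f z := by
  rw [cderiv_mul (differentiableAt_const c) hf, cderiv_const]; simp

/-! ## Second order jets along a pair of derivations -/

/-- The function `f` is `C²` at `p`, and `f, X f, Y f, X Y f` take the given values at `p`. -/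
structure HasJet (p : Cn n) (X Y : Cn n × Cn n) (f : Cn n → ℂ) (f0 f1 f2 f3 : ℂ) : Prop where
  smooth : ContDiffAt ℝ 2 f p
  val : f p = f0
  fst : cderiv X f p = f1
  snd : cderiv Y f p = f2
  mix : cderiv X (cderiv Y f) p = f3

namespace HasJet
variable {f0 f1 f2 f3 g0 g1 g2 g3 : ℂ}

lemma of_smooth (hf : ContDiffAt ℝ 2 f p) :
    HasJet p X Y f (f p) (cderiv X f p) (cderiv Y f p) (cderiv X (cderiv Y f) p) :=
  ⟨hf, rfl, rfl, rfl, rfl⟩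

lemma congr (h : HasJet p X Y f f0 f1 f2 f3) (hfg : f =ᶠ[nhds p] g) :
    HasJet p X Y g f0 f1 f2 f3 :=
  ⟨h.smooth.congr_of_eventuallyEq hfg.symm, by rw [← hfg.eq_of_nhds, h.val],
    by rw [← cderiv_congr hfg, h.fst], by rw [← cderiv_congr hfg, h.snd],
    by rw [← cderiv_congr (cderiv_eventuallyEq hfg), h.mix]⟩

lemma const (c : ℂ) : HasJet p X Y (fun _ => c) c 0 0 0 :=
  ⟨contDiffAt_const, rfl, by rw [cderiv_const], by rw [cderiv_const],
    by rw [cderiv_const, cderiv_const]⟩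

lemma eventually_diff (h : ContDiffAt ℝ 2 f p) : ∀ᶠ z in nhds p, DifferentiableAt ℝ f z :=
  (h.eventually (by simp)).mono fun z hz => hz.differentiableAt (by simp)

lemma add (hf : HasJet p X Y f f0 f1 f2 f3) (hg : HasJet p X Y g g0 g1 g2 g3) :
    HasJet p X Y (fun z => f z + g z) (f0 + g0) (f1 + g1) (f2 + g2) (f3 + g3) := by
  have hfd := hf.smooth.differentiableAt (by simp)
  have hgd := hg.smooth.differentiableAt (by simp)
  refine ⟨hf.smooth.add hg.smooth, by rw [hf.val, hg.val],
    by rw [cderiv_add hfd hgd, hf.fst, hg.fst], by rw [cderiv_add hfd hgd, hf.snd, hg.snd], ?_⟩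
  have : cderiv Y (fun z => f z + g z) =ᶠ[nhds p] fun z => cderiv Y f z + cderiv Y g z := by
    filter_upwards [eventually_diff hf.smooth, eventually_diff hg.smooth] with z h1 h2
    exact cderiv_add h1 h2
  rw [cderiv_congr this, cderiv_add, hf.mix, hg.mix]
  · exact (hf.smooth.cderiv (l := 1) (by norm_num)).differentiableAt (by simp)
  · exact (hg.smooth.cderiv (l := 1) (by norm_num)).differentiableAt (by simp)

lemma mul (hf : HasJet p X Y f f0 f1 f2 f3) (hg : HasJet p X Y g g0 g1 g2 g3) :
    HasJet p X Y (fun z => f z * g z) (f0 * g0) (f1 * g0 + f0 * g1) (f2 * g0 + f0 * g2)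
      (f3 * g0 + f2 * g1 + f1 * g2 + f0 * g3) := by
  have hfd := hf.smooth.differentiableAt (by simp)
  have hgd := hg.smooth.differentiableAt (by simp)
  have hfd' := (hf.smooth.cderiv (X := Y) (l := 1) (by norm_num)).differentiableAt (by simp)
  have hgd' := (hg.smooth.cderiv (X := Y) (l := 1) (by norm_num)).differentiableAt (by simp)
  refine ⟨hf.smooth.mul hg.smooth, by rw [hf.val, hg.val],
    by rw [cderiv_mul hfd hgd, hf.fst, hg.fst, hf.val, hg.val],
    by rw [cderiv_mul hfd hgd, hf.snd, hg.snd, hf.val, hg.val], ?_⟩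
  have : cderiv Y (fun z => f z * g z) =ᶠ[nhds p]
      fun z => cderiv Y f z * g z + f z * cderiv Y g z := by
    filter_upwards [eventually_diff hf.smooth, eventually_diff hg.smooth] with z h1 h2
    exact cderiv_mul h1 h2
  rw [cderiv_congr this, cderiv_add (hfd'.fun_mul hgd) (hfd.fun_mul hgd'), cderiv_mul hfd' hgd,
    cderiv_mul hfd hgd', hf.mix, hf.fst, hf.snd, hf.val, hg.mix, hg.fst, hg.snd, hg.val]
  ring

lemma const_mul (c : ℂ) (hf : HasJet p X Y f f0 f1 f2 f3) :
    HasJet p X Y (fun z => c * f z) (c * f0) (c * f1) (c * f2) (c * f3) := by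
  simpa using (const (p := p) (X := X) (Y := Y) c).mul hf

lemma neg (hf : HasJet p X Y f f0 f1 f2 f3) :
    HasJet p X Y (fun z => -f z) (-f0) (-f1) (-f2) (-f3) := by
  simpa using hf.const_mul (-1)

lemma sub (hf : HasJet p X Y f f0 f1 f2 f3) (hg : HasJet p X Y g g0 g1 g2 g3) :
    HasJet p X Y (fun z => f z - g z) (f0 - g0) (f1 - g1) (f2 - g2) (f3 - g3) := by
  simpa [sub_eq_add_neg] using hf.add hg.neg

lemma sum {ι : Type*} (s : Finset ι) {f : ι → Cn n → ℂ} {f0 f1 f2 f3 : ι → ℂ}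
    (h : ∀ i ∈ s, HasJet p X Y (f i) (f0 i) (f1 i) (f2 i) (f3 i)) :
    HasJet p X Y (fun z => ∑ i ∈ s, f i z) (∑ i ∈ s, f0 i) (∑ i ∈ s, f1 i) (∑ i ∈ s, f2 i)
      (∑ i ∈ s, f3 i) := by
  classical
  induction s using Finset.induction_on with
  | empty => simpa using const (p := p) (X := X) (Y := Y) 0
  | insert i s hi ih =>
    simp only [Finset.sum_insert hi]
    exact (h i (by simp)).add (ih fun j hj => h j (by simp [hj]))

lemma conjVec_conjVec (X : Cn n × Cn n) : conjVec (conjVec X) = X := by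
  simp [conjVec]

/-- Conjugation intertwines the derivations along X and its conjugate, so the two first order
entries change places; the mixed entry then needs the commutation of second derivatives. -/
lemma star (hf : HasJet p X (conjVec X) f f0 f1 f2 f3) :
    HasJet p X (conjVec X) (fun z => star (f z)) (star f0) (star f2) (star f1) (star f3) := by
  have hfd := hf.smooth.differentiableAt (by simp)
  refine ⟨?_, by rw [hf.val], by rw [cderiv_star hfd, hf.snd],
    by rw [cderiv_star hfd, conjVec_conjVec, hf.fst], ?_⟩
  · exact (Complex.conjCLE : ℂ →L[ℝ] ℂ).contDiff.contDiffAt.comp p hf.smooth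
  have : cderiv (conjVec X) (fun z => Star.star (f z)) =ᶠ[nhds p]
      fun z => Star.star (cderiv X f z) := by
    filter_upwards [eventually_diff hf.smooth] with z h1
    rw [cderiv_star h1, conjVec_conjVec]
  rw [cderiv_congr this, cderiv_star, cderiv_comm hf.smooth, hf.mix]
  exact (hf.smooth.cderiv (l := 1) (by norm_num)).differentiableAt (by simp)

/-- The product rule for f · f⁻¹ = 1 is a triangular system for the derivatives of f⁻¹; it is solved
entry by entry. -/
lemma inv (hf : HasJet p X Y f f0 f1 f2 f3) (h0 : f0 ≠ 0) :
    HasJet p X Y (fun z => (f z)⁻¹) f0⁻¹ (-(f1 / f0 ^ 2)) (-(f2 / f0 ^ 2))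
      (2 * f1 * f2 / f0 ^ 3 - f3 / f0 ^ 2) := by
  have hs : ContDiffAt ℝ 2 (fun z => (f z)⁻¹) p := hf.smooth.inv (by rw [hf.val]; exact h0)
  have h1 := hf.mul (of_smooth (X := X) (Y := Y) hs)
  have hev : (fun z => f z * (f z)⁻¹) =ᶠ[nhds p] fun _ => (1 : ℂ) := by
    have : ∀ᶠ z in nhds p, f z ≠ 0 :=
      hf.smooth.continuousAt.eventually_ne (by rw [hf.val]; exact h0)
    filter_upwards [this] with z hz using mul_inv_cancel₀ hz
  have h2 := h1.congr hev
  have h3 := const (p := p) (X := X) (Y := Y) (1 : ℂ)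
  have e1 := h2.fst.symm.trans h3.fst
  have e2 := h2.snd.symm.trans h3.snd
  have e3 := h2.mix.symm.trans h3.mix
  rw [hf.val] at e1 e2 e3
  refine ⟨hs, by rw [hf.val], ?_, ?_, ?_⟩
  · field_simp at e1 ⊢
    linear_combination e1
  · field_simp at e2 ⊢
    linear_combination e2
  · set x := cderiv X (fun z => (f z)⁻¹) p
    set y := cderiv Y (fun z => (f z)⁻¹) p
    have hx : x = -(f1 / f0 ^ 2) := by field_simp at e1 ⊢; linear_combination e1
    have hy : y = -(f2 / f0 ^ 2) := by field_simp at e2 ⊢; linear_combination e2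
    rw [hx, hy] at e3
    field_simp at e3 ⊢
    linear_combination e3

lemma div (hf : HasJet p X Y f f0 f1 f2 f3) (hg : HasJet p X Y g g0 g1 g2 g3) (h0 : g0 ≠ 0) :
    HasJet p X Y (fun z => f z / g z) (f0 / g0) (f1 / g0 - f0 * g1 / g0 ^ 2)
      (f2 / g0 - f0 * g2 / g0 ^ 2)
      (f3 / g0 - (f2 * g1 + f1 * g2) / g0 ^ 2 + f0 * (2 * g1 * g2 / g0 ^ 3 - g3 / g0 ^ 2)) := by
  have := hf.mul (hg.inv h0)
  simp only [← div_eq_mul_inv] at this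
  convert this using 1 <;> ring

lemma uniq (h : HasJet p X Y f f0 f1 f2 f3) (h' : HasJet p X Y f g0 g1 g2 g3) :
    f0 = g0 ∧ f1 = g1 ∧ f2 = g2 ∧ f3 = g3 :=
  ⟨h.val.symm.trans h'.val, h.fst.symm.trans h'.fst, h.snd.symm.trans h'.snd,
    h.mix.symm.trans h'.mix⟩

end HasJet

/-! ### Jets of matrix valued functions -/

/-- The entrywise second order jet of a matrix valued function. -/
def HasMJet {ι κ : Type*} (p : Cn n) (X Y : Cn n × Cn n) (F : Cn n → Matrix ι κ ℂ)
    (F0 F1 F2 F3 : Matrix ι κ ℂ) : Prop :=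
  ∀ i j, HasJet p X Y (fun z => F z i j) (F0 i j) (F1 i j) (F2 i j) (F3 i j)

namespace HasMJet
open Matrix
variable {ι κ μ : Type*} {F F' : Cn n → Matrix ι κ ℂ} {G : Cn n → Matrix κ μ ℂ}
  {F0 F1 F2 F3 F0' F1' F2' F3' : Matrix ι κ ℂ} {G0 G1 G2 G3 : Matrix κ μ ℂ}

lemma congr (h : HasMJet p X Y F F0 F1 F2 F3) (hF : F =ᶠ[nhds p] F') :
    HasMJet p X Y F' F0 F1 F2 F3 := fun i j =>
  (h i j).congr (hF.mono fun z hz => by simp only [hz])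

lemma const (C : Matrix ι κ ℂ) : HasMJet p X Y (fun _ => C) C 0 0 0 := fun i j =>
  HasJet.const (C i j)

lemma sub (h : HasMJet p X Y F F0 F1 F2 F3) (h' : HasMJet p X Y F' F0' F1' F2' F3') :
    HasMJet p X Y (fun z => F z - F' z) (F0 - F0') (F1 - F1') (F2 - F2') (F3 - F3') :=
  fun i j => (h i j).sub (h' i j)

lemma mul [Fintype κ] (h : HasMJet p X Y F F0 F1 F2 F3) (h' : HasMJet p X Y G G0 G1 G2 G3) :
    HasMJet p X Y (fun z => F z * G z) (F0 * G0) (F1 * G0 + F0 * G1) (F2 * G0 + F0 * G2)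
      (F3 * G0 + F2 * G1 + F1 * G2 + F0 * G3) := by
  intro i j
  have := HasJet.sum Finset.univ fun k _ => (h i k).mul (h' k j)
  simpa only [Matrix.add_apply, Matrix.mul_apply, Finset.sum_add_distrib] using this

lemma conjTranspose (h : HasMJet p X (conjVec X) F F0 F1 F2 F3) :
    HasMJet p X (conjVec X) (fun z => (F z)ᴴ) F0ᴴ F2ᴴ F1ᴴ F3ᴴ := fun i j => (h j i).star

lemma transpose (h : HasMJet p X Y F F0 F1 F2 F3) :
    HasMJet p X Y (fun z => (F z)ᵀ) F0ᵀ F1ᵀ F2ᵀ F3ᵀ := fun i j => h j i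

lemma mapStar (h : HasMJet p X (conjVec X) F F0 F1 F2 F3) :
    HasMJet p X (conjVec X) (fun z => (F z).map star) (F0.map star) (F2.map star)
      (F1.map star) (F3.map star) := fun i j => (h i j).star

lemma trace [Fintype ι] {F : Cn n → Matrix ι ι ℂ} {F0 F1 F2 F3 : Matrix ι ι ℂ}
    (h : HasMJet p X Y F F0 F1 F2 F3) :
    HasJet p X Y (fun z => (F z).trace) F0.trace F1.trace F2.trace F3.trace :=
  HasJet.sum Finset.univ fun k _ => h k k

lemma contDiffAt_det [Fintype ι] [DecidableEq ι] {F : Cn n → Matrix ι ι ℂ}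
    (h : ∀ i j, ContDiffAt ℝ 2 (fun z => F z i j) p) :
    ContDiffAt ℝ 2 (fun z => (F z).det) p := by
  simp only [Matrix.det_apply]
  refine ContDiffAt.sum fun σ _ => ?_
  refine ContDiffAt.const_smul (σ.sign : ℤˣ) (contDiffAt_prod fun i _ => h _ _)

/-- By Cramer's rule each entry of the inverse is a quotient of two determinants, which are
polynomials in the entries. -/
lemma contDiffAt_inv [Fintype ι] [DecidableEq ι] {F : Cn n → Matrix ι ι ℂ}
    (h : ∀ i j, ContDiffAt ℝ 2 (fun z => F z i j) p) (h0 : (F p).det ≠ 0) (i j : ι) :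
    ContDiffAt ℝ 2 (fun z => (F z)⁻¹ i j) p := by
  have h1 : (fun z => (F z)⁻¹ i j) = fun z => ((F z).det)⁻¹ * ((F z).updateRow j (Pi.single i 1)).det := by
    funext z
    rw [Matrix.inv_def, Matrix.smul_apply, Ring.inverse_eq_inv', smul_eq_mul,
      Matrix.adjugate_apply]
  rw [h1]
  refine ((contDiffAt_det h).inv h0).mul (contDiffAt_det fun k l => ?_)
  by_cases hk : k = j
  · subst hk; simp only [Matrix.updateRow_self]; exact contDiffAt_const
  · simp only [Matrix.updateRow_ne hk]; exact h k l

/-- As in the scalar case, the derivatives of the inverse are solved from F⁻¹F = 1; the order of the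
factors now matters, which gives two quadratic terms. -/
lemma inv [Fintype ι] [DecidableEq ι] {F : Cn n → Matrix ι ι ℂ} {F0 F1 F2 F3 : Matrix ι ι ℂ}
    (h : HasMJet p X Y F F0 F1 F2 F3) (h0 : F0.det ≠ 0) :
    HasMJet p X Y (fun z => (F z)⁻¹) F0⁻¹ (-(F0⁻¹ * F1 * F0⁻¹)) (-(F0⁻¹ * F2 * F0⁻¹))
      (F0⁻¹ * F1 * F0⁻¹ * F2 * F0⁻¹ + F0⁻¹ * F2 * F0⁻¹ * F1 * F0⁻¹ - F0⁻¹ * F3 * F0⁻¹) := by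
  have hp : F p = F0 := by ext i j; exact (h i j).val
  have hs := contDiffAt_inv (fun i j => (h i j).smooth) (by rw [hp]; exact h0)
  obtain ⟨K0, K1, K2, K3, hK⟩ : ∃ K0 K1 K2 K3, HasMJet p X Y (fun z => (F z)⁻¹) K0 K1 K2 K3 :=
    ⟨Matrix.of fun _ _ => _, Matrix.of fun _ _ => _, Matrix.of fun _ _ => _,
      Matrix.of fun _ _ => _, fun i j => HasJet.of_smooth (hs i j)⟩
  have hK0 : K0 = F0⁻¹ := by
    ext i j; rw [← (hK i j).val, ← hp]
  have hev : (fun z => (F z)⁻¹ * F z) =ᶠ[nhds p] fun _ => (1 : Matrix ι ι ℂ) := by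
    have : ∀ᶠ z in nhds p, (F z).det ≠ 0 :=
      (contDiffAt_det fun i j => (h i j).smooth).continuousAt.eventually_ne
        (by rw [hp]; exact h0)
    filter_upwards [this] with z hz using Matrix.nonsing_inv_mul _ (isUnit_iff_ne_zero.2 hz)
  have h2 := (hK.mul h).congr hev
  have h3 := const (p := p) (X := X) (Y := Y) (1 : Matrix ι ι ℂ)
  have hu : IsUnit F0.det := isUnit_iff_ne_zero.2 h0
  have e1 : K1 * F0 + K0 * F1 = 0 := by ext i j; exact ((h2 i j).uniq (h3 i j)).2.1
  have e2 : K2 * F0 + K0 * F2 = 0 := by ext i j; exact ((h2 i j).uniq (h3 i j)).2.2.1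
  have e3 : K3 * F0 + K2 * F1 + K1 * F2 + K0 * F3 = 0 := by
    ext i j; exact ((h2 i j).uniq (h3 i j)).2.2.2
  have key (A B : Matrix ι ι ℂ) (hAB : A * F0 + B = 0) : A = -(B * F0⁻¹) := by
    have : A * F0 * F0⁻¹ = -B * F0⁻¹ := by rw [eq_neg_of_add_eq_zero_left hAB]
    rwa [Matrix.mul_nonsing_inv_cancel_right _ _ hu, Matrix.neg_mul] at this
  have hK1 := key _ _ e1
  have hK2 := key _ _ e2
  have hK3 := key _ _ (by simpa only [add_assoc] using e3)
  rw [hK0] at hK1 hK2 hK3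
  rw [hK1, hK2] at hK3
  rw [hK0, hK1, hK2, hK3] at hK
  convert hK using 1
  noncomm_ring

end HasMJet
end
end

noncomputable section

/-! ## Top degree forms and determinants -/

lemma add_pow_succ_of_sq_zero {A : Type*} [Ring A] {a x : A} (h : Commute a x) (hx : x * x = 0)
    (k : ℕ) : (a + x) ^ (k + 1) = a ^ (k + 1) + (k + 1) • (a ^ k * x) := by
  induction k with
  | zero => simp
  | succ k ih =>
    rw [pow_succ, ih, add_mul, mul_add, mul_add, smul_mul_assoc, smul_mul_assoc, mul_assoc (a ^ k),
      ← h.eq, mul_assoc (a ^ k) x x, hx, ← mul_assoc, ← pow_succ, ← pow_succ]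
    simp only [mul_zero, smul_zero, add_zero]
    rw [add_assoc, succ_nsmul (a ^ (k + 1) * x) (k + 1)]
    abel

/-- Only squarefree monomials survive. The vanishing of the next power is carried along because the
induction needs it to discard the term without the new element. -/
lemma sum_pow_of_sq_zero {A : Type*} [Ring A] : ∀ {n : ℕ} (x : Fin n → A),
    (∀ i j, Commute (x i) (x j)) → (∀ i, x i * x i = 0) →
    (∑ i, x i) ^ n = n.factorial • (List.ofFn x).prod ∧ (∑ i, x i) ^ (n + 1) = 0 := by
  intro n
  induction n with
  | zero => intro x _ _; simp
  | succ n ih =>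
    intro x hc hs
    obtain ⟨h1, h2⟩ := ih (fun i => x i.castSucc) (fun i j => hc _ _) (fun i => hs _)
    have hcomm : Commute (∑ i : Fin n, x i.castSucc) (x (Fin.last n)) :=
      Commute.sum_left _ _ _ fun i _ => hc _ _
    rw [Fin.sum_univ_castSucc]
    constructor
    · rw [add_pow_succ_of_sq_zero hcomm (hs _), h2, h1, List.ofFn_succ', List.concat_eq_append,
        List.prod_append, zero_add, Nat.factorial_succ, mul_smul, smul_mul_assoc]
      simp
    · rw [add_pow_succ_of_sq_zero hcomm (hs _), pow_succ, h2]
      simp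

section
variable {n : ℕ}

-- Moving a covector past a product of two covectors costs two signs.
open ExteriorAlgebra in
lemma commute_ι_mul_ι {M : Type*} [AddCommGroup M] [Module ℂ M] (u v w : M) :
    Commute (ι ℂ u * ι ℂ v) (ι ℂ w) := by
  have h1 : ι ℂ v * ι ℂ w = -(ι ℂ w * ι ℂ v) := eq_neg_of_add_eq_zero_left (ι_add_mul_swap v w)
  have h2 : ι ℂ u * ι ℂ w = -(ι ℂ w * ι ℂ u) := eq_neg_of_add_eq_zero_left (ι_add_mul_swap u w)
  change _ * _ = _ * _
  rw [mul_assoc, h1, mul_neg, ← mul_assoc, h2, neg_mul, neg_neg, mul_assoc]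

lemma commute_two_forms (i j k l : Fin n) :
    Commute (dz i * dzbar j : Forms n) (dz k * dzbar l) :=
  (commute_ι_mul_ι _ _ _).mul_right (commute_ι_mul_ι _ _ _)

lemma commute_formOf (M N : Matrix (Fin n) (Fin n) ℂ) : Commute (formOf M) (formOf N) := by
  unfold formOf
  refine (Commute.smul_left ?_ _).smul_right _
  refine Commute.sum_left _ _ _ fun i _ => Commute.sum_left _ _ _ fun j _ =>
    Commute.smul_left ?_ _
  exact Commute.sum_right _ _ _ fun k _ => Commute.sum_right _ _ _ fun l _ =>
    (commute_two_forms i j k l).smul_right _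

lemma formOf_add_smul (M N : Matrix (Fin n) (Fin n) ℂ) (s : ℂ) :
    formOf (M + s • N) = formOf M + s • formOf N := by
  unfold formOf
  rw [smul_comm s, ← smul_add]
  simp [Finset.smul_sum, add_smul, Finset.sum_add_distrib, mul_smul]

/-- The substitution dz̄^i ↦ ∑ M_{ij} dz̄^j turns the standard form into the form of M, so powers of
a general form are obtained from the standard one by functoriality. -/
lemma map_formOf_one (M : Matrix (Fin n) (Fin n) ℂ) :
    ExteriorAlgebra.map (Matrix.toLin' (Matrix.fromBlocks 1 0 0 M.transpose)) (formOf 1)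
      = formOf M := by
  have h1 (i : Fin n) : ExteriorAlgebra.map (Matrix.toLin' (Matrix.fromBlocks 1 0 0 M.transpose))
      (dz i) = dz i := by
    rw [dz, ExteriorAlgebra.map_apply_ι, Matrix.toLin'_apply]
    congr 1
    ext j
    rw [Matrix.mulVec_single_one]
    rcases j with j | j <;> simp [Matrix.one_apply, Pi.single_apply]
  have h2 (i : Fin n) : ExteriorAlgebra.map (Matrix.toLin' (Matrix.fromBlocks 1 0 0 M.transpose))
      (dzbar i) = ∑ j, M i j • dzbar j := by
    simp only [dzbar, ← map_smul, ← map_sum]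
    rw [ExteriorAlgebra.map_apply_ι, Matrix.toLin'_apply]
    congr 1
    ext j
    rw [Matrix.mulVec_single_one]
    rcases j with j | j <;> simp [Pi.single_apply]
  simp only [formOf, map_smul, map_sum, map_mul, h1, h2]
  congr 1
  refine Finset.sum_congr rfl fun i _ => ?_
  simp [Matrix.one_apply, ite_smul, Finset.mul_sum]

/-- The basis `dz^1, dz̄^1, dz^2, dz̄^2, …` of covectors. -/
def interleavedBasis (n : ℕ) : Module.Basis (Fin (n * 2)) ℂ (Fin n ⊕ Fin n → ℂ) :=
  (Pi.basisFun ℂ (Fin n ⊕ Fin n)).reindex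
    (((Equiv.boolProdEquivSum (Fin n)).symm.trans (Equiv.prodComm _ _)).trans
      ((Equiv.prodCongr (Equiv.refl _) finTwoEquiv.symm).trans finProdFinEquiv))

/-- The functional reading off the top degree coefficient. -/
def topCoeff (n : ℕ) : Forms n →ₗ[ℂ] ℂ :=
  ExteriorAlgebra.liftAlternating
    (Pi.single (M := fun i => (Fin n ⊕ Fin n → ℂ) [⋀^Fin i]→ₗ[ℂ] ℂ) (n * 2)
      (interleavedBasis n).det)

lemma topCoeff_ιMulti (v : Fin (n * 2) → (Fin n ⊕ Fin n → ℂ)) :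
    topCoeff n (ExteriorAlgebra.ιMulti ℂ (n * 2) v) = (interleavedBasis n).det v := by
  rw [topCoeff, ExteriorAlgebra.liftAlternating_apply_ιMulti, Pi.single_eq_same]

/-- In top degree this is the behaviour of the determinant under composition; in every other degree
both sides vanish. -/
lemma topCoeff_map (g : (Fin n ⊕ Fin n → ℂ) →ₗ[ℂ] (Fin n ⊕ Fin n → ℂ)) (x : Forms n) :
    topCoeff n (ExteriorAlgebra.map g x) = LinearMap.det g * topCoeff n x := by
  have : (topCoeff n).comp (ExteriorAlgebra.map g).toLinearMap = LinearMap.det g • topCoeff n := by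
    refine ExteriorAlgebra.lhom_ext fun i => ?_
    ext v
    simp only [LinearMap.compAlternatingMap_apply, LinearMap.comp_apply, AlgHom.toLinearMap_apply,
      ExteriorAlgebra.map_apply_ιMulti, LinearMap.smul_apply]
    by_cases hi : i = n * 2
    · subst hi
      rw [topCoeff_ιMulti, topCoeff_ιMulti, Module.Basis.det_comp, smul_eq_mul]
    · simp only [topCoeff, ExteriorAlgebra.liftAlternating_apply_ιMulti, Pi.single_eq_of_ne hi]
      simp
  exact LinearMap.congr_fun this x

/-- The basis is interleaved precisely so that this product is the wedge of the basis in order and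
no sign appears. -/
lemma topCoeff_prod : topCoeff n (List.ofFn fun i : Fin n => (dz i * dzbar i : Forms n)).prod = 1 := by
  have : (List.ofFn fun i : Fin n => (dz i * dzbar i : Forms n)).prod =
      ExteriorAlgebra.ιMulti ℂ (n * 2) (interleavedBasis n) := by
    rw [ExteriorAlgebra.ιMulti_apply, List.ofFn_mul, List.prod_flatten, List.map_ofFn]
    congr 2
    funext i
    have h0 (j : Fin 2) (h) : (⟨i * 2 + j, h⟩ : Fin (n * 2)) = finProdFinEquiv (i, j) := by
      ext; simp [finProdFinEquiv]; ring
    simp only [Function.comp, List.ofFn_succ, List.ofFn_zero, List.prod_cons, List.prod_nil, mul_one,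
      h0]
    congr 1 <;> simp [interleavedBasis, dz, dzbar, finTwoEquiv]
  rw [this, topCoeff_ιMulti, Module.Basis.det_self]

lemma topCoeff_formOf_one_ne_zero : topCoeff n (formOf (1 : Matrix (Fin n) (Fin n) ℂ) ^ n) ≠ 0 := by
  have h : formOf (1 : Matrix (Fin n) (Fin n) ℂ) = Complex.I • ∑ i : Fin n, (dz i * dzbar i) := by
    simp [formOf, Matrix.one_apply, ite_smul]
  have h2 := (sum_pow_of_sq_zero (fun i : Fin n => (dz i * dzbar i : Forms n))
    (fun i j => commute_two_forms _ _ _ _) (fun i => by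
      have hc : Commute (dz i * dzbar i : Forms n) (dz i) := commute_ι_mul_ι _ _ _
      have hz : (dz i * dz i : Forms n) = 0 := ExteriorAlgebra.ι_sq_zero _
      rw [← mul_assoc, hc.eq, ← mul_assoc, hz, zero_mul, zero_mul])).1
  rw [h, smul_pow, h2, map_smul, map_nsmul, topCoeff_prod]
  simp [Nat.factorial_ne_zero]

lemma topCoeff_formOf_pow (M : Matrix (Fin n) (Fin n) ℂ) :
    topCoeff n (formOf M ^ n) =
      M.det * topCoeff n (formOf (1 : Matrix (Fin n) (Fin n) ℂ) ^ n) := by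
  rw [← map_formOf_one M, ← map_pow, topCoeff_map, LinearMap.det_toLin',
    Matrix.det_fromBlocks_zero₂₁, Matrix.det_one, one_mul, Matrix.det_transpose]

/-- Jacobi's formula, with the adjugate so that it also holds where H is singular. -/
lemma hasDerivAt_det_add_smul (H G : Matrix (Fin n) (Fin n) ℂ) :
    HasDerivAt (fun s : ℂ => (H + s • G).det) (H.adjugate * G).trace 0 := by
  have h1 (σ : Equiv.Perm (Fin n)) : HasDerivAt
      (fun s : ℂ => ((σ.sign : ℤ) : ℂ) * ∏ i, (H + s • G) (σ i) i)
      (((σ.sign : ℤ) : ℂ) * ∑ i, (∏ j ∈ Finset.univ.erase i, H (σ j) j) * G (σ i) i) 0 := by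
    refine HasDerivAt.const_mul _ ?_
    have := HasDerivAt.fun_finsetProd (u := Finset.univ) (f := fun i s => (H + s • G) (σ i) i)
      (f' := fun i => G (σ i) i) (x := (0 : ℂ)) (fun i _ => by
        simpa using ((hasDerivAt_id (0 : ℂ)).mul_const (G (σ i) i)).const_add (H (σ i) i))
    simpa using this
  have h2 : (fun s : ℂ => (H + s • G).det) =
      fun s => ∑ σ : Equiv.Perm (Fin n), ((σ.sign : ℤ) : ℂ) * ∏ i, (H + s • G) (σ i) i := by
    funext s; rw [Matrix.det_apply']
  rw [h2]
  refine (HasDerivAt.fun_sum (u := Finset.univ) fun σ _ => h1 σ).congr_deriv ?_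
  have h3 (i : Fin n) : (H.adjugate * G) i i =
      ∑ σ : Equiv.Perm (Fin n), ((σ.sign : ℤ) : ℂ) *
        ((∏ j ∈ Finset.univ.erase i, H (σ j) j) * G (σ i) i) := by
    have : (H.adjugate * G) i i = (H.updateCol i fun k => G k i).det := by
      rw [← Matrix.cramer_apply, Matrix.cramer_eq_adjugate_mulVec]; rfl
    rw [this, Matrix.det_apply']
    refine Finset.sum_congr rfl fun σ _ => ?_
    rw [← Finset.prod_erase_mul _ _ (Finset.mem_univ i), Matrix.updateCol_self]
    congr 2
    refine Finset.prod_congr rfl fun j hj => ?_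
    rw [Matrix.updateCol_ne (Finset.ne_of_mem_erase hj)]
  simp only [Matrix.trace, Matrix.diag, h3]
  rw [Finset.sum_comm]
  simp only [Finset.mul_sum]

/-- The Hessian quotient equation in terms of determinants. -/
lemma det_eq_of_formOf_eq {H G : Matrix (Fin n) (Fin n) ℂ} {ε : ℂ}
    (h : formOf H ^ n = ε • (formOf H ^ (n - 1) * formOf G)) :
    (n : ℂ) * H.det = ε * (H.adjugate * G).trace := by
  rcases Nat.eq_zero_or_pos n with hn | hn
  · subst hn; simp [Matrix.trace]
  set c := topCoeff n (formOf (1 : Matrix (Fin n) (Fin n) ℂ) ^ n) with hc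
  have hc0 : c ≠ 0 := topCoeff_formOf_one_ne_zero
  have h1 : HasDerivAt (fun s : ℂ => (H + s • G).det * c) ((H.adjugate * G).trace * c) 0 :=
    (hasDerivAt_det_add_smul H G).mul_const c
  -- Binomial expansion of (ω_H + sω_G)^n. Its coefficient of s is n times the right side of the
  -- equation up to ε, and it must agree with Jacobi's formula.
  have h2 : (fun s : ℂ => (H + s • G).det * c) = fun s => ∑ k ∈ Finset.range (n + 1),
      s ^ k * topCoeff n (formOf G ^ k * formOf H ^ (n - k) * (n.choose k : ℕ)) := by
    funext s
    rw [← topCoeff_formOf_pow, formOf_add_smul, add_comm,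
      ((commute_formOf G H).smul_left s).add_pow, map_sum]
    refine Finset.sum_congr rfl fun k _ => ?_
    rw [smul_pow, smul_mul_assoc, smul_mul_assoc, map_smul, smul_eq_mul]
  have h3 : HasDerivAt (fun s : ℂ => (H + s • G).det * c)
      (topCoeff n (formOf G * formOf H ^ (n - 1) * (n : ℕ))) 0 := by
    rw [h2]
    refine (HasDerivAt.fun_sum (u := Finset.range (n + 1)) fun k _ =>
      ((hasDerivAt_pow k (0 : ℂ)).mul_const
        (topCoeff n (formOf G ^ k * formOf H ^ (n - k) * (n.choose k : ℕ))))).congr_deriv ?_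
    rw [Finset.sum_eq_single 1]
    · simp
    · intro k _ hk
      rcases k with _ | _ | k
      · simp
      · exact absurd rfl hk
      · simp
    · intro hn'; simp at hn'; omega
  have h4 := h1.unique h3
  have h5 := congrArg (topCoeff n) h
  rw [topCoeff_formOf_pow, ← hc, map_smul, smul_eq_mul] at h5
  rw [← nsmul_eq_mul', map_nsmul, (commute_formOf G H).pow_right (n - 1) |>.eq, nsmul_eq_mul] at h4
  refine mul_right_cancel₀ hc0 ?_
  linear_combination (n : ℂ) * h5 - ε * h4

end
end

noncomputable section
open scoped ContDiff

/-! ## Pointwise consequences of robustness -/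

section
variable {n : ℕ}

lemma hasJet_coord (p : Cn n) (X Y : Cn n × Cn n) (i : Fin n) :
    HasJet p X Y (fun z => z i) (p i) (X.1 i + Complex.I * X.2 i) (Y.1 i + Complex.I * Y.2 i) 0 := by
  set l : Cn n →L[ℝ] ℂ := (EuclideanSpace.proj i : Cn n →L[ℂ] ℂ).restrictScalars ℝ
  have hl : (fun z : Cn n => z i) = l := rfl
  have h1 (Z : Cn n × Cn n) : cderiv Z (fun z : Cn n => z i) =
      fun _ => Z.1 i + Complex.I * Z.2 i := by
    funext z
    rw [cderiv, hl, l.fderiv]; rfl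
  refine ⟨hl ▸ l.contDiff.contDiffAt, rfl, by rw [h1], by rw [h1], by rw [h1, cderiv_const]⟩

lemma hasJet_coord_star (p : Cn n) (X Y : Cn n × Cn n) (i : Fin n) :
    HasJet p X Y (fun z => star (z i)) (star (p i)) (star (X.1 i - Complex.I * X.2 i))
      (star (Y.1 i - Complex.I * Y.2 i)) 0 := by
  have h0 (z : Cn n) : DifferentiableAt ℝ (fun z : Cn n => z i) z :=
    (hasJet_coord z X Y i).smooth.differentiableAt (by simp)
  have h1 (Z : Cn n × Cn n) : cderiv Z (fun z : Cn n => star (z i)) =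
      fun _ => star (Z.1 i - Complex.I * Z.2 i) := by
    funext z
    rw [cderiv_star (h0 z), (hasJet_coord z (conjVec Z) X i).fst]
    simp [conjVec, sub_eq_add_neg]
  refine ⟨(Complex.conjCLE : ℂ →L[ℝ] ℂ).contDiff.contDiffAt.comp p (hasJet_coord p X Y i).smooth,
    rfl, by rw [h1], by rw [h1], by rw [h1, cderiv_const]⟩

lemma hasJet_linear (p : Cn n) (X Y : Cn n × Cn n) (w : Fin n → ℂ) :
    HasJet p X Y (fun z => ∑ i, w i * z i) (∑ i, w i * p i)
      (∑ i, w i * (X.1 i + Complex.I * X.2 i)) (∑ i, w i * (Y.1 i + Complex.I * Y.2 i)) 0 := by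
  simpa using HasJet.sum Finset.univ fun i _ => (hasJet_coord p X Y i).const_mul (w i)

lemma hasJet_linear_star (p : Cn n) (X Y : Cn n × Cn n) (w : Fin n → ℂ) :
    HasJet p X Y (fun z => star (∑ i, w i * z i)) (star (∑ i, w i * p i))
      (star (∑ i, w i * (X.1 i - Complex.I * X.2 i)))
      (star (∑ i, w i * (Y.1 i - Complex.I * Y.2 i))) 0 := by
  have := HasJet.sum Finset.univ fun i _ => (hasJet_coord_star p X Y i).const_mul (star (w i))
  simpa only [star_sum, star_mul', mul_zero, Finset.sum_const_zero] using this

lemma holVec_fst_add (v : Cn n) (i : Fin n) :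
    (holVec v).1 i + Complex.I * (holVec v).2 i = v i := by
  simp only [holVec, PiLp.smul_apply, PiLp.neg_apply, smul_eq_mul, Complex.real_smul]
  push_cast
  linear_combination (-(1 / 2 : ℂ) * v i) * Complex.I_sq

lemma holVec_fst_sub (v : Cn n) (i : Fin n) :
    (holVec v).1 i - Complex.I * (holVec v).2 i = 0 := by
  simp only [holVec, PiLp.smul_apply, PiLp.neg_apply, smul_eq_mul, Complex.real_smul]
  push_cast
  linear_combination ((1 / 2 : ℂ) * v i) * Complex.I_sq

lemma antiVec_fst_add (v : Cn n) (i : Fin n) :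
    (antiVec v).1 i + Complex.I * (antiVec v).2 i = 0 := by
  simp only [antiVec, PiLp.smul_apply, smul_eq_mul, Complex.real_smul]
  push_cast
  linear_combination ((1 / 2 : ℂ) * v i) * Complex.I_sq

lemma antiVec_fst_sub (v : Cn n) (i : Fin n) :
    (antiVec v).1 i - Complex.I * (antiVec v).2 i = v i := by
  simp only [antiVec, PiLp.smul_apply, smul_eq_mul, Complex.real_smul]
  push_cast
  linear_combination (-(1 / 2 : ℂ) * v i) * Complex.I_sq

/-- The pluriharmonic polynomial `Re ((w·z)² + b·z)`. -/
def pluriQuad (w b : Fin n → ℂ) (z : Cn n) : ℝ :=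
  ((∑ i, w i * z i) ^ 2 + ∑ i, b i * z i).re

lemma isPluriharmonicQuadratic_pluriQuad (w b : Fin n → ℂ) :
    IsPluriharmonicQuadratic (pluriQuad w b) := by
  refine ⟨Matrix.of fun i j => w i * w j, b, 0, fun z => ?_⟩
  rw [pluriQuad, sq, Finset.sum_mul_sum, add_zero]
  congr 2
  exact Finset.sum_congr rfl fun i _ => Finset.sum_congr rfl fun j _ => by
    simp only [Matrix.of_apply]; ring

/-- The directions are left general so that gradient, complex Hessian and holomorphic Hessian of the
test polynomial all come from this one computation. -/
lemma hasJet_pluriQuad (p : Cn n) (X Y : Cn n × Cn n) (w b : Fin n → ℂ) :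
    ∃ f0, HasJet p X Y (toC (pluriQuad w b)) f0
      ((∑ i, w i * p i) * (∑ i, w i * (X.1 i + Complex.I * X.2 i))
        + star ((∑ i, w i * p i) * (∑ i, w i * (X.1 i - Complex.I * X.2 i)))
        + (∑ i, b i * (X.1 i + Complex.I * X.2 i)
          + star (∑ i, b i * (X.1 i - Complex.I * X.2 i))) / 2)
      ((∑ i, w i * p i) * (∑ i, w i * (Y.1 i + Complex.I * Y.2 i))
        + star ((∑ i, w i * p i) * (∑ i, w i * (Y.1 i - Complex.I * Y.2 i)))
        + (∑ i, b i * (Y.1 i + Complex.I * Y.2 i)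
          + star (∑ i, b i * (Y.1 i - Complex.I * Y.2 i))) / 2)
      ((∑ i, w i * (X.1 i + Complex.I * X.2 i)) * (∑ i, w i * (Y.1 i + Complex.I * Y.2 i))
        + star ((∑ i, w i * (X.1 i - Complex.I * X.2 i))
          * (∑ i, w i * (Y.1 i - Complex.I * Y.2 i)))) := by
  have e : toC (pluriQuad w b) = fun z : Cn n => (1 / 2 : ℂ) *
      (((∑ i, w i * z i) * (∑ i, w i * z i) + ∑ i, b i * z i)
        + (star (∑ i, w i * z i) * star (∑ i, w i * z i) + star (∑ i, b i * z i))) := by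
    funext z
    rw [toC, pluriQuad, Complex.re_eq_add_conj, sq]
    simp only [← starRingEnd_apply, map_add, map_mul]
    ring
  have hl := hasJet_linear p X Y w
  have hs := hasJet_linear_star p X Y w
  have h := (((hl.mul hl).add (hasJet_linear p X Y b)).add
    ((hs.mul hs).add (hasJet_linear_star p X Y b))).const_mul (1 / 2)
  rw [← e] at h
  refine ⟨toC (pluriQuad w b) p, ?_⟩
  convert h using 1
  · exact h.val
  · simp only [star_mul']; ring
  · simp only [star_mul']; ring
  · simp only [star_mul']; ring

lemma sum_mul_stdFrame (w : Fin n → ℂ) (k : Fin n) : ∑ i, w i * stdFrame n k i = w k := by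
  simp [stdFrame]

lemma grad_pluriQuad (w b : Fin n → ℂ) (z : Cn n) (k : Fin n) :
    grad (stdFrame n) (pluriQuad w b) z k = (∑ i, w i * z i) * w k + b k / 2 := by
  obtain ⟨f0, h⟩ := hasJet_pluriQuad z (holVec (stdFrame n k)) (holVec (stdFrame n k)) w b
  rw [grad, dHol_eq, h.fst]
  simp only [holVec_fst_add, holVec_fst_sub, sum_mul_stdFrame]
  simp

lemma toC_contDiffAt {Φ : Cn n → ℝ} {p : Cn n} {k : WithTop ℕ∞} (h : ContDiffAt ℝ k Φ p) :
    ContDiffAt ℝ k (toC Φ) p :=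
  Complex.ofRealCLM.contDiff.contDiffAt.comp p h

lemma grad_sub_pluriQuad {Φ : Cn n → ℝ} {p : Cn n} (h : ContDiffAt ℝ 2 Φ p) (w b : Fin n → ℂ)
    (k : Fin n) : grad (stdFrame n) (fun z => Φ z - pluriQuad w b z) p k =
      grad (stdFrame n) Φ p k - ((∑ i, w i * p i) * w k + b k / 2) := by
  rw [← grad_pluriQuad]
  obtain ⟨f0, h1⟩ := hasJet_pluriQuad p (holVec (stdFrame n k)) (holVec (stdFrame n k)) w b
  have h2 := (HasJet.of_smooth (X := holVec (stdFrame n k)) (Y := holVec (stdFrame n k))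
    (toC_contDiffAt h)).sub h1
  have e : toC (fun z => Φ z - pluriQuad w b z) = fun z => toC Φ z - toC (pluriQuad w b) z := by
    funext z; simp [toC]
  rw [grad, grad, grad, dHol_eq, dHol_eq, dHol_eq, e, h2.fst, h1.fst]

lemma mixedHess_sub_pluriQuad {Φ : Cn n → ℝ} {p : Cn n} (h : ContDiffAt ℝ 2 Φ p)
    (w b : Fin n → ℂ) : mixedHess (stdFrame n) (fun z => Φ z - pluriQuad w b z) p =
      mixedHess (stdFrame n) Φ p := by
  ext k l
  obtain ⟨f0, h1⟩ := hasJet_pluriQuad p (holVec (stdFrame n k)) (antiVec (stdFrame n l)) w b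
  have h2 := (HasJet.of_smooth (X := holVec (stdFrame n k)) (Y := antiVec (stdFrame n l))
    (toC_contDiffAt h)).sub h1
  have e : toC (fun z => Φ z - pluriQuad w b z) = fun z => toC Φ z - toC (pluriQuad w b) z := by
    funext z; simp [toC]
  simp only [mixedHess, Matrix.of_apply, dHol_eq, dAnti_eq]
  rw [e, h2.mix]
  simp only [antiVec_fst_add, holVec_fst_sub]
  simp

lemma holHess_sub_pluriQuad {Φ : Cn n → ℝ} {p : Cn n} (h : ContDiffAt ℝ 2 Φ p)
    (w b : Fin n → ℂ) (k l : Fin n) : holHess (stdFrame n) (fun z => Φ z - pluriQuad w b z) p k l =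
      holHess (stdFrame n) Φ p k l - w k * w l := by
  obtain ⟨f0, h1⟩ := hasJet_pluriQuad p (holVec (stdFrame n k)) (holVec (stdFrame n l)) w b
  have h2 := (HasJet.of_smooth (X := holVec (stdFrame n k)) (Y := holVec (stdFrame n l))
    (toC_contDiffAt h)).sub h1
  have e : toC (fun z => Φ z - pluriQuad w b z) = fun z => toC Φ z - toC (pluriQuad w b) z := by
    funext z; simp [toC]
  simp only [holHess, Matrix.of_apply, dHol_eq]
  rw [e, h2.mix]
  simp only [holVec_fst_add, holVec_fst_sub, sum_mul_stdFrame]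
  simp

lemma gradNormSq_le (G : Matrix (Fin n) (Fin n) ℂ) (f : Cn n → ℝ) (z : Cn n) :
    gradNormSq G f z ≤ (∑ i, ∑ j, ‖upper G i j‖) * ∑ i, ‖grad (stdFrame n) f z i‖ ^ 2 := by
  rw [gradNormSq]
  refine (Complex.re_le_norm _).trans ((norm_sum_le _ _).trans ?_)
  rw [Finset.sum_mul]
  refine Finset.sum_le_sum fun i _ => (norm_sum_le _ _).trans ?_
  rw [Finset.sum_mul]
  refine Finset.sum_le_sum fun j _ => ?_
  rw [norm_mul, norm_mul, norm_star, mul_assoc]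
  refine mul_le_mul_of_nonneg_left ?_ (norm_nonneg _)
  set g := grad (stdFrame n) f z
  have hi : ‖g i‖ ^ 2 ≤ ∑ i, ‖g i‖ ^ 2 :=
    Finset.single_le_sum (f := fun i => ‖g i‖ ^ 2) (fun _ _ => by positivity) (Finset.mem_univ i)
  have hj : ‖g j‖ ^ 2 ≤ ∑ i, ‖g i‖ ^ 2 :=
    Finset.single_le_sum (f := fun i => ‖g i‖ ^ 2) (fun _ _ => by positivity) (Finset.mem_univ j)
  nlinarith [sq_nonneg (‖g i‖ - ‖g j‖)]

lemma exists_unit_sq_mul_eq_neg_norm (z : ℂ) : ∃ θ : ℂ, ‖θ‖ = 1 ∧ θ ^ 2 * z = -(‖z‖ : ℂ) := by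
  refine ⟨Complex.exp (((Real.pi - z.arg) / 2 : ℝ) * Complex.I),
    Complex.norm_exp_ofReal_mul_I _, ?_⟩
  have hz := Complex.norm_mul_exp_arg_mul_I z
  conv_lhs => enter [2]; rw [← hz]
  rw [← Complex.exp_nat_mul, mul_left_comm, ← Complex.exp_add]
  have : ((2 : ℕ) : ℂ) * ((((Real.pi - z.arg) / 2 : ℝ) : ℂ) * Complex.I) + z.arg * Complex.I =
      Real.pi * Complex.I := by push_cast; ring
  rw [this, Complex.exp_pi_mul_I]; ring

/-- Subtracting a linear q with ∇q = ∇Φ(p) creates a critical point at p, which is forbidden when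
|∇Φ(p)| is small. Subtracting Re (w·(z-p))² leaves gradient and complex Hessian at p unchanged but
shifts the holomorphic Hessian by -w wᵀ; with w proportional to v̄ this costs a definite multiple of
|v|² on the line of v. -/
lemma pointwise_of_robustness (G : Matrix (Fin n) (Fin n) ℂ) {δ : ℝ} (hδ : 0 < δ) (D : ℝ) :
    ∃ c : ℝ, 0 < c ∧ ∀ (Ω : Set (Cn n)) (Φ : Cn n → ℝ), IsOpen Ω → Bornology.IsBounded Ω →
      Metric.diam Ω ≤ D → ContDiffOn ℝ (⊤ : ℕ∞) Φ Ω → RobustnessGT G Ω Φ δ → ∀ p ∈ Ω,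
        c ≤ ∑ i, ‖grad (stdFrame n) Φ p i‖ ^ 2 ∧
        ∀ v : Fin n → ℂ, ∑ i, grad (stdFrame n) Φ p i * v i = 0 →
          c * ∑ i, ‖v i‖ ^ 2 + ‖∑ i, ∑ j, holHess (stdFrame n) Φ p i j * v i * v j‖ ≤
            (∑ i, ∑ j, mixedHess (stdFrame n) Φ p i j * v i * star (v j)).re := by
  set K : ℝ := ∑ i, ∑ j, ‖upper G i j‖ with hK
  have hK0 : 0 ≤ K := by positivity
  -- With |w|² = κ the gradient of Re (w·(z-p))² at distance at most |D| from p has Euclidean size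
  -- at most κ|D|, hence 𝒢-size at most δ.
  set κ : ℝ := δ / ((K + 1) * (|D| + 1)) with hκ
  have hκ0 : 0 < κ := by positivity
  refine ⟨min (δ ^ 2 / (K + 1)) κ, by positivity, ?_⟩
  intro Ω Φ hΩ hb hD hs hr p hp
  have hΦ : ContDiffAt ℝ 2 Φ p := by
    exact_mod_cast contDiffAt_infty.1 (hs.contDiffAt (hΩ.mem_nhds hp)) 2
  constructor
  · refine (min_le_left _ _).trans ?_
    by_contra! hlt
    -- The gradient of Re (b·z) is b/2, hence the factor 2.
    have h1 := hr (pluriQuad 0 fun k => 2 * grad (stdFrame n) Φ p k)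
      (isPluriharmonicQuadratic_pluriQuad _ _) (fun z _ => by
        rw [Real.sqrt_le_left hδ.le]
        refine (gradNormSq_le _ _ _).trans ?_
        simp only [grad_pluriQuad, Pi.zero_apply, mul_zero, zero_add,
          mul_div_cancel_left₀ _ (two_ne_zero' ℂ)]
        rw [lt_div_iff₀ (by positivity)] at hlt
        have : 0 ≤ ∑ i, ‖grad (stdFrame n) Φ p i‖ ^ 2 := by positivity
        rw [← hK]; nlinarith) p hp
    refine h1.1 (funext fun k => ?_)
    rw [grad_sub_pluriQuad hΦ]
    simp
  · intro v hv
    rcases eq_or_ne v 0 with rfl | hv0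
    · simp
    set s : ℝ := ∑ i, ‖v i‖ ^ 2 with hsdef
    have hs0 : 0 < s := by
      obtain ⟨i, hi⟩ := Function.ne_iff.1 hv0
      exact Finset.sum_pos' (fun _ _ => by positivity)
        ⟨i, Finset.mem_univ i, by have : 0 < ‖v i‖ := norm_pos_iff.2 hi
                                  positivity⟩
    have hsC : ∑ i, star (v i) * v i = (s : ℂ) := by
      rw [hsdef]; push_cast
      exact Finset.sum_congr rfl fun i _ => Complex.conj_mul' (v i)
    set Pv := ∑ i, ∑ j, holHess (stdFrame n) Φ p i j * v i * v j with hPv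
    -- Convexity is tested at θv, with the phase that makes the holomorphic quadratic part as
    -- negative as possible; this produces the absolute value of P(v, v).
    obtain ⟨θ, hθ, hθP⟩ := exists_unit_sq_mul_eq_neg_norm Pv
    have hθθ : θ * star θ = 1 := by
      rw [Complex.star_def, Complex.mul_conj', hθ]; simp
    set μ : ℂ := (Real.sqrt (κ / s) : ℂ) * star θ with hμ
    have hμn : ‖μ‖ ^ 2 = κ / s := by
      rw [hμ, norm_mul, norm_star, hθ, mul_one, Complex.norm_real, Real.norm_eq_abs, sq_abs,
        Real.sq_sqrt (by positivity)]
    set w : Fin n → ℂ := fun i => μ * star (v i) with hw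
    -- The linear coefficient recentres the square at p, up to an additive constant.
    have h1 := hr (pluriQuad w fun k => -2 * (∑ i, w i * p i) * w k)
      (isPluriharmonicQuadratic_pluriQuad _ _) (fun z hz => by
        rw [Real.sqrt_le_left hδ.le]
        refine (gradNormSq_le _ _ _).trans ?_
        have e (k : Fin n) : (∑ i, w i * z i) * w k + -2 * (∑ i, w i * p i) * w k / 2 =
            (∑ i, w i * (z i - p i)) * w k := by
          simp only [mul_sub, Finset.sum_sub_distrib]; ring
        simp only [grad_pluriQuad, e, norm_mul, mul_pow]
        rw [← Finset.mul_sum]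
        have hw2 : ∑ i, ‖w i‖ ^ 2 = κ := by
          simp only [hw, norm_mul, norm_star, mul_pow]
          rw [← Finset.mul_sum, hμn, ← hsdef, div_mul_cancel₀ _ hs0.ne']
        have hzp : ∑ i, ‖z i - p i‖ ^ 2 ≤ |D| ^ 2 := by
          have h2 : dist z p ≤ |D| := (Metric.dist_le_diam_of_mem hb hz hp).trans
            (hD.trans (le_abs_self D))
          have h3 := pow_le_pow_left₀ dist_nonneg h2 2
          rw [EuclideanSpace.dist_eq, Real.sq_sqrt (by positivity)] at h3
          simpa only [dist_eq_norm] using h3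
        have hcs : ‖∑ i, w i * (z i - p i)‖ ^ 2 ≤ κ * |D| ^ 2 := by
          have h4 : ‖∑ i, w i * (z i - p i)‖ ≤ ∑ i, ‖w i‖ * ‖z i - p i‖ :=
            (norm_sum_le _ _).trans (le_of_eq (by simp))
          calc _ ≤ (∑ i, ‖w i‖ * ‖z i - p i‖) ^ 2 := pow_le_pow_left₀ (norm_nonneg _) h4 2
            _ ≤ (∑ i, ‖w i‖ ^ 2) * ∑ i, ‖z i - p i‖ ^ 2 := Finset.sum_mul_sq_le_sq_mul_sq _ _ _
            _ ≤ _ := by rw [hw2]; gcongr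
        rw [hw2, ← hK]
        have h5 : κ * ((K + 1) * (|D| + 1)) = δ := by rw [hκ]; field_simp
        have h6 : (κ * |D|) ^ 2 * (K + 1) ^ 2 ≤ δ ^ 2 := by
          rw [← h5, ← mul_pow]
          refine pow_le_pow_left₀ (by positivity) ?_ 2
          have := abs_nonneg D
          nlinarith [mul_nonneg hκ0.le (by linarith : 0 ≤ K + 1)]
        calc K * (‖∑ i, w i * (z i - p i)‖ ^ 2 * κ) ≤ K * (κ * |D| ^ 2 * κ) := by gcongr
          _ = (κ * |D|) ^ 2 * K := by ring
          _ ≤ (κ * |D|) ^ 2 * (K + 1) ^ 2 := by gcongr; nlinarith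
          _ ≤ δ ^ 2 := h6) p hp
    have h2 := h1.2 (WithLp.toLp 2 fun i => θ * v i) (by
      intro h0
      apply hv0
      funext i
      have := congrArg (fun u : Cn n => star θ * u i) h0
      simp only [PiLp.zero_apply, mul_zero] at this
      rwa [← mul_assoc, mul_comm (star θ), hθθ, one_mul] at this) (by
      have e (k : Fin n) : grad (stdFrame n) Φ p k - ((∑ i, w i * p i) * w k +
          -2 * (∑ i, w i * p i) * w k / 2) = grad (stdFrame n) Φ p k := by ring
      simp only [grad_sub_pluriQuad hΦ, e, mul_left_comm _ θ]
      rw [← Finset.mul_sum, hv, mul_zero])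
    rw [mixedHess_sub_pluriQuad hΦ] at h2
    simp only [holHess_sub_pluriQuad hΦ] at h2
    have e1 : ∑ i, ∑ j, mixedHess (stdFrame n) Φ p i j * (θ * v i) * star (θ * v j) =
        ∑ i, ∑ j, mixedHess (stdFrame n) Φ p i j * v i * star (v j) := by
      refine Finset.sum_congr rfl fun i _ => Finset.sum_congr rfl fun j _ => ?_
      rw [star_mul']
      linear_combination (mixedHess (stdFrame n) Φ p i j * v i * star (v j)) * hθθ
    have hwv : ∑ i, w i * v i = μ * s := by
      rw [← hsC, Finset.mul_sum]; exact Finset.sum_congr rfl fun i _ => by rw [hw]; ring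
    have e2 : ∑ i, ∑ j, (holHess (stdFrame n) Φ p i j - w i * w j) * (θ * v i) * (θ * v j) =
        θ ^ 2 * Pv - (θ * ∑ i, w i * v i) ^ 2 := by
      rw [hPv, mul_pow, sq (∑ i, w i * v i), Finset.sum_mul_sum]
      simp only [Finset.mul_sum, ← Finset.sum_sub_distrib]
      exact Finset.sum_congr rfl fun i _ => Finset.sum_congr rfl fun j _ => by ring
    have e3 : (θ * ∑ i, w i * v i) ^ 2 = ((κ * s : ℝ) : ℂ) := by
      rw [hwv, hμ]
      have : θ * ((Real.sqrt (κ / s) : ℂ) * star θ * s) = ((Real.sqrt (κ / s) * s : ℝ) : ℂ) := by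
        push_cast; linear_combination ((Real.sqrt (κ / s) : ℂ) * s) * hθθ
      rw [this, ← Complex.ofReal_pow, mul_pow, Real.sq_sqrt (by positivity)]
      congr 1; field_simp
    rw [e1, e2, hθP, e3, ← Complex.ofReal_neg, ← Complex.ofReal_sub, Complex.ofReal_re] at h2
    have h3 : min (δ ^ 2 / (K + 1)) κ * s ≤ κ * s := by gcongr; exact min_le_right _ _
    linarith

/-! ## Bounds for first and second derivatives -/

lemma fderiv_toC {Φ : Cn n → ℝ} {z : Cn n} (h : DifferentiableAt ℝ Φ z) (v : Cn n) :
    fderiv ℝ (toC Φ) z v = (fderiv ℝ Φ z v : ℂ) := by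
  have : HasFDerivAt (toC Φ) (Complex.ofRealCLM.comp (fderiv ℝ Φ z)) z :=
    Complex.ofRealCLM.hasFDerivAt.comp z h.hasFDerivAt
  rw [this.fderiv]; rfl

lemma cderiv_toC_eq {Φ : Cn n → ℝ} {z : Cn n} (h : DifferentiableAt ℝ Φ z) (X : Cn n × Cn n) :
    cderiv X (toC Φ) z = (fderiv ℝ Φ z X.1 : ℂ) + Complex.I * (fderiv ℝ Φ z X.2 : ℂ) := by
  rw [cderiv, fderiv_toC h, fderiv_toC h]

lemma norm_cderiv_toC_le {Φ : Cn n → ℝ} {z : Cn n} (h : DifferentiableAt ℝ Φ z) {C : ℝ}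
    (hC : ‖fderiv ℝ Φ z‖ ≤ C) (X : Cn n × Cn n) :
    ‖cderiv X (toC Φ) z‖ ≤ C * (‖X.1‖ + ‖X.2‖) := by
  rw [cderiv_toC_eq h, mul_add]
  refine (norm_add_le _ _).trans (add_le_add ?_ ?_)
  · rw [Complex.norm_real]; exact (fderiv ℝ Φ z).le_of_opNorm_le hC _
  · rw [norm_mul, Complex.norm_I, one_mul, Complex.norm_real]
    exact (fderiv ℝ Φ z).le_of_opNorm_le hC _

lemma norm_cderiv_cderiv_toC_le {Φ : Cn n → ℝ} {z : Cn n} (h : ContDiffAt ℝ 2 Φ z) {C : ℝ}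
    (hC : ‖fderiv ℝ (fderiv ℝ Φ) z‖ ≤ C) (X Y : Cn n × Cn n) :
    ‖cderiv X (cderiv Y (toC Φ)) z‖ ≤ C * (‖X.1‖ + ‖X.2‖) * (‖Y.1‖ + ‖Y.2‖) := by
  have hd : DifferentiableAt ℝ (fderiv ℝ Φ) z :=
    (h.fderiv_right (m := 1) (by norm_num)).differentiableAt (by simp)
  have hv (v : Cn n) : HasFDerivAt (fun z => fderiv ℝ Φ z v)
      ((fderiv ℝ (fderiv ℝ Φ) z).flip v) z := by
    exact (hd.hasFDerivAt.clm_apply (hasFDerivAt_const v z)).congr_fderiv (by ext u; simp)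
  have hev : cderiv Y (toC Φ) =ᶠ[nhds z] fun z => toC (fun z => fderiv ℝ Φ z Y.1) z +
      Complex.I * toC (fun z => fderiv ℝ Φ z Y.2) z := by
    filter_upwards [(h.eventually (by simp))] with w hw
    exact cderiv_toC_eq (hw.differentiableAt (by simp)) Y
  have hdt (v : Cn n) : DifferentiableAt ℝ (toC fun z => fderiv ℝ Φ z v) z :=
    Complex.ofRealCLM.differentiableAt.comp z (hv v).differentiableAt
  rw [cderiv_congr hev, cderiv_add (hdt _) ((hdt _).const_mul _), cderiv_const_mul _ (hdt _)]
  have hb (v u : Cn n) : ‖fderiv ℝ (fderiv ℝ Φ) z u v‖ ≤ C * ‖u‖ * ‖v‖ :=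
    ((fderiv ℝ (fderiv ℝ Φ) z).le_opNorm₂ u v).trans (by gcongr)
  have hb2 (v : Cn n) : ‖cderiv X (toC fun z => fderiv ℝ Φ z v) z‖ ≤
      C * (‖X.1‖ + ‖X.2‖) * ‖v‖ := by
    rw [cderiv_toC_eq (hv v).differentiableAt, (hv v).fderiv]
    refine (norm_add_le _ _).trans ?_
    rw [norm_mul, Complex.norm_I, one_mul, Complex.norm_real, Complex.norm_real]
    have h1 := hb v X.1
    have h2 := hb v X.2
    simp only [ContinuousLinearMap.flip_apply]
    nlinarith
  refine (norm_add_le _ _).trans ?_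
  rw [norm_mul, Complex.norm_I, one_mul]
  have h1 := hb2 Y.1
  have h2 := hb2 Y.2
  nlinarith

lemma norm_holVec_le (v : Cn n) : ‖(holVec v).1‖ + ‖(holVec v).2‖ = ‖v‖ := by
  simp only [holVec, norm_neg, norm_smul, Complex.norm_I]
  norm_num; ring

lemma norm_antiVec_le (v : Cn n) : ‖(antiVec v).1‖ + ‖(antiVec v).2‖ = ‖v‖ := by
  simp only [antiVec, norm_smul, Complex.norm_I]
  norm_num; ring

lemma norm_derivatives_le {Φ : Cn n → ℝ} {z : Cn n} (h : ContDiffAt ℝ 2 Φ z) {C : ℝ}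
    (h1 : ‖fderiv ℝ Φ z‖ ≤ C) (h2 : ‖fderiv ℝ (fderiv ℝ Φ) z‖ ≤ C) (i j : Fin n) :
    ‖grad (stdFrame n) Φ z i‖ ≤ C ∧ ‖mixedHess (stdFrame n) Φ z i j‖ ≤ C ∧
      ‖holHess (stdFrame n) Φ z i j‖ ≤ C := by
  have hn (i : Fin n) : ‖stdFrame n i‖ = 1 := by simp [stdFrame]
  refine ⟨?_, ?_, ?_⟩
  · have := norm_cderiv_toC_le (h.differentiableAt (by simp)) h1 (holVec (stdFrame n i))
    rwa [norm_holVec_le, hn, mul_one, ← dHol_eq] at this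
  · have := norm_cderiv_cderiv_toC_le h h2 (holVec (stdFrame n i)) (antiVec (stdFrame n j))
    rwa [norm_holVec_le, norm_antiVec_le, hn, hn, mul_one, mul_one, ← dHol_eq, ← dAnti_eq] at this
  · have := norm_cderiv_cderiv_toC_le h h2 (holVec (stdFrame n i)) (holVec (stdFrame n j))
    rwa [norm_holVec_le, norm_holVec_le, hn, hn, mul_one, mul_one, ← dHol_eq, ← dHol_eq] at this

end
end

noncomputable section

/-! ## Linear algebra: frames adapted to a gradient and a complex Hessian -/

-- A square root from the spectral theorem. It serves both to factor the metric 𝒢 and to normalize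
-- the tangential part of the Hessian.
open Matrix in
lemma Matrix.PosDef.exists_eq_conjTranspose_mul {k : Type*} [Fintype k] [DecidableEq k]
    {A : Matrix k k ℂ} (hA : A.PosDef) : ∃ Q : Matrix k k ℂ, Q.det ≠ 0 ∧ A = Qᴴ * Q := by
  set U : Matrix k k ℂ := (hA.1.eigenvectorUnitary : Matrix k k ℂ)
  set S : Matrix k k ℂ := diagonal fun i => ((Real.sqrt (hA.1.eigenvalues i) : ℝ) : ℂ)
  have hA2 : A = (S * Uᴴ)ᴴ * (S * Uᴴ) := by
    have h := hA.1.spectral_theorem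
    rw [Unitary.conjStarAlgAut_apply] at h
    conv_lhs => rw [h]
    rw [conjTranspose_mul, conjTranspose_conjTranspose, diagonal_conjTranspose]
    simp only [Matrix.mul_assoc]
    congr 1
    simp only [← Matrix.mul_assoc]
    congr 1
    rw [diagonal_mul_diagonal]
    congr 1
    funext i
    simp only [Function.comp, Pi.star_apply, Complex.star_def, Complex.conj_ofReal]
    rw [← Complex.ofReal_mul, Real.mul_self_sqrt (hA.eigenvalues_pos i).le]; rfl
  refine ⟨S * Uᴴ, fun h0 => ?_, hA2⟩
  have h1 := hA.det_pos.ne'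
  rw [hA2, det_mul, h0, mul_zero] at h1
  exact h1 rfl

open Matrix

section
variable {n : ℕ}

lemma sum_sum_mul_eq_dotProduct {k : Type*} [Fintype k] (M : Matrix k k ℂ) (v w : k → ℂ) :
    ∑ i, ∑ j, M i j * v i * w j = v ⬝ᵥ (M *ᵥ w) := by
  simp only [dotProduct, mulVec, Finset.mul_sum]
  exact Finset.sum_congr rfl fun i _ => Finset.sum_congr rfl fun j _ => by ring

lemma sesquilinear_vecMul {k l : Type*} [Fintype k] [Fintype l] (M : Matrix k k ℂ)
    (T : Matrix l k ℂ) (x : l → ℂ) :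
    ∑ i, ∑ j, M i j * (x ᵥ* T) i * star ((x ᵥ* T) j) =
      ∑ a, ∑ b, (T * M * Tᴴ) a b * x a * star (x b) := by
  have h1 := sum_sum_mul_eq_dotProduct M (x ᵥ* T) (star (x ᵥ* T))
  have h2 := sum_sum_mul_eq_dotProduct (T * M * Tᴴ) x (star x)
  simp only [Pi.star_apply] at h1 h2
  rw [h1, h2, star_vecMul, ← dotProduct_mulVec, mulVec_mulVec, mulVec_mulVec, Matrix.mul_assoc]

lemma bilinear_vecMul {k l : Type*} [Fintype k] [Fintype l] (M : Matrix k k ℂ)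
    (T : Matrix l k ℂ) (x : l → ℂ) :
    ∑ i, ∑ j, M i j * (x ᵥ* T) i * (x ᵥ* T) j =
      ∑ a, ∑ b, (T * M * Tᵀ) a b * x a * x b := by
  rw [sum_sum_mul_eq_dotProduct M (x ᵥ* T) (x ᵥ* T), sum_sum_mul_eq_dotProduct (T * M * Tᵀ) x x]
  conv_lhs => enter [2, 2]; rw [← mulVec_transpose]
  rw [← dotProduct_mulVec, mulVec_mulVec, mulVec_mulVec, Matrix.mul_assoc]

lemma norm_det_le {k : Type*} [Fintype k] [DecidableEq k] {A : Matrix k k ℂ} {a : ℝ}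
    (h : ∀ i j, ‖A i j‖ ≤ a) :
    ‖A.det‖ ≤ (Fintype.card k).factorial * a ^ Fintype.card k := by
  have := Matrix.det_le (A := A) (abv := NormedField.toAbsoluteValue ℂ) (x := a) h
  rw [nsmul_eq_mul] at this
  exact this

lemma norm_adjugate_le {k : Type*} [Fintype k] [DecidableEq k] {A : Matrix k k ℂ} {a : ℝ}
    (ha : 1 ≤ a) (h : ∀ i j, ‖A i j‖ ≤ a) (i j : k) :
    ‖A.adjugate i j‖ ≤ (Fintype.card k).factorial * a ^ Fintype.card k := by
  rw [adjugate_apply]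
  refine norm_det_le fun k l => ?_
  by_cases hk : k = j
  · subst hk
    rw [updateRow_self, Pi.single_apply]
    split_ifs
    · simpa using ha
    · simp; linarith
  · rw [updateRow_ne hk]; exact h k l

lemma norm_inv_le {k : Type*} [Fintype k] [DecidableEq k] {A : Matrix k k ℂ} {a b : ℝ}
    (ha : 1 ≤ a) (h : ∀ i j, ‖A i j‖ ≤ a) (hb : 0 < b) (hd : b ≤ ‖A.det‖) (i j : k) :
    ‖A⁻¹ i j‖ ≤ (Fintype.card k).factorial * a ^ Fintype.card k / b := by
  rw [inv_def, Matrix.smul_apply, Ring.inverse_eq_inv', smul_eq_mul, norm_mul, norm_inv,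
    inv_mul_eq_div]
  exact div_le_div₀ (by positivity) (norm_adjugate_le ha h i j) hb hd

lemma norm_mul_apply_le {k l o : Type*} [Fintype l] {A : Matrix k l ℂ}
    {B : Matrix l o ℂ} {a b : ℝ} (hA : ∀ i j, ‖A i j‖ ≤ a) (hB : ∀ i j, ‖B i j‖ ≤ b) (i : k)
    (j : o) : ‖(A * B) i j‖ ≤ Fintype.card l * (a * b) := by
  rw [mul_apply]
  refine (norm_sum_le _ _).trans ?_
  refine (Finset.sum_le_card_nsmul _ _ (a * b) fun x _ => ?_).trans (by simp)
  rw [norm_mul]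
  exact mul_le_mul (hA i x) (hB x j) (norm_nonneg _) ((norm_nonneg _).trans (hA i x))

lemma exists_mulVec_eq_single {d : Fin n → ℂ} (hd : d ≠ 0) (a : Fin n) :
    ∃ R : Matrix (Fin n) (Fin n) ℂ, R.det ≠ 0 ∧ R *ᵥ d = Pi.single a 1 := by
  obtain ⟨A, hA⟩ := SeparatingDual.exists_continuousLinearEquiv_apply_eq (R := ℂ) hd
    (y := Pi.single a (1 : ℂ)) (by simp)
  refine ⟨LinearMap.toMatrix' (A.toLinearEquiv : (Fin n → ℂ) →ₗ[ℂ] (Fin n → ℂ)), ?_, ?_⟩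
  · rw [LinearMap.det_toMatrix']
    exact (LinearEquiv.isUnit_det' A.toLinearEquiv).ne_zero
  · rw [LinearMap.toMatrix'_mulVec]; exact hA

end

/-- The diagonal entries `(1, …, 1, ε)`. -/
def lastWeight (m : ℕ) (ε : ℝ) (a : Fin (m + 1)) : ℝ := if a = Fin.last m then ε else 1

@[simp] lemma lastWeight_last (m : ℕ) (ε : ℝ) : lastWeight m ε (Fin.last m) = ε := by
  simp [lastWeight]

@[simp] lemma lastWeight_castSucc (m : ℕ) (ε : ℝ) (α : Fin m) :
    lastWeight m ε α.castSucc = 1 := by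
  simp [lastWeight, Fin.castSucc_ne_last]

section
variable {m : ℕ}

/-- Both sides are multiplied by |det T|². The adjugate form needs no invertibility of T or H. -/
lemma det_eq_conj_frame {n : ℕ} {H G : Matrix (Fin n) (Fin n) ℂ} {ε : ℂ}
    (h : (n : ℂ) * H.det = ε * (H.adjugate * G).trace) (T : Matrix (Fin n) (Fin n) ℂ) :
    (n : ℂ) * (T * H * Tᴴ).det = ε * ((T * H * Tᴴ).adjugate * (T * G * Tᴴ)).trace := by
  have h1 : ((T * H * Tᴴ).adjugate * (T * G * Tᴴ)).trace =
      T.det * Tᴴ.det * (H.adjugate * G).trace := by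
    rw [adjugate_mul_distrib, adjugate_mul_distrib]
    have : Tᴴ.adjugate * (H.adjugate * T.adjugate) * (T * G * Tᴴ) =
        T.det • (Tᴴ.adjugate * (H.adjugate * G * Tᴴ)) := by
      have e : T.adjugate * T = T.det • 1 := adjugate_mul T
      calc _ = Tᴴ.adjugate * (H.adjugate * ((T.adjugate * T) * G) * Tᴴ) := by
            simp only [Matrix.mul_assoc]
        _ = _ := by rw [e]; simp
    rw [this, trace_smul, trace_mul_comm, Matrix.mul_assoc, mul_adjugate]
    simp [mul_assoc]
  rw [h1, det_mul, det_mul]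
  linear_combination T.det * Tᴴ.det * h

/-- Stated with the adjugate because it is applied before the last entry h is known to be nonzero.
-/
lemma trace_adjugate_diagonal (h : ℂ) (K : Matrix (Fin (m + 1)) (Fin (m + 1)) ℂ) :
    ((diagonal fun a => if a = Fin.last m then h else 1).adjugate * K).trace =
      h * ∑ α : Fin m, K α.castSucc α.castSucc + K (Fin.last m) (Fin.last m) := by
  rw [adjugate_diagonal]
  simp only [Matrix.trace, Matrix.diag, diagonal_mul]
  rw [Fin.sum_univ_castSucc, Finset.mul_sum]
  congr 1
  · refine Finset.sum_congr rfl fun α _ => ?_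
    congr 1
    rw [Finset.prod_eq_single_of_mem (Fin.last m)]
    · simp
    · simp [(Fin.castSucc_ne_last α).symm]
    · intro b _ hb; simp [hb]
  · rw [Finset.prod_eq_one, one_mul]
    intro b hb
    simp [Finset.ne_of_mem_erase hb]

lemma det_diagonal_last (h : ℂ) :
    (diagonal fun a => if a = Fin.last m then h else 1 : Matrix (Fin (m + 1)) (Fin (m + 1)) ℂ).det
      = h := by
  rw [det_diagonal, Fin.prod_univ_castSucc]
  simp [Fin.castSucc_ne_last]

/-- A Hermitian form which is positive on the annihilator of `d` is diagonalized by a frame whose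
first `m` vectors annihilate `d`. -/
lemma exists_diagonalizing_frame {H : Matrix (Fin (m + 1)) (Fin (m + 1)) ℂ} (hH : H.IsHermitian)
    {d : Fin (m + 1) → ℂ} (hd : d ≠ 0)
    (hpos : ∀ v : Fin (m + 1) → ℂ, v ≠ 0 → ∑ i, d i * v i = 0 →
      0 < (∑ i, ∑ j, H i j * v i * star (v j)).re) :
    ∃ (T : Matrix (Fin (m + 1)) (Fin (m + 1)) ℂ) (h : ℝ),
      T * H * Tᴴ = (diagonal fun a => if a = Fin.last m then (h : ℂ) else 1) ∧
      T *ᵥ d = Pi.single (Fin.last m) 1 := by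
  -- The first m rows of R then span the annihilator of d, and the last row pairs to 1 with d.
  obtain ⟨R, hR, hRd⟩ := exists_mulVec_eq_single hd (Fin.last m)
  set R0 : Matrix (Fin m) (Fin (m + 1)) ℂ := R.submatrix Fin.castSucc id
  have hR0d : R0 *ᵥ d = 0 := by
    funext α
    have := congrFun hRd α.castSucc
    rw [Pi.single_eq_of_ne (Fin.castSucc_ne_last α)] at this
    exact this
  have hinj (x : Fin m → ℂ) (hx : x ᵥ* R0 = 0) : x = 0 := by
    have h1 : (Fin.snoc (α := fun _ => ℂ) x 0 : Fin (m + 1) → ℂ) ᵥ* R = 0 := by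
      rw [← hx]
      funext j
      simp [vecMul, dotProduct, Fin.sum_univ_castSucc, R0]
    have h2 := Matrix.eq_zero_of_vecMul_eq_zero hR h1
    funext α
    simpa using congrFun h2 α.castSucc
  have hA0 : (R0 * H * R0ᴴ).PosDef := by
    refine Matrix.PosDef.of_dotProduct_mulVec_pos (isHermitian_mul_mul_conjTranspose _ hH) ?_
    intro x hx
    set M := R0 * H * R0ᴴ with hM
    have hMh : M.IsHermitian := isHermitian_mul_mul_conjTranspose _ hH
    have e1 : star x ⬝ᵥ M *ᵥ x = ∑ i, ∑ j, H i j * (star x ᵥ* R0) i * star ((star x ᵥ* R0) j) := by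
      rw [sesquilinear_vecMul, ← hM]
      have := sum_sum_mul_eq_dotProduct M (star x) x
      rw [← this]; simp
    have h1 := hpos (star x ᵥ* R0) (fun h0 => hx (by simpa using hinj _ h0)) (by
      have : ∑ i, d i * (star x ᵥ* R0) i = (star x ᵥ* R0) ⬝ᵥ d := by
        simp [dotProduct, mul_comm]
      rw [this, ← dotProduct_mulVec, hR0d, dotProduct_zero])
    rw [← e1] at h1
    have him : (star x ⬝ᵥ M *ᵥ x).im = 0 := hMh.im_star_dotProduct_mulVec_self x
    exact Complex.pos_iff.2 ⟨h1, him.symm⟩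
  obtain ⟨Q, hQ, hQA⟩ := hA0.exists_eq_conjTranspose_mul
  -- Rows of E are an H-orthonormal basis of the annihilator of d.
  set E : Matrix (Fin m) (Fin (m + 1)) ℂ := (Qᴴ)⁻¹ * R0 with hE
  have hQu : IsUnit Q.det := isUnit_iff_ne_zero.2 hQ
  have hQu' : IsUnit Qᴴ.det := by rw [det_conjTranspose]; exact hQu.star
  have hEE : E * H * Eᴴ = 1 := by
    rw [hE, conjTranspose_mul]
    calc _ = (Qᴴ)⁻¹ * (R0 * H * R0ᴴ) * ((Qᴴ)⁻¹)ᴴ := by simp only [Matrix.mul_assoc]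
      _ = 1 := by
        rw [hQA, ← Matrix.mul_assoc, nonsing_inv_mul _ hQu', Matrix.one_mul,
          conjTranspose_nonsing_inv, conjTranspose_conjTranspose, mul_nonsing_inv _ hQu]
  have hEd : E *ᵥ d = 0 := by rw [hE, ← mulVec_mulVec, hR0d, mulVec_zero]
  -- One Gram–Schmidt step against E. It does not change the pairing with d, since E annihilates d.
  set t : Fin (m + 1) → ℂ := R (Fin.last m) - (R (Fin.last m) ᵥ* (H * Eᴴ)) ᵥ* E with ht
  have htd : t ⬝ᵥ d = 1 := by
    rw [ht, sub_dotProduct, ← dotProduct_mulVec, hEd, dotProduct_zero, sub_zero]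
    have := congrFun hRd (Fin.last m)
    rwa [Pi.single_eq_same] at this
  have htE : t ᵥ* (H * Eᴴ) = 0 := by
    rw [ht, sub_vecMul, vecMul_vecMul, ← Matrix.mul_assoc E, hEE, vecMul_one, sub_self]
  set T : Matrix (Fin (m + 1)) (Fin (m + 1)) ℂ :=
    of (Fin.snoc (α := fun _ => Fin (m + 1) → ℂ) (fun α => E α) t) with hT
  have hTc (α : Fin m) : T α.castSucc = E α :=
    Fin.snoc_castSucc (α := fun _ => Fin (m + 1) → ℂ) (x := t) (p := fun α => E α) (i := α)
  have hTl : T (Fin.last m) = t :=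
    Fin.snoc_last (α := fun _ => Fin (m + 1) → ℂ) t (fun α => E α)
  have hentry (a b : Fin (m + 1)) : (T * H * Tᴴ) a b = T a ⬝ᵥ (H *ᵥ star (T b)) := by
    rw [Matrix.mul_assoc, mul_apply_eq_vecMul, vecMul_eq_sum]
    simp only [dotProduct, mulVec, mul_apply, conjTranspose_apply, Finset.sum_apply,
      Pi.smul_apply, smul_eq_mul, Pi.star_apply]
  have hEentry (α β : Fin m) : E α ⬝ᵥ (H *ᵥ star (E β)) = (E * H * Eᴴ) α β := by
    rw [Matrix.mul_assoc]
    simp only [dotProduct, mulVec, mul_apply, conjTranspose_apply, Pi.star_apply]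
  have htEentry (β : Fin m) : t ⬝ᵥ (H *ᵥ star (E β)) = 0 := by
    have := congrFun htE β
    simpa only [vecMul, dotProduct, mulVec, mul_apply, conjTranspose_apply, Pi.star_apply,
      Pi.zero_apply] using this
  have hTH : (T * H * Tᴴ).IsHermitian := isHermitian_mul_mul_conjTranspose _ hH
  refine ⟨T, ((T * H * Tᴴ) (Fin.last m) (Fin.last m)).re, ?_, ?_⟩
  · ext a b
    induction a using Fin.lastCases with
    | last =>
      induction b using Fin.lastCases with
      | last =>
        have h1 := hTH.apply (Fin.last m) (Fin.last m)
        rw [diagonal_apply_eq, if_pos rfl]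
        exact (Complex.conj_eq_iff_re.1 h1).symm
      | cast β =>
        rw [diagonal_apply_ne _ (Fin.castSucc_ne_last β).symm, hentry, hTl, hTc, htEentry]
    | cast α =>
      induction b using Fin.lastCases with
      | last =>
        rw [diagonal_apply_ne _ (Fin.castSucc_ne_last α), ← hTH.apply, hentry, hTl, hTc, htEentry,
          star_zero]
      | cast β =>
        rw [hentry, hTc, hTc, hEentry, hEE, diagonal_apply, one_apply]
        simp [Fin.castSucc_ne_last]
  · funext a
    induction a using Fin.lastCases with
    | last => rw [Pi.single_eq_same, ← htd, ← hTl]; rfl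
    | cast α =>
      rw [Pi.single_eq_of_ne (Fin.castSucc_ne_last α)]
      have := congrFun hEd α
      rw [mulVec, hTc]
      exact this

end
end

/-! ### Normalized frames with bounds independent of ε -/

noncomputable section
open Matrix

/-- The frame with rows `T` diagonalizes `H` as `diag(1, …, 1, ε)`, its first `m` vectors
annihilate `d`, and all relevant quantities are bounded in terms of `Λ` and `κ`. -/
structure IsAdaptedFrame {m : ℕ} (N : Matrix (Fin (m + 1)) (Fin (m + 1)) ℂ) (Λ κ ε : ℝ)
    (H P : Matrix (Fin (m + 1)) (Fin (m + 1)) ℂ) (d : Fin (m + 1) → ℂ)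
    (T : Matrix (Fin (m + 1)) (Fin (m + 1)) ℂ) : Prop where
  det_ne : T.det ≠ 0
  diag : T * H * Tᴴ = diagonal fun a => (lastWeight m ε a : ℂ)
  grad_castSucc : ∀ α : Fin m, (T *ᵥ d) α.castSucc = 0
  grad_le : ‖(T *ᵥ d) (Fin.last m)‖ ≤ Λ
  grad_ge : 1 ≤ Λ * ‖(T *ᵥ d) (Fin.last m)‖
  metric_le : ∀ k a, ‖(N * Tᴴ) k a‖ ≤ Λ
  metric_inv_le : ∀ a k, ‖(N * Tᴴ)⁻¹ a k‖ ≤ Λ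
  hol_le : ∀ a b, ‖(T * P * Tᵀ) a b‖ ≤ Λ
  contraction : ∀ x : Fin m → ℂ,
    ‖∑ α : Fin m, ∑ β : Fin m, (T * P * Tᵀ) α.castSucc β.castSucc * x α * x β‖ ≤
      (1 - κ) * ∑ α, ‖x α‖ ^ 2

section
variable {m : ℕ}

lemma sum_norm_mul_conjTranspose_sq_le {n : ℕ} (N : Matrix (Fin n) (Fin n) ℂ)
    (T : Matrix (Fin n) (Fin n) ℂ) (a : Fin n) :
    ∑ k, ‖(N * Tᴴ) k a‖ ^ 2 ≤ (∑ k, ∑ i, ‖N k i‖ ^ 2) * ∑ i, ‖T a i‖ ^ 2 := by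
  rw [Finset.sum_mul]
  refine Finset.sum_le_sum fun k _ => ?_
  rw [mul_apply]
  have h1 : ‖∑ i, N k i * Tᴴ i a‖ ≤ ∑ i, ‖N k i‖ * ‖T a i‖ :=
    (norm_sum_le _ _).trans (le_of_eq (by simp [conjTranspose_apply]))
  exact (pow_le_pow_left₀ (norm_nonneg _) h1 2).trans (Finset.sum_mul_sq_le_sq_mul_sq _ _ _)

lemma metric_diag {n : ℕ} {N G : Matrix (Fin n) (Fin n) ℂ} (hN : G = Nᴴ * N)
    (T : Matrix (Fin n) (Fin n) ℂ) (a : Fin n) :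
    (T * G * Tᴴ) a a = ((∑ k, ‖(N * Tᴴ) k a‖ ^ 2 : ℝ) : ℂ) := by
  have : T * G * Tᴴ = (N * Tᴴ)ᴴ * (N * Tᴴ) := by
    rw [hN, conjTranspose_mul, conjTranspose_conjTranspose]; simp only [Matrix.mul_assoc]
  rw [this, mul_apply]
  push_cast
  refine Finset.sum_congr rfl fun k _ => ?_
  rw [conjTranspose_apply]
  exact Complex.conj_mul' _

lemma mulVec_restrict (d : Fin (m + 1) → ℂ) (T : Matrix (Fin (m + 1)) (Fin (m + 1)) ℂ)
    (h : ∀ α : Fin m, (T *ᵥ d) α.castSucc = 0) (x : Fin m → ℂ) :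
    ∑ i, d i * ((Fin.snoc (α := fun _ => ℂ) x 0 : Fin (m + 1) → ℂ) ᵥ* T) i = 0 := by
  have : ∑ i, d i * ((Fin.snoc (α := fun _ => ℂ) x 0 : Fin (m + 1) → ℂ) ᵥ* T) i =
      ((Fin.snoc (α := fun _ => ℂ) x 0 : Fin (m + 1) → ℂ) ᵥ* T) ⬝ᵥ d := by
    simp [dotProduct, mul_comm]
  rw [this, ← dotProduct_mulVec, dotProduct, Fin.sum_univ_castSucc]
  simp [h]

lemma sesquilinear_le {n : ℕ} {H : Matrix (Fin n) (Fin n) ℂ} {C : ℝ} (hC : 0 ≤ C)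
    (hH : ∀ i j, ‖H i j‖ ≤ C) (v : Fin n → ℂ) :
    (∑ i, ∑ j, H i j * v i * star (v j)).re ≤ C * n * ∑ i, ‖v i‖ ^ 2 := by
  refine (Complex.re_le_norm _).trans ?_
  have h1 : ‖∑ i, ∑ j, H i j * v i * star (v j)‖ ≤ ∑ i, ∑ j, C * (‖v i‖ * ‖v j‖) := by
    refine (norm_sum_le _ _).trans (Finset.sum_le_sum fun i _ => (norm_sum_le _ _).trans
      (Finset.sum_le_sum fun j _ => ?_))
    rw [norm_mul, norm_mul, norm_star, mul_assoc]
    gcongr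
    exact hH i j
  refine h1.trans ?_
  simp only [← Finset.mul_sum]
  rw [← Finset.sum_mul, mul_assoc]
  refine mul_le_mul_of_nonneg_left ?_ hC
  have := sq_sum_le_card_mul_sum_sq (s := (Finset.univ : Finset (Fin n))) (f := fun i => ‖v i‖)
  simpa [sq] using this

lemma le_of_sq_le_of_one_le {x y : ℝ} (hy : 1 ≤ y) (h : x ^ 2 ≤ y) : x ≤ y := by nlinarith

lemma one_le_of_one_le_sq {x : ℝ} (hx : 0 ≤ x) (h : 1 ≤ x ^ 2) : 1 ≤ x := by nlinarith

lemma one_le_add_one_mul_of_one_le_mul_sq {q r : ℝ} (hq : 0 ≤ q) (hr : 0 ≤ r)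
    (h : 1 ≤ q * r ^ 2) : 1 ≤ (q + 1) * r := by
  refine one_le_of_one_le_sq (by positivity) ?_
  rw [mul_pow]
  have : q ≤ (q + 1) ^ 2 := by nlinarith
  nlinarith [mul_le_mul_of_nonneg_right this (sq_nonneg r)]

-- In a frame with H = diag(1, …, 1, h) the equation reads n h = ε(h·g_tan + g_ττ). Robustness
-- bounds the tangential metric g_tan, so h > 0 for small ε, and rescaling the last vector replaces
-- h by ε. The rescaled equation then bounds g_ττ. For the inverse, the original equation gives |det
-- H| = O(ε), while |det T|²|det H| = ε; hence det T is bounded below.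
set_option maxHeartbeats 1000000 in
lemma exists_adapted_frame (m : ℕ) {N G : Matrix (Fin (m + 1)) (Fin (m + 1)) ℂ}
    (hN : N.det ≠ 0) (hG : G = Nᴴ * N) {c : ℝ} (hc : 0 < c) (C : ℝ) :
    ∃ ε₀ Λ κ : ℝ, 0 < ε₀ ∧ 1 ≤ Λ ∧ 0 < κ ∧ ∀ ε : ℝ, 0 < ε → ε < ε₀ →
      ∀ (H P : Matrix (Fin (m + 1)) (Fin (m + 1)) ℂ) (d : Fin (m + 1) → ℂ),
        H.IsHermitian → (∀ i j, ‖H i j‖ ≤ C) → (∀ i j, ‖P i j‖ ≤ C) → (∀ i, ‖d i‖ ≤ C) →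
        c ≤ ∑ i, ‖d i‖ ^ 2 →
        (∀ v : Fin (m + 1) → ℂ, ∑ i, d i * v i = 0 →
          c * ∑ i, ‖v i‖ ^ 2 + ‖∑ i, ∑ j, P i j * v i * v j‖ ≤
            (∑ i, ∑ j, H i j * v i * star (v j)).re) →
        (((m + 1 : ℕ) : ℂ) * H.det = ε * (H.adjugate * G).trace) →
        ∃ T, IsAdaptedFrame N Λ κ ε H P d T := by
  obtain ⟨n, hn⟩ : ∃ x : ℝ, x = (m : ℝ) + 1 := ⟨_, rfl⟩
  have hn1 : 1 ≤ n := by rw [hn]; linarith [(Nat.cast_nonneg m : (0 : ℝ) ≤ m)]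
  obtain ⟨C1, hC1⟩ : ∃ x : ℝ, x = max C 1 := ⟨_, rfl⟩
  have hC11 : 1 ≤ C1 := hC1 ▸ le_max_right _ _
  have hCC1 : C ≤ C1 := hC1 ▸ le_max_left _ _
  obtain ⟨KN, hKN⟩ : ∃ x : ℝ, x = ∑ k, ∑ i, ‖N k i‖ ^ 2 := ⟨_, rfl⟩
  have hKN0 : 0 ≤ KN := by rw [hKN]; positivity
  obtain ⟨b1, hb1⟩ : ∃ x : ℝ, x = KN / c + n + 1 := ⟨_, rfl⟩
  have hb11 : 1 ≤ b1 := by have : 0 ≤ KN / c := div_nonneg hKN0 hc.le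
                           linarith
  obtain ⟨f, hf⟩ : ∃ x : ℝ, x = ((m + 1).factorial : ℝ) := ⟨_, rfl⟩
  have hf1 : 1 ≤ f := by rw [hf]; exact_mod_cast (Nat.factorial_pos (m + 1) : 1 ≤ (m + 1).factorial)
  obtain ⟨g1, hg1⟩ : ∃ x : ℝ, x = ∑ i, ∑ j, ‖G i j‖ := ⟨_, rfl⟩
  have hg10 : 0 ≤ g1 := by rw [hg1]; positivity
  obtain ⟨C3, hC3⟩ : ∃ x : ℝ, x = n * (f * C1 ^ (m + 1) * g1) * n + 1 := ⟨_, rfl⟩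
  have hC30 : 0 < C3 := by rw [hC3]; positivity
  obtain ⟨δ1, hδ1⟩ : ∃ x : ℝ, x = ‖N.det‖ / Real.sqrt C3 := ⟨_, rfl⟩
  have hδ10 : 0 < δ1 := by have := norm_pos_iff.2 hN
                           rw [hδ1]; positivity
  obtain ⟨b2, hb2⟩ : ∃ x : ℝ, x = f * b1 ^ (m + 1) / δ1 := ⟨_, rfl⟩
  have hb20 : 0 < b2 := by rw [hb2]; positivity
  obtain ⟨n1, hn1'⟩ : ∃ x : ℝ, x = ∑ i, ∑ j, ‖N⁻¹ i j‖ := ⟨_, rfl⟩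
  have hn10 : 0 ≤ n1 := by rw [hn1']; positivity
  obtain ⟨n2, hn2'⟩ : ∃ x : ℝ, x = ∑ i, ∑ j, ‖N i j‖ := ⟨_, rfl⟩
  have hn20 : 0 ≤ n2 := by rw [hn2']; positivity
  obtain ⟨b3, hb3⟩ : ∃ x : ℝ, x = n * (n1 * b1) := ⟨_, rfl⟩
  obtain ⟨b4, hb4⟩ : ∃ x : ℝ, x = n * (b2 * n2) := ⟨_, rfl⟩
  have hb30 : 0 ≤ b3 := by rw [hb3]; positivity
  have hb40 : 0 ≤ b4 := by rw [hb4]; positivity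
  -- A sum of nonnegative bounds, so that each quantity in `IsAdaptedFrame` is at most Λ.
  obtain ⟨Λ, hΛ⟩ : ∃ x : ℝ, x = 1 + b1 + b2 + n * (b3 * C1) + (n * b4 ^ 2 / c + 1) + n * (n * (b3 * C1) * b3) := ⟨_, rfl⟩
  have hp1 : 0 ≤ n * (b3 * C1) := by positivity
  have hp2 : 0 ≤ n * b4 ^ 2 / c := by positivity
  have hp3 : 0 ≤ n * (n * (b3 * C1) * b3) := by positivity
  have hentry {M : Matrix (Fin (m + 1)) (Fin (m + 1)) ℂ} (i j) : ‖M i j‖ ≤ ∑ i, ∑ j, ‖M i j‖ :=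
    (Finset.single_le_sum (f := fun j => ‖M i j‖) (fun _ _ => norm_nonneg _)
      (Finset.mem_univ j)).trans (Finset.single_le_sum (f := fun i => ∑ j, ‖M i j‖)
        (fun _ _ => Finset.sum_nonneg fun _ _ => norm_nonneg _) (Finset.mem_univ i))
  -- The first constant makes ε times the tangential trace less than 1; the last one compares the
  -- margin c|v|² with H(v, v̄) ≤ C₁n|v|².
  refine ⟨c / (m * KN + 1), Λ, c / (C1 * n), by positivity, by linarith, by positivity, ?_⟩
  intro ε hε hε0 H P d hH hHC hPC hdC hd hpos heq
  have hHC1 (i j) : ‖H i j‖ ≤ C1 := (hHC i j).trans hCC1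
  have hPC1 (i j) : ‖P i j‖ ≤ C1 := (hPC i j).trans hCC1
  have hdC1 (i) : ‖d i‖ ≤ C1 := (hdC i).trans hCC1
  have hd0 : d ≠ 0 := by rintro rfl; simp at hd; linarith
  obtain ⟨T1, h, hT1H, hT1d⟩ := exists_diagonalizing_frame hH hd0 (fun v hv hdv => by
    have h1 := hpos v hdv
    have h2 : 0 < ∑ i, ‖v i‖ ^ 2 := by
      obtain ⟨i, hi⟩ := Function.ne_iff.1 hv
      exact Finset.sum_pos' (fun _ _ => by positivity)
        ⟨i, Finset.mem_univ i, by have : 0 < ‖v i‖ := norm_pos_iff.2 hi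
                                  positivity⟩
    have h3 := norm_nonneg (∑ i, ∑ j, P i j * v i * v j)
    have h4 := mul_pos hc h2
    linarith)
  have hT1c (α : Fin m) : (T1 *ᵥ d) α.castSucc = 0 := by
    rw [hT1d, Pi.single_eq_of_ne (Fin.castSucc_ne_last α)]
  -- bounds for the tangential part of the metric
  have hrow (T : Matrix (Fin (m + 1)) (Fin (m + 1)) ℂ) (hc1 : ∀ α : Fin m, (T *ᵥ d) α.castSucc = 0)
      (α : Fin m) (hα : (T * H * Tᴴ) α.castSucc α.castSucc = 1) :
      ∑ k, ‖(N * Tᴴ) k α.castSucc‖ ^ 2 ≤ KN / c := by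
    refine (sum_norm_mul_conjTranspose_sq_le N T α.castSucc).trans ?_
    have h1 := hpos (T α.castSucc) (by
      have := hc1 α
      simpa [mulVec, dotProduct, mul_comm] using this)
    have h2 : ∑ i, ∑ j, H i j * T α.castSucc i * star (T α.castSucc j) = 1 := by
      have := sesquilinear_vecMul H T (Pi.single α.castSucc 1)
      rw [single_one_vecMul] at this
      refine this.trans ?_
      simp [Pi.single_apply, hα]
    rw [h2, Complex.one_re] at h1
    have h3 := norm_nonneg (∑ i, ∑ j, P i j * T α.castSucc i * T α.castSucc j)
    rw [div_eq_mul_one_div, ← hKN]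
    refine mul_le_mul_of_nonneg_left ?_ hKN0
    rw [le_div_iff₀ hc]; linarith
  have hdiag1 (α : Fin m) : (T1 * H * T1ᴴ) α.castSucc α.castSucc = 1 := by
    rw [hT1H]; simp [Fin.castSucc_ne_last]
  -- the last diagonal entry is positive
  obtain ⟨gl, hgl⟩ : ∃ x : ℝ, x = ∑ k, ‖(N * T1ᴴ) k (Fin.last m)‖ ^ 2 := ⟨_, rfl⟩
  obtain ⟨gt, hgt⟩ : ∃ x : ℝ, x = ∑ α : Fin m, ∑ k, ‖(N * T1ᴴ) k α.castSucc‖ ^ 2 := ⟨_, rfl⟩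
  -- gt and gl are the traces of 𝒢 over the tangential vectors and over the last vector.
  have heq1 : n * h = ε * (h * gt + gl) := by
    have h1 := det_eq_conj_frame heq T1
    rw [hT1H, det_diagonal_last, trace_adjugate_diagonal] at h1
    simp only [metric_diag hG] at h1
    rw [← Complex.ofReal_inj, hn, hgt, hgl]
    push_cast at h1 ⊢
    exact h1
  have hgl0 : 0 < gl := by
    rcases (show 0 ≤ gl by rw [hgl]; exact Finset.sum_nonneg fun _ _ => sq_nonneg _).lt_or_eq with h1 | h1
    · exact h1
    exfalso
    have h2 : ∀ k, (N * T1ᴴ) k (Fin.last m) = 0 := fun k => by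
      have := (Finset.sum_eq_zero_iff_of_nonneg (fun k _ => sq_nonneg _)).1 (hgl.symm.trans h1.symm) k
        (Finset.mem_univ k)
      simpa using this
    have h3 : N *ᵥ (star (T1 (Fin.last m))) = 0 := by
      funext k
      simpa [mulVec, dotProduct, mul_apply, conjTranspose_apply] using h2 k
    have h4 := Matrix.eq_zero_of_mulVec_eq_zero hN h3
    have h5 : (T1 *ᵥ d) (Fin.last m) = 1 := by rw [hT1d]; simp
    rw [mulVec, star_eq_zero.1 h4, zero_dotProduct] at h5
    exact zero_ne_one h5
  have hgtle : gt ≤ m * (KN / c) := by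
    rw [hgt]
    refine (Finset.sum_le_card_nsmul _ _ (KN / c) fun α _ => hrow T1 hT1c α (hdiag1 α)).trans ?_
    simp
  have hεgt : ε * gt < 1 := by
    have h1 : ε * gt ≤ ε * (m * (KN / c)) := by gcongr
    have h2 : ε * (m * KN + 1) < c := by rwa [lt_div_iff₀ (by positivity)] at hε0
    have h3 : ε * (m * (KN / c)) = ε * (m * KN) / c := by ring
    have h4 : ε * (m * KN) / c < 1 := by rw [div_lt_one hc]; linarith
    linarith
  have hh0 : 0 < h := by
    have h1 : h * (n - ε * gt) = ε * gl := by linarith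
    have h2 : 0 < n - ε * gt := by linarith
    -- From h(n - ε·gt) = ε·gl with n - ε·gt > 0 and gl > 0.
    by_contra! h3
    have : h * (n - ε * gt) ≤ 0 := mul_nonpos_of_nonpos_of_nonneg h3 h2.le
    have : 0 < ε * gl := by positivity
    linarith
  -- rescale the last vector
  obtain ⟨s, hs⟩ : ∃ x : ℝ, x = Real.sqrt (ε / h) := ⟨_, rfl⟩
  have hs2 : s * s * h = ε := by
    rw [hs, Real.mul_self_sqrt (by positivity), div_mul_cancel₀ _ hh0.ne']
  obtain ⟨Ds, hDs⟩ : ∃ x : Matrix (Fin (m + 1)) (Fin (m + 1)) ℂ,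
    x = diagonal fun a => if a = Fin.last m then (s : ℂ) else 1 := ⟨_, rfl⟩
  obtain ⟨T, hT⟩ : ∃ x, x = Ds * T1 := ⟨_, rfl⟩
  have hTH : T * H * Tᴴ = diagonal fun a => (lastWeight m ε a : ℂ) := by
    have : T * H * Tᴴ = Ds * (T1 * H * T1ᴴ) * Dsᴴ := by
      rw [hT, conjTranspose_mul]; simp only [Matrix.mul_assoc]
    rw [this, hT1H, hDs, diagonal_conjTranspose, diagonal_mul_diagonal, diagonal_mul_diagonal]
    congr 1
    funext a
    by_cases ha : a = Fin.last m
    · simp only [ha, if_true, lastWeight, Pi.star_apply, Complex.star_def, Complex.conj_ofReal]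
      rw [← hs2]; push_cast; ring
    · simp [ha, lastWeight]
  have hTH' : T * H * Tᴴ = diagonal fun a => if a = Fin.last m then (ε : ℂ) else 1 := by
    rw [hTH]; congr 1; funext a; unfold lastWeight; split_ifs <;> simp
  have hTc (α : Fin m) : (T *ᵥ d) α.castSucc = 0 := by
    rw [hT, ← mulVec_mulVec, hDs, mulVec_diagonal, hT1c, mul_zero]
  have hdetT : T.det * H.det * star T.det = ε := by
    have := congrArg Matrix.det hTH'
    rwa [det_diagonal_last, det_mul, det_mul, det_conjTranspose] at this
  have hT0 : T.det ≠ 0 := by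
    intro h0
    rw [h0] at hdetT
    simp at hdetT
    exact hε.ne' (by exact_mod_cast hdetT.symm)
  obtain ⟨B, hB⟩ : ∃ x, x = N * Tᴴ := ⟨_, rfl⟩
  -- With last eigenvalue exactly ε a factor ε cancels, and both groups of terms are nonnegative:
  -- this bounds the last column of B.
  have heq2 : n = ε * (∑ α : Fin m, ∑ k, ‖B k α.castSucc‖ ^ 2) + ∑ k, ‖B k (Fin.last m)‖ ^ 2 := by
    have h1 := det_eq_conj_frame heq T
    rw [hTH', det_diagonal_last, trace_adjugate_diagonal] at h1
    simp only [metric_diag hG, ← hB] at h1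
    have h2 : n * ε = ε * (ε * (∑ α : Fin m, ∑ k, ‖B k α.castSucc‖ ^ 2) +
        ∑ k, ‖B k (Fin.last m)‖ ^ 2) := by
      rw [← Complex.ofReal_inj, hn]
      push_cast at h1 ⊢
      exact h1
    have := mul_left_cancel₀ hε.ne' ((mul_comm ε n).trans h2)
    exact this
  have hBle (k a) : ‖B k a‖ ≤ b1 := by
    have h1 : ∑ k, ‖B k a‖ ^ 2 ≤ b1 := by
      induction a using Fin.lastCases with
      | last =>
        have : 0 ≤ ε * (∑ α : Fin m, ∑ k, ‖B k α.castSucc‖ ^ 2) :=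
          mul_nonneg hε.le (Finset.sum_nonneg fun _ _ => Finset.sum_nonneg fun _ _ => sq_nonneg _)
        have : 0 ≤ KN / c := div_nonneg hKN0 hc.le
        linarith
      | cast α =>
        have := hrow T hTc α (by rw [hTH]; simp)
        rw [← hB] at this
        linarith
    have h2 : ‖B k a‖ ^ 2 ≤ ∑ k, ‖B k a‖ ^ 2 :=
      Finset.single_le_sum (f := fun k => ‖B k a‖ ^ 2) (fun _ _ => sq_nonneg _)
        (Finset.mem_univ k)
    exact le_of_sq_le_of_one_le hb11 (h2.trans h1)
  -- The equation itself shows that det H is of order ε, since adj H is bounded by the bounds on H.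
  have hdetH : ‖H.det‖ ≤ ε * C3 := by
    have h1 : ‖(H.adjugate * G).trace‖ ≤ C3 := by
      have h2 (i : Fin (m + 1)) : ‖(H.adjugate * G) i i‖ ≤ n * (f * C1 ^ (m + 1) * g1) := by
        have := norm_mul_apply_le (A := H.adjugate) (B := G)
          (fun i j => norm_adjugate_le hC11 hHC1 i j) (fun i j => hentry i j) i i
        simpa [hn, hf, hg1] using this
      refine (norm_sum_le _ _).trans ((Finset.sum_le_card_nsmul _ _ _ fun i _ => h2 i).trans ?_)
      simp only [Finset.card_univ, Fintype.card_fin, nsmul_eq_mul, Nat.cast_add, Nat.cast_one,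
        ← hn, hC3]
      linarith
    have h2 := congrArg norm heq
    rw [norm_mul, norm_mul, Complex.norm_real, Real.norm_eq_abs, abs_of_pos hε,
      Complex.norm_natCast] at h2
    have h3 : ‖H.det‖ ≤ ((m + 1 : ℕ) : ℝ) * ‖H.det‖ := by
      have : (1 : ℝ) ≤ ((m + 1 : ℕ) : ℝ) := by push_cast; linarith
      exact le_mul_of_one_le_left (norm_nonneg _) this
    have h4 : ε * ‖(H.adjugate * G).trace‖ ≤ ε * C3 := by gcongr
    linarith
  -- Combine |det T|²|det H| = ε with |det H| ≤ εC₃.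
  have hdetB : δ1 ≤ ‖B.det‖ := by
    rw [hδ1, hB, det_mul, det_conjTranspose, norm_mul, norm_star, div_eq_mul_inv]
    refine mul_le_mul_of_nonneg_left ?_ (norm_nonneg _)
    have h1 := congrArg norm hdetT
    rw [norm_mul, norm_mul, norm_star, Complex.norm_real, Real.norm_eq_abs, abs_of_pos hε] at h1
    have h2 : ε ≤ ‖T.det‖ ^ 2 * (ε * C3) := by
      calc ε = ‖T.det‖ ^ 2 * ‖H.det‖ := by rw [← h1]; ring
        _ ≤ _ := by gcongr
    have h3 : 1 ≤ (‖T.det‖ * Real.sqrt C3) ^ 2 := by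
      rw [mul_pow, Real.sq_sqrt hC30.le]
      have : ε * 1 ≤ ε * (‖T.det‖ ^ 2 * C3) := by linarith
      exact le_of_mul_le_mul_left this hε
    have h4 : 1 ≤ ‖T.det‖ * Real.sqrt C3 :=
      one_le_of_one_le_sq (mul_nonneg (norm_nonneg _) (Real.sqrt_nonneg _)) h3
    rwa [inv_le_iff_one_le_mul₀ (by positivity)]
  have hBinv (i j) : ‖B⁻¹ i j‖ ≤ b2 := by
    have := norm_inv_le hb11 hBle hδ10 hdetB i j
    simpa [hb2, hf] using this
  have hNu : IsUnit N.det := isUnit_iff_ne_zero.2 hN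
  have hTu : IsUnit T.det := isUnit_iff_ne_zero.2 hT0
  have hTle (i j) : ‖T i j‖ ≤ b3 := by
    have h1 : T = (N⁻¹ * B)ᴴ := by
      rw [hB, nonsing_inv_mul_cancel_left _ _ hNu, conjTranspose_conjTranspose]
    rw [h1, conjTranspose_apply, norm_star]
    have := norm_mul_apply_le (A := N⁻¹) (B := B) (fun i j => hentry i j) hBle j i
    simpa [hb3, hn1', hn] using this
  have hTinv (i j) : ‖T⁻¹ i j‖ ≤ b4 := by
    have h1 : T⁻¹ = (B⁻¹ * N)ᴴ := by
      rw [hB, Matrix.mul_inv_rev, Matrix.mul_assoc, nonsing_inv_mul _ hNu, Matrix.mul_one,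
        conjTranspose_nonsing_inv, conjTranspose_conjTranspose]
    rw [h1, conjTranspose_apply, norm_star]
    have := norm_mul_apply_le (A := B⁻¹) (B := N) hBinv (fun i j => hentry i j) j i
    simpa [hb4, hn2', hn] using this
  have hsymm : T *ᵥ d = Pi.single (Fin.last m) ((T *ᵥ d) (Fin.last m)) := by
    funext a
    induction a using Fin.lastCases with
    | last => simp
    | cast α => rw [hTc, Pi.single_eq_of_ne (Fin.castSucc_ne_last α)]
  refine ⟨T, hT0, hTH, hTc, ?_, ?_, fun k a => hB ▸ (hBle k a).trans (by linarith),
    fun a k => hB ▸ (hBinv a k).trans (by linarith), fun a b => ?_, fun x => ?_⟩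
  · rw [mulVec, dotProduct]
    refine (norm_sum_le _ _).trans ((Finset.sum_le_card_nsmul _ _ (b3 * C1) fun i _ => ?_).trans ?_)
    · rw [norm_mul]; exact mul_le_mul (hTle _ _) (hdC1 i) (norm_nonneg _) hb30
    · simp only [Finset.card_univ, Fintype.card_fin, nsmul_eq_mul, Nat.cast_add, Nat.cast_one,
        ← hn]
      linarith
  · set r := (T *ᵥ d) (Fin.last m) with hr
    have h1 (i) : ‖d i‖ ≤ b4 * ‖r‖ := by
      have : d = T⁻¹ *ᵥ (T *ᵥ d) := by rw [mulVec_mulVec, nonsing_inv_mul _ hTu, one_mulVec]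
      rw [this, hsymm, mulVec_single, ]
      simp only [Pi.smul_apply, MulOpposite.smul_eq_mul_unop, MulOpposite.unop_op, col_apply,
        norm_mul]
      gcongr
      exact hTinv _ _
    have h2 : c ≤ n * (b4 * ‖r‖) ^ 2 := by
      refine hd.trans ((Finset.sum_le_card_nsmul _ _ ((b4 * ‖r‖) ^ 2) fun i _ => ?_).trans ?_)
      · exact pow_le_pow_left₀ (norm_nonneg _) (h1 i) 2
      · simp [hn]
    have h3 : 1 ≤ n * b4 ^ 2 / c * ‖r‖ ^ 2 := by
      have : n * b4 ^ 2 / c * ‖r‖ ^ 2 = n * (b4 * ‖r‖) ^ 2 / c := by ring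
      rw [this, one_le_div hc]; exact h2
    have h4 : 0 ≤ ‖r‖ := norm_nonneg _
    have h5 : n * b4 ^ 2 / c + 1 ≤ Λ := by linarith
    have h7 := one_le_add_one_mul_of_one_le_mul_sq hp2 h4 h3
    exact h7.trans (by gcongr)
  · have h1 := norm_mul_apply_le (A := T) (B := P) hTle hPC1
    have h2 := norm_mul_apply_le (A := T * P) (B := Tᵀ) h1 (fun i j => hTle j i) a b
    simp only [Fintype.card_fin, Nat.cast_add, Nat.cast_one, ← hn] at h2
    linarith
  -- Here H(v, v̄) = |x|² for the tangent vector v with components x, so the margin c|v|² becomes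
  -- the strict contraction constant κ.
  · set x' : Fin (m + 1) → ℂ := Fin.snoc (α := fun _ => ℂ) x 0 with hx'
    have h1 := hpos (x' ᵥ* T) (mulVec_restrict d T hTc x)
    have h2 := sesquilinear_le (by linarith : (0 : ℝ) ≤ C1) hHC1 (x' ᵥ* T)
    rw [bilinear_vecMul] at h1
    have h3 : ∑ i, ∑ j, H i j * (x' ᵥ* T) i * star ((x' ᵥ* T) j) =
        ((∑ α, ‖x α‖ ^ 2 : ℝ) : ℂ) := by
      rw [sesquilinear_vecMul, hTH]
      simp only [diagonal_apply, ite_mul, zero_mul, Finset.sum_ite_eq, Finset.mem_univ, if_true]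
      rw [Fin.sum_univ_castSucc]
      simp only [hx', Fin.snoc_castSucc, Fin.snoc_last, lastWeight_castSucc]
      push_cast
      simp [Complex.mul_conj']
    have h4 : ∑ a, ∑ b, (T * P * Tᵀ) a b * x' a * x' b =
        ∑ α : Fin m, ∑ β : Fin m, (T * P * Tᵀ) α.castSucc β.castSucc * x α * x β := by
      rw [Fin.sum_univ_castSucc]
      simp only [Fin.sum_univ_castSucc, hx', Fin.snoc_castSucc, Fin.snoc_last]
      simp
    rw [h3, Complex.ofReal_re] at h1 h2
    rw [h4] at h1
    set X := ∑ α, ‖x α‖ ^ 2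
    set V := ∑ i, ‖(x' ᵥ* T) i‖ ^ 2
    have h5 : c / (C1 * n) * X ≤ c * V := by
      have h6 : X ≤ C1 * n * V := by simpa [hn] using h2
      calc c / (C1 * n) * X ≤ c / (C1 * n) * (C1 * n * V) := by gcongr
        _ = c * V := by field_simp
    linarith

end
end

noncomputable section
open scoped ContDiff
open Matrix

/-! ## Linear frames and third order derivatives -/

/-- The coordinate vectors `t_a = ∑ T_{a i} e_i`. -/
def frameOf {n : ℕ} (T : Matrix (Fin n) (Fin n) ℂ) : Fin n → Cn n :=
  fun a => ∑ i, T a i • stdFrame n i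

section
variable {n : ℕ} {Ω : Set (Cn n)} {f g : Cn n → ℂ} {z p : Cn n}

lemma ContDiffOn.contDiffAt_two (hf : ContDiffOn ℝ ∞ f Ω) (hΩ : IsOpen Ω) (hz : z ∈ Ω) :
    ContDiffAt ℝ 2 f z := by
  exact_mod_cast contDiffAt_infty.1 (hf.contDiffAt (hΩ.mem_nhds hz)) 2

lemma ContDiffOn.dHol (hf : ContDiffOn ℝ ∞ f Ω) (hΩ : IsOpen Ω) (v : Cn n) :
    ContDiffOn ℝ ∞ (dHol v f) Ω := by
  rw [dHol_eq]; exact ContDiffOn.cderiv hΩ hf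

lemma ContDiffOn.dAnti (hf : ContDiffOn ℝ ∞ f Ω) (hΩ : IsOpen Ω) (v : Cn n) :
    ContDiffOn ℝ ∞ (dAnti v f) Ω := by
  rw [dAnti_eq]; exact ContDiffOn.cderiv hΩ hf

lemma ContDiffOn.toC_comp {Φ : Cn n → ℝ} (hΦ : ContDiffOn ℝ ∞ Φ Ω) : ContDiffOn ℝ ∞ (toC Φ) Ω :=
  Complex.ofRealCLM.contDiff.comp_contDiffOn hΦ

lemma cderiv_congr_on (hΩ : IsOpen Ω) (h : Set.EqOn f g Ω) (hz : z ∈ Ω) (X : Cn n × Cn n) :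
    cderiv X f z = cderiv X g z :=
  cderiv_congr (h.eventuallyEq_of_mem (hΩ.mem_nhds hz))

lemma cderiv_comm_on (hΩ : IsOpen Ω) (hf : ContDiffOn ℝ ∞ f Ω) (X Y : Cn n × Cn n) :
    Set.EqOn (cderiv X (cderiv Y f)) (cderiv Y (cderiv X f)) Ω := fun _ hz =>
  cderiv_comm (hf.contDiffAt_two hΩ hz)

/-- This turns the operator L applied to an entry of a Hessian into second derivatives of the
Hessian along the two indices of that entry, to which the differentiated equation applies. -/
lemma cderiv_pairs_comm (hΩ : IsOpen Ω) (hf : ContDiffOn ℝ ∞ f Ω) (A B P Q : Cn n × Cn n)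
    (hz : z ∈ Ω) :
    cderiv A (cderiv B (cderiv P (cderiv Q f))) z =
      cderiv P (cderiv Q (cderiv A (cderiv B f))) z := by
  have hc {f : Cn n → ℂ} (hf : ContDiffOn ℝ ∞ f Ω) (X : Cn n × Cn n) := hf.cderiv (X := X) hΩ
  have h1 : Set.EqOn (cderiv B (cderiv P (cderiv Q f))) (cderiv P (cderiv Q (cderiv B f))) Ω :=
    fun w hw => (cderiv_comm_on hΩ (hc hf Q) B P hw).trans
      (cderiv_congr_on hΩ (cderiv_comm_on hΩ hf B Q) hw P)
  rw [cderiv_congr_on hΩ h1 hz A, cderiv_comm_on hΩ (hc (hc hf B) Q) A P hz,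
    cderiv_congr_on hΩ (cderiv_comm_on hΩ (hc hf B) A Q) hz P]

lemma star_cderiv_toC {Φ : Cn n → ℝ} (h : DifferentiableAt ℝ Φ z) (X : Cn n × Cn n) :
    star (cderiv X (toC Φ) z) = cderiv (conjVec X) (toC Φ) z := by
  rw [cderiv_toC_eq h, cderiv_toC_eq h]
  simp [conjVec]

lemma star_cderiv_cderiv_toC {Φ : Cn n → ℝ} (hΩ : IsOpen Ω) (hΦ : ContDiffOn ℝ ∞ Φ Ω)
    (X Y : Cn n × Cn n) (hz : z ∈ Ω) : star (cderiv X (cderiv Y (toC Φ)) z) =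
      cderiv (conjVec X) (cderiv (conjVec Y) (toC Φ)) z := by
  have h1 : Set.EqOn (cderiv (conjVec Y) (toC Φ)) (fun z => star (cderiv Y (toC Φ) z)) Ω :=
    fun w hw => (star_cderiv_toC ((hΦ.contDiffAt (hΩ.mem_nhds hw)).differentiableAt (by simp)) Y).symm
  have h2 := ((hΦ.toC_comp.cderiv (X := Y) hΩ).contDiffAt_two hΩ hz).differentiableAt (by simp)
  rw [cderiv_congr_on hΩ h1 hz, cderiv_star h2, HasJet.conjVec_conjVec]

lemma star_cderiv_cderiv_cderiv_toC {Φ : Cn n → ℝ} (hΩ : IsOpen Ω) (hΦ : ContDiffOn ℝ ∞ Φ Ω)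
    (X Y Z : Cn n × Cn n) (hz : z ∈ Ω) : star (cderiv X (cderiv Y (cderiv Z (toC Φ))) z) =
      cderiv (conjVec X) (cderiv (conjVec Y) (cderiv (conjVec Z) (toC Φ))) z := by
  have h1 : Set.EqOn (cderiv (conjVec Y) (cderiv (conjVec Z) (toC Φ)))
      (fun z => star (cderiv Y (cderiv Z (toC Φ)) z)) Ω :=
    fun w hw => (star_cderiv_cderiv_toC hΩ hΦ Y Z hw).symm
  have h2 := (((hΦ.toC_comp.cderiv (X := Z) hΩ).cderiv (X := Y) hΩ).contDiffAt_two hΩ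
    hz).differentiableAt (by simp)
  rw [cderiv_congr_on hΩ h1 hz, cderiv_star h2, HasJet.conjVec_conjVec]

/-! ### Change of frame -/

lemma frameOf_mul (S T : Matrix (Fin n) (Fin n) ℂ) :
    frameOf (S * T) = fun a => ∑ b, S a b • frameOf T b := by
  funext a
  simp only [frameOf, mul_apply, Finset.sum_smul, Finset.smul_sum, smul_smul]
  exact Finset.sum_comm

lemma grad_comb (t : Fin n → Cn n) (S : Matrix (Fin n) (Fin n) ℂ) (Φ : Cn n → ℝ) (z : Cn n) :
    grad (fun a => ∑ b, S a b • t b) Φ z = S *ᵥ grad t Φ z := by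
  funext a
  simp only [grad, dHol_sum]
  rfl

lemma dHol_dAnti_comb (hf : ContDiffAt ℝ 2 f z) {ι κ : Type*}
    (s : Finset ι) (s' : Finset κ) (c : ι → ℂ) (c' : κ → ℂ) (v : ι → Cn n) (v' : κ → Cn n) :
    dHol (∑ i ∈ s, c i • v i) (dAnti (∑ j ∈ s', c' j • v' j) f) z =
      ∑ i ∈ s, ∑ j ∈ s', c i * star (c' j) * dHol (v i) (dAnti (v' j) f) z := by
  rw [dHol_sum, dAnti_sum]
  refine Finset.sum_congr rfl fun i _ => ?_
  have hd (j) : DifferentiableAt ℝ (dAnti (v' j) f) z :=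
    dAnti_eq (v' j) f ▸ (hf.cderiv (X := antiVec (v' j)) (l := 1) (by norm_num)).differentiableAt
      (by simp)
  rw [dHol_eq, cderiv_sum _ (fun j _ => (hd j).const_mul _), Finset.mul_sum]
  refine Finset.sum_congr rfl fun j _ => ?_
  rw [cderiv_const_mul _ (hd j), mul_assoc, dHol_eq (v i)]

lemma dHol_dHol_comb (hΩ : IsOpen Ω) (hf : ContDiffOn ℝ ∞ f Ω) (hz : z ∈ Ω) {ι κ : Type*}
    (s : Finset ι) (s' : Finset κ) (c : ι → ℂ) (c' : κ → ℂ) (v : ι → Cn n) (v' : κ → Cn n) :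
    dHol (∑ i ∈ s, c i • v i) (dHol (∑ j ∈ s', c' j • v' j) f) z =
      ∑ i ∈ s, ∑ j ∈ s', c i * c' j * dHol (v i) (dHol (v' j) f) z := by
  rw [dHol_sum, dHol_sum]
  refine Finset.sum_congr rfl fun i _ => ?_
  have hd (j) : DifferentiableAt ℝ (dHol (v' j) f) z :=
    ((hf.dHol hΩ (v' j)).contDiffAt_two hΩ hz).differentiableAt (by simp)
  rw [dHol_eq, cderiv_sum _ (fun j _ => (hd j).const_mul _), Finset.mul_sum]
  refine Finset.sum_congr rfl fun j _ => ?_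
  rw [cderiv_const_mul _ (hd j), mul_assoc, dHol_eq (v i)]

lemma mixedHess_comb {Φ : Cn n → ℝ} (hΦ : ContDiffAt ℝ 2 (toC Φ) z)
    (t : Fin n → Cn n) (S : Matrix (Fin n) (Fin n) ℂ) :
    mixedHess (fun a => ∑ b, S a b • t b) Φ z = S * mixedHess t Φ z * Sᴴ := by
  ext a b
  simp only [mixedHess, of_apply, dHol_dAnti_comb hΦ, mul_apply,
    conjTranspose_apply, Finset.sum_mul]
  rw [Finset.sum_comm]
  exact Finset.sum_congr rfl fun i _ => Finset.sum_congr rfl fun j _ => by ring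

lemma holHess_comb {Φ : Cn n → ℝ} (hΩ : IsOpen Ω) (hΦ : ContDiffOn ℝ ∞ Φ Ω) (hz : z ∈ Ω)
    (t : Fin n → Cn n) (S : Matrix (Fin n) (Fin n) ℂ) :
    holHess (fun a => ∑ b, S a b • t b) Φ z = S * holHess t Φ z * Sᵀ := by
  ext a b
  simp only [holHess, of_apply, dHol_dHol_comb hΩ hΦ.toC_comp hz, mul_apply,
    transpose_apply, Finset.sum_mul]
  rw [Finset.sum_comm]
  exact Finset.sum_congr rfl fun i _ => Finset.sum_congr rfl fun j _ => by ring

lemma grad_frameOf (T : Matrix (Fin n) (Fin n) ℂ) (Φ : Cn n → ℝ) (z : Cn n) :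
    grad (frameOf T) Φ z = T *ᵥ grad (stdFrame n) Φ z := grad_comb _ _ _ _

lemma mixedHess_frameOf {Φ : Cn n → ℝ} (hΦ : ContDiffAt ℝ 2 (toC Φ) z)
    (T : Matrix (Fin n) (Fin n) ℂ) :
    mixedHess (frameOf T) Φ z = T * mixedHess (stdFrame n) Φ z * Tᴴ := mixedHess_comb hΦ _ _

lemma holHess_frameOf {Φ : Cn n → ℝ} (hΩ : IsOpen Ω) (hΦ : ContDiffOn ℝ ∞ Φ Ω) (hz : z ∈ Ω)
    (T : Matrix (Fin n) (Fin n) ℂ) :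
    holHess (frameOf T) Φ z = T * holHess (stdFrame n) Φ z * Tᵀ := holHess_comb hΩ hΦ hz _ _

lemma mixedHess_isHermitian {Φ : Cn n → ℝ} (hΩ : IsOpen Ω) (hΦ : ContDiffOn ℝ ∞ Φ Ω) (hz : z ∈ Ω)
    (t : Fin n → Cn n) : (mixedHess t Φ z).IsHermitian := by
  ext a b
  simp only [conjTranspose_apply, mixedHess, of_apply, dHol_eq, dAnti_eq]
  rw [star_cderiv_cderiv_toC hΩ hΦ _ _ hz, conjVec_holVec, conjVec_antiVec,
    cderiv_comm_on hΩ hΦ.toC_comp _ _ hz]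

lemma holHess_isSymm {Φ : Cn n → ℝ} (hΩ : IsOpen Ω) (hΦ : ContDiffOn ℝ ∞ Φ Ω) (hz : z ∈ Ω)
    (t : Fin n → Cn n) : (holHess t Φ z)ᵀ = holHess t Φ z := by
  ext a b
  simp only [transpose_apply, holHess, of_apply, dHol_eq]
  exact cderiv_comm_on hΩ hΦ.toC_comp _ _ hz

/-! ### Third order derivatives -/

/-- The third order derivatives `Φ_{a b c̄}` in the frame `t`. -/
def third (t : Fin n → Cn n) (Φ : Cn n → ℝ) (z : Cn n) (a b c : Fin n) : ℂ :=
  dHol (t a) (dHol (t b) (dAnti (t c) (toC Φ))) z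

lemma third_symm {Φ : Cn n → ℝ} (hΩ : IsOpen Ω) (hΦ : ContDiffOn ℝ ∞ Φ Ω) (hz : z ∈ Ω)
    (t : Fin n → Cn n) (a b c : Fin n) : third t Φ z a b c = third t Φ z b a c := by
  simp only [third, dHol_eq]
  exact cderiv_comm_on hΩ (hΦ.toC_comp.dAnti hΩ _) _ _ hz

/-- `∂_ξ (Φ_{a c̄})` for `ξ = ∑ x_b t_b`. -/
def mixedDeriv (x : Fin n → ℂ) (Θ : Fin n → Fin n → Fin n → ℂ) : Matrix (Fin n) (Fin n) ℂ :=
  of fun a c => ∑ b, x b * Θ a b c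

/-- `∂̄_ξ (Φ_{a b})` for `ξ = ∑ x_c t_c`. -/
def holDeriv (x : Fin n → ℂ) (Θ : Fin n → Fin n → Fin n → ℂ) : Matrix (Fin n) (Fin n) ℂ :=
  of fun a b => ∑ c, star (x c) * Θ a b c

lemma dAnti_holHess {Φ : Cn n → ℝ} (hΩ : IsOpen Ω) (hΦ : ContDiffOn ℝ ∞ Φ Ω) (hz : z ∈ Ω)
    (t : Fin n → Cn n) (a b c : Fin n) :
    dAnti (t c) (fun z => holHess t Φ z a b) z = third t Φ z a b c := by
  have h : (fun z => holHess t Φ z a b) = dHol (t a) (dHol (t b) (toC Φ)) := rfl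
  rw [h, third]
  simp only [dHol_eq, dAnti_eq]
  have hc {f : Cn n → ℂ} (hf : ContDiffOn ℝ ∞ f Ω) (X : Cn n × Cn n) := hf.cderiv (X := X) hΩ
  rw [cderiv_comm_on hΩ (hc hΦ.toC_comp _) _ _ hz]
  exact cderiv_congr_on hΩ (cderiv_comm_on hΩ hΦ.toC_comp _ _) hz _

lemma dAnti_mixedHess {Φ : Cn n → ℝ} (hΩ : IsOpen Ω) (hΦ : ContDiffOn ℝ ∞ Φ Ω) (hz : z ∈ Ω)
    (t : Fin n → Cn n) (a b c : Fin n) :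
    dAnti (t c) (fun z => mixedHess t Φ z a b) z = star (third t Φ z b c a) := by
  have h : (fun z => mixedHess t Φ z a b) = dHol (t a) (dAnti (t b) (toC Φ)) := rfl
  rw [third_symm hΩ hΦ hz, h, third]
  simp only [dHol_eq, dAnti_eq]
  rw [star_cderiv_cderiv_cderiv_toC hΩ hΦ _ _ _ hz]
  simp only [conjVec_holVec, conjVec_antiVec]
  exact cderiv_congr_on hΩ (cderiv_comm_on hΩ hΦ.toC_comp _ _) hz _

lemma contDiffOn_mixedHess {Φ : Cn n → ℝ} (hΩ : IsOpen Ω) (hΦ : ContDiffOn ℝ ∞ Φ Ω)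
    (t : Fin n → Cn n) (a b : Fin n) : ContDiffOn ℝ ∞ (fun z => mixedHess t Φ z a b) Ω :=
  (hΦ.toC_comp.dAnti hΩ _).dHol hΩ _

lemma contDiffOn_holHess {Φ : Cn n → ℝ} (hΩ : IsOpen Ω) (hΦ : ContDiffOn ℝ ∞ Φ Ω)
    (t : Fin n → Cn n) (a b : Fin n) : ContDiffOn ℝ ∞ (fun z => holHess t Φ z a b) Ω :=
  (hΦ.toC_comp.dHol hΩ _).dHol hΩ _

lemma contDiffOn_grad {Φ : Cn n → ℝ} (hΩ : IsOpen Ω) (hΦ : ContDiffOn ℝ ∞ Φ Ω)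
    (t : Fin n → Cn n) (a : Fin n) : ContDiffOn ℝ ∞ (fun z => grad t Φ z a) Ω :=
  hΦ.toC_comp.dHol hΩ _

/-- Entrywise `∂_v ∂̄_v` of a matrix valued function. -/
def lineLaplacian {ι κ : Type*} (v : Cn n) (F : Cn n → Matrix ι κ ℂ) (z : Cn n) : Matrix ι κ ℂ :=
  of fun a b => dHol v (dAnti v fun z => F z a b) z

lemma hasMJet_mixedHess {Φ : Cn n → ℝ} (hΩ : IsOpen Ω) (hΦ : ContDiffOn ℝ ∞ Φ Ω) (hz : z ∈ Ω)
    (t : Fin n → Cn n) (x : Fin n → ℂ) :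
    HasMJet z (holVec (∑ b, x b • t b)) (conjVec (holVec (∑ b, x b • t b))) (mixedHess t Φ)
      (mixedHess t Φ z) (mixedDeriv x (third t Φ z)) (mixedDeriv x (third t Φ z))ᴴ
      (lineLaplacian (∑ b, x b • t b) (mixedHess t Φ) z) := by
  intro a c
  refine ⟨(contDiffOn_mixedHess hΩ hΦ t a c).contDiffAt_two hΩ hz, rfl, ?_, ?_, ?_⟩
  · rw [← dHol_eq, dHol_sum]
    simp only [mixedDeriv, of_apply]
    exact Finset.sum_congr rfl fun b _ => by rw [third_symm hΩ hΦ hz]; rfl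
  · rw [conjVec_holVec, ← dAnti_eq, dAnti_sum]
    simp only [mixedDeriv, conjTranspose_apply, of_apply, star_sum, star_mul']
    exact Finset.sum_congr rfl fun b _ => by rw [dAnti_mixedHess hΩ hΦ hz]
  · rw [conjVec_holVec, ← dAnti_eq, ← dHol_eq]; rfl

/-- The entry ∂_ξ P consists of purely holomorphic third derivatives. The equation gives no control
of them, so they are left as they are; the auxiliary function V is there to dominate them. -/
lemma hasMJet_holHess {Φ : Cn n → ℝ} (hΩ : IsOpen Ω) (hΦ : ContDiffOn ℝ ∞ Φ Ω) (hz : z ∈ Ω)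
    (t : Fin n → Cn n) (x : Fin n → ℂ) :
    HasMJet z (holVec (∑ b, x b • t b)) (conjVec (holVec (∑ b, x b • t b))) (holHess t Φ)
      (holHess t Φ z) (of fun a b => dHol (∑ b, x b • t b) (fun z => holHess t Φ z a b) z)
      (holDeriv x (third t Φ z))
      (lineLaplacian (∑ b, x b • t b) (holHess t Φ) z) := by
  intro a c
  refine ⟨(contDiffOn_holHess hΩ hΦ t a c).contDiffAt_two hΩ hz, rfl, ?_, ?_, ?_⟩
  · rw [← dHol_eq]; rfl
  · rw [conjVec_holVec, ← dAnti_eq, dAnti_sum]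
    simp only [holDeriv, of_apply]
    exact Finset.sum_congr rfl fun b _ => by rw [dAnti_holHess hΩ hΦ hz]
  · rw [conjVec_holVec, ← dAnti_eq, ← dHol_eq]; rfl

lemma hasJet_grad {Φ : Cn n → ℝ} (hΩ : IsOpen Ω) (hΦ : ContDiffOn ℝ ∞ Φ Ω) (hz : z ∈ Ω)
    (t : Fin n → Cn n) (x : Fin n → ℂ) (a : Fin n) :
    HasJet z (holVec (∑ b, x b • t b)) (conjVec (holVec (∑ b, x b • t b))) (fun z => grad t Φ z a)
      (grad t Φ z a) (∑ b, x b * holHess t Φ z b a) (∑ b, star (x b) * mixedHess t Φ z a b)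
      (∑ b, ∑ c, x b * third t Φ z a b c * star (x c)) := by
  refine ⟨(contDiffOn_grad hΩ hΦ t a).contDiffAt_two hΩ hz, rfl, ?_, ?_, ?_⟩
  · rw [← dHol_eq, dHol_sum]; rfl
  · rw [conjVec_holVec, ← dAnti_eq, dAnti_sum]
    refine Finset.sum_congr rfl fun b _ => ?_
    simp only [mixedHess, of_apply, dHol_eq, dAnti_eq, grad]
    rw [cderiv_comm_on hΩ hΦ.toC_comp _ _ hz]
  · rw [conjVec_holVec, ← dAnti_eq, ← dHol_eq, dHol_dAnti_comb ((contDiffOn_grad hΩ hΦ t a).contDiffAt_two hΩ hz)]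
    refine Finset.sum_congr rfl fun b _ => Finset.sum_congr rfl fun c _ => ?_
    rw [third_symm hΩ hΦ hz, third]
    have : Set.EqOn (cderiv (antiVec (t c)) fun z => grad t Φ z a)
        (cderiv (holVec (t a)) (cderiv (antiVec (t c)) (toC Φ))) Ω := fun w hw => by
      simp only [grad, dHol_eq]
      exact cderiv_comm_on hΩ hΦ.toC_comp _ _ hw
    simp only [dHol_eq, dAnti_eq]
    rw [cderiv_congr_on hΩ this hz]
    ring

end
end

noncomputable section
open scoped ContDiff
open Matrix

/-! ## The linearized operator as a sum of second derivatives along complex lines -/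

section
variable {n : ℕ} {Ω : Set (Cn n)} {z p : Cn n}

lemma HasJet.re {X : Cn n × Cn n} {F : Cn n → ℂ} {f0 f1 f2 f3 : ℂ}
    (h : HasJet p X (conjVec X) F f0 f1 f2 f3) :
    HasJet p X (conjVec X) (toC fun z => (F z).re) (f0.re : ℂ) ((f1 + Star.star f2) / 2)
      ((f2 + Star.star f1) / 2) (f3.re : ℂ) := by
  have e (w : ℂ) : (w.re : ℂ) = 1 / 2 * (w + Star.star w) := by
    rw [Complex.re_eq_add_conj]; simp; ring
  have h1 : (toC fun z => (F z).re) = fun z => 1 / 2 * (F z + Star.star (F z)) := by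
    funext z; exact e _
  rw [h1, e, e]
  convert (h.add h.star).const_mul (1 / 2) using 1 <;> ring

/-- A real function equals its real part, so uniqueness of jets forces the conjugation symmetry of
its derivatives. -/
lemma HasJet.real_of_toC {X : Cn n × Cn n} {f : Cn n → ℝ} {f0 f1 f2 f3 : ℂ}
    (h : HasJet p X (conjVec X) (toC f) f0 f1 f2 f3) :
    f0 = (f p : ℂ) ∧ f2 = Star.star f1 ∧ f3 = (f3.re : ℂ) := by
  have h1 := h.re
  have h2 : (toC fun z => (toC f z).re) = toC f := by funext z; simp [toC]
  rw [h2] at h1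
  obtain ⟨-, e1, e2, e3⟩ := h.uniq h1
  refine ⟨h.val.symm, ?_, e3⟩
  have e4 : Star.star f1 = (Star.star f1 + f2) / 2 := by
    nth_rewrite 1 [e1]; simp [star_div₀]
  linear_combination e2 - e4

/-- Since H is Hermitian and G = N*N, one has ε²H⁻¹GH⁻¹ = (εNH⁻¹)*(εNH⁻¹). The operator is therefore
a sum of Laplacians along the complex lines spanned by the rows of εNH⁻¹. -/
lemma Lop_eq_sum {N G : Matrix (Fin n) (Fin n) ℂ} (hG : G = Nᴴ * N) {ε : ℝ} {Φ f : Cn n → ℝ}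
    (hH : (mixedHess (stdFrame n) Φ p).IsHermitian) (hf : ContDiffAt ℝ 2 (toC f) p) :
    Lop G ε Φ f p = ∑ k, (dHol (frameOf ((ε : ℂ) • (N * (mixedHess (stdFrame n) Φ p)⁻¹)) k)
      (dAnti (frameOf ((ε : ℂ) • (N * (mixedHess (stdFrame n) Φ p)⁻¹)) k) (toC f)) p).re := by
  obtain ⟨K, hK⟩ : ∃ K, K = (mixedHess (stdFrame n) Φ p)⁻¹ := ⟨_, rfl⟩
  have hKh : Kᴴ = K := by rw [hK, conjTranspose_nonsing_inv, hH.eq]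
  have h1 : ∑ k, dHol (frameOf ((ε : ℂ) • (N * K)) k)
      (dAnti (frameOf ((ε : ℂ) • (N * K)) k) (toC f)) p =
      (mixedHess (frameOf ((ε : ℂ) • (N * K))) f p).trace := rfl
  rw [← hK, ← Complex.re_sum, h1, mixedHess_frameOf hf, Matrix.mul_assoc, trace_mul_comm,
    Matrix.mul_assoc]
  have h2 : ((ε : ℂ) • (N * K))ᴴ * ((ε : ℂ) • (N * K)) = (ε : ℂ) ^ 2 • (K * G * K) := by
    rw [conjTranspose_smul, conjTranspose_mul, hKh, hG]
    simp only [Complex.star_def, Complex.conj_ofReal, Matrix.smul_mul, Matrix.mul_smul, smul_smul,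
      Matrix.mul_assoc, sq]
  rw [h2, trace_mul_comm, Lop]
  congr 1
  simp only [trace, diag_apply, mul_apply (M := (ε : ℂ) ^ 2 • _)]
  rw [Finset.sum_comm]
  refine Finset.sum_congr rfl fun q _ => Finset.sum_congr rfl fun p' _ => ?_
  congr 1
  rw [Lcoef, Matrix.smul_apply, smul_eq_mul, mul_apply]
  congr 1
  rw [Finset.sum_comm]
  refine Finset.sum_congr rfl fun v _ => ?_
  rw [mul_apply, Finset.sum_mul]
  refine Finset.sum_congr rfl fun u _ => ?_
  rw [upper, upper, ← hK]; ring

lemma Lop_eq_of_hasJet {N G : Matrix (Fin n) (Fin n) ℂ} (hG : G = Nᴴ * N) {ε : ℝ} {Φ f : Cn n → ℝ}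
    (hH : (mixedHess (stdFrame n) Φ p).IsHermitian) {v : Fin n → Cn n}
    (hv : v = frameOf ((ε : ℂ) • (N * (mixedHess (stdFrame n) Φ p)⁻¹)))
    {F0 F1 F2 F3 : Fin n → ℂ} (hf : ContDiffAt ℝ 2 (toC f) p)
    (h : ∀ k, HasJet p (holVec (v k)) (conjVec (holVec (v k))) (toC f) (F0 k) (F1 k) (F2 k) (F3 k)) :
    Lop G ε Φ f p = ∑ k, (F3 k).re := by
  rw [Lop_eq_sum hG hH hf, ← hv]
  refine Finset.sum_congr rfl fun k _ => ?_
  rw [← (h k).mix, conjVec_holVec, dHol_eq, dAnti_eq]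

/-! ## Differentiated equation -/

/-- All derivatives of the constant function tr(F⁻¹K) vanish; the jet of the inverse makes this
explicit. -/
lemma trace_inv_mul_jet {X Y : Cn n × Cn n} {F : Cn n → Matrix (Fin n) (Fin n) ℂ}
    {F0 F1 F2 F3 K : Matrix (Fin n) (Fin n) ℂ} {c : ℂ} (hF : HasMJet p X Y F F0 F1 F2 F3)
    (h0 : F0.det ≠ 0) (h : ∀ᶠ z in nhds p, ((F z)⁻¹ * K).trace = c) :
    (F0⁻¹ * F1 * F0⁻¹ * K).trace = 0 ∧ (F0⁻¹ * F3 * F0⁻¹ * K).trace =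
      (F0⁻¹ * F1 * F0⁻¹ * F2 * F0⁻¹ * K).trace + (F0⁻¹ * F2 * F0⁻¹ * F1 * F0⁻¹ * K).trace := by
  have h1 := (((hF.inv h0).mul (HasMJet.const K)).trace).congr h
  obtain ⟨-, e1, -, e3⟩ := h1.uniq (HasJet.const c)
  simp only [Matrix.mul_zero, add_zero, trace_neg, neg_eq_zero, neg_mul, Matrix.add_mul,
    Matrix.sub_mul, trace_add, trace_sub, neg_zero, add_zero] at e1 e3
  exact ⟨e1, by linear_combination -e3⟩

/-- Weights of the adapted directions: `ε` divided by the eigenvalue of the complex Hessian. -/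
def dirWeight (m : ℕ) (ε : ℝ) (a : Fin (m + 1)) : ℝ := if a = Fin.last m then 1 else ε

@[simp] lemma dirWeight_last (m : ℕ) (ε : ℝ) : dirWeight m ε (Fin.last m) = 1 := by
  simp [dirWeight]

@[simp] lemma dirWeight_castSucc (m : ℕ) (ε : ℝ) (α : Fin m) :
    dirWeight m ε α.castSucc = ε := by
  simp [dirWeight, Fin.castSucc_ne_last]

lemma dirWeight_eq {m : ℕ} {ε : ℝ} (hε : ε ≠ 0) (a : Fin (m + 1)) :
    dirWeight m ε a = ε * (lastWeight m ε a)⁻¹ := by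
  cases a using Fin.lastCases <;> simp [hε]

lemma lastWeight_ne_zero {m : ℕ} {ε : ℝ} (hε : ε ≠ 0) (a : Fin (m + 1)) :
    (lastWeight m ε a : ℂ) ≠ 0 := by
  cases a using Fin.lastCases <;> simp [hε]

/-- The inverse of the diagonalized complex Hessian. -/
def hInv (m : ℕ) (ε : ℝ) : Matrix (Fin (m + 1)) (Fin (m + 1)) ℂ :=
  diagonal fun a => ((lastWeight m ε a)⁻¹ : ℂ)

lemma inv_diagonal_lastWeight {m : ℕ} {ε : ℝ} (hε : ε ≠ 0) :
    (diagonal fun a => (lastWeight m ε a : ℂ))⁻¹ = hInv m ε := by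
  refine inv_eq_left_inv ?_
  rw [hInv, diagonal_mul_diagonal, ← diagonal_one]
  congr 1; funext a
  exact inv_mul_cancel₀ (lastWeight_ne_zero hε a)

lemma det_diagonal_lastWeight {m : ℕ} {ε : ℝ} (hε : ε ≠ 0) :
    (diagonal fun a => (lastWeight m ε a : ℂ)).det ≠ 0 := by
  rw [det_diagonal]
  exact Finset.prod_ne_zero_iff.2 fun a _ => lastWeight_ne_zero hε a

/-- Components of the adapted directions in the adapted frame. -/
def dirMatrix {m : ℕ} (ε : ℝ) (B : Matrix (Fin (m + 1)) (Fin (m + 1)) ℂ) :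
    Matrix (Fin (m + 1)) (Fin (m + 1)) ℂ := B * diagonal fun a => (dirWeight m ε a : ℂ)

lemma dirMatrix_apply {m : ℕ} (ε : ℝ) (B : Matrix (Fin (m + 1)) (Fin (m + 1)) ℂ) (k a) :
    dirMatrix ε B k a = B k a * dirWeight m ε a := by
  simp [dirMatrix, mul_diagonal]

lemma dirMatrix_eq {m : ℕ} {ε : ℝ} (hε : ε ≠ 0) (B : Matrix (Fin (m + 1)) (Fin (m + 1)) ℂ) :
    dirMatrix ε B = (ε : ℂ) • (B * hInv m ε) := by
  ext k a
  simp only [dirMatrix_apply, hInv, Matrix.smul_apply, mul_diagonal, smul_eq_mul, dirWeight_eq hε]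
  push_cast; ring

lemma hInv_conjTranspose (m : ℕ) (ε : ℝ) : (hInv m ε)ᴴ = hInv m ε := by
  rw [hInv, diagonal_conjTranspose]
  congr 1; funext a; simp

lemma trace_dirMatrix {m : ℕ} {ε : ℝ} (hε : ε ≠ 0) (B F : Matrix (Fin (m + 1)) (Fin (m + 1)) ℂ) :
    (ε : ℂ) ^ 2 * (hInv m ε * F * hInv m ε * (Bᴴ * B)).trace =
      ∑ k, ∑ b, ∑ c, dirMatrix ε B k b * F b c * star (dirMatrix ε B k c) := by
  have h1 : (dirMatrix ε B * F * (dirMatrix ε B)ᴴ).trace =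
      ∑ k, ∑ b, ∑ c, dirMatrix ε B k b * F b c * star (dirMatrix ε B k c) := by
    simp only [trace, diag_apply, mul_apply, conjTranspose_apply, Finset.sum_mul]
    exact Finset.sum_congr rfl fun k _ => Finset.sum_comm
  rw [← h1, dirMatrix_eq hε, conjTranspose_smul, conjTranspose_mul, hInv_conjTranspose]
  simp only [Complex.star_def, Complex.conj_ofReal, Matrix.smul_mul, Matrix.mul_smul, smul_smul,
    trace_smul, smul_eq_mul, sq]
  congr 1
  rw [show hInv m ε * F * hInv m ε * (Bᴴ * B) = (hInv m ε * F * hInv m ε * Bᴴ) * B by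
    simp only [Matrix.mul_assoc], trace_mul_comm]
  simp only [Matrix.mul_assoc]

lemma mul_hInv_mul_apply {m : ℕ} {ε : ℝ} {ι κ : Type*} (F : Matrix ι (Fin (m + 1)) ℂ)
    (F' : Matrix (Fin (m + 1)) κ ℂ) (b : ι) (c : κ) :
    (F * hInv m ε * F') b c = ∑ e, F b e * (lastWeight m ε e : ℂ)⁻¹ * F' e c := by
  rw [mul_apply]
  simp only [hInv, mul_diagonal]

lemma sandwich_mul {m : ℕ} {ε : ℝ} (x : Fin (m + 1) → ℂ)
    (F F' : Matrix (Fin (m + 1)) (Fin (m + 1)) ℂ) :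
    ∑ b, ∑ c, x b * (F * hInv m ε * F') b c * star (x c) =
      ∑ e, (∑ b, x b * F b e) * (lastWeight m ε e : ℂ)⁻¹ * (∑ c, F' e c * star (x c)) := by
  have h (b : Fin (m + 1)) : ∑ c, x b * (F * hInv m ε * F') b c * star (x c) =
      ∑ e, x b * F b e * (lastWeight m ε e : ℂ)⁻¹ * ∑ c, F' e c * star (x c) := by
    simp only [mul_hInv_mul_apply, Finset.mul_sum, Finset.sum_mul]
    rw [Finset.sum_comm]
    exact Finset.sum_congr rfl fun e _ => Finset.sum_congr rfl fun c _ => by ring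
  simp only [h]
  rw [Finset.sum_comm]
  simp only [Finset.sum_mul]

/-- From THT* = Δ follows H⁻¹ = T*Δ⁻¹T, so εNH⁻¹ = (εNT*Δ⁻¹)T, and the bracket holds the components
of the directions in the frame T. -/
lemma frameOf_dirMatrix {m : ℕ} {ε : ℝ} (hε : ε ≠ 0)
    {N H T : Matrix (Fin (m + 1)) (Fin (m + 1)) ℂ} (hT : T.det ≠ 0)
    (hd : T * H * Tᴴ = diagonal fun a => (lastWeight m ε a : ℂ)) :
    (fun k => ∑ b, dirMatrix ε (N * Tᴴ) k b • frameOf T b) = frameOf ((ε : ℂ) • (N * H⁻¹)) := by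
  rw [← frameOf_mul, dirMatrix_eq hε, ← inv_diagonal_lastWeight hε, ← hd, Matrix.mul_inv_rev, Matrix.mul_inv_rev]
  have hu : IsUnit T.det := isUnit_iff_ne_zero.2 hT
  have hu' : IsUnit Tᴴ.det := by rw [det_conjTranspose]; exact hu.star
  congr 1
  rw [Matrix.smul_mul]
  congr 1
  rw [← Matrix.mul_assoc (N * Tᴴ),
    mul_nonsing_inv_cancel_right _ _ hu', ← Matrix.mul_assoc N,
    nonsing_inv_mul_cancel_right _ _ hu]

/-- The equation in the form tr(H⁻¹G) = n/ε, whose left side does not depend on the frame. -/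
lemma trace_inv_mul_frame {n : ℕ} {H G T : Matrix (Fin n) (Fin n) ℂ} {ε : ℝ} (hε : ε ≠ 0)
    (hT : T.det ≠ 0) (h0 : H.det ≠ 0) (h : (n : ℂ) * H.det = ε * (H.adjugate * G).trace) :
    ((T * H * Tᴴ)⁻¹ * (T * G * Tᴴ)).trace = n / ε := by
  have hu : IsUnit T.det := isUnit_iff_ne_zero.2 hT
  have hu' : IsUnit Tᴴ.det := by rw [det_conjTranspose]; exact hu.star
  rw [Matrix.mul_inv_rev, Matrix.mul_inv_rev, trace_mul_comm]
  have : T * G * Tᴴ * (Tᴴ⁻¹ * (H⁻¹ * T⁻¹)) = T * (G * H⁻¹ * T⁻¹) := by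
    rw [← Matrix.mul_assoc, mul_nonsing_inv_cancel_right _ _ hu']
    simp only [Matrix.mul_assoc]
  rw [this, trace_mul_comm, nonsing_inv_mul_cancel_right _ _ hu, trace_mul_comm, inv_def,
    Ring.inverse_eq_inv', Matrix.smul_mul, trace_smul, smul_eq_mul]
  field_simp
  linear_combination -h

/-- The equation and the frame, expressed at one point. -/
structure EquationAt {m : ℕ} (N : Matrix (Fin (m + 1)) (Fin (m + 1)) ℂ) (ε : ℝ)
    (Ω : Set (Cn (m + 1))) (Φ : Cn (m + 1) → ℝ) (p : Cn (m + 1))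
    (T : Matrix (Fin (m + 1)) (Fin (m + 1)) ℂ) : Prop where
  isOpen : IsOpen Ω
  smooth : ContDiffOn ℝ ∞ Φ Ω
  mem : p ∈ Ω
  eps_ne : ε ≠ 0
  det_hess : ∀ z ∈ Ω, (mixedHess (stdFrame (m + 1)) Φ z).det ≠ 0
  equation : ∀ z ∈ Ω, ((m + 1 : ℕ) : ℂ) * (mixedHess (stdFrame (m + 1)) Φ z).det =
    ε * ((mixedHess (stdFrame (m + 1)) Φ z).adjugate * (Nᴴ * N)).trace
  det_frame : T.det ≠ 0
  diag : T * mixedHess (stdFrame (m + 1)) Φ p * Tᴴ = diagonal fun a => (lastWeight m ε a : ℂ)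

/-! ### First and second derivatives of the equation -/

namespace EquationAt
variable {m : ℕ} {N T : Matrix (Fin (m + 1)) (Fin (m + 1)) ℂ} {ε : ℝ} {Ω : Set (Cn (m + 1))}
  {Φ : Cn (m + 1) → ℝ} {p : Cn (m + 1)}

lemma contDiffAt_toC (E : EquationAt N ε Ω Φ p T) {z : Cn (m + 1)} (hz : z ∈ Ω) :
    ContDiffAt ℝ 2 (toC Φ) z := E.smooth.toC_comp.contDiffAt_two E.isOpen hz

lemma mixedHess_eq (E : EquationAt N ε Ω Φ p T) :
    mixedHess (frameOf T) Φ p = diagonal fun a => (lastWeight m ε a : ℂ) := by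
  rw [mixedHess_frameOf (E.contDiffAt_toC E.mem), E.diag]

lemma eventually_trace (E : EquationAt N ε Ω Φ p T) :
    ∀ᶠ z in nhds p, ((mixedHess (frameOf T) Φ z)⁻¹ * ((N * Tᴴ)ᴴ * (N * Tᴴ))).trace =
      ((m + 1 : ℕ) : ℂ) / ε := by
  filter_upwards [E.isOpen.mem_nhds E.mem] with z hz
  rw [mixedHess_frameOf (E.contDiffAt_toC hz)]
  rw [show (N * Tᴴ)ᴴ * (N * Tᴴ) = T * (Nᴴ * N) * Tᴴ by
    simp only [conjTranspose_mul, conjTranspose_conjTranspose, Matrix.mul_assoc]]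
  exact trace_inv_mul_frame E.eps_ne E.det_frame (E.det_hess z hz) (E.equation z hz)

/-- The derivatives of tr(H⁻¹G) = n/ε are multiplied by ε², after which contraction with h G h is a
sum over the adapted directions. -/
lemma jet_identity (E : EquationAt N ε Ω Φ p T) {X Y : Cn (m + 1) × Cn (m + 1)}
    {F1 F2 F3 : Matrix (Fin (m + 1)) (Fin (m + 1)) ℂ}
    (hF : HasMJet p X Y (mixedHess (frameOf T) Φ)
      (diagonal fun a => (lastWeight m ε a : ℂ)) F1 F2 F3) :
    (∑ k, ∑ b, ∑ c, dirMatrix ε (N * Tᴴ) k b * F1 b c * star (dirMatrix ε (N * Tᴴ) k c) = 0) ∧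
    ∑ k, ∑ b, ∑ c, dirMatrix ε (N * Tᴴ) k b * F3 b c * star (dirMatrix ε (N * Tᴴ) k c) =
      ∑ k, ∑ b, ∑ c, dirMatrix ε (N * Tᴴ) k b *
        (F1 * hInv m ε * F2 + F2 * hInv m ε * F1) b c * star (dirMatrix ε (N * Tᴴ) k c) := by
  have h := trace_inv_mul_jet hF (det_diagonal_lastWeight E.eps_ne) E.eventually_trace
  rw [inv_diagonal_lastWeight E.eps_ne] at h
  simp only [← trace_dirMatrix E.eps_ne]
  refine ⟨by rw [h.1, mul_zero], ?_⟩
  rw [h.2]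
  simp only [Matrix.mul_add, Matrix.add_mul, trace_add, Matrix.mul_assoc]

/-- The first derivative of the equation. -/
lemma first_order (E : EquationAt N ε Ω Φ p T) (a : Fin (m + 1)) :
    ∑ k, ∑ b, ∑ c, dirMatrix ε (N * Tᴴ) k b * third (frameOf T) Φ p a b c *
      star (dirMatrix ε (N * Tᴴ) k c) = 0 := by
  have hs (i j) := (contDiffOn_mixedHess E.isOpen E.smooth (frameOf T) i j).contDiffAt_two
    E.isOpen E.mem
  obtain ⟨F3, hF3⟩ : ∃ F3 : Matrix (Fin (m + 1)) (Fin (m + 1)) ℂ,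
      HasMJet p (holVec (frameOf T a)) (holVec (frameOf T a)) (mixedHess (frameOf T) Φ)
      (diagonal fun a => (lastWeight m ε a : ℂ)) (of fun b c => third (frameOf T) Φ p a b c)
      (of fun b c => third (frameOf T) Φ p a b c) F3 := by
    refine ⟨of fun i j => _, fun i j => ⟨hs i j, ?_, ?_, ?_, rfl⟩⟩
    · rw [E.mixedHess_eq]
    · rw [← dHol_eq]; rfl
    · rw [← dHol_eq]; rfl
  exact (E.jet_identity hF3).1

/-- Commuting derivatives reduces this to ∂_a ∂̄_c of the equation. The two quadratic terms are Gram
matrices for the positive weight h; their sign is the source of all positivity, through W. -/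
lemma second_order_mixed (E : EquationAt N ε Ω Φ p T) :
    ∑ k, lineLaplacian (∑ b, dirMatrix ε (N * Tᴴ) k b • frameOf T b) (mixedHess (frameOf T) Φ) p =
      ∑ k, (mixedDeriv (dirMatrix ε (N * Tᴴ) k) (third (frameOf T) Φ p) * hInv m ε *
          (mixedDeriv (dirMatrix ε (N * Tᴴ) k) (third (frameOf T) Φ p))ᴴ +
        holDeriv (dirMatrix ε (N * Tᴴ) k) (third (frameOf T) Φ p) * hInv m ε *
          (holDeriv (dirMatrix ε (N * Tᴴ) k) (third (frameOf T) Φ p))ᴴ) := by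
  obtain ⟨t, ht⟩ : ∃ t, t = frameOf T := ⟨_, rfl⟩
  obtain ⟨x, hx⟩ : ∃ x, x = dirMatrix ε (N * Tᴴ) := ⟨_, rfl⟩
  ext a c
  have hF : HasMJet p (holVec (t a)) (antiVec (t c)) (mixedHess (frameOf T) Φ)
      (diagonal fun a => (lastWeight m ε a : ℂ)) (of fun i j => third t Φ p a i j)
      (of fun i j => star (third t Φ p j c i))
      (of fun i j => dHol (t i) (dAnti (t j) fun z => mixedHess t Φ z a c) p) := by
    intro i j
    refine ⟨(contDiffOn_mixedHess E.isOpen E.smooth (frameOf T) i j).contDiffAt_two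
      E.isOpen E.mem, ?_, ?_, ?_, ?_⟩
    · rw [E.mixedHess_eq]
    · rw [← dHol_eq, ht]; rfl
    · rw [← dAnti_eq, ht, dAnti_mixedHess E.isOpen E.smooth E.mem]; rfl
    · simp only [ht, mixedHess, of_apply, dHol_eq, dAnti_eq]
      exact cderiv_pairs_comm E.isOpen E.smooth.toC_comp _ _ _ _ E.mem
  have h := (E.jet_identity hF).2
  rw [← hx] at h ⊢
  rw [← ht]
  simp only [Matrix.sum_apply, Matrix.add_apply]
  have e1 (k) : lineLaplacian (∑ b, x k b • t b) (mixedHess t Φ) p a c =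
      ∑ i, ∑ j, x k i * (of fun i j => dHol (t i) (dAnti (t j) fun z => mixedHess t Φ z a c) p) i j
        * star (x k j) := by
    simp only [lineLaplacian, of_apply]
    rw [dHol_dAnti_comb ((contDiffOn_mixedHess E.isOpen E.smooth t a c).contDiffAt_two
      E.isOpen E.mem)]
    exact Finset.sum_congr rfl fun i _ => Finset.sum_congr rfl fun j _ => by ring
  simp only [e1, h]
  refine Finset.sum_congr rfl fun k _ => ?_
  simp only [Matrix.add_apply, mul_add, add_mul, Finset.sum_add_distrib, sandwich_mul]
  have hs (i j) : ∑ l, x k l * third t Φ p i l j = mixedDeriv (x k) (third t Φ p) i j := rfl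
  have hs' (i j) : ∑ l, third t Φ p i j l * star (x k l) = holDeriv (x k) (third t Φ p) i j :=
    Finset.sum_congr rfl fun l _ => mul_comm _ _
  congr 1
  · rw [mul_hInv_mul_apply]
    refine Finset.sum_congr rfl fun e _ => ?_
    simp only [of_apply, hs, conjTranspose_apply]
    congr 1
    rw [← hs, star_sum]
    refine Finset.sum_congr rfl fun l _ => ?_
    rw [star_mul', third_symm E.isOpen E.smooth E.mem]; ring
  · rw [mul_hInv_mul_apply]
    refine Finset.sum_congr rfl fun e _ => ?_
    simp only [of_apply, hs', conjTranspose_apply]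
    have h2 : ∑ b, x k b * star (third t Φ p e c b) =
        star (holDeriv (x k) (third t Φ p) c e) := by
      rw [← hs', star_sum]
      refine Finset.sum_congr rfl fun l _ => ?_
      rw [star_mul', third_symm E.isOpen E.smooth E.mem, star_star]; ring
    rw [h2]; ring

/-- The same argument with ∂_a ∂_c. The right side has no sign and is used through its size, and
through a cancellation in the derivative of 𝓑. -/
lemma second_order_hol (E : EquationAt N ε Ω Φ p T) :
    ∑ k, lineLaplacian (∑ b, dirMatrix ε (N * Tᴴ) k b • frameOf T b) (holHess (frameOf T) Φ) p =
      ∑ k, (mixedDeriv (dirMatrix ε (N * Tᴴ) k) (third (frameOf T) Φ p) * hInv m ε *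
          holDeriv (dirMatrix ε (N * Tᴴ) k) (third (frameOf T) Φ p) +
        holDeriv (dirMatrix ε (N * Tᴴ) k) (third (frameOf T) Φ p) * hInv m ε *
          (mixedDeriv (dirMatrix ε (N * Tᴴ) k) (third (frameOf T) Φ p))ᵀ) := by
  obtain ⟨t, ht⟩ : ∃ t, t = frameOf T := ⟨_, rfl⟩
  obtain ⟨x, hx⟩ : ∃ x, x = dirMatrix ε (N * Tᴴ) := ⟨_, rfl⟩
  ext a c
  have hF : HasMJet p (holVec (t a)) (holVec (t c)) (mixedHess (frameOf T) Φ)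
      (diagonal fun a => (lastWeight m ε a : ℂ)) (of fun i j => third t Φ p a i j)
      (of fun i j => third t Φ p c i j)
      (of fun i j => dHol (t i) (dAnti (t j) fun z => holHess t Φ z a c) p) := by
    intro i j
    refine ⟨(contDiffOn_mixedHess E.isOpen E.smooth (frameOf T) i j).contDiffAt_two
      E.isOpen E.mem, ?_, ?_, ?_, ?_⟩
    · rw [E.mixedHess_eq]
    · rw [← dHol_eq, ht]; rfl
    · rw [← dHol_eq, ht]; rfl
    · simp only [ht, mixedHess, holHess, of_apply, dHol_eq, dAnti_eq]
      exact cderiv_pairs_comm E.isOpen E.smooth.toC_comp _ _ _ _ E.mem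
  have h := (E.jet_identity hF).2
  rw [← hx] at h ⊢
  rw [← ht]
  simp only [Matrix.sum_apply, Matrix.add_apply]
  have e1 (k) : lineLaplacian (∑ b, x k b • t b) (holHess t Φ) p a c =
      ∑ i, ∑ j, x k i * (of fun i j => dHol (t i) (dAnti (t j) fun z => holHess t Φ z a c) p) i j
        * star (x k j) := by
    simp only [lineLaplacian, of_apply]
    rw [dHol_dAnti_comb ((contDiffOn_holHess E.isOpen E.smooth t a c).contDiffAt_two
      E.isOpen E.mem)]
    exact Finset.sum_congr rfl fun i _ => Finset.sum_congr rfl fun j _ => by ring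
  simp only [e1, h]
  refine Finset.sum_congr rfl fun k _ => ?_
  simp only [Matrix.add_apply, mul_add, add_mul, Finset.sum_add_distrib, sandwich_mul]
  have hs (i j) : ∑ l, x k l * third t Φ p i l j = mixedDeriv (x k) (third t Φ p) i j := rfl
  have hs' (i j) : ∑ l, third t Φ p i j l * star (x k l) = holDeriv (x k) (third t Φ p) i j :=
    Finset.sum_congr rfl fun l _ => mul_comm _ _
  have hsymm (i j) : holDeriv (x k) (third t Φ p) i j = holDeriv (x k) (third t Φ p) j i := by
    rw [← hs', ← hs']
    exact Finset.sum_congr rfl fun l _ => by rw [third_symm E.isOpen E.smooth E.mem]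
  congr 1
  · rw [mul_hInv_mul_apply]
    refine Finset.sum_congr rfl fun e _ => ?_
    simp only [of_apply, hs, hs']
    rw [hsymm]
  · rw [mul_hInv_mul_apply]
    refine Finset.sum_congr rfl fun e _ => ?_
    simp only [of_apply, hs, hs', transpose_apply]
    ring

end EquationAt
end
end

noncomputable section
open Matrix

/-! ## Bounds for third derivatives -/

section
variable {m : ℕ} {ε Λ : ℝ} {B : Matrix (Fin (m + 1)) (Fin (m + 1)) ℂ}
  {Θ : Fin (m + 1) → Fin (m + 1) → Fin (m + 1) → ℂ}

/-- The weighted size of all derivatives `∂_k Φ_{a c̄}` and `∂̄_k Φ_{a c}`. -/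
def thirdEnergy (ε : ℝ) (B : Matrix (Fin (m + 1)) (Fin (m + 1)) ℂ)
    (Θ : Fin (m + 1) → Fin (m + 1) → Fin (m + 1) → ℂ) : ℝ :=
  ∑ k, ∑ a, ∑ c, (lastWeight m ε c)⁻¹ * (‖mixedDeriv (dirMatrix ε B k) Θ a c‖ ^ 2 +
    ‖holDeriv (dirMatrix ε B k) Θ a c‖ ^ 2)

lemma lastWeight_pos (hε : 0 < ε) (a : Fin (m + 1)) : 0 < lastWeight m ε a := by
  cases a using Fin.lastCases <;> simp [hε]

lemma lastWeight_le_one (hε1 : ε ≤ 1) (a : Fin (m + 1)) : lastWeight m ε a ≤ 1 := by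
  cases a using Fin.lastCases <;> simp [hε1]

lemma dirWeight_pos (hε : 0 < ε) (a : Fin (m + 1)) : 0 < dirWeight m ε a := by
  cases a using Fin.lastCases <;> simp [hε]

lemma dirWeight_le_one (hε1 : ε ≤ 1) (a : Fin (m + 1)) : dirWeight m ε a ≤ 1 := by
  cases a using Fin.lastCases <;> simp [hε1]

lemma thirdEnergy_nonneg (hε : 0 < ε) : 0 ≤ thirdEnergy ε B Θ := by
  refine Finset.sum_nonneg fun k _ => Finset.sum_nonneg fun a _ => Finset.sum_nonneg fun c _ => ?_
  exact mul_nonneg (inv_nonneg.2 (lastWeight_pos hε c).le) (by positivity)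

lemma le_thirdEnergy (hε : 0 < ε) (k a c : Fin (m + 1)) :
    (lastWeight m ε c)⁻¹ * (‖mixedDeriv (dirMatrix ε B k) Θ a c‖ ^ 2 +
      ‖holDeriv (dirMatrix ε B k) Θ a c‖ ^ 2) ≤ thirdEnergy ε B Θ := by
  have h0 (k a c : Fin (m + 1)) : 0 ≤ (lastWeight m ε c)⁻¹ *
      (‖mixedDeriv (dirMatrix ε B k) Θ a c‖ ^ 2 + ‖holDeriv (dirMatrix ε B k) Θ a c‖ ^ 2) :=
    mul_nonneg (inv_nonneg.2 (lastWeight_pos hε c).le) (by positivity)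
  have h1 := Finset.single_le_sum (f := fun c => (lastWeight m ε c)⁻¹ *
      (‖mixedDeriv (dirMatrix ε B k) Θ a c‖ ^ 2 + ‖holDeriv (dirMatrix ε B k) Θ a c‖ ^ 2))
    (fun c _ => h0 k a c) (Finset.mem_univ c)
  have h2 := Finset.single_le_sum (f := fun a => ∑ c, (lastWeight m ε c)⁻¹ *
      (‖mixedDeriv (dirMatrix ε B k) Θ a c‖ ^ 2 + ‖holDeriv (dirMatrix ε B k) Θ a c‖ ^ 2))
    (fun a _ => Finset.sum_nonneg fun c _ => h0 k a c) (Finset.mem_univ a)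
  have h3 := Finset.single_le_sum (f := fun k => ∑ a, ∑ c, (lastWeight m ε c)⁻¹ *
      (‖mixedDeriv (dirMatrix ε B k) Θ a c‖ ^ 2 + ‖holDeriv (dirMatrix ε B k) Θ a c‖ ^ 2))
    (fun k _ => Finset.sum_nonneg fun a _ => Finset.sum_nonneg fun c _ => h0 k a c)
    (Finset.mem_univ k)
  exact h1.trans (h2.trans h3)

lemma norm_deriv_le (hε : 0 < ε) (hε1 : ε ≤ 1) (k a c : Fin (m + 1)) :
    ‖mixedDeriv (dirMatrix ε B k) Θ a c‖ ≤ √(thirdEnergy ε B Θ) ∧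
      ‖holDeriv (dirMatrix ε B k) Θ a c‖ ≤ √(thirdEnergy ε B Θ) := by
  have h := le_thirdEnergy (B := B) (Θ := Θ) hε k a c
  have h1 : 1 ≤ (lastWeight m ε c)⁻¹ :=
    (one_le_inv₀ (lastWeight_pos hε c)).2 (lastWeight_le_one hε1 c)
  have h2 : 1 * (‖mixedDeriv (dirMatrix ε B k) Θ a c‖ ^ 2 +
      ‖holDeriv (dirMatrix ε B k) Θ a c‖ ^ 2) ≤ _ :=
    (mul_le_mul_of_nonneg_right h1 (by positivity)).trans h
  constructor <;> refine Real.le_sqrt_of_sq_le ?_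
  · linarith [sq_nonneg ‖holDeriv (dirMatrix ε B k) Θ a c‖]
  · linarith [sq_nonneg ‖mixedDeriv (dirMatrix ε B k) Θ a c‖]

/-- Inverting the matrix B recovers derivatives along frame vectors from derivatives along the
adapted directions. The weight stays: tangential derivatives are seen only with a factor ε. -/
lemma dirWeight_mul_third (hB : B.det ≠ 0) (a b c : Fin (m + 1)) :
    (dirWeight m ε b : ℂ) * Θ a b c = ∑ k, B⁻¹ b k * mixedDeriv (dirMatrix ε B k) Θ a c := by
  have hu : B⁻¹ * B = 1 := nonsing_inv_mul _ (isUnit_iff_ne_zero.2 hB)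
  simp only [mixedDeriv, of_apply, dirMatrix_apply, Finset.mul_sum]
  rw [Finset.sum_comm]
  have h (e : Fin (m + 1)) : ∑ k, B⁻¹ b k * (B k e * dirWeight m ε e * Θ a e c) =
      (1 : Matrix (Fin (m + 1)) (Fin (m + 1)) ℂ) b e * (dirWeight m ε e * Θ a e c) := by
    rw [← hu, mul_apply, Finset.sum_mul]
    exact Finset.sum_congr rfl fun k _ => by ring
  simp only [h, one_apply, ite_mul, one_mul, zero_mul]
  simp

lemma dirWeight_mul_third' (hB : B.det ≠ 0) (a b c : Fin (m + 1)) :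
    (dirWeight m ε c : ℂ) * Θ a b c =
      ∑ k, star (B⁻¹ c k) * holDeriv (dirMatrix ε B k) Θ a b := by
  have hu : B⁻¹ * B = 1 := nonsing_inv_mul _ (isUnit_iff_ne_zero.2 hB)
  simp only [holDeriv, of_apply, dirMatrix_apply, Finset.mul_sum]
  rw [Finset.sum_comm]
  have h (e : Fin (m + 1)) : ∑ k, star (B⁻¹ c k) * (star (B k e * dirWeight m ε e) * Θ a b e) =
      star ((1 : Matrix (Fin (m + 1)) (Fin (m + 1)) ℂ) c e) * (dirWeight m ε e * Θ a b e) := by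
    rw [← hu, mul_apply, star_sum, Finset.sum_mul]
    refine Finset.sum_congr rfl fun k _ => ?_
    simp only [star_mul', Complex.star_def, Complex.conj_ofReal]; ring
  simp only [h, one_apply]
  simp

lemma norm_sum_mul_le {ι : Type*} [Fintype ι] {u v : ι → ℂ} {C D : ℝ} (hC : 0 ≤ C)
    (hu : ∀ i, ‖u i‖ ≤ C) (hv : ∀ i, ‖v i‖ ≤ D) :
    ‖∑ i, u i * v i‖ ≤ Fintype.card ι * (C * D) := by
  refine (norm_sum_le _ _).trans ?_
  have : ∀ i ∈ (Finset.univ : Finset ι), ‖u i * v i‖ ≤ C * D := fun i _ => by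
    rw [norm_mul]; exact mul_le_mul (hu i) (hv i) (norm_nonneg _) hC
  simpa using Finset.sum_le_card_nsmul _ _ _ this

lemma dirWeight_mul_norm_third_le (hε : 0 < ε) (hε1 : ε ≤ 1) (hΛ : 1 ≤ Λ) (hB : B.det ≠ 0)
    (hBi : ∀ a k, ‖B⁻¹ a k‖ ≤ Λ) (a b c : Fin (m + 1)) :
    dirWeight m ε b * ‖Θ a b c‖ ≤ (m + 1) * Λ * √(thirdEnergy ε B Θ) ∧
      dirWeight m ε c * ‖Θ a b c‖ ≤ (m + 1) * Λ * √(thirdEnergy ε B Θ) := by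
  have e (w : ℝ) (hw : 0 < w) (θ : ℂ) : w * ‖θ‖ = ‖(w : ℂ) * θ‖ := by
    rw [norm_mul, Complex.norm_of_nonneg hw.le]
  constructor
  · rw [e _ (dirWeight_pos hε b), dirWeight_mul_third hB]
    refine (norm_sum_mul_le (by linarith) (hBi b) fun k => (norm_deriv_le hε hε1 k a c).1).trans ?_
    rw [Fintype.card_fin]; push_cast; rw [mul_assoc]
  · rw [e _ (dirWeight_pos hε c), dirWeight_mul_third' hB]
    refine (norm_sum_mul_le (by linarith) (fun k => (norm_star (B⁻¹ c k)).trans_le (hBi c k))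
      fun k => (norm_deriv_le hε hε1 k a b).2).trans ?_
    rw [Fintype.card_fin]; push_cast; rw [mul_assoc]

/-- A column of B cannot be small, because B⁻¹B = 1 and B⁻¹ is bounded. -/
lemma one_le_last_column (hB : B.det ≠ 0) (hBi : ∀ a k, ‖B⁻¹ a k‖ ≤ Λ)
    (b : Fin (m + 1)) : 1 ≤ (m + 1) * Λ ^ 2 * ∑ k, ‖B k b‖ ^ 2 := by
  have hu : B⁻¹ * B = 1 := nonsing_inv_mul _ (isUnit_iff_ne_zero.2 hB)
  have h1 : (1 : ℝ) = ‖∑ k, B⁻¹ b k * B k b‖ := by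
    rw [← mul_apply, hu, one_apply_eq, norm_one]
  have h2 : ‖∑ k, B⁻¹ b k * B k b‖ ≤ ∑ k, Λ * ‖B k b‖ :=
    (norm_sum_le _ _).trans (Finset.sum_le_sum fun k _ => by
      rw [norm_mul]; exact mul_le_mul_of_nonneg_right (hBi b k) (norm_nonneg _))
  rw [← Finset.mul_sum] at h2
  have h3 := sq_sum_le_card_mul_sum_sq (s := (Finset.univ : Finset (Fin (m + 1))))
    (f := fun k => ‖B k b‖)
  simp only [Finset.card_univ, Fintype.card_fin, Nat.cast_add, Nat.cast_one] at h3
  have h4 : 1 ≤ (Λ * ∑ k, ‖B k b‖) ^ 2 := one_le_pow₀ (h1.trans_le h2)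
  rw [mul_pow] at h4
  have h5 := mul_le_mul_of_nonneg_left h3 (sq_nonneg Λ)
  linarith

/-- The first order equation improves the bound on `Φ_{a τ τ̄}`. -/
lemma dirWeight_mul_dirWeight_mul_norm_third_le (hε : 0 < ε) (hε1 : ε ≤ 1) (hΛ : 1 ≤ Λ)
    (hB : B.det ≠ 0) (hBe : ∀ k a, ‖B k a‖ ≤ Λ) (hBi : ∀ a k, ‖B⁻¹ a k‖ ≤ Λ)
    (h1 : ∀ a, ∑ k, ∑ b, ∑ c, dirMatrix ε B k b * Θ a b c * star (dirMatrix ε B k c) = 0)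
    (a b c : Fin (m + 1)) :
    dirWeight m ε b * dirWeight m ε c * ‖Θ a b c‖ ≤
      ((m + 1) * Λ) ^ 5 * ε * √(thirdEnergy ε B Θ) := by
  obtain ⟨y, hy⟩ : ∃ y, y = √(thirdEnergy ε B Θ) := ⟨_, rfl⟩
  obtain ⟨s, hs⟩ : ∃ s : ℝ, s = m + 1 := ⟨_, rfl⟩
  have hs1 : 1 ≤ s := by rw [hs]; linarith [(Nat.cast_nonneg m : (0 : ℝ) ≤ m)]
  have hy0 : 0 ≤ y := hy ▸ Real.sqrt_nonneg _
  have hΓ : 1 ≤ s * Λ := one_le_mul_of_one_le_of_one_le hs1 hΛ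
  have hb := dirWeight_mul_norm_third_le (Θ := Θ) hε hε1 hΛ hB hBi a
  simp only [← hs, ← hy] at hb ⊢
  -- If b or c is tangential its weight already supplies the factor ε. Only the pair (τ, τ) has
  -- weight 1.
  have key (b c : Fin (m + 1)) (hbc : ¬ (b = Fin.last m ∧ c = Fin.last m)) :
      dirWeight m ε b * dirWeight m ε c * ‖Θ a b c‖ ≤ s * Λ * ε * y := by
    cases b using Fin.lastCases with
    | cast β =>
      rw [dirWeight_castSucc, mul_assoc]
      have := mul_le_mul_of_nonneg_left (hb β.castSucc c).2 hε.le
      linarith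
    | last =>
      cases c using Fin.lastCases with
      | cast γ =>
        rw [dirWeight_castSucc, mul_comm _ ε, mul_assoc]
        have := mul_le_mul_of_nonneg_left (hb (Fin.last m) γ.castSucc).1 hε.le
        linarith
      | last => exact absurd ⟨rfl, rfl⟩ hbc
  have hpow : s * Λ * ε * y ≤ (s * Λ) ^ 5 * ε * y := by
    gcongr; exact le_self_pow₀ hΓ (by norm_num)
  by_cases hbc : b = Fin.last m ∧ c = Fin.last m
  swap
  · exact (key b c hbc).trans hpow
  obtain ⟨rfl, rfl⟩ := hbc
  obtain ⟨g, hg⟩ : ∃ g : Fin (m + 1) → Fin (m + 1) → ℂ,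
    g = fun b c => ∑ k, B k b * star (B k c) := ⟨_, rfl⟩
  have hgl : g (Fin.last m) (Fin.last m) = ((∑ k, ‖B k (Fin.last m)‖ ^ 2 : ℝ) : ℂ) := by
    rw [hg]; push_cast
    exact Finset.sum_congr rfl fun k _ => Complex.mul_conj' _
  have hgle (b c) : ‖g b c‖ ≤ s * Λ ^ 2 := by
    rw [hg, hs]
    refine (norm_sum_mul_le (by linarith) (fun k => hBe k b)
      fun k => (norm_star (B k c)).trans_le (hBe k c)).trans ?_
    rw [Fintype.card_fin]; push_cast; rw [sq]
  have h2 : ∑ q : Fin (m + 1) × Fin (m + 1),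
      (dirWeight m ε q.1 * dirWeight m ε q.2 * g q.1 q.2 * Θ a q.1 q.2 : ℂ) = 0 := by
    rw [← h1 a, Fintype.sum_prod_type]
    have : ∀ k, ∑ b, ∑ c, dirMatrix ε B k b * Θ a b c * star (dirMatrix ε B k c) =
      ∑ b, ∑ c, (dirWeight m ε b * dirWeight m ε c * (B k b * star (B k c)) * Θ a b c : ℂ) := by
      intro k
      refine Finset.sum_congr rfl fun b _ => Finset.sum_congr rfl fun c _ => ?_
      simp only [dirMatrix_apply, star_mul', Complex.star_def, Complex.conj_ofReal]; ring
    simp only [this]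
    symm
    rw [Finset.sum_comm]
    refine Finset.sum_congr rfl fun b _ => ?_
    rw [Finset.sum_comm]
    refine Finset.sum_congr rfl fun c _ => ?_
    rw [hg]
    simp only [Finset.mul_sum, Finset.sum_mul]
  -- The first order equation expresses the (τ, τ) term through the others, all of which are O(ε√Y);
  -- its coefficient is bounded below by `one_le_last_column`.
  rw [← Finset.add_sum_erase _ _ (Finset.mem_univ (Fin.last m, Fin.last m))] at h2
  simp only [dirWeight_last, Complex.ofReal_one, one_mul] at h2 ⊢
  have h3 := eq_neg_of_add_eq_zero_left h2
  have h4 : ‖g (Fin.last m) (Fin.last m) * Θ a (Fin.last m) (Fin.last m)‖ ≤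
      s ^ 2 * (s * Λ ^ 2 * (s * Λ * ε * y)) := by
    rw [h3, norm_neg]
    refine (norm_sum_le _ _).trans ?_
    refine (Finset.sum_le_card_nsmul _ _ (s * Λ ^ 2 * (s * Λ * ε * y)) fun q hq => ?_).trans ?_
    · have hq' : ¬ (q.1 = Fin.last m ∧ q.2 = Fin.last m) := by
        rintro ⟨e1, e2⟩
        exact (Finset.mem_erase.1 hq).1 (Prod.ext e1 e2)
      have := mul_le_mul (hgle q.1 q.2) (key q.1 q.2 hq')
        (mul_nonneg (mul_nonneg (dirWeight_pos hε _).le (dirWeight_pos hε _).le) (norm_nonneg _))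
        (by positivity)
      simp only [norm_mul, Complex.norm_of_nonneg (dirWeight_pos hε _).le]
      linarith
    · rw [nsmul_eq_mul]
      refine mul_le_mul_of_nonneg_right ?_ (by positivity)
      have : (Finset.univ.erase ((Fin.last m, Fin.last m) : Fin (m + 1) × Fin (m + 1))).card ≤
          (m + 1) * (m + 1) := by
        refine (Finset.card_le_univ _).trans ?_
        simp
      rw [hs, sq]; exact_mod_cast this
  rw [norm_mul, hgl, Complex.norm_of_nonneg (by positivity)] at h4
  have h5 := one_le_last_column hB hBi (Fin.last m)
  rw [← hs] at h5
  have h6 := mul_le_mul_of_nonneg_left h4 (by positivity : 0 ≤ s * Λ ^ 2)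
  have h7 := mul_le_mul_of_nonneg_right h5 (norm_nonneg (Θ a (Fin.last m) (Fin.last m)))
  calc ‖Θ a (Fin.last m) (Fin.last m)‖ ≤ s * Λ ^ 2 * (s ^ 2 * (s * Λ ^ 2 * (s * Λ * ε * y))) := by
        linarith
    _ = (s * Λ) ^ 5 * ε * y := by ring

/-- Derivatives with one index in the distinguished direction are of order `ε`. -/
lemma norm_deriv_last_le (hε : 0 < ε) (hε1 : ε ≤ 1) (hΛ : 1 ≤ Λ)
    (hB : B.det ≠ 0) (hBe : ∀ k a, ‖B k a‖ ≤ Λ) (hBi : ∀ a k, ‖B⁻¹ a k‖ ≤ Λ)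
    (h1 : ∀ a, ∑ k, ∑ b, ∑ c, dirMatrix ε B k b * Θ a b c * star (dirMatrix ε B k c) = 0)
    (k a : Fin (m + 1)) :
    ‖mixedDeriv (dirMatrix ε B k) Θ a (Fin.last m)‖ ≤
      ((m + 1) * Λ) ^ 6 * ε * √(thirdEnergy ε B Θ) ∧
    ‖holDeriv (dirMatrix ε B k) Θ a (Fin.last m)‖ ≤
      ((m + 1) * Λ) ^ 6 * ε * √(thirdEnergy ε B Θ) := by
  have h := dirWeight_mul_dirWeight_mul_norm_third_le hε hε1 hΛ hB hBe hBi h1 a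
  obtain ⟨W, hW⟩ : ∃ W, W = ((m + 1) * Λ) ^ 5 * ε * √(thirdEnergy ε B Θ) := ⟨_, rfl⟩
  rw [← hW] at h
  have e : ((m + 1) * Λ) ^ 6 * ε * √(thirdEnergy ε B Θ) = (m + 1 : ℝ) * (Λ * W) := by
    rw [hW]; ring
  have hc : ((Fintype.card (Fin (m + 1)) : ℕ) : ℝ) = m + 1 := by simp
  rw [e, ← hc]
  constructor
  -- The last index has weight 1, so the doubly weighted bound applies term by term.
  · simp only [mixedDeriv, of_apply, dirMatrix_apply, mul_assoc]
    refine norm_sum_mul_le (by linarith) (fun b => hBe k b) fun b => ?_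
    have := h b (Fin.last m)
    rw [dirWeight_last, mul_one] at this
    rwa [norm_mul, Complex.norm_of_nonneg (dirWeight_pos hε _).le]
  · simp only [holDeriv, of_apply, dirMatrix_apply, star_mul', mul_assoc]
    refine norm_sum_mul_le (by linarith) (fun b => (norm_star (B k b)).trans_le (hBe k b))
      fun b => ?_
    have := h (Fin.last m) b
    rw [dirWeight_last, one_mul] at this
    rwa [norm_mul, norm_star, Complex.norm_of_nonneg (dirWeight_pos hε _).le]

end
end

noncomputable section
open Matrix

/-! ## The auxiliary functions `W`, `|z|²` and `V` -/

section
variable {m : ℕ} {ε Λ : ℝ}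

lemma trace_mul_conjTranspose_self {ι κ : Type*} [Fintype ι] [Fintype κ] (F : Matrix ι κ ℂ) :
    (F * Fᴴ).trace = ((∑ i, ∑ j, ‖F i j‖ ^ 2 : ℝ) : ℂ) := by
  push_cast
  refine Finset.sum_congr rfl fun i _ => ?_
  rw [diag_apply, mul_apply]
  exact Finset.sum_congr rfl fun j _ => Complex.mul_conj' _

lemma trace_mul_hInv_mul_conjTranspose {ι : Type*} [Fintype ι] (F : Matrix ι (Fin (m + 1)) ℂ) :
    (F * hInv m ε * Fᴴ).trace = ((∑ i, ∑ c, (lastWeight m ε c)⁻¹ * ‖F i c‖ ^ 2 : ℝ) : ℂ) := by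
  push_cast
  refine Finset.sum_congr rfl fun i _ => ?_
  rw [diag_apply, mul_hInv_mul_apply]
  refine Finset.sum_congr rfl fun j _ => ?_
  rw [conjTranspose_apply, mul_right_comm, Complex.star_def, Complex.mul_conj', mul_comm]

lemma sum_norm_sq_mul_le {ι κ μ : Type*} [Fintype ι] [Fintype κ] {A : Matrix ι κ ℂ} {a : ℝ}
    (hA : ∀ i j, ‖A i j‖ ≤ a) (F : Matrix κ μ ℂ) (c : μ) :
    ∑ i, ‖(A * F) i c‖ ^ 2 ≤ Fintype.card ι * Fintype.card κ * a ^ 2 * ∑ k, ‖F k c‖ ^ 2 := by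
  have h (i : ι) : ‖(A * F) i c‖ ^ 2 ≤ Fintype.card κ * a ^ 2 * ∑ k, ‖F k c‖ ^ 2 := by
    have h1 : ‖(A * F) i c‖ ≤ ∑ k, ‖A i k‖ * ‖F k c‖ := by
      rw [mul_apply]
      exact (norm_sum_le _ _).trans (le_of_eq (by simp only [norm_mul]))
    refine (pow_le_pow_left₀ (norm_nonneg _) h1 2).trans
      ((Finset.sum_mul_sq_le_sq_mul_sq _ _ _).trans ?_)
    refine mul_le_mul_of_nonneg_right ?_ (by positivity)
    refine (Finset.sum_le_card_nsmul _ _ (a ^ 2) fun k _ =>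
      pow_le_pow_left₀ (norm_nonneg _) (hA i k) 2).trans (by simp)
  refine (Finset.sum_le_card_nsmul _ _ _ fun i _ => h i).trans ?_
  rw [nsmul_eq_mul, Finset.card_univ]
  simp only [mul_assoc]; rfl

lemma conjTranspose_mul_inv_cancel {n : ℕ} {B : Matrix (Fin n) (Fin n) ℂ} (hB : B.det ≠ 0)
    {κ : Type*} (F : Matrix (Fin n) κ ℂ) : Bᴴ * (B⁻¹ᴴ * F) = F := by
  rw [← Matrix.mul_assoc, ← conjTranspose_mul, nonsing_inv_mul _ (isUnit_iff_ne_zero.2 hB),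
    conjTranspose_one, Matrix.one_mul]

/-- Comparison of the Frobenius norm in the adapted frame with the one defined by the metric, which
is comparable to it uniformly in ε. Only the row index is changed; the weighted column index is
untouched. -/
lemma weighted_norm_sq_le (hε : 0 < ε) {B : Matrix (Fin (m + 1)) (Fin (m + 1)) ℂ}
    (hB : B.det ≠ 0) (hBe : ∀ k a, ‖B k a‖ ≤ Λ) (F : Matrix (Fin (m + 1)) (Fin (m + 1)) ℂ) :
    ∑ a, ∑ c, (lastWeight m ε c)⁻¹ * ‖F a c‖ ^ 2 ≤
      ((m + 1) * Λ) ^ 2 * (F * hInv m ε * Fᴴ * (B⁻¹ * B⁻¹ᴴ)).trace.re := by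
  have h1 : (F * hInv m ε * Fᴴ * (B⁻¹ * B⁻¹ᴴ)).trace =
      ((B⁻¹ᴴ * F) * hInv m ε * (B⁻¹ᴴ * F)ᴴ).trace := by
    rw [← Matrix.mul_assoc, trace_mul_comm]
    simp only [conjTranspose_mul, conjTranspose_conjTranspose, Matrix.mul_assoc]
  rw [h1, trace_mul_hInv_mul_conjTranspose, Complex.ofReal_re, Finset.sum_comm,
    Finset.sum_comm (s := Finset.univ) (t := Finset.univ)
      (f := fun i c => (lastWeight m ε c)⁻¹ * ‖(B⁻¹ᴴ * F) i c‖ ^ 2), Finset.mul_sum]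
  refine Finset.sum_le_sum fun c _ => ?_
  have h2 := sum_norm_sq_mul_le (A := Bᴴ) (a := Λ)
    (fun i j => (norm_star (B j i)).trans_le (hBe j i)) (B⁻¹ᴴ * F) c
  rw [conjTranspose_mul_inv_cancel hB] at h2
  simp only [Fintype.card_fin, Nat.cast_add, Nat.cast_one] at h2
  rw [← Finset.mul_sum, ← Finset.mul_sum]
  have h3 := mul_le_mul_of_nonneg_left h2 (inv_nonneg.2 (lastWeight_pos hε c).le)
  refine h3.trans (le_of_eq ?_)
  ring

/-- Contracting the second order equation with the inverse metric gives LW on one side and a sum of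
weighted squares on the other. This is the lower bound LW ≥ cY. -/
lemma thirdEnergy_le (hε : 0 < ε) {B : Matrix (Fin (m + 1)) (Fin (m + 1)) ℂ}
    {Θ : Fin (m + 1) → Fin (m + 1) → Fin (m + 1) → ℂ}
    (hB : B.det ≠ 0) (hBe : ∀ k a, ‖B k a‖ ≤ Λ)
    {η : Fin (m + 1) → Matrix (Fin (m + 1)) (Fin (m + 1)) ℂ}
    (hη : ∑ k, η k = ∑ k, (mixedDeriv (dirMatrix ε B k) Θ * hInv m ε *
        (mixedDeriv (dirMatrix ε B k) Θ)ᴴ + holDeriv (dirMatrix ε B k) Θ * hInv m ε *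
        (holDeriv (dirMatrix ε B k) Θ)ᴴ)) :
    thirdEnergy ε B Θ ≤ ((m + 1) * Λ) ^ 2 * ∑ k, (η k * (B⁻¹ * B⁻¹ᴴ)).trace.re := by
  have h1 : ∑ k, (η k * (B⁻¹ * B⁻¹ᴴ)).trace.re = ((∑ k, η k) * (B⁻¹ * B⁻¹ᴴ)).trace.re := by
    rw [Finset.sum_mul, trace_sum, Complex.re_sum]
  rw [h1, hη, Finset.sum_mul, trace_sum, Complex.re_sum, thirdEnergy, Finset.mul_sum]
  refine Finset.sum_le_sum fun k _ => ?_
  simp only [mul_add, Finset.sum_add_distrib, Matrix.add_mul, trace_add, Complex.add_re]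
  exact add_le_add (weighted_norm_sq_le hε hB hBe _) (weighted_norm_sq_le hε hB hBe _)

/-- Each product α_{ae} h_e β_{ec} is at most half the sum of the two weighted squares, by the
symmetry of β; each of the two groups of terms is then at most Y. -/
lemma norm_sum_hol_le (hε : 0 < ε) {B : Matrix (Fin (m + 1)) (Fin (m + 1)) ℂ}
    {Θ : Fin (m + 1) → Fin (m + 1) → Fin (m + 1) → ℂ} (hΘ : ∀ a b c, Θ a b c = Θ b a c)
    {π : Fin (m + 1) → Matrix (Fin (m + 1)) (Fin (m + 1)) ℂ}
    (hπ : ∑ k, π k = ∑ k, (mixedDeriv (dirMatrix ε B k) Θ * hInv m ε *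
        holDeriv (dirMatrix ε B k) Θ + holDeriv (dirMatrix ε B k) Θ * hInv m ε *
        (mixedDeriv (dirMatrix ε B k) Θ)ᵀ)) (a c : Fin (m + 1)) :
    ‖(∑ k, π k) a c‖ ≤ 2 * thirdEnergy ε B Θ := by
  have hs (k e c) : holDeriv (dirMatrix ε B k) Θ e c = holDeriv (dirMatrix ε B k) Θ c e := by
    simp only [holDeriv, of_apply]
    exact Finset.sum_congr rfl fun l _ => by rw [hΘ]
  have key (k e a c : Fin (m + 1)) : ‖mixedDeriv (dirMatrix ε B k) Θ a e *
      (lastWeight m ε e : ℂ)⁻¹ * holDeriv (dirMatrix ε B k) Θ c e‖ ≤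
      (lastWeight m ε e)⁻¹ * (‖mixedDeriv (dirMatrix ε B k) Θ a e‖ ^ 2 +
        ‖holDeriv (dirMatrix ε B k) Θ c e‖ ^ 2) / 2 := by
    rw [norm_mul, norm_mul, norm_inv, Complex.norm_of_nonneg (lastWeight_pos hε e).le]
    have h1 := two_mul_le_add_sq ‖mixedDeriv (dirMatrix ε B k) Θ a e‖
      ‖holDeriv (dirMatrix ε B k) Θ c e‖
    have h2 := mul_le_mul_of_nonneg_left h1 (inv_nonneg.2 (lastWeight_pos hε e).le)
    linarith
  have hY (a c : Fin (m + 1)) : ∑ k, ∑ e, (lastWeight m ε e)⁻¹ *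
      (‖mixedDeriv (dirMatrix ε B k) Θ a e‖ ^ 2 + ‖holDeriv (dirMatrix ε B k) Θ c e‖ ^ 2) / 2 ≤
      thirdEnergy ε B Θ := by
    have h0 (k a e : Fin (m + 1)) : 0 ≤ (lastWeight m ε e)⁻¹ *
        ‖mixedDeriv (dirMatrix ε B k) Θ a e‖ ^ 2 :=
      mul_nonneg (inv_nonneg.2 (lastWeight_pos hε e).le) (by positivity)
    have h0' (k a e : Fin (m + 1)) : 0 ≤ (lastWeight m ε e)⁻¹ *
        ‖holDeriv (dirMatrix ε B k) Θ a e‖ ^ 2 :=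
      mul_nonneg (inv_nonneg.2 (lastWeight_pos hε e).le) (by positivity)
    refine Finset.sum_le_sum fun k _ => ?_
    simp only [mul_add, add_div, Finset.sum_add_distrib]
    have h1 := Finset.single_le_sum (f := fun a => ∑ e, (lastWeight m ε e)⁻¹ *
      ‖mixedDeriv (dirMatrix ε B k) Θ a e‖ ^ 2) (fun a _ => Finset.sum_nonneg fun e _ => h0 k a e)
      (Finset.mem_univ a)
    have h2 := Finset.single_le_sum (f := fun a => ∑ e, (lastWeight m ε e)⁻¹ *
      ‖holDeriv (dirMatrix ε B k) Θ a e‖ ^ 2) (fun a _ => Finset.sum_nonneg fun e _ => h0' k a e)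
      (Finset.mem_univ c)
    have h3 : 0 ≤ ∑ a, ∑ e, (lastWeight m ε e)⁻¹ * ‖mixedDeriv (dirMatrix ε B k) Θ a e‖ ^ 2 :=
      Finset.sum_nonneg fun a _ => Finset.sum_nonneg fun e _ => h0 k a e
    have h4 : 0 ≤ ∑ a, ∑ e, (lastWeight m ε e)⁻¹ * ‖holDeriv (dirMatrix ε B k) Θ a e‖ ^ 2 :=
      Finset.sum_nonneg fun a _ => Finset.sum_nonneg fun e _ => h0' k a e
    simp only [← Finset.sum_div]
    linarith
  rw [hπ]
  simp only [Matrix.sum_apply, Matrix.add_apply, mul_hInv_mul_apply, transpose_apply,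
    Finset.sum_add_distrib]
  rw [two_mul]
  refine (norm_add_le _ _).trans (add_le_add ?_ ?_)
  · refine le_trans ?_ (hY a c)
    refine (norm_sum_le _ _).trans (Finset.sum_le_sum fun k _ => (norm_sum_le _ _).trans
      (Finset.sum_le_sum fun e _ => ?_))
    rw [hs k e c]; exact key k e a c
  · refine le_trans ?_ (hY c a)
    refine (norm_sum_le _ _).trans (Finset.sum_le_sum fun k _ => (norm_sum_le _ _).trans
      (Finset.sum_le_sum fun e _ => ?_))
    rw [mul_comm, mul_comm (holDeriv (dirMatrix ε B k) Θ a e), ← mul_assoc]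
    exact key k e c a

/-- Lower bound for the linearized operator applied to `|P|²` in a moving metric. -/
lemma sum_norm_sq_le_of_frobenius_jet (hΛ : 1 ≤ Λ)
    {B P : Matrix (Fin (m + 1)) (Fin (m + 1)) ℂ} (hB : B.det ≠ 0) (hBe : ∀ k a, ‖B k a‖ ≤ Λ)
    (hBi : ∀ a k, ‖B⁻¹ a k‖ ≤ Λ) (hP : ∀ a b, ‖P a b‖ ≤ Λ)
    {γ β π : Fin (m + 1) → Matrix (Fin (m + 1)) (Fin (m + 1)) ℂ} {Y : ℝ} (hY : 0 ≤ Y)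
    (hπ : ∀ a b, ‖(∑ k, π k) a b‖ ≤ 2 * Y)
    {φ : Matrix (Fin (m + 1)) (Fin (m + 1)) ℂ → Matrix (Fin (m + 1)) (Fin (m + 1)) ℂ}
    (hφ : φ = fun K => B⁻¹ᴴ * K * B⁻¹.map star) :
    ∑ k, ∑ a, ∑ b, ‖γ k a b‖ ^ 2 ≤ ((m + 1) * Λ) ^ 4 *
      (∑ k, (φ (π k) * (φ P)ᴴ + φ (β k) * (φ (β k))ᴴ + φ (γ k) * (φ (γ k))ᴴ +
        φ P * (φ (π k))ᴴ).trace.re + 4 * ((m + 1) * Λ) ^ 6 * Y) := by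
  obtain ⟨s, hs⟩ : ∃ s : ℝ, s = m + 1 := ⟨_, rfl⟩
  have hs1 : 1 ≤ s := by rw [hs]; linarith [(Nat.cast_nonneg m : (0 : ℝ) ≤ m)]
  have hc : ((Fintype.card (Fin (m + 1)) : ℕ) : ℝ) = s := by simp [hs]
  -- φ is the passage to a unitary frame of the metric; its inverse is bounded, so norms may be
  -- compared on either side.
  have hφi (K) : Bᴴ * φ K * B.map star = K := by
    have hb : B⁻¹.map star * B.map star = 1 := by
      have h := nonsing_inv_mul _ (isUnit_iff_ne_zero.2 hB)
      have h2 : (B⁻¹ * B).map star = B⁻¹.map star * B.map star :=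
        Matrix.map_mul (f := starRingEnd ℂ)
      rw [← h2, h]; exact Matrix.map_one _ (star_zero ℂ) (star_one ℂ)
    rw [hφ]
    simp only [Matrix.mul_assoc, hb, Matrix.mul_one]
    exact conjTranspose_mul_inv_cancel hB K
  have hBs : ∀ k a, ‖B.map star k a‖ ≤ Λ := fun k a => (norm_star (B k a)).trans_le (hBe k a)
  have hBt : ∀ k a, ‖Bᴴ k a‖ ≤ Λ := fun k a => (norm_star (B a k)).trans_le (hBe a k)
  have hBis : ∀ k a, ‖B⁻¹.map star k a‖ ≤ Λ := fun k a => (norm_star (B⁻¹ k a)).trans_le (hBi k a)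
  have hBit : ∀ k a, ‖B⁻¹ᴴ k a‖ ≤ Λ := fun k a => (norm_star (B⁻¹ a k)).trans_le (hBi a k)
  have h1 (K : Matrix (Fin (m + 1)) (Fin (m + 1)) ℂ) : ∑ a, ∑ b, ‖K a b‖ ^ 2 ≤
      (s * Λ) ^ 4 * (φ K * (φ K)ᴴ).trace.re := by
    rw [trace_mul_conjTranspose_self, Complex.ofReal_re]
    have e1 : ∑ a, ∑ b, ‖K a b‖ ^ 2 ≤ s * s * Λ ^ 2 * ∑ a, ∑ b, ‖(φ K * B.map star) a b‖ ^ 2 := by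
      rw [Finset.sum_comm, Finset.sum_comm (f := fun a b => ‖(φ K * B.map star) a b‖ ^ 2),
        Finset.mul_sum]
      refine Finset.sum_le_sum fun b _ => ?_
      have := sum_norm_sq_mul_le hBt (φ K * B.map star) b
      rwa [hc, ← Matrix.mul_assoc, hφi] at this
    have e2 : ∑ a, ∑ b, ‖(φ K * B.map star) a b‖ ^ 2 ≤ s * s * Λ ^ 2 *
        ∑ a, ∑ b, ‖φ K a b‖ ^ 2 := by
      rw [Finset.mul_sum]
      refine Finset.sum_le_sum fun a _ => ?_
      have := sum_norm_sq_mul_le (A := (B.map star)ᵀ) (fun i j => hBs j i) (φ K)ᵀ a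
      rw [hc, ← transpose_mul] at this
      exact this
    refine e1.trans ((mul_le_mul_of_nonneg_left e2 (by positivity)).trans (le_of_eq ?_))
    ring
  have h2 (a b) : ‖φ P a b‖ ≤ s ^ 2 * Λ ^ 3 := by
    rw [hφ]
    refine (norm_mul_apply_le (norm_mul_apply_le hBit hP) hBis a b).trans (le_of_eq ?_)
    rw [hc]; ring
  have h3 (a b) : ‖φ (∑ k, π k) a b‖ ≤ s ^ 2 * Λ ^ 2 * (2 * Y) := by
    rw [hφ]
    refine (norm_mul_apply_le (norm_mul_apply_le hBit hπ) hBis a b).trans (le_of_eq ?_)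
    rw [hc]; ring
  -- The terms containing the second derivative of P are not squares. They cost at most a multiple
  -- of Y because P is bounded; the β-squares are dropped, and the γ-squares are what is kept.
  have h4 : |(φ (∑ k, π k) * (φ P)ᴴ).trace.re| ≤ 2 * (s * Λ) ^ 6 * Y := by
    refine (Complex.abs_re_le_norm _).trans ((norm_sum_le _ _).trans ?_)
    have h5 (i) : ‖(φ (∑ k, π k) * (φ P)ᴴ) i i‖ ≤ s * (s ^ 2 * Λ ^ 2 * (2 * Y) * (s ^ 2 * Λ ^ 3)) := by
      have := norm_mul_apply_le h3 (B := (φ P)ᴴ)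
        (fun i j => (norm_star (φ P j i)).trans_le (h2 j i)) i i
      rwa [hc] at this
    refine (Finset.sum_le_card_nsmul _ _ _ fun i _ => h5 i).trans ?_
    rw [nsmul_eq_mul, Finset.card_univ, hc]
    have : s * (s * (s ^ 2 * Λ ^ 2 * (2 * Y) * (s ^ 2 * Λ ^ 3))) = 2 * (s ^ 6 * Λ ^ 5) * Y := by ring
    rw [this, mul_pow]
    gcongr
    norm_num
  have hφs : ∑ k, φ (π k) = φ (∑ k, π k) := by
    rw [hφ]; simp only [Finset.mul_sum, Finset.sum_mul]
  have h5 : ∑ k, (φ (π k) * (φ P)ᴴ + φ (β k) * (φ (β k))ᴴ + φ (γ k) * (φ (γ k))ᴴ +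
        φ P * (φ (π k))ᴴ).trace.re = 2 * (φ (∑ k, π k) * (φ P)ᴴ).trace.re +
        ∑ k, (φ (β k) * (φ (β k))ᴴ).trace.re + ∑ k, (φ (γ k) * (φ (γ k))ᴴ).trace.re := by
    have e1 (k) : (φ P * (φ (π k))ᴴ).trace.re = (φ (π k) * (φ P)ᴴ).trace.re := by
      have : φ P * (φ (π k))ᴴ = (φ (π k) * (φ P)ᴴ)ᴴ := by
        rw [conjTranspose_mul, conjTranspose_conjTranspose]
      rw [this, trace_conjTranspose]; rfl
    have e2 : (φ (∑ k, π k) * (φ P)ᴴ).trace.re = ∑ k, (φ (π k) * (φ P)ᴴ).trace.re := by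
      rw [← hφs, Finset.sum_mul, trace_sum, Complex.re_sum]
    simp only [trace_add, Complex.add_re, Finset.sum_add_distrib, e1, e2]
    ring
  rw [← hs, h5]
  have h6 : 0 ≤ ∑ k, (φ (β k) * (φ (β k))ᴴ).trace.re := Finset.sum_nonneg fun k _ => by
    rw [trace_mul_conjTranspose_self, Complex.ofReal_re]; positivity
  have h7 : ∑ k, ∑ a, ∑ b, ‖γ k a b‖ ^ 2 ≤ (s * Λ) ^ 4 *
      ∑ k, (φ (γ k) * (φ (γ k))ᴴ).trace.re := by
    rw [Finset.mul_sum]; exact Finset.sum_le_sum fun k _ => h1 _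
  refine h7.trans (mul_le_mul_of_nonneg_left ?_ (by positivity))
  have := (abs_le.1 h4).1
  linarith

end

/-! ### Jets of the auxiliary functions -/

namespace EquationAt
variable {m : ℕ} {N T : Matrix (Fin (m + 1)) (Fin (m + 1)) ℂ} {ε : ℝ} {Ω : Set (Cn (m + 1))}
  {Φ : Cn (m + 1) → ℝ} {p : Cn (m + 1)}

/-- The adapted directions. -/
def dir (N T : Matrix (Fin (m + 1)) (Fin (m + 1)) ℂ) (ε : ℝ) (k : Fin (m + 1)) : Cn (m + 1) :=
  ∑ b, dirMatrix ε (N * Tᴴ) k b • frameOf T b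

lemma det_metric_ne (E : EquationAt N ε Ω Φ p T) (hN : N.det ≠ 0) : (N * Tᴴ).det ≠ 0 := by
  rw [det_mul, det_conjTranspose]
  exact mul_ne_zero hN (star_ne_zero.2 E.det_frame)

lemma frame_eq (E : EquationAt N ε Ω Φ p T) {z : Cn (m + 1)} (hz : z ∈ Ω) :
    mixedHess (stdFrame (m + 1)) Φ z = T⁻¹ * mixedHess (frameOf T) Φ z * T⁻¹ᴴ := by
  have hu : IsUnit T.det := isUnit_iff_ne_zero.2 E.det_frame
  rw [mixedHess_frameOf (E.contDiffAt_toC hz), Matrix.mul_assoc T, nonsing_inv_mul_cancel_left _ _ hu,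
    Matrix.mul_assoc, ← conjTranspose_mul, nonsing_inv_mul _ hu, conjTranspose_one, Matrix.mul_one]

lemma metric_inv (N T : Matrix (Fin (m + 1)) (Fin (m + 1)) ℂ) :
    (N * Tᴴ)⁻¹ = T⁻¹ᴴ * N⁻¹ := by
  rw [Matrix.mul_inv_rev, conjTranspose_nonsing_inv]

lemma Wfun_eq (E : EquationAt N ε Ω Φ p T) {z : Cn (m + 1)} (hz : z ∈ Ω) :
    Wfun (Nᴴ * N) Φ z =
      (mixedHess (frameOf T) Φ z * ((N * Tᴴ)⁻¹ * (N * Tᴴ)⁻¹ᴴ)).trace.re := by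
  have h1 : Wfun (Nᴴ * N) Φ z = (mixedHess (stdFrame (m + 1)) Φ z * (Nᴴ * N)⁻¹).trace.re := by
    simp only [Wfun, upper, trace, diag_apply, mul_apply]
  rw [h1, E.frame_eq hz, metric_inv, Matrix.mul_inv_rev, ← conjTranspose_nonsing_inv,
    conjTranspose_mul, conjTranspose_conjTranspose]
  congr 1
  rw [Matrix.mul_assoc, Matrix.mul_assoc, trace_mul_comm]
  simp only [Matrix.mul_assoc]

lemma exists_hasJet_Wfun (E : EquationAt N ε Ω Φ p T) (k : Fin (m + 1)) :
    ∃ f0 f1 f2, HasJet p (holVec (dir N T ε k)) (conjVec (holVec (dir N T ε k)))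
      (toC (Wfun (Nᴴ * N) Φ)) f0 f1 f2
      (((lineLaplacian (dir N T ε k) (mixedHess (frameOf T) Φ) p) *
        ((N * Tᴴ)⁻¹ * (N * Tᴴ)⁻¹ᴴ)).trace.re : ℂ) := by
  have h1 := (((hasMJet_mixedHess E.isOpen E.smooth E.mem (frameOf T)
    (dirMatrix ε (N * Tᴴ) k)).mul (HasMJet.const ((N * Tᴴ)⁻¹ * (N * Tᴴ)⁻¹ᴴ))).trace).re
  have h2 := h1.congr (g := toC (Wfun (Nᴴ * N) Φ)) (by
    filter_upwards [E.isOpen.mem_nhds E.mem] with z hz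
    rw [toC, toC, E.Wfun_eq hz])
  simp only [Matrix.mul_zero, add_zero] at h2
  exact ⟨_, _, _, h2⟩

lemma exists_hasJet_normSqG {n : ℕ} (G : Matrix (Fin n) (Fin n) ℂ) (p v : Cn n) :
    ∃ f0 f1 f2, HasJet p (holVec v) (conjVec (holVec v)) (toC (normSqG G)) f0 f1 f2
      (normSqG G v : ℂ) := by
  have h := (HasJet.sum Finset.univ fun i _ => HasJet.sum Finset.univ fun j _ =>
    ((hasJet_coord p (holVec v) (conjVec (holVec v)) i).const_mul (G i j)).mul
      (hasJet_coord_star p (holVec v) (conjVec (holVec v)) j)).re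
  simp only [conjVec_holVec, holVec_fst_add, antiVec_fst_sub, holVec_fst_sub, antiVec_fst_add,
    mul_zero, zero_mul, star_zero, add_zero, zero_add] at h ⊢
  exact ⟨_, _, _, h⟩

/-- L|z|² is the sum of |ξ|² over the adapted directions. The τ-components of these directions have
weight 1, so they form the last column of B, which is bounded below independently of ε. -/
lemma one_le_sum_normSqG (E : EquationAt N ε Ω Φ p T) {Λ : ℝ} (hN : N.det ≠ 0)
    (hBi : ∀ a k, ‖(N * Tᴴ)⁻¹ a k‖ ≤ Λ) :
    1 ≤ ((m + 1) * Λ ^ 2) ^ 2 * ∑ k, normSqG (Nᴴ * N) (dir N T ε k) := by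
  obtain ⟨B, hB⟩ : ∃ B, B = N * Tᴴ := ⟨_, rfl⟩
  have hBd : B.det ≠ 0 := hB ▸ E.det_metric_ne hN
  rw [← hB] at hBi
  have hdir (k i) : dir N T ε k i = (dirMatrix ε B * T) k i := by
    simp only [dir, frameOf, mul_apply, ← hB]
    simp [stdFrame, Pi.single_apply]
  have h1 (k) : normSqG (Nᴴ * N) (dir N T ε k) = ∑ l, ‖(B * (dirMatrix ε B)ᴴ) l k‖ ^ 2 := by
    have e1 : B * (dirMatrix ε B)ᴴ = N * (dirMatrix ε B * T)ᴴ := by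
      rw [conjTranspose_mul, hB]; simp only [Matrix.mul_assoc]
    have e2 : (normSqG (Nᴴ * N) (dir N T ε k)) =
        (∑ l, (B * (dirMatrix ε B)ᴴ) l k * star ((B * (dirMatrix ε B)ᴴ) l k)).re := by
      rw [normSqG, e1]
      congr 1
      simp only [hdir]
      obtain ⟨Z, hZ⟩ : ∃ Z, Z = dirMatrix ε B * T := ⟨_, rfl⟩
      rw [← hZ]
      have e3 (l) : (N * Zᴴ) l k * star ((N * Zᴴ) l k) =
          ∑ i, ∑ j, Nᴴ i l * N l j * Z k i * star (Z k j) := by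
        rw [mul_comm, mul_apply, star_sum, Finset.sum_mul_sum]
        refine Finset.sum_congr rfl fun i _ => Finset.sum_congr rfl fun j _ => ?_
        simp only [conjTranspose_apply, star_mul', star_star]; ring
      simp only [e3, mul_apply (M := Nᴴ), Finset.sum_mul]
      symm
      rw [Finset.sum_comm]
      exact Finset.sum_congr rfl fun i _ => Finset.sum_comm
    rw [e2]
    have : ∀ l, (B * (dirMatrix ε B)ᴴ) l k * star ((B * (dirMatrix ε B)ᴴ) l k) =
        ((‖(B * (dirMatrix ε B)ᴴ) l k‖ ^ 2 : ℝ) : ℂ) := fun l => by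
      rw [Complex.star_def, Complex.mul_conj']; push_cast; rfl
    simp only [this]
    rw [← Complex.ofReal_sum, Complex.ofReal_re]
  simp only [h1]
  have h2 : B⁻¹ * (B * (dirMatrix ε B)ᴴ) = (dirMatrix ε B)ᴴ :=
    nonsing_inv_mul_cancel_left _ _ (isUnit_iff_ne_zero.2 hBd)
  have h3 (k) : ‖B k (Fin.last m)‖ ^ 2 ≤ (m + 1) * Λ ^ 2 *
      ∑ l, ‖(B * (dirMatrix ε B)ᴴ) l k‖ ^ 2 := by
    have e1 := sum_norm_sq_mul_le (A := of fun (_ : Unit) l => B⁻¹ (Fin.last m) l)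
      (fun _ j => hBi _ j) (B * (dirMatrix ε B)ᴴ) k
    have e2 : ((of fun (_ : Unit) l => B⁻¹ (Fin.last m) l) * (B * (dirMatrix ε B)ᴴ)) () k =
        star (B k (Fin.last m)) := by
      have : ((of fun (_ : Unit) l => B⁻¹ (Fin.last m) l) * (B * (dirMatrix ε B)ᴴ)) () k =
        (B⁻¹ * (B * (dirMatrix ε B)ᴴ)) (Fin.last m) k := rfl
      rw [this, h2, conjTranspose_apply, dirMatrix_apply, dirWeight_last]; simp
    simpa [e2] using e1
  have h4 := one_le_last_column hBd hBi (Fin.last m)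
  refine h4.trans ?_
  have h5 := Finset.sum_le_sum fun k (_ : k ∈ Finset.univ) => h3 k
  rw [← Finset.mul_sum] at h5
  have h6 := mul_le_mul_of_nonneg_left h5 (by positivity : 0 ≤ (m + 1) * Λ ^ 2)
  refine h6.trans (le_of_eq ?_)
  ring

/-- V is the squared Frobenius norm of P in a unitary frame of the metric; the symmetry of P
identifies its conjugate with its adjoint. -/
lemma Vfun_eq (E : EquationAt N ε Ω Φ p T) {z : Cn (m + 1)} (hz : z ∈ Ω) :
    Vfun (Nᴴ * N) Φ z =
      (((N * Tᴴ)⁻¹ᴴ * holHess (frameOf T) Φ z * (N * Tᴴ)⁻¹.map star) *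
        ((N * Tᴴ)⁻¹ᴴ * holHess (frameOf T) Φ z * (N * Tᴴ)⁻¹.map star)ᴴ).trace.re := by
  obtain ⟨P, hP⟩ : ∃ P, P = holHess (stdFrame (m + 1)) Φ z := ⟨_, rfl⟩
  have hPs : Pᴴ = P.map star := by
    ext i j
    have := congrFun (congrFun (holHess_isSymm E.isOpen E.smooth hz (stdFrame (m + 1))) i) j
    rw [← hP] at this
    rw [conjTranspose_apply, map_apply, ← this, transpose_apply]
  have h1 : Vfun (Nᴴ * N) Φ z =
      (P * (Nᴴ * N)⁻¹ᵀ * P.map star * (Nᴴ * N)⁻¹).trace.re := by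
    simp only [Vfun, ← hP, upper]
    congr 1
    simp only [trace, diag_apply, mul_apply, Finset.sum_mul, map_apply, transpose_apply]
    refine Finset.sum_congr rfl fun i _ => ?_
    symm
    rw [Finset.sum_comm]
    refine (Finset.sum_congr rfl fun k _ => Finset.sum_comm).trans ?_
    rw [Finset.sum_comm]
  have h2 : (N * Tᴴ)⁻¹ᴴ * holHess (frameOf T) Φ z * (N * Tᴴ)⁻¹.map star =
      N⁻¹ᴴ * P * N⁻¹.map star := by
    have hu : IsUnit T.det := isUnit_iff_ne_zero.2 E.det_frame
    have e1 : (T⁻¹ᴴ * N⁻¹).map star = T⁻¹ᵀ * N⁻¹.map star := by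
      rw [show (T⁻¹ᴴ * N⁻¹).map star = T⁻¹ᴴ.map star * N⁻¹.map star from
        Matrix.map_mul (f := starRingEnd ℂ)]
      congr 1
      ext i j; simp
    have e2 : Tᵀ * (T⁻¹ᵀ * N⁻¹.map star) = N⁻¹.map star := by
      rw [← Matrix.mul_assoc, ← transpose_mul, nonsing_inv_mul _ hu, transpose_one, Matrix.one_mul]
    rw [metric_inv, e1, conjTranspose_mul, conjTranspose_conjTranspose,
      holHess_frameOf E.isOpen E.smooth hz, ← hP]
    simp only [Matrix.mul_assoc, e2]
    rw [nonsing_inv_mul_cancel_left _ _ hu]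
  rw [h1, h2]
  congr 1
  have e3 : (N⁻¹.map star)ᴴ = N⁻¹ᵀ := by ext i j; simp
  have e4 : N⁻¹ᴴᵀ = N⁻¹.map star := by ext i j; simp
  rw [Matrix.mul_inv_rev, ← conjTranspose_nonsing_inv, transpose_mul, e4, conjTranspose_mul,
    conjTranspose_mul, e3, hPs, conjTranspose_conjTranspose, ← Matrix.mul_assoc, trace_mul_comm]
  simp only [Matrix.mul_assoc]

/-- The frame is constant, so differentiation passes through φ, and the mixed derivative of
φ(P)φ(P)* has four terms, two of which are squares. -/
lemma exists_hasJet_Vfun (E : EquationAt N ε Ω Φ p T) (k : Fin (m + 1))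
    {φ : Matrix (Fin (m + 1)) (Fin (m + 1)) ℂ → Matrix (Fin (m + 1)) (Fin (m + 1)) ℂ}
    (hφ : φ = fun K => (N * Tᴴ)⁻¹ᴴ * K * (N * Tᴴ)⁻¹.map star)
    {γ : Matrix (Fin (m + 1)) (Fin (m + 1)) ℂ}
    (hγ : γ = of fun a b => dHol (dir N T ε k) (fun z => holHess (frameOf T) Φ z a b) p) :
    ∃ f0 f1 f2, HasJet p (holVec (dir N T ε k)) (conjVec (holVec (dir N T ε k)))
      (toC (Vfun (Nᴴ * N) Φ)) f0 f1 f2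
      (((φ (lineLaplacian (dir N T ε k) (holHess (frameOf T) Φ) p) *
          (φ (holHess (frameOf T) Φ p))ᴴ +
        φ (holDeriv (dirMatrix ε (N * Tᴴ) k) (third (frameOf T) Φ p)) *
          (φ (holDeriv (dirMatrix ε (N * Tᴴ) k) (third (frameOf T) Φ p)))ᴴ + φ γ * (φ γ)ᴴ +
        φ (holHess (frameOf T) Φ p) *
          (φ (lineLaplacian (dir N T ε k) (holHess (frameOf T) Φ) p))ᴴ).trace.re : ℝ) : ℂ) := by
  have h1 := ((HasMJet.const ((N * Tᴴ)⁻¹ᴴ)).mul (hasMJet_holHess E.isOpen E.smooth E.mem (frameOf T)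
    (dirMatrix ε (N * Tᴴ) k))).mul (HasMJet.const ((N * Tᴴ)⁻¹.map star))
  simp only [Matrix.mul_zero, Matrix.zero_mul, add_zero, zero_add] at h1
  have h2 := ((h1.mul h1.conjTranspose).trace).re
  have h3 := h2.congr (g := toC (Vfun (Nᴴ * N) Φ)) (by
    filter_upwards [E.isOpen.mem_nhds E.mem] with z hz
    rw [toC, toC, E.Vfun_eq hz])
  rw [hφ, hγ]
  exact ⟨_, _, _, h3⟩

end EquationAt
end

noncomputable section
open scoped ContDiff
open Matrix

/-! ## The function `S` -/

section
variable {n : ℕ} {p : Cn n} {X Y : Cn n × Cn n} {f : Cn n → ℝ} {f0 f1 f2 f3 : ℂ}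

lemma cderiv_toC_log (hf : DifferentiableAt ℝ f p) (h0 : f p ≠ 0) (X : Cn n × Cn n) :
    cderiv X (toC fun z => Real.log (f z)) p = cderiv X (toC f) p / toC f p := by
  rw [cderiv_toC_eq hf, cderiv_toC_eq (hf.log h0), fderiv.log hf h0]
  simp [toC]
  ring

lemma HasJet.log (hf : ContDiffAt ℝ 2 f p) (h : HasJet p X Y (toC f) f0 f1 f2 f3) (h0 : f p ≠ 0) :
    HasJet p X Y (toC fun z => Real.log (f z)) (toC (fun z => Real.log (f z)) p) (f1 / f0)
      (f2 / f0) (f3 / f0 - f1 * f2 / f0 ^ 2) := by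
  have hf0 : f0 = toC f p := h.val.symm
  have h0' : f0 ≠ 0 := by rw [hf0]; simpa [toC] using h0
  have hd := hf.differentiableAt (by simp)
  refine ⟨toC_contDiffAt (hf.log h0), rfl, ?_, ?_, ?_⟩
  · rw [cderiv_toC_log hd h0, h.fst, hf0]
  · rw [cderiv_toC_log hd h0, h.snd, hf0]
  · have hev : cderiv Y (toC fun z => Real.log (f z)) =ᶠ[nhds p]
        fun z => cderiv Y (toC f) z * (toC f z)⁻¹ := by
      filter_upwards [hf.eventually (by simp), hf.continuousAt.eventually_ne h0] with z hz hz0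
      rw [cderiv_toC_log (hz.differentiableAt (by simp)) hz0, div_eq_mul_inv]
    have hi := h.inv h0'
    rw [cderiv_congr hev, cderiv_mul ((h.smooth.cderiv (l := 1) (by norm_num)).differentiableAt
      (by simp)) (hi.smooth.differentiableAt (by simp)), h.mix, hi.fst, hi.val, h.snd]
    field_simp
    ring

end

section
variable {m : ℕ} {ε Λ : ℝ}

lemma hInv_mul_apply {ι : Type*} (F : Matrix (Fin (m + 1)) ι ℂ) (a : Fin (m + 1)) (i : ι) :
    (hInv m ε * F) a i = (lastWeight m ε a : ℂ)⁻¹ * F a i := by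
  rw [hInv, diagonal_mul]

/-- If v ≤ u the triangle inequality gives ρ(u - v) ≤ ‖b + a‖; otherwise the left side is not
positive. -/
lemma sq_sub_le_of_norm_add {a b : ℂ} {ρ u v : ℝ} (hρ : 0 ≤ ρ) (hu : 0 ≤ u) (hv : 0 ≤ v)
    (ha : ‖a‖ = ρ * u) (hb : ‖b‖ = ρ * v) : ρ ^ 2 * (u ^ 2 - 2 * u * v) ≤ ‖b + a‖ ^ 2 := by
  have h1 : ‖a‖ ≤ ‖b + a‖ + ‖b‖ := by
    calc ‖a‖ = ‖(b + a) - b‖ := by ring_nf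
      _ ≤ _ := norm_sub_le _ _
  rw [ha, hb] at h1
  rcases le_total v u with h | h
  · have h2 : (ρ * (u - v)) ^ 2 ≤ ‖b + a‖ ^ 2 :=
      pow_le_pow_left₀ (mul_nonneg hρ (by linarith)) (by linarith) 2
    nlinarith [mul_nonneg (sq_nonneg ρ) (sq_nonneg v)]
  · have h2 : u ^ 2 - 2 * u * v ≤ 0 := by nlinarith
    exact (mul_nonpos_of_nonneg_of_nonpos (sq_nonneg ρ) h2).trans (sq_nonneg _)

/-- Lower bound for `-log S` under the linearized operator, at the level of jets. -/
lemma neg_log_jet_bound (hε : 0 < ε) (hε1 : ε ≤ 1) (hΛ : 1 ≤ Λ)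
    {d0 : Matrix (Fin (m + 1)) Unit ℂ} {d1 d2 d3 : Fin (m + 1) → Matrix (Fin (m + 1)) Unit ℂ}
    {α β η : Fin (m + 1) → Matrix (Fin (m + 1)) (Fin (m + 1)) ℂ} {y : ℝ} (hy : 0 ≤ y)
    (hd0 : ∀ a : Fin m, d0 a.castSucc () = 0) (hr : ‖d0 (Fin.last m) ()‖ ≤ Λ)
    (hr' : 1 ≤ Λ * ‖d0 (Fin.last m) ()‖)
    (hd1 : ∀ k a, ‖d1 k a ()‖ ≤ ((m + 1) * Λ) ^ 2) (hd2 : ∀ k a, ‖d2 k a ()‖ ≤ ε * Λ)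
    (hd3 : ∑ k, d3 k = 0) (hα : ∀ k a c, ‖α k a c‖ ≤ y)
    (hατ : ∀ k a, ‖α k a (Fin.last m)‖ ≤ ((m + 1) * Λ) ^ 6 * ε * y)
    (hη : ∑ k, η k = ∑ k, (α k * hInv m ε * (α k)ᴴ + β k * hInv m ε * (β k)ᴴ))
    {F1 F3 : Fin (m + 1) → ℂ}
    (hF1 : ∀ k, F1 k = ε * (((d2 k)ᴴ * hInv m ε + d0ᴴ * -(hInv m ε * α k * hInv m ε)) * d0 +
      d0ᴴ * hInv m ε * d1 k).trace)
    (hF3 : ∀ k, F3 k = ε * (((d3 k)ᴴ * hInv m ε + (d1 k)ᴴ * -(hInv m ε * α k * hInv m ε) +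
        (d2 k)ᴴ * -(hInv m ε * (α k)ᴴ * hInv m ε) +
        d0ᴴ * (hInv m ε * α k * hInv m ε * (α k)ᴴ * hInv m ε +
          hInv m ε * (α k)ᴴ * hInv m ε * α k * hInv m ε - hInv m ε * η k * hInv m ε)) * d0 +
      ((d1 k)ᴴ * hInv m ε + d0ᴴ * -(hInv m ε * (α k)ᴴ * hInv m ε)) * d1 k +
      ((d2 k)ᴴ * hInv m ε + d0ᴴ * -(hInv m ε * α k * hInv m ε)) * d2 k +
      d0ᴴ * hInv m ε * d3 k).trace) :
    ∑ k, ((F3 k).re - ‖F1 k‖ ^ 2 / ‖d0 (Fin.last m) ()‖ ^ 2) ≤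
      16 * ((m + 1) * Λ) ^ 16 * ε * (1 + y ^ 2) := by
  obtain ⟨h, hh⟩ : ∃ h, h = hInv m ε := ⟨_, rfl⟩
  obtain ⟨s, hs⟩ : ∃ s : ℝ, s = m + 1 := ⟨_, rfl⟩
  have hs1 : 1 ≤ s := by rw [hs]; linarith [(Nat.cast_nonneg m : (0 : ℝ) ≤ m)]
  obtain ⟨Γ, hΓ⟩ : ∃ Γ : ℝ, Γ = s * Λ := ⟨_, rfl⟩
  have hΓ1 : 1 ≤ Γ := hΓ ▸ one_le_mul_of_one_le_of_one_le hs1 hΛ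
  have hΛΓ : Λ ≤ Γ := by rw [hΓ]; exact le_mul_of_one_le_left (by linarith) hs1
  have hsΓ : s ≤ Γ := by rw [hΓ]; exact le_mul_of_one_le_right (by linarith) hΛ
  have hc : ((Fintype.card (Fin (m + 1)) : ℕ) : ℝ) = s := by simp [hs]
  have hht : hᴴ = h := by rw [hh, hInv_conjTranspose]
  have hh2 (F : Matrix (Fin (m + 1)) Unit ℂ) (a) : (h * F) a () = (lastWeight m ε a : ℂ)⁻¹ * F a () := by
    rw [hh, hInv_mul_apply]
  rw [← hs, ← hΓ] at hd1 hατ ⊢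
  rw [← hh] at hη
  simp only [← hh] at hF1 hF3
  obtain ⟨r, hrr⟩ : ∃ r, r = d0 (Fin.last m) () := ⟨_, rfl⟩
  rw [← hrr] at hr hr' ⊢
  have hr0 : 0 < ‖r‖ := by
    by_contra hcon
    have : ‖r‖ = 0 := le_antisymm (not_lt.1 hcon) (norm_nonneg _)
    rw [this] at hr'; linarith
  -- The covariant derivative of the gradient with respect to H: it collects the derivative of ∇Φ
  -- and the derivative of H⁻¹.
  obtain ⟨w, hw⟩ : ∃ w : Fin (m + 1) → Matrix (Fin (m + 1)) Unit ℂ,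
    w = fun k => d1 k - α k * (h * d0) := ⟨_, rfl⟩
  have hd0h (a : Fin m) : (h * d0) a.castSucc () = 0 := by rw [hh2, hd0, mul_zero]
  have hd0l : (h * d0) (Fin.last m) () = (ε : ℂ)⁻¹ * r := by rw [hh2, hrr]; simp
  -- the weighted square completed in the third order terms
  have e1 (k) : F3 k = ε * (((w k)ᴴ * h * w k).trace + ((d2 k)ᴴ * h * d2 k).trace -
      (d0ᴴ * (h * α k * h) * d2 k + (d2 k)ᴴ * (h * (α k)ᴴ * h) * d0).trace +
      ((d3 k)ᴴ * h * d0 + d0ᴴ * h * d3 k).trace +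
      (d0ᴴ * h * (α k * h * (α k)ᴴ - η k) * h * d0).trace) := by
    rw [hF3, hw]
    simp only [← trace_add, ← trace_sub]
    congr 2
    simp only [conjTranspose_sub, conjTranspose_mul, hht, Matrix.add_mul, Matrix.mul_add,
      Matrix.sub_mul, Matrix.mul_sub, Matrix.neg_mul, Matrix.mul_neg, Matrix.mul_assoc]
    abel
  -- The terms with third derivatives of the form Φ_{a ξ ξ̄} disappear by the first order equation.
  have e2 : ∑ k, ((d3 k)ᴴ * h * d0 + d0ᴴ * h * d3 k).trace = 0 := by
    rw [← trace_sum, Finset.sum_add_distrib, ← Matrix.sum_mul, ← Matrix.sum_mul, ← Matrix.mul_sum,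
      ← conjTranspose_sum, hd3]
    simp
  -- By the second order equation, ∑(αhα* - η) = -∑ βhβ*, so this contribution has the favourable
  -- sign.
  have e3 : (∑ k, (d0ᴴ * h * (α k * h * (α k)ᴴ - η k) * h * d0).trace).re ≤ 0 := by
    have : ∑ k, (d0ᴴ * h * (α k * h * (α k)ᴴ - η k) * h * d0).trace =
        -∑ k, ((d0ᴴ * h * β k) * hInv m ε * (d0ᴴ * h * β k)ᴴ).trace := by
      rw [← trace_sum, ← trace_sum, ← Matrix.sum_mul, ← Matrix.sum_mul, ← Matrix.mul_sum,
        Finset.sum_sub_distrib, hη, Finset.sum_add_distrib, sub_add_cancel_left, ← trace_neg,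
        Matrix.mul_neg, Matrix.neg_mul, Matrix.neg_mul, Matrix.mul_sum, Matrix.sum_mul,
        Matrix.sum_mul]
      simp only [conjTranspose_mul, conjTranspose_conjTranspose, Matrix.mul_assoc, hh, hInv_conjTranspose]
    rw [this, Complex.neg_re, neg_nonpos, Complex.re_sum]
    refine Finset.sum_nonneg fun k _ => ?_
    rw [trace_mul_hInv_mul_conjTranspose, Complex.ofReal_re]
    exact Finset.sum_nonneg fun i _ => Finset.sum_nonneg fun c _ =>
      mul_nonneg (inv_nonneg.2 (lastWeight_pos hε c).le) (by positivity)
  have hquad (u : Matrix (Fin (m + 1)) Unit ℂ) : (uᴴ * h * u).trace =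
      ((∑ c, (lastWeight m ε c)⁻¹ * ‖u c ()‖ ^ 2 : ℝ) : ℂ) := by
    have := trace_mul_hInv_mul_conjTranspose (ε := ε) uᴴ
    rw [conjTranspose_conjTranspose, ← hh] at this
    rw [this]
    simp
  -- Since ε h d₀ is the vector r along τ, only the τ-components of d₂ and w enter the first
  -- derivative of S.
  have hF1' (k) : F1 k = star (d2 k (Fin.last m) ()) * r + star r * w k (Fin.last m) () := by
    have h1 : F1 k = ε * (((d2 k)ᴴ * (h * d0)).trace + ((h * d0)ᴴ * w k).trace) := by
      rw [hF1, hw, ← trace_add]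
      congr 2
      simp only [conjTranspose_mul, hht, Matrix.add_mul, Matrix.mul_sub, Matrix.neg_mul, Matrix.mul_neg, Matrix.mul_assoc]
      abel
    have h2 (u v : Matrix (Fin (m + 1)) Unit ℂ) : (uᴴ * v).trace = ∑ a, star (u a ()) * v a () := by
      simp [trace, mul_apply]
    rw [h1, h2, h2, Fin.sum_univ_castSucc, Fin.sum_univ_castSucc]
    simp only [hd0h, hd0l, mul_zero, star_zero, zero_mul, Finset.sum_const_zero, zero_add]
    have : (ε : ℂ) ≠ 0 := by exact_mod_cast hε.ne'
    simp only [star_mul', Complex.star_def, map_inv₀, Complex.conj_ofReal]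
    field_simp
  -- So |F₁|²/|r|² recovers |w_τ|², up to a product with d₂, which is O(ε).
  have hF1'' (k) : ‖w k (Fin.last m) ()‖ ^ 2 - 2 * ‖w k (Fin.last m) ()‖ * ‖d2 k (Fin.last m) ()‖ ≤
      ‖F1 k‖ ^ 2 / ‖r‖ ^ 2 := by
    rw [le_div_iff₀ (by positivity), mul_comm, hF1']
    refine sq_sub_le_of_norm_add hr0.le (norm_nonneg _) (norm_nonneg _) ?_ ?_
    · rw [norm_mul, norm_star]
    · rw [norm_mul, norm_star, mul_comm]
  -- sizes
  have hwle (k a) : ‖w k a ()‖ ≤ 2 * Γ ^ 7 * (1 + y) := by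
    have h1 : (α k * (h * d0)) a () = α k a (Fin.last m) * ((ε : ℂ)⁻¹ * r) := by
      rw [mul_apply, Fin.sum_univ_castSucc]
      simp [hd0h, hd0l]
    have h2 : ‖(α k * (h * d0)) a ()‖ ≤ Γ ^ 7 * y := by
      rw [h1, norm_mul, norm_mul, norm_inv, Complex.norm_of_nonneg hε.le]
      calc ‖α k a (Fin.last m)‖ * (ε⁻¹ * ‖r‖) ≤ (Γ ^ 6 * ε * y) * (ε⁻¹ * Γ) := by
            gcongr
            · exact hατ k a
            · linarith
        _ = Γ ^ 7 * y := by field_simp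
    have h3 : Γ ^ 2 ≤ Γ ^ 7 := pow_le_pow_right₀ hΓ1 (by norm_num)
    have h4 : w k a () = d1 k a () - (α k * (h * d0)) a () := by rw [hw]; rfl
    rw [h4]
    have h5 : 0 ≤ Γ ^ 7 * y := by positivity
    have h6 : 0 ≤ Γ ^ 7 := by positivity
    linarith [norm_sub_le (d1 k a ()) ((α k * (h * d0)) a ()), hd1 k a]
  have hd2q (k) : (∑ c, (lastWeight m ε c)⁻¹ * ‖d2 k c ()‖ ^ 2) ≤ Γ ^ 3 := by
    have h1 (c) : (lastWeight m ε c)⁻¹ * ‖d2 k c ()‖ ^ 2 ≤ Λ ^ 2 := by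
      have h2 : (lastWeight m ε c)⁻¹ ≤ ε⁻¹ := by
        refine inv_anti₀ hε ?_
        cases c using Fin.lastCases <;> simp [hε1]
      calc (lastWeight m ε c)⁻¹ * ‖d2 k c ()‖ ^ 2 ≤ ε⁻¹ * (ε * Λ) ^ 2 := by
            gcongr; exact hd2 k c
        _ = ε * Λ ^ 2 := by field_simp
        _ ≤ 1 * Λ ^ 2 := by gcongr
        _ = Λ ^ 2 := one_mul _
    refine (Finset.sum_le_card_nsmul _ _ _ fun c _ => h1 c).trans ?_
    rw [nsmul_eq_mul, Finset.card_univ, hc]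
    calc s * Λ ^ 2 ≤ Γ * Γ ^ 2 := by gcongr
      _ = Γ ^ 3 := by ring
  -- The factor ε⁻¹ of h d₀ is offset by d₂ = O(ε). The second factor ε⁻¹ occurs only at the last
  -- index, where `hατ` supplies a factor ε.
  have hcross (k) : ‖(d0ᴴ * (h * α k * h) * d2 k).trace‖ ≤ Γ ^ 9 * y := by
    have h1 : (d0ᴴ * (h * α k * h) * d2 k).trace =
        ∑ c, (star ((ε : ℂ)⁻¹ * r) * α k (Fin.last m) c) * (h * d2 k) c () := by
      have : d0ᴴ * (h * α k * h) * d2 k = ((h * d0)ᴴ * α k) * (h * d2 k) := by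
        simp only [conjTranspose_mul, hht, Matrix.mul_assoc]
      rw [this]
      simp only [trace, diag_apply, mul_apply (M := (h * d0)ᴴ * α k)]
      rw [Fintype.sum_unique]
      refine Finset.sum_congr rfl fun c _ => ?_
      congr 1
      rw [mul_apply, Fin.sum_univ_castSucc]
      simp only [conjTranspose_apply]
      rw [show (default : Unit) = () from rfl]
      simp [hd0h, hd0l]
    rw [h1]
    have h2 (c) : ‖(star ((ε : ℂ)⁻¹ * r) * α k (Fin.last m) c) * (h * d2 k) c ()‖ ≤ Γ ^ 8 * y := by
      rw [hh2, norm_mul, norm_mul, norm_star, norm_mul, norm_mul, norm_inv, norm_inv,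
        Complex.norm_of_nonneg hε.le, Complex.norm_of_nonneg (lastWeight_pos hε c).le]
      have h3 : ‖α k (Fin.last m) c‖ * (lastWeight m ε c)⁻¹ ≤ Γ ^ 6 * y := by
        cases c using Fin.lastCases with
        | last =>
          rw [lastWeight_last, ← div_eq_mul_inv, div_le_iff₀ hε]
          linarith [hατ k (Fin.last m)]
        | cast c =>
          rw [lastWeight_castSucc, inv_one, mul_one]
          exact (hα k _ _).trans (le_mul_of_one_le_left hy (one_le_pow₀ hΓ1))
      calc ε⁻¹ * ‖r‖ * ‖α k (Fin.last m) c‖ * ((lastWeight m ε c)⁻¹ * ‖d2 k c ()‖)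
          = ε⁻¹ * ‖r‖ * (‖α k (Fin.last m) c‖ * (lastWeight m ε c)⁻¹) * ‖d2 k c ()‖ := by ring
        _ ≤ ε⁻¹ * Γ * (Γ ^ 6 * y) * (ε * Γ) := by
            have a1 : ‖r‖ ≤ Γ := by linarith
            have a2 : 0 ≤ ‖α k (Fin.last m) c‖ * (lastWeight m ε c)⁻¹ :=
              mul_nonneg (norm_nonneg _) (inv_nonneg.2 (lastWeight_pos hε c).le)
            have a3 : ‖d2 k c ()‖ ≤ ε * Γ := (hd2 k c).trans (by gcongr)
            gcongr
        _ = Γ ^ 8 * y := by field_simp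
    refine (norm_sum_le _ _).trans ((Finset.sum_le_card_nsmul _ _ _ fun c _ => h2 c).trans ?_)
    rw [nsmul_eq_mul, Finset.card_univ, hc]
    calc s * (Γ ^ 8 * y) ≤ Γ * (Γ ^ 8 * y) := by gcongr
      _ = Γ ^ 9 * y := by ring
  have hcross' (k) : (d0ᴴ * (h * α k * h) * d2 k + (d2 k)ᴴ * (h * (α k)ᴴ * h) * d0).trace.re =
      2 * (d0ᴴ * (h * α k * h) * d2 k).trace.re := by
    have : (d2 k)ᴴ * (h * (α k)ᴴ * h) * d0 = (d0ᴴ * (h * α k * h) * d2 k)ᴴ := by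
      simp only [conjTranspose_mul, conjTranspose_conjTranspose, hht, Matrix.mul_assoc]
    rw [this, trace_add, trace_conjTranspose, Complex.add_re, Complex.star_def, Complex.conj_re]
    ring
  -- The τ-part of ε w*hw has weight ε·ε⁻¹ = 1 and is the only term not of order ε. It is cancelled
  -- by |F₁|²/|r|².
  have hterm (k) : ε * ((∑ c, (lastWeight m ε c)⁻¹ * ‖w k c ()‖ ^ 2) +
      (∑ c, (lastWeight m ε c)⁻¹ * ‖d2 k c ()‖ ^ 2) -
      2 * (d0ᴴ * (h * α k * h) * d2 k).trace.re) - ‖F1 k‖ ^ 2 / ‖r‖ ^ 2 ≤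
      16 * Γ ^ 15 * ε * (1 + y ^ 2) := by
    have h1 : ε * (∑ c, (lastWeight m ε c)⁻¹ * ‖w k c ()‖ ^ 2) =
        ε * (∑ a : Fin m, ‖w k a.castSucc ()‖ ^ 2) + ‖w k (Fin.last m) ()‖ ^ 2 := by
      rw [Fin.sum_univ_castSucc, mul_add]
      congr 1
      · simp
      · rw [lastWeight_last, mul_inv_cancel_left₀ hε.ne']
    have h2 : ∑ a : Fin m, ‖w k a.castSucc ()‖ ^ 2 ≤ Γ * (2 * Γ ^ 7 * (1 + y)) ^ 2 := by
      refine (Finset.sum_le_card_nsmul _ _ _ fun c _ =>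
        pow_le_pow_left₀ (norm_nonneg _) (hwle k c.castSucc) 2).trans ?_
      rw [nsmul_eq_mul, Finset.card_univ, Fintype.card_fin]
      gcongr
      linarith
    have h3 : ‖w k (Fin.last m) ()‖ * ‖d2 k (Fin.last m) ()‖ ≤ (2 * Γ ^ 7 * (1 + y)) * (ε * Γ) :=
      mul_le_mul (hwle k _) ((hd2 k _).trans (by gcongr)) (norm_nonneg _) (by positivity)
    have h4 := abs_le.1 ((Complex.abs_re_le_norm _).trans (hcross k))
    have h5 := mul_le_mul_of_nonneg_left h2 hε.le
    have h6 := mul_le_mul_of_nonneg_left (hd2q k) hε.le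
    have h7 := mul_le_mul_of_nonneg_left h4.1 hε.le
    have p3 : Γ ^ 3 ≤ Γ ^ 15 := pow_le_pow_right₀ hΓ1 (by norm_num)
    have p8 : Γ ^ 8 ≤ Γ ^ 15 := pow_le_pow_right₀ hΓ1 (by norm_num)
    have p9 : Γ ^ 9 ≤ Γ ^ 15 := pow_le_pow_right₀ hΓ1 (by norm_num)
    have q3 := mul_le_mul_of_nonneg_left p3 hε.le
    have q8 := mul_le_mul_of_nonneg_left p8 (by positivity : 0 ≤ 4 * ε * (1 + y))
    have q9 := mul_le_mul_of_nonneg_left p9 (by positivity : 0 ≤ 2 * ε * y)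
    have h8 : ε * Γ ^ 15 * (4 * (1 + y) ^ 2 + 4 * (1 + y) + 1 + 2 * y) ≤
        16 * Γ ^ 15 * ε * (1 + y ^ 2) := by
      have : 4 * (1 + y) ^ 2 + 4 * (1 + y) + 1 + 2 * y ≤ 16 * (1 + y ^ 2) := by
        linarith [sq_nonneg (y - 1), sq_nonneg (12 * y - 7)]
      have := mul_le_mul_of_nonneg_left this (by positivity : 0 ≤ ε * Γ ^ 15)
      linarith
    have e5 : Γ * (2 * Γ ^ 7 * (1 + y)) ^ 2 = Γ ^ 15 * (4 * (1 + y) ^ 2) := by ring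
    have e6 : 2 * Γ ^ 7 * (1 + y) * (ε * Γ) = Γ ^ 8 * (2 * ε * (1 + y)) := by ring
    rw [e5] at h5
    rw [e6] at h3
    linarith [hF1'' k]
  have htot : ∑ k, ((F3 k).re - ‖F1 k‖ ^ 2 / ‖r‖ ^ 2) ≤
      ∑ k, (ε * ((∑ c, (lastWeight m ε c)⁻¹ * ‖w k c ()‖ ^ 2) +
        (∑ c, (lastWeight m ε c)⁻¹ * ‖d2 k c ()‖ ^ 2) -
        2 * (d0ᴴ * (h * α k * h) * d2 k).trace.re) - ‖F1 k‖ ^ 2 / ‖r‖ ^ 2) := by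
    have h1 (k) : (F3 k).re = ε * ((∑ c, (lastWeight m ε c)⁻¹ * ‖w k c ()‖ ^ 2) +
        (∑ c, (lastWeight m ε c)⁻¹ * ‖d2 k c ()‖ ^ 2) -
        2 * (d0ᴴ * (h * α k * h) * d2 k).trace.re) +
        ε * (((d3 k)ᴴ * h * d0 + d0ᴴ * h * d3 k).trace.re +
        (d0ᴴ * h * (α k * h * (α k)ᴴ - η k) * h * d0).trace.re) := by
      rw [e1, Complex.re_ofReal_mul, hquad, hquad]
      simp only [Complex.add_re, Complex.sub_re, Complex.ofReal_re, hcross']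
      ring
    have h2 : ∑ k, (ε * (((d3 k)ᴴ * h * d0 + d0ᴴ * h * d3 k).trace.re +
        (d0ᴴ * h * (α k * h * (α k)ᴴ - η k) * h * d0).trace.re)) ≤ 0 := by
      rw [← Finset.mul_sum, Finset.sum_add_distrib, ← Complex.re_sum, ← Complex.re_sum, e2,
        Complex.zero_re, zero_add]
      exact mul_nonpos_of_nonneg_of_nonpos hε.le e3
    rw [← sub_nonpos, ← Finset.sum_sub_distrib]
    refine le_trans (le_of_eq (Finset.sum_congr rfl fun k _ => ?_)) h2
    rw [h1]; ring
  refine htot.trans ((Finset.sum_le_card_nsmul _ _ _ fun k _ => hterm k).trans ?_)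
  rw [nsmul_eq_mul, Finset.card_univ, hc]
  calc s * (16 * Γ ^ 15 * ε * (1 + y ^ 2)) ≤ Γ * (16 * Γ ^ 15 * ε * (1 + y ^ 2)) := by gcongr
    _ = 16 * Γ ^ 16 * ε * (1 + y ^ 2) := by ring

end
end

/-! ### The linearized operator on -log S -/

noncomputable section
open scoped ContDiff
open Matrix

namespace EquationAt
variable {m : ℕ} {N T : Matrix (Fin (m + 1)) (Fin (m + 1)) ℂ} {ε Λ κ : ℝ} {Ω : Set (Cn (m + 1))}
  {Φ : Cn (m + 1) → ℝ} {p : Cn (m + 1)}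

/-- The gradient in the frame `t`, as a column. -/
def gradCol (t : Fin (m + 1) → Cn (m + 1)) (Φ : Cn (m + 1) → ℝ) (z : Cn (m + 1)) :
    Matrix (Fin (m + 1)) Unit ℂ := of fun a _ => grad t Φ z a

lemma det_mixedHess_ne (E : EquationAt N ε Ω Φ p T) {z : Cn (m + 1)} (hz : z ∈ Ω) :
    (mixedHess (frameOf T) Φ z).det ≠ 0 := by
  rw [mixedHess_frameOf (E.contDiffAt_toC hz), det_mul, det_mul, det_conjTranspose]
  exact mul_ne_zero (mul_ne_zero E.det_frame (E.det_hess z hz)) (star_ne_zero.2 E.det_frame)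

lemma toC_Sfun (E : EquationAt N ε Ω Φ p T) {z : Cn (m + 1)} (hz : z ∈ Ω) :
    toC (Sfun ε Φ) z = ε * ((gradCol (frameOf T) Φ z)ᴴ * (mixedHess (frameOf T) Φ z)⁻¹ *
      gradCol (frameOf T) Φ z).trace := by
  have hu : IsUnit T.det := isUnit_iff_ne_zero.2 E.det_frame
  have hu' : IsUnit Tᴴ.det := by rw [det_conjTranspose]; exact hu.star
  obtain ⟨H, hH⟩ : ∃ H, H = mixedHess (stdFrame (m + 1)) Φ z := ⟨_, rfl⟩
  obtain ⟨g, hg⟩ : ∃ g, g = gradCol (stdFrame (m + 1)) Φ z := ⟨_, rfl⟩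
  have h1 : gradCol (frameOf T) Φ z = T * g := by
    ext a i
    rw [hg, gradCol, of_apply, grad_frameOf, mul_apply]; rfl
  have h2 : (gradCol (frameOf T) Φ z)ᴴ * (mixedHess (frameOf T) Φ z)⁻¹ *
      gradCol (frameOf T) Φ z = gᴴ * H⁻¹ * g := by
    rw [h1, mixedHess_frameOf (E.contDiffAt_toC hz), ← hH, Matrix.mul_inv_rev, Matrix.mul_inv_rev,
      conjTranspose_mul]
    rw [Matrix.mul_assoc gᴴ, mul_nonsing_inv_cancel_left _ _ hu', ← Matrix.mul_assoc gᴴ,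
      Matrix.mul_assoc, nonsing_inv_mul_cancel_left _ _ hu]
  have h3 : (gᴴ * H⁻¹ * g).trace = ∑ i, ∑ j, grad (stdFrame (m + 1)) Φ z i *
      star (grad (stdFrame (m + 1)) Φ z j) * upper H i j := by
    simp only [trace, diag_apply, mul_apply, Finset.sum_mul, Fintype.sum_unique,
      conjTranspose_apply, hg, gradCol, of_apply, upper]
    exact Finset.sum_congr rfl fun i _ => Finset.sum_congr rfl fun j _ => by ring
  have h4 : star ((gᴴ * H⁻¹ * g).trace) = (gᴴ * H⁻¹ * g).trace := by
    rw [← trace_conjTranspose, conjTranspose_mul, conjTranspose_mul, conjTranspose_conjTranspose,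
      conjTranspose_nonsing_inv, hH, (mixedHess_isHermitian E.isOpen E.smooth hz _).eq,
      Matrix.mul_assoc]
  rw [h2, toC, Sfun, ← hH, ← h3]
  refine Complex.conj_eq_iff_re.1 ?_
  rw [map_mul, Complex.conj_ofReal]
  congr 1

lemma exists_hasJet_Sfun (E : EquationAt N ε Ω Φ p T) (k : Fin (m + 1))
    {d0 d1 d2 d3 : Matrix (Fin (m + 1)) Unit ℂ} {α η h : Matrix (Fin (m + 1)) (Fin (m + 1)) ℂ}
    (hd0 : d0 = gradCol (frameOf T) Φ p)
    (hd1 : d1 = of fun a _ => ∑ b, dirMatrix ε (N * Tᴴ) k b * holHess (frameOf T) Φ p b a)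
    (hd2 : d2 = of fun a _ => ∑ b, star (dirMatrix ε (N * Tᴴ) k b) * mixedHess (frameOf T) Φ p a b)
    (hd3 : d3 = of fun a _ => ∑ b, ∑ c, dirMatrix ε (N * Tᴴ) k b * third (frameOf T) Φ p a b c *
      star (dirMatrix ε (N * Tᴴ) k c))
    (hα : α = mixedDeriv (dirMatrix ε (N * Tᴴ) k) (third (frameOf T) Φ p))
    (hη : η = lineLaplacian (dir N T ε k) (mixedHess (frameOf T) Φ) p) (hh : h = hInv m ε) :
    ∃ F0 F1 F2 F3, HasJet p (holVec (dir N T ε k)) (conjVec (holVec (dir N T ε k)))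
      (toC (Sfun ε Φ)) F0 F1 F2 F3 ∧ F0 = ε * (d0ᴴ * h * d0).trace ∧
      F1 = ε * ((d2ᴴ * h + d0ᴴ * -(h * α * h)) * d0 + d0ᴴ * h * d1).trace ∧
      F3 = ε * ((d3ᴴ * h + d1ᴴ * -(h * α * h) + d2ᴴ * -(h * αᴴ * h) +
        d0ᴴ * (h * α * h * αᴴ * h + h * αᴴ * h * α * h - h * η * h)) * d0 +
      (d1ᴴ * h + d0ᴴ * -(h * αᴴ * h)) * d1 +
      (d2ᴴ * h + d0ᴴ * -(h * α * h)) * d2 + d0ᴴ * h * d3).trace := by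
  have hK := (hasMJet_mixedHess E.isOpen E.smooth E.mem (frameOf T)
    (dirMatrix ε (N * Tᴴ) k)).inv (E.det_mixedHess_ne E.mem)
  rw [E.mixedHess_eq, inv_diagonal_lastWeight E.eps_ne, ← hh, ← hα] at hK
  have hd : HasMJet p (holVec (dir N T ε k)) (conjVec (holVec (dir N T ε k)))
      (gradCol (frameOf T) Φ) d0 d1 d2 d3 := by
    intro a i
    rw [hd0, hd1, hd2, hd3]
    exact hasJet_grad E.isOpen E.smooth E.mem (frameOf T) (dirMatrix ε (N * Tᴴ) k) a
  have h1 := (((hd.conjTranspose.mul hK).mul hd).trace).const_mul (ε : ℂ)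
  have h2 := h1.congr (g := toC (Sfun ε Φ)) (by
    filter_upwards [E.isOpen.mem_nhds E.mem] with z hz
    rw [E.toC_Sfun hz])
  rw [hη]
  exact ⟨_, _, _, _, h2, rfl, rfl, rfl⟩

lemma contDiffAt_of_toC {n : ℕ} {f : Cn n → ℝ} {p : Cn n} (h : ContDiffAt ℝ 2 (toC f) p) :
    ContDiffAt ℝ 2 f p :=
  Complex.reCLM.contDiff.contDiffAt.comp p h

/-- The estimate for `-log S`. -/
lemma exists_hasJet_neg_log_Sfun (E : EquationAt N ε Ω Φ p T)
    (A : IsAdaptedFrame N Λ κ ε (mixedHess (stdFrame (m + 1)) Φ p) (holHess (stdFrame (m + 1)) Φ p)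
      (grad (stdFrame (m + 1)) Φ p) T)
    (hN : N.det ≠ 0) (hε : 0 < ε) (hε1 : ε ≤ 1) (hΛ : 1 ≤ Λ) :
    0 < Sfun ε Φ p ∧ ContDiffAt ℝ 2 (toC fun z => -Real.log (Sfun ε Φ z)) p ∧
    ∃ f0 f1 f2 f3 : Fin (m + 1) → ℂ,
      (∀ k, HasJet p (holVec (dir N T ε k)) (conjVec (holVec (dir N T ε k)))
        (toC fun z => -Real.log (Sfun ε Φ z)) (f0 k) (f1 k) (f2 k) (f3 k)) ∧
      -(16 * ((m + 1) * Λ) ^ 18 * ε * (1 + thirdEnergy ε (N * Tᴴ) (third (frameOf T) Φ p))) ≤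
        ∑ k, (f3 k).re := by
  have hB := E.det_metric_ne hN
  have hY := thirdEnergy_nonneg (B := N * Tᴴ) (Θ := third (frameOf T) Φ p) hε
  have hg : grad (frameOf T) Φ p = T *ᵥ grad (stdFrame (m + 1)) Φ p := grad_frameOf _ _ _
  have hr0 : 0 < ‖grad (frameOf T) Φ p (Fin.last m)‖ := by
    by_contra hcon
    have h := A.grad_ge
    rw [← hg, le_antisymm (not_lt.1 hcon) (norm_nonneg _)] at h
    linarith
  have hs1 : (1 : ℝ) ≤ m + 1 := by linarith [(Nat.cast_nonneg m : (0 : ℝ) ≤ m)]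
  have hdir (k b) : ‖dirMatrix ε (N * Tᴴ) k b‖ ≤ Λ := by
    rw [dirMatrix_apply, norm_mul, Complex.norm_of_nonneg (dirWeight_pos hε b).le]
    calc _ ≤ Λ * 1 := mul_le_mul (A.metric_le k b) (dirWeight_le_one hε1 b)
          (dirWeight_pos hε b).le (by linarith)
      _ = Λ := mul_one _
  choose F0 F1 F2 F3 hF hF0 hF1 hF3 using fun k => E.exists_hasJet_Sfun k rfl rfl rfl rfl rfl rfl rfl
  -- The gradient lies along τ, where H⁻¹ has entry ε⁻¹; the factor ε in the definition of S
  -- compensates it.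
  have hS : (Sfun ε Φ p : ℂ) = ((‖grad (frameOf T) Φ p (Fin.last m)‖ ^ 2 : ℝ) : ℂ) := by
    have h1 := (hF 0).val
    rw [toC, hF0] at h1
    rw [h1]
    have h2 : ((gradCol (frameOf T) Φ p)ᴴ * hInv m ε * gradCol (frameOf T) Φ p).trace =
        (ε : ℂ)⁻¹ * ((‖grad (frameOf T) Φ p (Fin.last m)‖ ^ 2 : ℝ) : ℂ) := by
      have := trace_mul_hInv_mul_conjTranspose (ε := ε) (gradCol (frameOf T) Φ p)ᴴ
      rw [conjTranspose_conjTranspose] at this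
      rw [this, Fintype.sum_unique, Fin.sum_univ_castSucc]
      have h3 (a : Fin m) : ‖(gradCol (frameOf T) Φ p)ᴴ default a.castSucc‖ = 0 := by
        rw [conjTranspose_apply, norm_star, gradCol, of_apply, hg, A.grad_castSucc, norm_zero]
      simp only [h3]
      rw [conjTranspose_apply, norm_star, gradCol, of_apply]
      simp
    rw [h2, mul_inv_cancel_left₀ (by exact_mod_cast hε.ne')]
  have hS' : Sfun ε Φ p = ‖grad (frameOf T) Φ p (Fin.last m)‖ ^ 2 := by exact_mod_cast hS
  have hS0 : 0 < Sfun ε Φ p := by rw [hS']; positivity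
  have hlog (k) := ((hF k).log (contDiffAt_of_toC (hF k).smooth) hS0.ne').neg
  have hneg : (fun z => -toC (fun z => Real.log (Sfun ε Φ z)) z) =
      toC fun z => -Real.log (Sfun ε Φ z) := by
    funext z; simp [toC]
  simp only [hneg] at hlog
  refine ⟨hS0, (hlog 0).smooth, _, _, _, _, hlog, ?_⟩
  have hd1 (k a) : ‖(of fun a (_ : Unit) => ∑ b, dirMatrix ε (N * Tᴴ) k b *
      holHess (frameOf T) Φ p b a) a ()‖ ≤ ((m + 1) * Λ) ^ 2 := by
    have hP (b) : ‖holHess (frameOf T) Φ p b a‖ ≤ Λ := by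
      rw [holHess_frameOf E.isOpen E.smooth E.mem]; exact A.hol_le b a
    refine (norm_sum_mul_le (C := Λ) (D := Λ) (by linarith) (hdir k) hP).trans ?_
    rw [Fintype.card_fin]
    push_cast
    have h2 : (m + 1 : ℝ) ≤ (m + 1) ^ 2 := le_self_pow₀ hs1 (by norm_num)
    calc (m + 1 : ℝ) * (Λ * Λ) ≤ (m + 1) ^ 2 * (Λ * Λ) := by gcongr
      _ = ((m + 1) * Λ) ^ 2 := by ring
  have key := neg_log_jet_bound hε hε1 hΛ (Real.sqrt_nonneg (thirdEnergy ε (N * Tᴴ)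
      (third (frameOf T) Φ p)))
    (d0 := gradCol (frameOf T) Φ p)
    (d1 := fun k => of fun a _ => ∑ b, dirMatrix ε (N * Tᴴ) k b * holHess (frameOf T) Φ p b a)
    (d2 := fun k => of fun a _ =>
      ∑ b, star (dirMatrix ε (N * Tᴴ) k b) * mixedHess (frameOf T) Φ p a b)
    (fun a => by rw [gradCol, of_apply, hg, A.grad_castSucc])
    (by rw [gradCol, of_apply, hg]; exact A.grad_le)
    (by rw [gradCol, of_apply, hg]; exact A.grad_ge)
    hd1
    (fun k a => by
      rw [of_apply, E.mixedHess_eq]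
      simp only [diagonal_apply, mul_ite, mul_zero]
      rw [Finset.sum_ite_eq, if_pos (Finset.mem_univ a), norm_mul, norm_star, dirMatrix_apply,
        norm_mul, Complex.norm_of_nonneg (dirWeight_pos hε a).le,
        Complex.norm_of_nonneg (lastWeight_pos hε a).le, dirWeight_eq hε.ne', mul_assoc,
        inv_mul_cancel_right₀ (lastWeight_pos hε a).ne', mul_comm]
      exact mul_le_mul_of_nonneg_left (A.metric_le k a) hε.le)
    (d3 := fun k => of fun a _ => ∑ b, ∑ c, dirMatrix ε (N * Tᴴ) k b *
      third (frameOf T) Φ p a b c * star (dirMatrix ε (N * Tᴴ) k c))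
    (by
      ext a i
      simp only [Matrix.sum_apply, of_apply]
      exact E.first_order a)
    (fun k a c => (norm_deriv_le hε hε1 k a c).1)
    (fun k a => (norm_deriv_last_le hε hε1 hΛ hB A.metric_le A.metric_inv_le E.first_order k a).1)
    E.second_order_mixed hF1 hF3
  rw [Real.sq_sqrt hY] at key
  have hrr : gradCol (frameOf T) Φ p (Fin.last m) () = grad (frameOf T) Φ p (Fin.last m) := rfl
  rw [hrr] at key
  obtain ⟨ρ, hρ⟩ : ∃ ρ, ρ = ‖grad (frameOf T) Φ p (Fin.last m)‖ := ⟨_, rfl⟩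
  rw [← hρ] at key hr0
  -- S is real, so its two first derivatives are conjugate and the mixed derivative of -log S is
  -- -(F₃ - |F₁|²/S)/S with S = ρ².
  have hterm (k) : (-(F3 k / F0 k - F1 k * F2 k / F0 k ^ 2)).re =
      -(ρ ^ 2)⁻¹ * ((F3 k).re - ‖F1 k‖ ^ 2 / ρ ^ 2) := by
    have h0 : F0 k = ((ρ ^ 2 : ℝ) : ℂ) := by rw [← (hF k).val, toC, hS, hρ]
    have h2 : F1 k * F2 k = ((‖F1 k‖ ^ 2 : ℝ) : ℂ) := by
      rw [(hF k).real_of_toC.2.1, Complex.star_def, Complex.mul_conj']; push_cast; rfl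
    rw [h0, h2, Complex.neg_re, Complex.sub_re, Complex.div_ofReal_re, ← Complex.ofReal_pow,
      ← Complex.ofReal_div, Complex.ofReal_re]
    field_simp
  simp only [hterm]
  rw [← Finset.mul_sum]
  have hρ2 : (ρ ^ 2)⁻¹ ≤ Λ ^ 2 := by
    rw [inv_le_iff_one_le_mul₀ (by positivity), ← mul_pow]
    have h := A.grad_ge
    rw [← hg, ← hρ] at h
    exact one_le_pow₀ h
  have h9 : 0 ≤ 16 * ((m + 1) * Λ) ^ 16 * ε *
      (1 + thirdEnergy ε (N * Tᴴ) (third (frameOf T) Φ p)) := by positivity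
  have h10 := mul_le_mul_of_nonneg_left key (inv_nonneg.2 (sq_nonneg ρ))
  have h11 := mul_le_mul_of_nonneg_right hρ2 h9
  have h12 : Λ ^ 2 ≤ ((m + 1) * Λ) ^ 2 :=
    pow_le_pow_left₀ (by linarith) (le_mul_of_one_le_left (by linarith) hs1) 2
  have h13 := mul_le_mul_of_nonneg_right h12 h9
  rw [neg_mul]
  refine neg_le_neg (h10.trans (h11.trans (h13.trans (le_of_eq ?_))))
  ring

end EquationAt
end

noncomputable section
open Matrix

/-! ## Symmetric contractions -/

section
variable {m : ℕ} {κ : ℝ} {B : Matrix (Fin m) (Fin m) ℂ}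

lemma dotProduct_star_self_eq {ι : Type*} [Fintype ι] (x : ι → ℂ) :
    star x ⬝ᵥ x = ((∑ i, ‖x i‖ ^ 2 : ℝ) : ℂ) := by
  push_cast
  exact Finset.sum_congr rfl fun i _ => Complex.conj_mul' _

/-- Polarization. With x the conjugate of By, the values of the quadratic form at x + y and x - y
differ by 4|By|². The hypothesis and the parallelogram law give 4|By|² ≤ 2(1 - κ)(|By|² + |y|²).
Symmetry of B is essential. -/
lemma sum_norm_sq_mulVec_le (hB : Bᵀ = B) (hκ : 0 < κ)
    (h : ∀ x : Fin m → ℂ, ‖∑ α, ∑ β, B α β * x α * x β‖ ≤ (1 - κ) * ∑ α, ‖x α‖ ^ 2)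
    (y : Fin m → ℂ) : ∑ i, ‖(B *ᵥ y) i‖ ^ 2 ≤ (1 - κ) * ∑ i, ‖y i‖ ^ 2 := by
  have hq (x : Fin m → ℂ) : ∑ α, ∑ β, B α β * x α * x β = x ⬝ᵥ B *ᵥ x := by
    simp only [dotProduct, mulVec, Finset.mul_sum]
    exact Finset.sum_congr rfl fun i _ => Finset.sum_congr rfl fun j _ => by ring
  simp only [hq] at h
  obtain ⟨x, hx⟩ : ∃ x : Fin m → ℂ, x = star (B *ᵥ y) := ⟨_, rfl⟩
  obtain ⟨s, hs⟩ : ∃ s : ℝ, s = ∑ i, ‖(B *ᵥ y) i‖ ^ 2 := ⟨_, rfl⟩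
  obtain ⟨Y, hY⟩ : ∃ Y : ℝ, Y = ∑ i, ‖y i‖ ^ 2 := ⟨_, rfl⟩
  have hxs : ∑ i, ‖x i‖ ^ 2 = s := by
    rw [hx, hs]; exact Finset.sum_congr rfl fun i _ => by rw [Pi.star_apply, norm_star]
  have h1 : x ⬝ᵥ B *ᵥ y = (s : ℂ) := by rw [hx, dotProduct_star_self_eq, hs]
  have h2 : y ⬝ᵥ B *ᵥ x = (s : ℂ) := by
    rw [dotProduct_mulVec, ← mulVec_transpose, hB, dotProduct_comm, h1]
  have hp := h (x + y)
  have hm := h (x - y)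
  have e1 : (x + y) ⬝ᵥ B *ᵥ (x + y) - (x - y) ⬝ᵥ B *ᵥ (x - y) = ((4 * s : ℝ) : ℂ) := by
    simp only [mulVec_add, mulVec_sub, add_dotProduct, dotProduct_add, sub_dotProduct,
      dotProduct_sub, h1, h2]
    push_cast; ring
  have e2 : ∑ i, ‖(x + y) i‖ ^ 2 + ∑ i, ‖(x - y) i‖ ^ 2 = 2 * (s + Y) := by
    rw [← hxs, hY, ← Finset.sum_add_distrib, ← Finset.sum_add_distrib, Finset.mul_sum]
    refine Finset.sum_congr rfl fun i _ => ?_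
    have := parallelogram_law_with_norm ℝ (x i) (y i)
    rw [Pi.add_apply, Pi.sub_apply]
    linarith
  have h3 : ‖((4 * s : ℝ) : ℂ)‖ ≤ _ := e1 ▸ norm_sub_le _ _
  have hs0 : 0 ≤ s := by rw [hs]; positivity
  rw [Complex.norm_of_nonneg (by positivity)] at h3
  rw [← hs, ← hY]
  have h4 : 4 * s ≤ (1 - κ) * (2 * (s + Y)) := by rw [← e2]; linarith
  nlinarith [mul_nonneg hκ.le hs0]

lemma map_star_mulVec_star (y : Fin m → ℂ) : B.map star *ᵥ star y = star (B *ᵥ y) := by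
  funext i
  simp [mulVec, dotProduct, Pi.star_apply]

lemma conjTranspose_eq_map_star (hB : Bᵀ = B) : Bᴴ = B.map star := by
  rw [conjTranspose, hB]

lemma norm_sq_conjTranspose_mulVec_le (hB : Bᵀ = B)
    (h : ∀ y, ∑ i, ‖(B *ᵥ y) i‖ ^ 2 ≤ (1 - κ) * ∑ i, ‖y i‖ ^ 2) (y : Fin m → ℂ) :
    ∑ i, ‖(Bᴴ *ᵥ y) i‖ ^ 2 ≤ (1 - κ) * ∑ i, ‖y i‖ ^ 2 := by
  have h1 := h (star y)
  rw [conjTranspose_eq_map_star hB, ← star_star y, map_star_mulVec_star]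
  simpa only [Pi.star_apply, norm_star, star_star] using h1

lemma star_dotProduct_one_sub (y : Fin m → ℂ) : star y ⬝ᵥ (1 - Bᴴ * B) *ᵥ y =
    ((∑ i, ‖y i‖ ^ 2 - ∑ i, ‖(B *ᵥ y) i‖ ^ 2 : ℝ) : ℂ) := by
  rw [sub_mulVec, one_mulVec, dotProduct_sub, dotProduct_star_self_eq, ← mulVec_mulVec,
    dotProduct_mulVec, ← star_mulVec, dotProduct_star_self_eq]
  push_cast; rfl

lemma posDef_one_sub (hκ : 0 < κ)
    (h : ∀ y, ∑ i, ‖(B *ᵥ y) i‖ ^ 2 ≤ (1 - κ) * ∑ i, ‖y i‖ ^ 2) : (1 - Bᴴ * B).PosDef := by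
  refine PosDef.of_dotProduct_mulVec_pos ?_ fun y hy => ?_
  · rw [IsHermitian, conjTranspose_sub, conjTranspose_one, conjTranspose_mul,
      conjTranspose_conjTranspose]
  · rw [star_dotProduct_one_sub]
    have h1 : 0 < ∑ i, ‖y i‖ ^ 2 := by
      obtain ⟨i, hi⟩ := Function.ne_iff.1 hy
      exact Finset.sum_pos' (fun i _ => sq_nonneg _)
        ⟨i, Finset.mem_univ i, pow_pos (norm_pos_iff.2 hi) 2⟩
    have h2 : 0 < ∑ i, ‖y i‖ ^ 2 - ∑ i, ‖(B *ᵥ y) i‖ ^ 2 := by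
      have := h y
      have := mul_pos hκ h1
      linarith
    exact_mod_cast h2

/-- Coercivity: if (1 - B*B)u is a basis vector, pairing with u gives κ|u|² ≤ |u|. -/
lemma norm_inv_one_sub_apply_le (hκ : 0 < κ)
    (h : ∀ y, ∑ i, ‖(B *ᵥ y) i‖ ^ 2 ≤ (1 - κ) * ∑ i, ‖y i‖ ^ 2) (i j : Fin m) :
    ‖(1 - Bᴴ * B)⁻¹ i j‖ ≤ κ⁻¹ := by
  have hu := (Matrix.isUnit_iff_isUnit_det _).1 (posDef_one_sub hκ h).isUnit
  obtain ⟨u, hu'⟩ : ∃ u, u = (1 - Bᴴ * B)⁻¹ *ᵥ Pi.single j 1 := ⟨_, rfl⟩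
  have h1 : (1 - Bᴴ * B) *ᵥ u = Pi.single j 1 := by
    rw [hu', mulVec_mulVec, mul_nonsing_inv _ hu, one_mulVec]
  have h2 := star_dotProduct_one_sub (B := B) u
  rw [h1, dotProduct_single, mul_one, Pi.star_apply] at h2
  have h3 (i) : ‖u i‖ ^ 2 ≤ ∑ i, ‖u i‖ ^ 2 :=
    Finset.single_le_sum (f := fun i => ‖u i‖ ^ 2) (fun i _ => sq_nonneg _) (Finset.mem_univ i)
  obtain ⟨s, hs⟩ : ∃ s : ℝ, s = √(∑ i, ‖u i‖ ^ 2) := ⟨_, rfl⟩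
  have hs2 : s ^ 2 = ∑ i, ‖u i‖ ^ 2 := by rw [hs, Real.sq_sqrt (by positivity)]
  have hs0 : 0 ≤ s := hs ▸ Real.sqrt_nonneg _
  have h4 (i) : ‖u i‖ ≤ s := by
    rw [hs]; exact Real.le_sqrt_of_sq_le (h3 i)
  have h5 : κ * s ^ 2 ≤ s := by
    have e1 : ∑ i, ‖u i‖ ^ 2 - ∑ i, ‖(B *ᵥ u) i‖ ^ 2 ≤ ‖u j‖ := by
      rw [← norm_star (u j), h2]
      exact (le_abs_self _).trans (le_of_eq (Complex.norm_real _).symm)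
    rw [hs2]
    linarith [h u, h4 j]
  have h6 : κ * s ≤ 1 := by
    rcases hs0.eq_or_lt with h0 | h0
    · rw [← h0]; simp
    · refine le_of_mul_le_mul_right ?_ h0
      linarith
  have h7 : (1 - Bᴴ * B)⁻¹ i j = u i := by rw [hu', mulVec_single_one]; rfl
  rw [h7, ← one_div, le_div_iff₀ hκ]
  have := mul_le_mul_of_nonneg_right (h4 i) hκ.le
  linarith

/-! ## Jets of `tr (1 - K)⁻¹` -/

/-- With S = (1 - BB')⁻¹ and Q = (1 - B'B)⁻¹ the hypotheses hold, and the quadratic expression in b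
and c turns out to be a single completed square. When primes are adjoints the right side is positive
semidefinite. -/
lemma resolvent_square_identity {R : Type*} [Ring R] {B B' b b' c c' S Q : R}
    (h1 : B' * S = Q * B') (h2 : S * B = B * Q) (h3 : S = 1 + B * Q * B')
    (h4 : B' * S * B = Q - 1) :
    (c * B' + B * b') * S * (b * B' + B * c') + c * c' - B * b' * b * B' =
      (c + B * b' * B) * Q * (c' + B' * b * B') := by
  have e1 : (c * B' + B * b') * S * (b * B' + B * c') = c * (B' * S * B) * c' +
      c * (B' * S) * b * B' + B * b' * (S * B) * c' + B * b' * S * b * B' := by noncomm_ring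
  have e2 : B * b' * S * b * B' = B * b' * b * B' + B * b' * B * Q * B' * b * B' := by
    rw [h3]; noncomm_ring
  rw [e1, e2, h4, h1, h2]
  noncomm_ring

lemma isUnit_det_of_posDef {M : Matrix (Fin m) (Fin m) ℂ} (h : M.PosDef) : IsUnit M.det :=
  (Matrix.isUnit_iff_isUnit_det _).1 h.isUnit

/-- The leading part of the second variation of `tr (1 - K)⁻¹` is non-negative. -/
lemma leading_part_nonneg (hR : (1 - B * Bᴴ).PosDef) (hQ : (1 - Bᴴ * B).PosDef)
    (b c : Matrix (Fin m) (Fin m) ℂ) {R F : Matrix (Fin m) (Fin m) ℂ} (hRe : R = (1 - B * Bᴴ)⁻¹)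
    (hF : F = c * Bᴴ + B * bᴴ) :
    0 ≤ ((b * bᴴ * R).trace + (R * F * R * Fᴴ * R).trace + (R * Fᴴ * R * F * R).trace -
      (R * (b * bᴴ) * R).trace +
      (R * (-(B * (bᴴ * b)) * Bᴴ + b * bᴴ + c * cᴴ) * R).trace).re := by
  obtain ⟨Q, hQe⟩ : ∃ Q, Q = (1 - Bᴴ * B)⁻¹ := ⟨_, rfl⟩
  have r1 : R * (1 - B * Bᴴ) = 1 := by rw [hRe, nonsing_inv_mul _ (isUnit_det_of_posDef hR)]
  have r2 : (1 - B * Bᴴ) * R = 1 := by rw [hRe, mul_nonsing_inv _ (isUnit_det_of_posDef hR)]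
  have q1 : Q * (1 - Bᴴ * B) = 1 := by rw [hQe, nonsing_inv_mul _ (isUnit_det_of_posDef hQ)]
  have q2 : (1 - Bᴴ * B) * Q = 1 := by rw [hQe, mul_nonsing_inv _ (isUnit_det_of_posDef hQ)]
  have h1 : Bᴴ * R = Q * Bᴴ := by
    have : Q * Bᴴ * ((1 - B * Bᴴ) * R) = (Q * (1 - Bᴴ * B)) * Bᴴ * R := by noncomm_ring
    rw [r2, q1, Matrix.mul_one, Matrix.one_mul] at this
    exact this.symm
  have h2 : R * B = B * Q := by
    have : (R * (1 - B * Bᴴ)) * B * Q = R * B * ((1 - Bᴴ * B) * Q) := by noncomm_ring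
    rw [r1, q2, Matrix.mul_one, Matrix.one_mul] at this
    exact this.symm
  have h3 : R = 1 + B * Q * Bᴴ := by
    rw [← h2, ← r1]; noncomm_ring
  have h4 : Bᴴ * R * B = Q - 1 := by
    rw [h1, ← q1]; noncomm_ring
  have hRp : R.PosSemidef := hRe ▸ hR.inv.posSemidef
  have hQp : Q.PosSemidef := hQe ▸ hQ.inv.posSemidef
  have hRh : Rᴴ = R := hRp.isHermitian.eq
  have hFh : Fᴴ = b * Bᴴ + B * cᴴ := by
    rw [hF, conjTranspose_add, conjTranspose_mul, conjTranspose_mul, conjTranspose_conjTranspose,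
      conjTranspose_conjTranspose, add_comm]
  -- Three of the five terms merge into R E Q E* R with E = c + B b* B. The other two are
  -- nonnegative separately.
  have e1 : R * F * R * Fᴴ * R - R * (b * bᴴ) * R +
      R * (-(B * (bᴴ * b)) * Bᴴ + b * bᴴ + c * cᴴ) * R =
      R * ((c + B * bᴴ * B) * Q * (c + B * bᴴ * B)ᴴ) * R := by
    have hE : (c + B * bᴴ * B)ᴴ = cᴴ + Bᴴ * b * Bᴴ := by
      simp only [conjTranspose_add, conjTranspose_mul, conjTranspose_conjTranspose, Matrix.mul_assoc]
    rw [hE, ← resolvent_square_identity h1 h2 h3 h4, hFh, hF]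
    noncomm_ring
  have n1 : 0 ≤ (b * bᴴ * R).trace := by
    have : (b * bᴴ * R).trace = (bᴴ * R * b).trace := by
      rw [Matrix.mul_assoc, trace_mul_comm]
    rw [this]
    exact (hRp.conjTranspose_mul_mul_same b).trace_nonneg
  have n2 : 0 ≤ (R * Fᴴ * R * F * R).trace := by
    have : R * Fᴴ * R * F * R = (F * R)ᴴ * R * (F * R) := by
      rw [conjTranspose_mul, hRh]; simp only [Matrix.mul_assoc]
    rw [this]
    exact (hRp.conjTranspose_mul_mul_same _).trace_nonneg
  have n3 : 0 ≤ (R * ((c + B * bᴴ * B) * Q * (c + B * bᴴ * B)ᴴ) * R).trace := by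
    have := ((hQp.mul_mul_conjTranspose_same (c + B * bᴴ * B)).conjTranspose_mul_mul_same R).trace_nonneg
    rwa [hRh] at this
  rw [← e1, trace_add, trace_sub] at n3
  have h := add_nonneg (add_nonneg n1 n2) n3
  have h' := (Complex.le_def.1 h).1
  simp only [Complex.add_re, Complex.sub_re, Complex.zero_re] at h' ⊢
  linarith

end

section
variable {n m : ℕ} {p : Cn n} {X : Cn n × Cn n}

/-- The jet of `tr (A (A - B Ā⁻¹ B̄)⁻¹)` where `A = 1` to first order. -/
lemma exists_hasJet_trace_mul_inv {A B : Cn n → Matrix (Fin m) (Fin m) ℂ}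
    {A3 B0 B1 B2 B3 R : Matrix (Fin m) (Fin m) ℂ}
    (hA : HasMJet p X (conjVec X) A 1 0 0 A3) (hB : HasMJet p X (conjVec X) B B0 B1 B2 B3)
    (h0 : B0ᵀ = B0) (h1 : B1ᵀ = B1) (h2 : B2ᵀ = B2) (h3 : B3ᵀ = B3)
    (hdet : (1 - B0 * B0ᴴ).det ≠ 0) (hR : R = (1 - B0 * B0ᴴ)⁻¹) :
    ∃ f0 f1 f2, HasJet p X (conjVec X)
      (fun z => (A z * (A z - B z * ((A z).map star)⁻¹ * (B z).map star)⁻¹).trace) f0 f1 f2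
      ((A3 * R).trace + (R * (B1 * B0ᴴ + B0 * B2ᴴ) * R * (B1 * B0ᴴ + B0 * B2ᴴ)ᴴ * R).trace +
        (R * (B1 * B0ᴴ + B0 * B2ᴴ)ᴴ * R * (B1 * B0ᴴ + B0 * B2ᴴ) * R).trace -
        (R * A3 * R).trace +
        (R * ((B3 - B0 * A3.map star) * B0ᴴ + B2 * B2ᴴ + B1 * B1ᴴ + B0 * B3ᴴ) * R).trace) := by
  have hs1 : (1 : Matrix (Fin m) (Fin m) ℂ).map star = 1 :=
    Matrix.map_one _ (star_zero ℂ) (star_one ℂ)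
  have hs0 : (0 : Matrix (Fin m) (Fin m) ℂ).map star = 0 := by ext i j; simp
  have j1 := (hA.mapStar).inv (by rw [hs1, det_one]; exact one_ne_zero)
  have j2 := hB.mul j1
  have j3 := j2.mul hB.mapStar
  have j4 := (hA.sub j3)
  simp only [hs1, hs0, inv_one, Matrix.mul_zero, neg_zero, Matrix.mul_one,
    Matrix.one_mul, add_zero, zero_sub] at j4
  have j5 := (hA.mul (j4.inv (by rw [← conjTranspose_eq_map_star h0]; exact hdet))).trace
  suffices h : (A3 * R).trace + (R * (B1 * B0ᴴ + B0 * B2ᴴ) * R * (B1 * B0ᴴ + B0 * B2ᴴ)ᴴ * R).trace +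
        (R * (B1 * B0ᴴ + B0 * B2ᴴ)ᴴ * R * (B1 * B0ᴴ + B0 * B2ᴴ) * R).trace -
        (R * A3 * R).trace +
        (R * ((B3 - B0 * A3.map star) * B0ᴴ + B2 * B2ᴴ + B1 * B1ᴴ + B0 * B3ᴴ) * R).trace = _ by
    rw [h]
    exact ⟨_, _, _, j5⟩
  rw [← conjTranspose_eq_map_star h0, ← conjTranspose_eq_map_star h1,
    ← conjTranspose_eq_map_star h2, ← conjTranspose_eq_map_star h3, ← hR]
  simp only [← trace_add, ← trace_sub]
  congr 1
  simp only [conjTranspose_add, conjTranspose_mul, conjTranspose_conjTranspose]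
  noncomm_ring

end
end

noncomputable section
open scoped ContDiff
open Matrix

/-! ## Dependence of `A`, `B` and `K` on the coordinates -/

section
variable {m : ℕ}

/-- The inclusion of the first `m` coordinates. -/
def topRows (m : ℕ) : Matrix (Fin m) (Fin (m + 1)) ℂ :=
  of fun α b => if b = α.castSucc then 1 else 0

/-- The last coordinate, as a row. -/
def lastRow (m : ℕ) : Matrix Unit (Fin (m + 1)) ℂ := of fun _ b => if b = Fin.last m then 1 else 0

/-- The column `d_α / d_τ`. -/
def slopeCol (d : Fin (m + 1) → ℂ) : Matrix (Fin m) Unit ℂ :=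
  of fun α _ => d α.castSucc / d (Fin.last m)

/-- The matrix whose rows span the complex tangent space `{v | ∑ v_a d_a = 0}`. -/
def tangentMatrix (d : Fin (m + 1) → ℂ) : Matrix (Fin m) (Fin (m + 1)) ℂ :=
  topRows m - slopeCol d * lastRow m

lemma topRows_mul_apply {κ : Type*} (F : Matrix (Fin (m + 1)) κ ℂ) (α : Fin m) (j : κ) :
    (topRows m * F) α j = F α.castSucc j := by
  simp [topRows, mul_apply]

lemma lastRow_mul_apply {κ : Type*} (F : Matrix (Fin (m + 1)) κ ℂ) (i : Unit) (j : κ) :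
    (lastRow m * F) i j = F (Fin.last m) j := by
  simp [lastRow, mul_apply]

lemma mul_topRows_transpose_apply {κ : Type*} (F : Matrix κ (Fin (m + 1)) ℂ) (i : κ) (α : Fin m) :
    (F * (topRows m)ᵀ) i α = F i α.castSucc := by
  simp [topRows, mul_apply]

lemma mul_lastRow_transpose_apply {κ : Type*} (F : Matrix κ (Fin (m + 1)) ℂ) (i : κ) (j : Unit) :
    (F * (lastRow m)ᵀ) i j = F i (Fin.last m) := by
  simp [lastRow, mul_apply]

lemma topRows_conjTranspose : (topRows m)ᴴ = (topRows m)ᵀ := by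
  ext b α; simp [topRows, apply_ite]

lemma lastRow_conjTranspose : (lastRow m)ᴴ = (lastRow m)ᵀ := by
  ext b α; simp [lastRow, apply_ite]

lemma topRows_mul_transpose : topRows m * (topRows m)ᵀ = 1 := by
  ext α β
  rw [topRows_mul_apply, transpose_apply, topRows, of_apply, one_apply]
  simp [Fin.castSucc_inj]

lemma lastRow_mul_topRows_transpose : lastRow m * (topRows m)ᵀ = 0 := by
  ext i β
  rw [lastRow_mul_apply, transpose_apply, topRows, of_apply, Matrix.zero_apply, if_neg]
  exact (Fin.castSucc_lt_last β).ne'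

lemma tangentMatrix_apply (d : Fin (m + 1) → ℂ) (α : Fin m) (b : Fin (m + 1)) :
    tangentMatrix d α b = (if b = α.castSucc then 1 else 0) -
      d α.castSucc / d (Fin.last m) * if b = Fin.last m then 1 else 0 := by
  rw [tangentMatrix, Matrix.sub_apply, mul_apply, Fintype.sum_unique]
  rfl

lemma tangentMatrix_mul_topRows_transpose (d : Fin (m + 1) → ℂ) :
    tangentMatrix d * (topRows m)ᵀ = 1 := by
  rw [tangentMatrix, Matrix.sub_mul, topRows_mul_transpose, Matrix.mul_assoc,
    lastRow_mul_topRows_transpose, Matrix.mul_zero, sub_zero]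

lemma tangentMatrix_mulVec {d : Fin (m + 1) → ℂ} (hd : d (Fin.last m) ≠ 0) :
    tangentMatrix d *ᵥ d = 0 := by
  funext α
  have h (F : Matrix (Fin m) (Fin (m + 1)) ℂ) : (F *ᵥ d) α = (F * of fun a (_ : Unit) => d a) α () := by
    simp [mulVec, dotProduct, mul_apply]
  rw [h, tangentMatrix, Matrix.sub_mul, Matrix.mul_assoc, Matrix.sub_apply, topRows_mul_apply, mul_apply]
  simp only [Finset.univ_unique, Finset.sum_singleton, lastRow_mul_apply, of_apply, slopeCol]
  rw [div_mul_cancel₀ _ hd, sub_self]; rfl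

/-- A row annihilating d is determined by its first m entries, because the last entry of d is
nonzero. -/
lemma eq_mul_tangentMatrix {d : Fin (m + 1) → ℂ} (hd : d (Fin.last m) ≠ 0)
    {κ : Type*} {F : Matrix κ (Fin (m + 1)) ℂ} (hF : F *ᵥ d = 0) :
    F = F * (topRows m)ᵀ * tangentMatrix d := by
  ext i b
  have h1 := congrFun hF i
  simp only [mulVec, dotProduct, Fin.sum_univ_castSucc, Pi.zero_apply] at h1
  have h2 : F i (Fin.last m) = -(∑ α : Fin m, F i α.castSucc * (d α.castSucc / d (Fin.last m))) := by
    rw [eq_neg_iff_add_eq_zero]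
    refine mul_right_cancel₀ hd ?_
    rw [zero_mul, add_mul, Finset.sum_mul, ← h1, add_comm]
    congr 1
    exact Finset.sum_congr rfl fun α _ => by rw [mul_assoc, div_mul_cancel₀ _ hd]
  rw [mul_apply]
  simp only [mul_topRows_transpose_apply, tangentMatrix_apply]
  refine Fin.lastCases ?_ (fun β => ?_) b
  · rw [h2, ← Finset.sum_neg_distrib]
    refine Finset.sum_congr rfl fun α _ => ?_
    rw [if_neg (Fin.castSucc_lt_last α).ne', if_pos rfl]; ring
  · simp only [if_neg (Fin.castSucc_lt_last β).ne, Fin.castSucc_inj, mul_zero, sub_zero]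
    simp

/-- The tangent matrices of two frames differ by an invertible factor. -/
lemma exists_tangentMatrix_mul {d d' : Fin (m + 1) → ℂ} {U : Matrix (Fin (m + 1)) (Fin (m + 1)) ℂ}
    (hU : U.det ≠ 0) (hd : d = U *ᵥ d') (h : d (Fin.last m) ≠ 0) (h' : d' (Fin.last m) ≠ 0) :
    ∃ g : Matrix (Fin m) (Fin m) ℂ, g.det ≠ 0 ∧ tangentMatrix d * U = g * tangentMatrix d' := by
  have hu : IsUnit U.det := isUnit_iff_ne_zero.2 hU
  have hd' : d' = U⁻¹ *ᵥ d := by rw [hd, mulVec_mulVec, nonsing_inv_mul _ hu, one_mulVec]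
  have h1 := eq_mul_tangentMatrix (F := tangentMatrix d * U) h' (by
    rw [← mulVec_mulVec, ← hd, tangentMatrix_mulVec h])
  have h2 := eq_mul_tangentMatrix (F := tangentMatrix d' * U⁻¹) h (by
    rw [← mulVec_mulVec, ← hd', tangentMatrix_mulVec h'])
  refine ⟨_, fun h0 => ?_, h1⟩
  obtain ⟨g, hg⟩ : ∃ g, g = tangentMatrix d * U * (topRows m)ᵀ := ⟨_, rfl⟩
  obtain ⟨g', hg'⟩ : ∃ g, g = tangentMatrix d' * U⁻¹ * (topRows m)ᵀ := ⟨_, rfl⟩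
  rw [← hg] at h1 h0
  rw [← hg'] at h2
  have h3 : g * g' = 1 := by
    rw [hg', ← Matrix.mul_assoc, ← Matrix.mul_assoc, ← h1, mul_nonsing_inv_cancel_right _ _ hu,
      tangentMatrix_mul_topRows_transpose]
  have := congrArg det h3
  rw [det_mul, h0, zero_mul, det_one] at this
  exact zero_ne_one this

lemma tangentMatrix_mul_apply (d : Fin (m + 1) → ℂ) {κ : Type*} (F : Matrix (Fin (m + 1)) κ ℂ)
    (α : Fin m) (j : κ) : (tangentMatrix d * F) α j =
      F α.castSucc j - d α.castSucc / d (Fin.last m) * F (Fin.last m) j := by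
  rw [tangentMatrix, Matrix.sub_mul, Matrix.sub_apply, topRows_mul_apply, Matrix.mul_assoc, mul_apply,
    Fintype.sum_unique, lastRow_mul_apply]
  rfl

lemma mul_tangentMatrix_transpose_apply (d : Fin (m + 1) → ℂ) {κ : Type*}
    (F : Matrix κ (Fin (m + 1)) ℂ) (i : κ) (β : Fin m) : (F * (tangentMatrix d)ᵀ) i β =
      F i β.castSucc - d β.castSucc / d (Fin.last m) * F i (Fin.last m) := by
  rw [← transpose_transpose F, ← transpose_mul, transpose_apply, tangentMatrix_mul_apply]
  rfl

lemma mul_tangentMatrix_conjTranspose_apply (d : Fin (m + 1) → ℂ) {κ : Type*}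
    (F : Matrix κ (Fin (m + 1)) ℂ) (i : κ) (β : Fin m) : (F * (tangentMatrix d)ᴴ) i β =
      F i β.castSucc - star (d β.castSucc) / star (d (Fin.last m)) * F i (Fin.last m) := by
  rw [← conjTranspose_conjTranspose F, ← conjTranspose_mul, conjTranspose_apply,
    tangentMatrix_mul_apply]
  simp only [star_sub, star_mul', star_div₀, conjTranspose_apply, star_star]

lemma Amat_eq (t : Fin (m + 1) → Cn (m + 1)) (Φ : Cn (m + 1) → ℝ) (z : Cn (m + 1)) :
    Amat t Φ z = tangentMatrix (grad t Φ z) * mixedHess t Φ z * (tangentMatrix (grad t Φ z))ᴴ := by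
  ext α β
  rw [mul_tangentMatrix_conjTranspose_apply, tangentMatrix_mul_apply, tangentMatrix_mul_apply]
  simp only [Amat, of_apply]
  ring

lemma Bmat_eq (t : Fin (m + 1) → Cn (m + 1)) (Φ : Cn (m + 1) → ℝ) (z : Cn (m + 1)) :
    Bmat t Φ z = tangentMatrix (grad t Φ z) * holHess t Φ z * (tangentMatrix (grad t Φ z))ᵀ := by
  ext α β
  rw [mul_tangentMatrix_transpose_apply, tangentMatrix_mul_apply, tangentMatrix_mul_apply]
  simp only [Bmat, of_apply]
  ring

/-- `K` as a function of `A` and `B`. -/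
def kOf {ι : Type*} [Fintype ι] [DecidableEq ι] (A B : Matrix ι ι ℂ) : Matrix ι ι ℂ :=
  B * A⁻¹.map star * B.map star * A⁻¹

/-! ### Invariance of tr(I - 𝓚)⁻¹ under congruence -/

section
variable {ι : Type*} [Fintype ι]

lemma map_star_mul (A B : Matrix ι ι ℂ) : (A * B).map star = A.map star * B.map star :=
  Matrix.map_mul (f := starRingEnd ℂ)

variable [DecidableEq ι]

lemma map_star_inv (A : Matrix ι ι ℂ) : A⁻¹.map star = (A.map star)⁻¹ := by
  have h (F : Matrix ι ι ℂ) : F.map star = Fᴴᵀ := rfl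
  rw [h, h, conjTranspose_nonsing_inv, transpose_nonsing_inv]

/-- A transforms as a Hermitian form and B as a bilinear one; the conjugations in 𝓚 are placed so
that all inner factors of g cancel. -/
lemma kOf_congruence {A B g : Matrix ι ι ℂ} (hg : g.det ≠ 0) :
    kOf (g * A * gᴴ) (g * B * gᵀ) = g * kOf A B * g⁻¹ := by
  have hu : IsUnit g.det := isUnit_iff_ne_zero.2 hg
  have hut : IsUnit gᵀ.det := by rwa [det_transpose]
  have huc : IsUnit gᴴ.det := by rw [det_conjTranspose]; exact hu.star
  have hus : IsUnit (g.map star).det := by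
    rw [show g.map star = gᴴᵀ from rfl, det_transpose]; exact huc
  have e1 : gᴴ.map star = gᵀ := by ext i j; simp
  have e2 : gᵀ.map star = gᴴ := rfl
  simp only [kOf, map_star_inv, map_star_mul, e1, e2, Matrix.mul_inv_rev]
  simp only [Matrix.mul_assoc, mul_nonsing_inv_cancel_left _ _ hut, nonsing_inv_mul_cancel_left _ _ hus,
    mul_nonsing_inv_cancel_left _ _ huc]

lemma one_sub_conj {K g : Matrix ι ι ℂ} (hg : g.det ≠ 0) :
    1 - g * K * g⁻¹ = g * (1 - K) * g⁻¹ := by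
  rw [Matrix.mul_sub, Matrix.sub_mul, Matrix.mul_one, mul_nonsing_inv _ (isUnit_iff_ne_zero.2 hg)]

lemma trace_inv_one_sub_conj {K g : Matrix ι ι ℂ} (hg : g.det ≠ 0) :
    ((1 - g * K * g⁻¹)⁻¹).trace = ((1 - K)⁻¹).trace := by
  have hu : IsUnit g.det := isUnit_iff_ne_zero.2 hg
  rw [one_sub_conj hg, Matrix.mul_inv_rev, Matrix.mul_inv_rev, nonsing_inv_nonsing_inv _ hu,
    trace_mul_comm, Matrix.mul_assoc, nonsing_inv_mul _ hu, Matrix.mul_one]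

/-- Factoring A⁻¹ out of I - 𝓚 leaves an expression that is easier to differentiate when A = I to
first order. -/
lemma trace_inv_one_sub_kOf {A B : Matrix ι ι ℂ} (hA : A.det ≠ 0) :
    ((1 - kOf A B)⁻¹).trace = (A * (A - B * (A.map star)⁻¹ * B.map star)⁻¹).trace := by
  have hu : IsUnit A.det := isUnit_iff_ne_zero.2 hA
  have h : 1 - kOf A B = (A - B * (A.map star)⁻¹ * B.map star) * A⁻¹ := by
    rw [Matrix.sub_mul, mul_nonsing_inv _ hu, kOf, map_star_inv]
  rw [h, Matrix.mul_inv_rev, nonsing_inv_nonsing_inv _ hu]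

lemma trace_inv_one_sub_kOf_congruence {A B g : Matrix ι ι ℂ} (hg : g.det ≠ 0) :
    ((1 - kOf (g * A * gᴴ) (g * B * gᵀ))⁻¹).trace = ((1 - kOf A B)⁻¹).trace := by
  rw [kOf_congruence hg, trace_inv_one_sub_conj hg]

end

lemma traceInv_eq (t : Fin (m + 1) → Cn (m + 1)) (Φ : Cn (m + 1) → ℝ) (z : Cn (m + 1)) :
    traceInv t Φ z = ((1 - kOf (Amat t Φ z) (Bmat t Φ z))⁻¹).trace.re := rfl

/-- A basis is the frame of an invertible matrix. -/
lemma exists_frameOf_eq {n : ℕ} (t : Module.Basis (Fin n) ℂ (Cn n)) :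
    ∃ S : Matrix (Fin n) (Fin n) ℂ, S.det ≠ 0 ∧ frameOf S = t := by
  obtain ⟨S, hS⟩ : ∃ S : Matrix (Fin n) (Fin n) ℂ, S = of fun a i => t a i := ⟨_, rfl⟩
  refine ⟨S, ?_, ?_⟩
  · have h : LinearIndependent ℂ S.row := by
      have := t.linearIndependent.map' (WithLp.linearEquiv 2 ℂ (Fin n → ℂ)).toLinearMap
        (LinearEquiv.ker _)
      rw [hS]
      exact this
    have := (linearIndependent_rows_iff_isUnit.1 h)
    exact isUnit_iff_ne_zero.1 ((Matrix.isUnit_iff_isUnit_det _).1 this)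
  · funext a
    ext i
    simp [frameOf, stdFrame, hS, Finset.sum_apply, Pi.single_apply]

/-- Coordinate changes act on `A` and `B` by congruence. -/
lemma exists_Amat_Bmat_congruence {Ω : Set (Cn (m + 1))} {Φ : Cn (m + 1) → ℝ} (hΩ : IsOpen Ω)
    (hΦ : ContDiffOn ℝ ∞ Φ Ω) {z : Cn (m + 1)} (hz : z ∈ Ω)
    {S T : Matrix (Fin (m + 1)) (Fin (m + 1)) ℂ} (hS : S.det ≠ 0) (hT : T.det ≠ 0)
    (h : grad (frameOf S) Φ z (Fin.last m) ≠ 0) (h' : grad (frameOf T) Φ z (Fin.last m) ≠ 0) :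
    ∃ g : Matrix (Fin m) (Fin m) ℂ, g.det ≠ 0 ∧
      Amat (frameOf S) Φ z = g * Amat (frameOf T) Φ z * gᴴ ∧
      Bmat (frameOf S) Φ z = g * Bmat (frameOf T) Φ z * gᵀ := by
  have hu : IsUnit T.det := isUnit_iff_ne_zero.2 hT
  obtain ⟨U, hU⟩ : ∃ U, U = S * T⁻¹ := ⟨_, rfl⟩
  have hST : S = U * T := by rw [hU, nonsing_inv_mul_cancel_right _ _ hu]
  have hUd : U.det ≠ 0 := fun h0 => hS (by rw [hST, det_mul, h0, zero_mul])
  have hd : grad (frameOf S) Φ z = U *ᵥ grad (frameOf T) Φ z := by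
    rw [grad_frameOf, grad_frameOf, mulVec_mulVec, ← hST]
  have hH : mixedHess (frameOf S) Φ z = U * mixedHess (frameOf T) Φ z * Uᴴ := by
    have hc := hΦ.toC_comp.contDiffAt_two hΩ hz
    rw [mixedHess_frameOf hc, mixedHess_frameOf hc, hST, conjTranspose_mul]
    simp only [Matrix.mul_assoc]
  have hP : holHess (frameOf S) Φ z = U * holHess (frameOf T) Φ z * Uᵀ := by
    rw [holHess_frameOf hΩ hΦ hz, holHess_frameOf hΩ hΦ hz, hST, transpose_mul]
    simp only [Matrix.mul_assoc]
  obtain ⟨g, hg, hgJ⟩ := exists_tangentMatrix_mul hUd hd h h'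
  refine ⟨g, hg, ?_, ?_⟩
  · rw [Amat_eq, Amat_eq, hH]
    have e := congrArg conjTranspose hgJ
    rw [conjTranspose_mul, conjTranspose_mul] at e
    rw [← Matrix.mul_assoc, ← Matrix.mul_assoc, ← Matrix.mul_assoc, ← Matrix.mul_assoc, ← hgJ,
      Matrix.mul_assoc _ (tangentMatrix _)ᴴ, ← e]
    simp only [Matrix.mul_assoc]
  · rw [Bmat_eq, Bmat_eq, hP]
    have e := congrArg transpose hgJ
    rw [transpose_mul, transpose_mul] at e
    rw [← Matrix.mul_assoc, ← Matrix.mul_assoc, ← Matrix.mul_assoc, ← Matrix.mul_assoc, ← hgJ,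
      Matrix.mul_assoc _ (tangentMatrix _)ᵀ, ← e]
    simp only [Matrix.mul_assoc]

end
end

noncomputable section
open Matrix

/-! ## Frobenius norm estimates -/

section
attribute [local instance] Matrix.frobeniusNormedAddCommGroup Matrix.frobeniusNormedSpace

section
variable {ι κ μ : Type*} [Fintype ι] [Fintype κ] [Fintype μ]

lemma frobenius_mul_le {A : Matrix ι κ ℂ} {B : Matrix κ μ ℂ} {a b : ℝ} (hA : ‖A‖ ≤ a)
    (hB : ‖B‖ ≤ b) : ‖A * B‖ ≤ a * b :=
  (frobenius_norm_mul A B).trans (mul_le_mul hA hB (norm_nonneg _) ((norm_nonneg _).trans hA))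

lemma frobenius_sq (A : Matrix ι κ ℂ) : ‖A‖ ^ 2 = ∑ i, ∑ j, ‖A i j‖ ^ 2 := by
  rw [frobenius_norm_def, ← Real.sqrt_eq_rpow, Real.sq_sqrt (by positivity)]
  simp

lemma norm_apply_le_frobenius (A : Matrix ι κ ℂ) (i : ι) (j : κ) : ‖A i j‖ ≤ ‖A‖ := by
  refine le_of_sq_le_sq ?_ (norm_nonneg _)
  rw [frobenius_sq]
  exact (Finset.single_le_sum (f := fun j => ‖A i j‖ ^ 2) (fun _ _ => sq_nonneg _)
    (Finset.mem_univ j)).trans (Finset.single_le_sum (f := fun i => ∑ j, ‖A i j‖ ^ 2)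
    (fun _ _ => Finset.sum_nonneg fun _ _ => sq_nonneg _) (Finset.mem_univ i))

lemma frobenius_le_of_apply_le {A : Matrix ι κ ℂ} {s c : ℝ} (hc : 0 ≤ c)
    (h : ∀ i j, ‖A i j‖ ≤ c) (hι : (Fintype.card ι : ℝ) ≤ s) (hκ : (Fintype.card κ : ℝ) ≤ s) :
    ‖A‖ ≤ s * c := by
  have hs : 0 ≤ s := (Nat.cast_nonneg _).trans hι
  refine le_of_sq_le_sq ?_ (mul_nonneg hs hc)
  rw [frobenius_sq]
  calc _ ≤ ∑ _i : ι, ∑ _j : κ, c ^ 2 := Finset.sum_le_sum fun i _ => Finset.sum_le_sum fun j _ =>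
        pow_le_pow_left₀ (norm_nonneg _) (h i j) 2
    _ = (Fintype.card ι : ℝ) * ((Fintype.card κ : ℝ) * c ^ 2) := by simp
    _ ≤ s * (s * c ^ 2) := by gcongr
    _ = (s * c) ^ 2 := by ring

lemma norm_trace_le_frobenius (A : Matrix ι ι ℂ) : ‖A.trace‖ ≤ Fintype.card ι * ‖A‖ := by
  refine (norm_sum_le _ _).trans ?_
  calc _ ≤ ∑ _i : ι, ‖A‖ := Finset.sum_le_sum fun i _ => norm_apply_le_frobenius A i i
    _ = _ := by simp

end

section
variable {m : ℕ}

/-- Splits h into its tangential part and the part with ε⁻¹ in direction τ. The first reproduces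
squares of tangential blocks, the second meets only the small last columns. -/
lemma hInv_eq (ε : ℝ) : hInv m ε = (topRows m)ᵀ * topRows m +
    (ε : ℂ)⁻¹ • ((lastRow m)ᵀ * lastRow m) := by
  ext a b
  refine Fin.lastCases ?_ (fun α => ?_) a <;> refine Fin.lastCases ?_ (fun β => ?_) b
  all_goals
    simp [hInv, topRows, lastRow, mul_apply, diagonal_apply, lastWeight, (Fin.castSucc_lt_last _).ne,
      (Fin.castSucc_lt_last _).ne', Fin.castSucc_inj]

lemma topRows_mul_diagonal_mul (ε : ℝ) :
    topRows m * diagonal (fun a => (lastWeight m ε a : ℂ)) * (topRows m)ᵀ = 1 := by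
  ext α β
  rw [mul_topRows_transpose_apply, topRows_mul_apply, diagonal_apply, one_apply]
  simp [Fin.castSucc_inj, lastWeight]

lemma lastRow_mul_diagonal_mul_topRows (ε : ℝ) :
    lastRow m * diagonal (fun a => (lastWeight m ε a : ℂ)) * (topRows m)ᵀ = 0 := by
  ext α β
  rw [mul_topRows_transpose_apply, lastRow_mul_apply, diagonal_apply_ne _ (Fin.castSucc_lt_last β).ne']
  rfl

lemma lastRow_mul_diagonal_mul_lastRow (ε : ℝ) :
    lastRow m * diagonal (fun a => (lastWeight m ε a : ℂ)) * (lastRow m)ᵀ = (ε : ℂ) • 1 := by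
  ext α β
  rw [mul_lastRow_transpose_apply, lastRow_mul_apply, diagonal_apply_eq]
  simp [lastWeight]

lemma topRows_transpose_conjTranspose : (topRows m)ᵀᴴ = topRows m := by
  rw [← topRows_conjTranspose, conjTranspose_conjTranspose]

lemma lastRow_transpose_conjTranspose : (lastRow m)ᵀᴴ = lastRow m := by
  rw [← lastRow_conjTranspose, conjTranspose_conjTranspose]

/-- A common bound for all error monomials, so that the error estimates reduce to counting them. -/
lemma monomial_le {K ε M t : ℝ} (hK : 1 ≤ K) (hε : 0 ≤ ε) (ht : 0 ≤ t) (htM : t ≤ M) {j : ℕ}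
    (hj : j ≤ 9) : K ^ j * (ε * t) ≤ K ^ 9 * (ε * M) := by
  have := pow_le_pow_right₀ hK hj
  have hM : 0 ≤ ε * M := mul_nonneg hε (ht.trans htM)
  gcongr

variable {K ε y w M : ℝ} {α β γ η π P : Matrix (Fin (m + 1)) (Fin (m + 1)) ℂ}
  {a1 a2 a3 : Matrix (Fin m) Unit ℂ}

/-- Sizes of the data entering the jets of `A` and `B`. -/
structure JetSizes (K ε y w : ℝ) (α β γ P : Matrix (Fin (m + 1)) (Fin (m + 1)) ℂ)
    (a1 a2 : Matrix (Fin m) Unit ℂ) : Prop where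
  one_le : 1 ≤ K
  eps_pos : 0 < ε
  eps_le : ε ≤ 1
  y_nonneg : 0 ≤ y
  w_nonneg : 0 ≤ w
  top_le : ‖topRows m‖ ≤ K
  last_le : ‖lastRow m‖ ≤ K
  P_le : ‖P‖ ≤ K
  α_le : ‖α‖ ≤ K * y
  β_le : ‖β‖ ≤ K * y
  γ_le : ‖γ‖ ≤ K * w
  α_last_le : ‖α * (lastRow m)ᵀ‖ ≤ K * (ε * y)
  β_last_le : ‖β * (lastRow m)ᵀ‖ ≤ K * (ε * y)
  a1_le : ‖a1‖ ≤ K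
  a2_le : ‖a2‖ ≤ K * ε

lemma norm_add_le_of {V : Type*} [SeminormedAddCommGroup V] {x x' : V} {r r' : ℝ} (h : ‖x‖ ≤ r)
    (h' : ‖x'‖ ≤ r') : ‖x + x'‖ ≤ r + r' := (norm_add_le _ _).trans (add_le_add h h')

lemma norm_sub_le_of {V : Type*} [SeminormedAddCommGroup V] {x x' : V} {r r' : ℝ} (h : ‖x‖ ≤ r)
    (h' : ‖x'‖ ≤ r') : ‖x - x'‖ ≤ r + r' := (norm_sub_le _ _).trans (add_le_add h h')

/-! ### Error terms in the second derivatives of 𝓐 and 𝓑 -/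

namespace JetSizes

lemma tr_le {ι κ : Type*} [Fintype ι] [Fintype κ] {A : Matrix ι κ ℂ} {r : ℝ} (h : ‖A‖ ≤ r) :
    ‖Aᵀ‖ ≤ r := by rwa [frobenius_norm_transpose]

lemma ct_le {ι κ : Type*} [Fintype ι] [Fintype κ] {A : Matrix ι κ ℂ} {r : ℝ} (h : ‖A‖ ≤ r) :
    ‖Aᴴ‖ ≤ r := by rwa [frobenius_norm_conjTranspose]

lemma smul_le {ι κ : Type*} [Fintype ι] [Fintype κ] {A : Matrix ι κ ℂ} {r : ℝ} (c : ℝ) (hc : 0 ≤ c)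
    (h : ‖A‖ ≤ r) : ‖(c : ℂ) • A‖ ≤ c * r := by
  rw [norm_smul, Complex.norm_of_nonneg hc]; gcongr

lemma slope_term_le (s : JetSizes K ε y w α β γ P a1 a2) :
    ‖a2 * lastRow m * P * (topRows m)ᵀ + topRows m * P * (a2 * lastRow m)ᵀ‖ ≤ 2 * (K ^ 4 * ε) := by
  have h1 := frobenius_mul_le (frobenius_mul_le (frobenius_mul_le s.a2_le s.last_le) s.P_le)
    (tr_le s.top_le)
  have h2 := frobenius_mul_le (frobenius_mul_le s.top_le s.P_le)
    (tr_le (frobenius_mul_le s.a2_le s.last_le))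
  exact (norm_add_le_of h1 h2).trans (le_of_eq (by ring))

/-- The tangential part of h turns the blocks of αhα* and βhβ* into A₁A₁* and b₀b₀*. The first is
removed by the gauge term, the second agrees with bb* up to small terms. The ε⁻¹ part contributes
ε⁻¹·O(εy)², and the slope terms carry a factor ε. The defect of the second order equation is
subtracted because it vanishes only after summation over directions. -/
lemma mixed_error_le (s : JetSizes K ε y w α β γ P a1 a2) (hM : M = 1 + y ^ 2 + w ^ 2)
    {Δ J1 J2 A1 A3 b : Matrix _ _ ℂ} (hΔ : Δ = diagonal fun a => (lastWeight m ε a : ℂ))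
    (hJ1 : J1 = -(a1 * lastRow m)) (hJ2 : J2 = -(a2 * lastRow m))
    (hA1 : A1 = topRows m * α * (topRows m)ᵀ)
    (hA3 : A3 = (J2 * α + J1 * αᴴ + topRows m * η) * (topRows m)ᵀ + (J2 * Δ + topRows m * αᴴ) * J2ᴴ +
      (J1 * Δ + topRows m * α) * J1ᴴ - A1 * A1ᴴ)
    (hb : b = (J2 * P + topRows m * β) * (topRows m)ᵀ + topRows m * P * J2ᵀ) :
    ‖A3 - b * bᴴ - topRows m * (η - (α * hInv m ε * αᴴ + β * hInv m ε * βᴴ)) * (topRows m)ᵀ‖ ≤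
      16 * (K ^ 9 * (ε * M)) := by
  have hK := s.one_le
  have hε := s.eps_pos
  have hy := s.y_nonneg
  have hεc : (ε : ℂ) ≠ 0 := by exact_mod_cast hε.ne'
  obtain ⟨S, hS⟩ : ∃ S, S = a2 * lastRow m * P * (topRows m)ᵀ + topRows m * P * (a2 * lastRow m)ᵀ :=
    ⟨_, rfl⟩
  obtain ⟨b0, hb0⟩ : ∃ b0, b0 = topRows m * β * (topRows m)ᵀ := ⟨_, rfl⟩
  have hbS : b = b0 - S := by
    rw [hb, hS, hb0, hJ2, transpose_neg, Matrix.neg_mul, Matrix.mul_neg, Matrix.add_mul,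
      Matrix.neg_mul]
    abel
  obtain ⟨αe, hαe⟩ : ∃ αe, αe = α * (lastRow m)ᵀ := ⟨_, rfl⟩
  obtain ⟨βe, hβe⟩ : ∃ βe, βe = β * (lastRow m)ᵀ := ⟨_, rfl⟩
  -- The (τ, τ) entry of H is ε, so a product of two slope derivatives through H is small.
  have e0 (a a' : Matrix (Fin m) Unit ℂ) :
      a * (lastRow m * (Δ * ((lastRow m)ᵀ * a'ᴴ))) = (ε : ℂ) • (a * a'ᴴ) := by
    have := congrArg (fun X => a * X * a'ᴴ) (lastRow_mul_diagonal_mul_lastRow (m := m) ε)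
    rw [← hΔ] at this
    simpa only [Matrix.mul_assoc, Matrix.mul_smul, Matrix.smul_mul, Matrix.one_mul] using this
  have key : A3 - b * bᴴ - topRows m * (η - (α * hInv m ε * αᴴ + β * hInv m ε * βᴴ)) * (topRows m)ᵀ =
      -(a2 * lastRow m * α * (topRows m)ᵀ) - a1 * αeᴴ * (topRows m)ᵀ + (ε : ℂ) • (a2 * a2ᴴ) -
      topRows m * αᴴ * (lastRow m)ᵀ * a2ᴴ + (ε : ℂ) • (a1 * a1ᴴ) - topRows m * αe * a1ᴴ +
      (ε : ℂ)⁻¹ • (topRows m * αe * (topRows m * αe)ᴴ) +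
      (ε : ℂ)⁻¹ • (topRows m * βe * (topRows m * βe)ᴴ) + S * b0ᴴ + b0 * Sᴴ - S * Sᴴ := by
    rw [hbS, hA3, hA1, hb0, hJ1, hJ2, hInv_eq, hαe, hβe]
    simp only [conjTranspose_sub, conjTranspose_neg, conjTranspose_mul, topRows_transpose_conjTranspose,
      lastRow_transpose_conjTranspose,
      Matrix.mul_sub, Matrix.sub_mul, Matrix.mul_add, Matrix.add_mul, Matrix.neg_mul,
      Matrix.mul_neg, Matrix.smul_mul, Matrix.mul_smul, Matrix.mul_assoc, e0,
      lastRow_conjTranspose, topRows_conjTranspose]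
    abel
  rw [key]
  have hα := s.α_last_le
  have hβ := s.β_last_le
  rw [← hαe] at hα
  rw [← hβe] at hβ
  have hSn := hS ▸ s.slope_term_le
  have hb0n : ‖b0‖ ≤ K * (K * y) * K :=
    hb0 ▸ frobenius_mul_le (frobenius_mul_le s.top_le s.β_le) (tr_le s.top_le)
  have hy1 : y ≤ M := by rw [hM]; nlinarith [sq_nonneg (y - 1), sq_nonneg w]
  have hy2 : y ^ 2 ≤ M := by rw [hM]; nlinarith [sq_nonneg w]
  have h1M : 1 ≤ M := by rw [hM]; nlinarith [sq_nonneg w, sq_nonneg y]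
  have hεM : ε ≤ M := s.eps_le.trans h1M
  have bd {x r t : ℝ} (j : ℕ) (h : x ≤ r) (hr : r = K ^ j * (ε * t)) (ht : 0 ≤ t) (htM : t ≤ M)
      (hj : j ≤ 9) : x ≤ K ^ 9 * (ε * M) := h.trans (hr ▸ monomial_le hK hε.le ht htM hj)
  have t1 : ‖-(a2 * lastRow m * α * (topRows m)ᵀ)‖ ≤ K ^ 9 * (ε * M) := by
    rw [norm_neg]
    exact bd 4 (frobenius_mul_le (frobenius_mul_le (frobenius_mul_le s.a2_le s.last_le) s.α_le)
      (tr_le s.top_le)) (by ring) hy hy1 (by norm_num)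
  have t2 : ‖a1 * αeᴴ * (topRows m)ᵀ‖ ≤ K ^ 9 * (ε * M) :=
    bd 3 (frobenius_mul_le (frobenius_mul_le s.a1_le (ct_le hα)) (tr_le s.top_le)) (by ring) hy hy1
      (by norm_num)
  have t3 : ‖(ε : ℂ) • (a2 * a2ᴴ)‖ ≤ K ^ 9 * (ε * M) :=
    bd 2 (smul_le ε hε.le (frobenius_mul_le s.a2_le (ct_le s.a2_le)))
      (show _ = K ^ 2 * (ε * (ε ^ 2)) by ring) (by positivity)
      ((pow_le_of_le_one hε.le s.eps_le two_ne_zero).trans hεM) (by norm_num)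
  have t4 : ‖topRows m * αᴴ * (lastRow m)ᵀ * a2ᴴ‖ ≤ K ^ 9 * (ε * M) :=
    bd 4 (frobenius_mul_le (frobenius_mul_le (frobenius_mul_le s.top_le (ct_le s.α_le))
      (tr_le s.last_le)) (ct_le s.a2_le)) (by ring) hy hy1 (by norm_num)
  have t5 : ‖(ε : ℂ) • (a1 * a1ᴴ)‖ ≤ K ^ 9 * (ε * M) :=
    bd 2 (smul_le ε hε.le (frobenius_mul_le s.a1_le (ct_le s.a1_le)))
      (show _ = K ^ 2 * (ε * 1) by ring) zero_le_one h1M (by norm_num)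
  have t6 : ‖topRows m * αe * a1ᴴ‖ ≤ K ^ 9 * (ε * M) :=
    bd 3 (frobenius_mul_le (frobenius_mul_le s.top_le hα) (ct_le s.a1_le)) (by ring) hy hy1
      (by norm_num)
  have t7 {v : Matrix (Fin (m + 1)) Unit ℂ} (hv : ‖v‖ ≤ K * (ε * y)) :
      ‖(ε : ℂ)⁻¹ • (topRows m * v * (topRows m * v)ᴴ)‖ ≤ K ^ 9 * (ε * M) := by
    rw [← Complex.ofReal_inv]
    refine bd 4 (smul_le ε⁻¹ (inv_nonneg.2 hε.le) (frobenius_mul_le (frobenius_mul_le s.top_le hv)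
      (ct_le (frobenius_mul_le s.top_le hv)))) (show _ = K ^ 4 * (ε * (y ^ 2)) from ?_) (sq_nonneg y)
      hy2 (by norm_num)
    field_simp
  have t9 : ‖S * b0ᴴ‖ ≤ 2 * (K ^ 9 * (ε * M)) := by
    refine (frobenius_mul_le hSn (ct_le hb0n)).trans ?_
    have := monomial_le hK hε.le hy hy1 (show 7 ≤ 9 by norm_num)
    linarith
  have t10 : ‖b0 * Sᴴ‖ ≤ 2 * (K ^ 9 * (ε * M)) := by
    rw [← frobenius_norm_conjTranspose, conjTranspose_mul, conjTranspose_conjTranspose]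
    exact t9
  have t11 : ‖S * Sᴴ‖ ≤ 4 * (K ^ 9 * (ε * M)) := by
    refine (frobenius_mul_le hSn (ct_le hSn)).trans ?_
    have := monomial_le hK hε.le hε.le hεM (show 8 ≤ 9 by norm_num)
    linarith
  refine (norm_sub_le_of (norm_add_le_of (norm_add_le_of (norm_add_le_of (norm_add_le_of
    (norm_sub_le_of (norm_add_le_of (norm_sub_le_of (norm_add_le_of (norm_sub_le_of t1 t2) t3) t4) t5)
    t6) (t7 hα)) (t7 hβ)) t9) t10) t11).trans (le_of_eq (by ring))

/-- The same cancellation for 𝓑: the gauge terms A₁B₂ + B₂A₁ᵀ match the tangential part of αhβ +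
βhαᵀ. The terms with a₃ are kept apart, since a₃ is small only after summation over directions. -/
lemma hol_error_le (s : JetSizes K ε y w α β γ P a1 a2) (hM : M = 1 + y ^ 2 + w ^ 2) (hβs : βᵀ = β)
    (hPs : Pᵀ = P)
    {J1 J2 J3 A1 B2 B3 : Matrix _ _ ℂ}
    (hJ1 : J1 = -(a1 * lastRow m)) (hJ2 : J2 = -(a2 * lastRow m)) (hJ3 : J3 = -(a3 * lastRow m))
    (hA1 : A1 = topRows m * α * (topRows m)ᵀ)
    (hB2 : B2 = (J2 * P + topRows m * β) * (topRows m)ᵀ + topRows m * P * J2ᵀ)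
    (hB3 : B3 = (J3 * P + J2 * γ + J1 * β + topRows m * π) * (topRows m)ᵀ +
      (J2 * P + topRows m * β) * J1ᵀ + (J1 * P + topRows m * γ) * J2ᵀ + topRows m * P * J3ᵀ -
      A1 * B2 - B2 * A1ᵀ) :
    ‖B3 - topRows m * (π - (α * hInv m ε * β + β * hInv m ε * αᵀ)) * (topRows m)ᵀ +
      (a3 * lastRow m * P * (topRows m)ᵀ + topRows m * P * (a3 * lastRow m)ᵀ)‖ ≤
      16 * (K ^ 9 * (ε * M)) := by
  have hK := s.one_le
  have hε := s.eps_pos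
  have hy := s.y_nonneg
  have hw := s.w_nonneg
  have hεc : (ε : ℂ) ≠ 0 := by exact_mod_cast hε.ne'
  obtain ⟨S, hS⟩ : ∃ S, S = a2 * lastRow m * P * (topRows m)ᵀ + topRows m * P * (a2 * lastRow m)ᵀ :=
    ⟨_, rfl⟩
  obtain ⟨b0, hb0⟩ : ∃ b0, b0 = topRows m * β * (topRows m)ᵀ := ⟨_, rfl⟩
  have hbS : B2 = b0 - S := by
    rw [hB2, hS, hb0, hJ2, transpose_neg, Matrix.neg_mul, Matrix.mul_neg, Matrix.add_mul,
      Matrix.neg_mul]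
    abel
  obtain ⟨αe, hαe⟩ : ∃ αe, αe = α * (lastRow m)ᵀ := ⟨_, rfl⟩
  obtain ⟨βe, hβe⟩ : ∃ βe, βe = β * (lastRow m)ᵀ := ⟨_, rfl⟩
  have hβe' : lastRow m * β = βeᵀ := by rw [hβe, transpose_mul, transpose_transpose, hβs]
  have key : B3 - topRows m * (π - (α * hInv m ε * β + β * hInv m ε * αᵀ)) * (topRows m)ᵀ +
      (a3 * lastRow m * P * (topRows m)ᵀ + topRows m * P * (a3 * lastRow m)ᵀ) =
      -(a2 * lastRow m * γ * (topRows m)ᵀ) - a1 * βeᵀ * (topRows m)ᵀ +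
      a2 * lastRow m * P * (a1 * lastRow m)ᵀ - topRows m * βe * a1ᵀ +
      a1 * lastRow m * P * (a2 * lastRow m)ᵀ - topRows m * γ * (a2 * lastRow m)ᵀ +
      (ε : ℂ)⁻¹ • (topRows m * αe * (topRows m * βe)ᵀ) +
      (ε : ℂ)⁻¹ • (topRows m * βe * (topRows m * αe)ᵀ) + A1 * S + S * A1ᵀ := by
    have e1 : topRows m * βe * (topRows m * αe)ᵀ =
        topRows m * β * (lastRow m)ᵀ * lastRow m * αᵀ * (topRows m)ᵀ := by
      rw [hβe, hαe]; simp only [transpose_mul, transpose_transpose, Matrix.mul_assoc]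
    have e2 : topRows m * αe * (topRows m * βe)ᵀ =
        topRows m * α * (lastRow m)ᵀ * lastRow m * β * (topRows m)ᵀ := by
      rw [hβe, hαe]; simp only [transpose_mul, transpose_transpose, Matrix.mul_assoc, hβs]
    rw [e1, e2, ← hβe', hB3, hbS, hA1, hb0, hJ1, hJ2, hJ3, hInv_eq, hβe]
    simp only [transpose_neg, transpose_mul, transpose_transpose,
      Matrix.mul_sub, Matrix.sub_mul, Matrix.mul_add, Matrix.add_mul, Matrix.neg_mul,
      Matrix.mul_neg, Matrix.smul_mul, Matrix.mul_smul, Matrix.mul_assoc]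
    abel
  rw [key]
  have hα := s.α_last_le
  have hβ := s.β_last_le
  rw [← hαe] at hα
  rw [← hβe] at hβ
  have hSn := hS ▸ s.slope_term_le
  have hA1n : ‖A1‖ ≤ K * (K * y) * K :=
    hA1 ▸ frobenius_mul_le (frobenius_mul_le s.top_le s.α_le) (tr_le s.top_le)
  have hy1 : y ≤ M := by rw [hM]; nlinarith [sq_nonneg (y - 1), sq_nonneg w]
  have hw1 : w ≤ M := by rw [hM]; nlinarith [sq_nonneg (w - 1), sq_nonneg y]
  have hy2 : y ^ 2 ≤ M := by rw [hM]; nlinarith [sq_nonneg w]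
  have h1M : 1 ≤ M := by rw [hM]; nlinarith [sq_nonneg w, sq_nonneg y]
  have bd {x r t : ℝ} (j : ℕ) (h : x ≤ r) (hr : r = K ^ j * (ε * t)) (ht : 0 ≤ t) (htM : t ≤ M)
      (hj : j ≤ 9) : x ≤ K ^ 9 * (ε * M) := h.trans (hr ▸ monomial_le hK hε.le ht htM hj)
  have t1 : ‖-(a2 * lastRow m * γ * (topRows m)ᵀ)‖ ≤ K ^ 9 * (ε * M) := by
    rw [norm_neg]
    exact bd 4 (frobenius_mul_le (frobenius_mul_le (frobenius_mul_le s.a2_le s.last_le) s.γ_le)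
      (tr_le s.top_le)) (by ring) hw hw1 (by norm_num)
  have t2 : ‖a1 * βeᵀ * (topRows m)ᵀ‖ ≤ K ^ 9 * (ε * M) :=
    bd 3 (frobenius_mul_le (frobenius_mul_le s.a1_le (tr_le hβ)) (tr_le s.top_le)) (by ring) hy hy1
      (by norm_num)
  have t3 : ‖a2 * lastRow m * P * (a1 * lastRow m)ᵀ‖ ≤ K ^ 9 * (ε * M) :=
    bd 5 (frobenius_mul_le (frobenius_mul_le (frobenius_mul_le s.a2_le s.last_le) s.P_le)
      (tr_le (frobenius_mul_le s.a1_le s.last_le))) (show _ = K ^ 5 * (ε * 1) by ring) zero_le_one h1M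
      (by norm_num)
  have t4 : ‖topRows m * βe * a1ᵀ‖ ≤ K ^ 9 * (ε * M) :=
    bd 3 (frobenius_mul_le (frobenius_mul_le s.top_le hβ) (tr_le s.a1_le)) (by ring) hy hy1
      (by norm_num)
  have t5 : ‖a1 * lastRow m * P * (a2 * lastRow m)ᵀ‖ ≤ K ^ 9 * (ε * M) :=
    bd 5 (frobenius_mul_le (frobenius_mul_le (frobenius_mul_le s.a1_le s.last_le) s.P_le)
      (tr_le (frobenius_mul_le s.a2_le s.last_le))) (show _ = K ^ 5 * (ε * 1) by ring) zero_le_one h1M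
      (by norm_num)
  have t6 : ‖topRows m * γ * (a2 * lastRow m)ᵀ‖ ≤ K ^ 9 * (ε * M) :=
    bd 4 (frobenius_mul_le (frobenius_mul_le s.top_le s.γ_le)
      (tr_le (frobenius_mul_le s.a2_le s.last_le))) (by ring) hw hw1 (by norm_num)
  have t7 {u v : Matrix (Fin (m + 1)) Unit ℂ} (hu : ‖u‖ ≤ K * (ε * y)) (hv : ‖v‖ ≤ K * (ε * y)) :
      ‖(ε : ℂ)⁻¹ • (topRows m * u * (topRows m * v)ᵀ)‖ ≤ K ^ 9 * (ε * M) := by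
    rw [← Complex.ofReal_inv]
    refine bd 4 (smul_le ε⁻¹ (inv_nonneg.2 hε.le) (frobenius_mul_le (frobenius_mul_le s.top_le hu)
      (tr_le (frobenius_mul_le s.top_le hv)))) (show _ = K ^ 4 * (ε * (y ^ 2)) from ?_) (sq_nonneg y)
      hy2 (by norm_num)
    field_simp
  have t9 : ‖A1 * S‖ ≤ 2 * (K ^ 9 * (ε * M)) := by
    refine (frobenius_mul_le hA1n hSn).trans ?_
    have := monomial_le hK hε.le hy hy1 (show 7 ≤ 9 by norm_num)
    linarith
  have t10 : ‖S * A1ᵀ‖ ≤ 2 * (K ^ 9 * (ε * M)) := by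
    have hSs : Sᵀ = S := by
      rw [hS]
      simp only [transpose_add, transpose_mul, transpose_transpose, hPs, Matrix.mul_assoc]
      rw [add_comm]
    rw [← frobenius_norm_transpose, transpose_mul, transpose_transpose, hSs]
    exact t9
  refine (norm_add_le_of (norm_add_le_of (norm_add_le_of (norm_add_le_of
    (norm_sub_le_of (norm_add_le_of (norm_sub_le_of (norm_add_le_of (norm_sub_le_of t1 t2) t3) t4) t5)
    t6) (t7 hα hβ)) (t7 hβ hα)) t9) t10).trans ?_
  have : 0 ≤ K ^ 9 * (ε * M) := (norm_nonneg _).trans t1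
  linarith

end JetSizes
end
end
end

noncomputable section
open Matrix

/-! ## The second variation of `tr (1 - K)⁻¹` summed over directions -/

section
attribute [local instance] Matrix.frobeniusNormedAddCommGroup Matrix.frobeniusNormedSpace

section
variable {m n : ℕ} {R B0 : Matrix (Fin m) (Fin m) ℂ}

/-- The part of the second variation of `tr (1 - K)⁻¹` that is linear in second derivatives. -/
def traceVariation (R B0 X Y : Matrix (Fin m) (Fin m) ℂ) : ℂ :=
  (X * R).trace - (R * X * R).trace + (R * ((Y - B0 * X.map star) * B0ᴴ + B0 * Yᴴ) * R).trace

lemma traceVariation_add (X X' Y Y' : Matrix (Fin m) (Fin m) ℂ) :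
    traceVariation R B0 (X + X') (Y + Y') = traceVariation R B0 X Y + traceVariation R B0 X' Y' := by
  have h : (X + X').map star = X.map star + X'.map star := by ext i j; simp
  simp only [traceVariation, h, conjTranspose_add, Matrix.mul_add, Matrix.add_mul, Matrix.mul_sub,
    Matrix.sub_mul, trace_add, trace_sub]
  ring

lemma traceVariation_sum {ι : Type*} (s : Finset ι) (X Y : ι → Matrix (Fin m) (Fin m) ℂ) :
    traceVariation R B0 (∑ k ∈ s, X k) (∑ k ∈ s, Y k) = ∑ k ∈ s, traceVariation R B0 (X k) (Y k) := by
  classical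
  induction s using Finset.induction_on with
  | empty =>
    have h := traceVariation_add (R := R) (B0 := B0) 0 0 0 0
    rw [add_zero] at h
    simpa using h
  | insert k s hk ih => rw [Finset.sum_insert hk, Finset.sum_insert hk, Finset.sum_insert hk,
      traceVariation_add, ih]

lemma norm_traceVariation_le {K e : ℝ} (hK : 1 ≤ K) (hm : (m : ℝ) ≤ K) (hR : ‖R‖ ≤ K)
    (hB : ‖B0‖ ≤ K) {X Y : Matrix (Fin m) (Fin m) ℂ} (hX : ‖X‖ ≤ e) (hY : ‖Y‖ ≤ e) :
    ‖traceVariation R B0 X Y‖ ≤ 5 * K ^ 5 * e := by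
  have he : 0 ≤ e := (norm_nonneg _).trans hX
  have htr {A : Matrix (Fin m) (Fin m) ℂ} {r : ℝ} (h : ‖A‖ ≤ r) : ‖A.trace‖ ≤ K * r := by
    refine (norm_trace_le_frobenius A).trans ?_
    rw [Fintype.card_fin]
    exact mul_le_mul hm h (norm_nonneg _) (by linarith)
  have hXs : ‖X.map star‖ ≤ e := by rwa [frobenius_norm_map_eq _ _ fun a => norm_star a]
  have hBs : ‖B0ᴴ‖ ≤ K := JetSizes.ct_le hB
  have h1 := htr (frobenius_mul_le hX hR)
  have h2 := htr (frobenius_mul_le (frobenius_mul_le hR hX) hR)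
  have h3 := htr (frobenius_mul_le (frobenius_mul_le hR (norm_add_le_of (frobenius_mul_le
    (norm_sub_le_of hY (frobenius_mul_le hB hXs)) hBs) (frobenius_mul_le hB (JetSizes.ct_le hY)))) hR)
  refine (norm_add_le_of (norm_sub_le_of h1 h2) h3).trans ?_
  have hp (j : ℕ) (hj : j ≤ 5) : K ^ j * e ≤ K ^ 5 * e :=
    mul_le_mul_of_nonneg_right (pow_le_pow_right₀ hK hj) he
  have p2 := hp 2 (by norm_num)
  have p3 := hp 3 (by norm_num)
  have p4 := hp 4 (by norm_num)
  calc _ = K ^ 2 * e + K ^ 3 * e + (2 * (K ^ 4 * e) + K ^ 5 * e) := by ring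
    _ ≤ _ := by linarith

/-- A lower bound for the sum of the mixed derivatives in `exists_hasJet_trace_mul_inv`. -/
lemma sum_trace_jet_ge (hR : (1 - B0 * B0ᴴ).PosDef) (hQ : (1 - B0ᴴ * B0).PosDef)
    (hRe : R = (1 - B0 * B0ᴴ)⁻¹) {K e : ℝ} (hK : 1 ≤ K) (hm : (m : ℝ) ≤ K) (hRK : ‖R‖ ≤ K)
    (hB : ‖B0‖ ≤ K) {b c A3 B3 : Fin n → Matrix (Fin m) (Fin m) ℂ} (hb : ∀ k, (b k)ᵀ = b k)
    (hA3 : ‖∑ k, (A3 k - b k * (b k)ᴴ)‖ ≤ e) (hB3 : ‖∑ k, B3 k‖ ≤ e) :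
    -(5 * K ^ 5 * e) ≤ ∑ k,
      ((A3 k * R).trace + (R * (c k * B0ᴴ + B0 * (b k)ᴴ) * R * (c k * B0ᴴ + B0 * (b k)ᴴ)ᴴ * R).trace +
        (R * (c k * B0ᴴ + B0 * (b k)ᴴ)ᴴ * R * (c k * B0ᴴ + B0 * (b k)ᴴ) * R).trace -
        (R * A3 k * R).trace +
        (R * ((B3 k - B0 * (A3 k).map star) * B0ᴴ + b k * (b k)ᴴ + c k * (c k)ᴴ +
          B0 * (B3 k)ᴴ) * R).trace).re := by
  -- Replacing A₃ by bb* and B₃ by 0 gives the nonnegative leading part; the remainder is linear in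
  -- A₃ - bb* and B₃.
  have key (k) : 0 + (traceVariation R B0 (A3 k - b k * (b k)ᴴ) (B3 k)).re ≤
      ((A3 k * R).trace + (R * (c k * B0ᴴ + B0 * (b k)ᴴ) * R * (c k * B0ᴴ + B0 * (b k)ᴴ)ᴴ * R).trace +
        (R * (c k * B0ᴴ + B0 * (b k)ᴴ)ᴴ * R * (c k * B0ᴴ + B0 * (b k)ᴴ) * R).trace -
        (R * A3 k * R).trace +
        (R * ((B3 k - B0 * (A3 k).map star) * B0ᴴ + b k * (b k)ᴴ + c k * (c k)ᴴ +
          B0 * (B3 k)ᴴ) * R).trace).re := by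
    refine (add_le_add (leading_part_nonneg hR hQ (b k) (c k) hRe rfl) le_rfl).trans (le_of_eq ?_)
    rw [← Complex.add_re]
    congr 1
    obtain ⟨F, hF⟩ : ∃ F, F = c k * B0ᴴ + B0 * (b k)ᴴ := ⟨_, rfl⟩
    have h1 : (A3 k - b k * (b k)ᴴ).map star = (A3 k).map star - (b k)ᴴ * b k := by
      have : (b k * (b k)ᴴ).map star = (b k)ᴴ * b k := by
        have e : (b k)ᴴ.map star = (b k)ᵀ := by ext i j; simp
        rw [map_star_mul, ← conjTranspose_eq_map_star (hb k), e, hb k]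
      rw [← this]; ext i j; exact star_sub _ _
    rw [← hF, traceVariation, h1]
    simp only [Matrix.mul_add, Matrix.add_mul, Matrix.mul_sub, Matrix.sub_mul, trace_add, trace_sub,
      Matrix.mul_neg, Matrix.neg_mul, trace_neg]
    ring
  refine le_trans ?_ (Finset.sum_le_sum fun k _ => key k)
  simp only [zero_add]
  -- By linearity, with R and B₀ independent of the direction, only the sums of the remainders
  -- matter, and these are small.
  rw [← Complex.re_sum, ← traceVariation_sum]
  have h := norm_traceVariation_le (R := R) (B0 := B0) hK hm hRK hB hA3 hB3
  have h2 := Complex.abs_re_le_norm (traceVariation R B0 (∑ k, (A3 k - b k * (b k)ᴴ)) (∑ k, B3 k))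
  linarith [(abs_le.1 (h2.trans h)).1]

end
end

/-! ## Removing the first derivative of `A` -/

section
variable {m n : ℕ} {p v : Cn n}

/-- A coordinate in which v has a nonzero component, recentred at p and divided by that component.
-/
lemma exists_hasJet_linear (hv : v ≠ 0) (p : Cn n) :
    ∃ l : Cn n → ℂ, HasJet p (holVec v) (conjVec (holVec v)) l 0 1 0 0 := by
  obtain ⟨i, hi⟩ : ∃ i, v i ≠ 0 := by
    by_contra! h
    exact hv (by ext i; simpa using h i)
  have h := (((hasJet_coord p (holVec v) (conjVec (holVec v)) i).sub (HasJet.const (p i))).const_mul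
    (v i)⁻¹)
  simp only [conjVec_holVec, holVec_fst_add, antiVec_fst_add, sub_self, mul_zero, sub_zero,
    inv_mul_cancel₀ hi] at h ⊢
  exact ⟨_, h⟩

/-- Jets after a holomorphic change of gauge that kills the first derivative of `A`. -/
lemma exists_hasMJet_gauge (hv : v ≠ 0) {A B : Cn n → Matrix (Fin m) (Fin m) ℂ}
    {A1 A3 B0 B1 B2 B3 : Matrix (Fin m) (Fin m) ℂ}
    (hA : HasMJet p (holVec v) (conjVec (holVec v)) A 1 A1 A1ᴴ A3)
    (hB : HasMJet p (holVec v) (conjVec (holVec v)) B B0 B1 B2 B3) :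
    ∃ (g : Cn n → Matrix (Fin m) (Fin m) ℂ) (c : Matrix (Fin m) (Fin m) ℂ),
      (∀ᶠ z in nhds p, (g z).det ≠ 0) ∧
      HasMJet p (holVec v) (conjVec (holVec v)) (fun z => g z * A z * (g z)ᴴ) 1 0 0 (A3 - A1 * A1ᴴ) ∧
      HasMJet p (holVec v) (conjVec (holVec v)) (fun z => g z * B z * (g z)ᵀ) B0 c B2
        (B3 - A1 * B2 - B2 * A1ᵀ) := by
  obtain ⟨l, hl⟩ := exists_hasJet_linear hv p
  -- The gauge 1 - l·A₁ has vanishing (0,1)-derivative, so it cancels the first derivatives A₁ and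
  -- A₁* while changing the mixed derivative only by -A₁A₁*.
  have hg : HasMJet p (holVec v) (conjVec (holVec v)) (fun z => 1 - l z • A1) 1 (-A1) 0 0 := by
    intro i j
    have := (HasJet.const ((1 : Matrix (Fin m) (Fin m) ℂ) i j)).sub (hl.mul (HasJet.const (A1 i j)))
    simpa using this
  refine ⟨fun z => 1 - l z • A1, B1 - A1 * B0 - B0 * A1ᵀ, ?_, ?_, ?_⟩
  · have h := (HasMJet.contDiffAt_det fun i j => (hg i j).smooth).continuousAt
    refine h.eventually_ne ?_
    have h0 : (fun z => 1 - l z • A1) p = 1 := by ext i j; exact (hg i j).val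
    simp only [h0] 
    simp
  · have := (hg.mul hA).mul hg.conjTranspose
    convert this using 1 <;> simp [neg_add_eq_sub]
  · have := (hg.mul hB).mul hg.transpose
    convert this using 1
    · simp
    · simp [sub_eq_add_neg, add_comm]
    · simp
    · simp [sub_eq_add_neg, add_comm]

end
end

noncomputable section
open Matrix

/-! ## Jets of `A` and `B` in an adapted frame -/

section
variable {m n : ℕ} {p : Cn n} {X Y : Cn n × Cn n}

/-- The slopes d_α/d_τ vanish at p, which removes most terms of the quotient rule. -/
lemma HasMJet.tangentMatrix {d : Cn n → Fin (m + 1) → ℂ} {f0 f1 f2 f3 : Fin (m + 1) → ℂ} {r : ℂ}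
    (hd : ∀ a, HasJet p X Y (fun z => d z a) (f0 a) (f1 a) (f2 a) (f3 a))
    (h0 : ∀ α : Fin m, f0 α.castSucc = 0) (hr : f0 (Fin.last m) = r) (hr0 : r ≠ 0)
    {a1 a2 a3 : Matrix (Fin m) Unit ℂ} (h1 : a1 = of fun α _ => f1 α.castSucc / r)
    (h2 : a2 = of fun α _ => f2 α.castSucc / r)
    (h3 : a3 = of fun α _ => f3 α.castSucc / r -
      (f2 α.castSucc * f1 (Fin.last m) + f1 α.castSucc * f2 (Fin.last m)) / r ^ 2) :
    HasMJet p X Y (fun z => _root_.tangentMatrix (d z)) (topRows m) (-(a1 * lastRow m))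
      (-(a2 * lastRow m)) (-(a3 * lastRow m)) := by
  have hs : HasMJet p X Y (fun z => slopeCol (d z)) 0 a1 a2 a3 := by
    intro α _
    have h := (hd α.castSucc).div (hd (Fin.last m)) (by rw [hr]; exact hr0)
    rw [h0, hr] at h
    simp only [zero_mul, zero_div, sub_zero, add_zero] at h
    rw [h1, h2, h3]
    exact h
  have h := (HasMJet.const (p := p) (X := X) (Y := Y) (topRows m)).sub
    (hs.mul (HasMJet.const (lastRow m)))
  simp only [Matrix.mul_zero, Matrix.zero_mul, add_zero, sub_zero, zero_sub] at h
  exact h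

variable {ε : ℝ} {α β γ η π P Δ : Matrix (Fin (m + 1)) (Fin (m + 1)) ℂ}
  {a1 a2 a3 : Matrix (Fin m) Unit ℂ} {J1 J2 J3 : Matrix (Fin m) (Fin (m + 1)) ℂ}

/-- H is diagonal at the point, so derivatives of the tangent matrix, which are multiples of the
last row, are H-orthogonal to the tangential rows. They do not enter the first derivatives of 𝓐, and
J₃ does not enter the mixed one. -/
lemma HasMJet.mixed_congruence {J : Cn n → Matrix (Fin m) (Fin (m + 1)) ℂ}
    {H : Cn n → Matrix (Fin (m + 1)) (Fin (m + 1)) ℂ}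
    (hJ : HasMJet p X (conjVec X) J (topRows m) J1 J2 J3)
    (hH : HasMJet p X (conjVec X) H Δ α αᴴ η)
    (hΔ : Δ = diagonal fun a => (lastWeight m ε a : ℂ))
    (hJ1 : J1 = -(a1 * lastRow m)) (hJ2 : J2 = -(a2 * lastRow m)) (hJ3 : J3 = -(a3 * lastRow m)) :
    HasMJet p X (conjVec X) (fun z => J z * H z * (J z)ᴴ) 1 (topRows m * α * (topRows m)ᵀ)
      (topRows m * α * (topRows m)ᵀ)ᴴ
      ((J2 * α + J1 * αᴴ + topRows m * η) * (topRows m)ᵀ + (J2 * Δ + topRows m * αᴴ) * J2ᴴ +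
        (J1 * Δ + topRows m * α) * J1ᴴ) := by
  have hz (a : Matrix (Fin m) Unit ℂ) : a * lastRow m * Δ * (topRows m)ᵀ = 0 := by
    rw [Matrix.mul_assoc a, Matrix.mul_assoc a, hΔ, lastRow_mul_diagonal_mul_topRows, Matrix.mul_zero]
  have hz' (a : Matrix (Fin m) Unit ℂ) : topRows m * Δ * (a * lastRow m)ᴴ = 0 := by
    have hΔh : Δᴴ = Δ := by
      rw [hΔ, diagonal_conjTranspose]
      congr 1; funext a; simp
    have := congrArg Matrix.conjTranspose (hz a)
    rw [conjTranspose_mul, conjTranspose_mul, topRows_transpose_conjTranspose, hΔh,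
      conjTranspose_zero, ← Matrix.mul_assoc] at this
    exact this
  have h1 : topRows m * Δ * (topRows m)ᵀ = 1 := by rw [hΔ, topRows_mul_diagonal_mul]
  have h := (hJ.mul hH).mul hJ.conjTranspose
  rw [topRows_conjTranspose, h1] at h
  have e1 : (J1 * Δ + topRows m * α) * (topRows m)ᵀ + topRows m * Δ * J2ᴴ =
      topRows m * α * (topRows m)ᵀ := by
    rw [hJ1, hJ2, conjTranspose_neg, Matrix.mul_neg, hz', Matrix.add_mul, Matrix.neg_mul,
      Matrix.neg_mul, hz]
    simp
  have e2 : (J2 * Δ + topRows m * αᴴ) * (topRows m)ᵀ + topRows m * Δ * J1ᴴ =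
      (topRows m * α * (topRows m)ᵀ)ᴴ := by
    rw [hJ1, hJ2, conjTranspose_neg, Matrix.mul_neg, hz', Matrix.add_mul, Matrix.neg_mul,
      Matrix.neg_mul, hz, conjTranspose_mul, conjTranspose_mul, topRows_transpose_conjTranspose,
      topRows_conjTranspose, Matrix.mul_assoc]
    simp
  have e3 : (J3 * Δ + J2 * α + J1 * αᴴ + topRows m * η) * (topRows m)ᵀ +
      (J2 * Δ + topRows m * αᴴ) * J2ᴴ + (J1 * Δ + topRows m * α) * J1ᴴ + topRows m * Δ * J3ᴴ =
      (J2 * α + J1 * αᴴ + topRows m * η) * (topRows m)ᵀ + (J2 * Δ + topRows m * αᴴ) * J2ᴴ +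
        (J1 * Δ + topRows m * α) * J1ᴴ := by
    have h3 : J3 * Δ * (topRows m)ᵀ = 0 := by rw [hJ3, Matrix.neg_mul, Matrix.neg_mul, hz, neg_zero]
    have h3' : topRows m * Δ * J3ᴴ = 0 := by
      rw [hJ3, conjTranspose_neg, Matrix.mul_neg, hz', neg_zero]
    rw [h3', add_zero, add_assoc (J3 * Δ), add_assoc (J3 * Δ), Matrix.add_mul (J3 * Δ), h3, zero_add]
  rw [e1, e2, e3] at h
  exact h

lemma HasMJet.hol_congruence {J : Cn n → Matrix (Fin m) (Fin (m + 1)) ℂ}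
    {F : Cn n → Matrix (Fin (m + 1)) (Fin (m + 1)) ℂ}
    (hJ : HasMJet p X Y J (topRows m) J1 J2 J3) (hF : HasMJet p X Y F P γ β π) :
    ∃ B1, HasMJet p X Y (fun z => J z * F z * (J z)ᵀ) (topRows m * P * (topRows m)ᵀ) B1
      ((J2 * P + topRows m * β) * (topRows m)ᵀ + topRows m * P * J2ᵀ)
      ((J3 * P + J2 * γ + J1 * β + topRows m * π) * (topRows m)ᵀ +
        (J2 * P + topRows m * β) * J1ᵀ + (J1 * P + topRows m * γ) * J2ᵀ + topRows m * P * J3ᵀ) :=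
  ⟨_, (hJ.mul hF).mul hJ.transpose⟩

/-- A function and its transpose agree near p, so their jets agree. -/
lemma HasMJet.isSymm {B : Cn n → Matrix (Fin m) (Fin m) ℂ} {B0 B1 B2 B3 : Matrix (Fin m) (Fin m) ℂ}
    (h : HasMJet p X Y B B0 B1 B2 B3) (hB : ∀ᶠ z in nhds p, (B z)ᵀ = B z) :
    B0ᵀ = B0 ∧ B1ᵀ = B1 ∧ B2ᵀ = B2 ∧ B3ᵀ = B3 := by
  have h' := h.transpose.congr hB
  exact ⟨by ext i j; exact ((h' i j).uniq (h i j)).1, by ext i j; exact ((h' i j).uniq (h i j)).2.1,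
    by ext i j; exact ((h' i j).uniq (h i j)).2.2.1, by ext i j; exact ((h' i j).uniq (h i j)).2.2.2⟩

end

/-! ### Jets of tr(I - 𝓚)⁻¹ along adapted directions -/

namespace EquationAt
variable {m : ℕ} {N T : Matrix (Fin (m + 1)) (Fin (m + 1)) ℂ} {ε Λ κ : ℝ} {Ω : Set (Cn (m + 1))}
  {Φ : Cn (m + 1) → ℝ} {p : Cn (m + 1)}

/-- A zero direction would give B a zero row. Nonvanishing is needed for the holomorphic gauge along
the direction. -/
lemma dir_ne_zero (E : EquationAt N ε Ω Φ p T) (hN : N.det ≠ 0) (hε : 0 < ε) (k : Fin (m + 1)) :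
    dir N T ε k ≠ 0 := by
  intro h
  have hu : IsUnit T.det := isUnit_iff_ne_zero.2 E.det_frame
  have h1 (i) : (dirMatrix ε (N * Tᴴ) * T) k i = 0 := by
    have := congrArg (fun v : Cn (m + 1) => v i) h
    simp only [dir, frameOf, stdFrame] at this
    rw [mul_apply]
    simpa [Finset.sum_apply, Pi.single_apply, Finset.mul_sum] using this
  have h2 (b) : dirMatrix ε (N * Tᴴ) k b = 0 := by
    rw [← mul_nonsing_inv_cancel_right (A := T) (dirMatrix ε (N * Tᴴ)) hu, mul_apply]
    exact Finset.sum_eq_zero fun i _ => by rw [h1, zero_mul]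
  refine E.det_metric_ne hN (det_eq_zero_of_row_eq_zero k fun b => ?_)
  have := h2 b
  rw [dirMatrix_apply] at this
  have hw : (dirWeight m ε b : ℂ) ≠ 0 := by exact_mod_cast (dirWeight_pos hε b).ne'
  exact (mul_eq_zero.1 this).resolve_right hw

/-- The jets of `tr (1 - K)⁻¹` along an adapted direction. -/
lemma exists_hasJet_traceInv (E : EquationAt N ε Ω Φ p T) (hN : N.det ≠ 0) (hε : 0 < ε)
    {S : Matrix (Fin (m + 1)) (Fin (m + 1)) ℂ} (hS : S.det ≠ 0)
    (hSl : grad (frameOf S) Φ p (Fin.last m) ≠ 0) (h0 : ∀ α : Fin m, grad (frameOf T) Φ p α.castSucc = 0)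
    {r : ℂ} (hr : grad (frameOf T) Φ p (Fin.last m) = r) (hr0 : r ≠ 0)
    {B0 : Matrix (Fin m) (Fin m) ℂ}
    (hB0 : B0 = topRows m * holHess (frameOf T) Φ p * (topRows m)ᵀ)
    (hdet : (1 - B0 * B0ᴴ).det ≠ 0) {R : Matrix (Fin m) (Fin m) ℂ} (hR : R = (1 - B0 * B0ᴴ)⁻¹)
    (k : Fin (m + 1)) {f1 f2 f3 : Fin (m + 1) → ℂ}
    (hf1 : f1 = fun a => ∑ b, dirMatrix ε (N * Tᴴ) k b * holHess (frameOf T) Φ p b a)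
    (hf2 : f2 = fun a => ∑ b, star (dirMatrix ε (N * Tᴴ) k b) * mixedHess (frameOf T) Φ p a b)
    (hf3 : f3 = fun a => ∑ b, ∑ c, dirMatrix ε (N * Tᴴ) k b * third (frameOf T) Φ p a b c *
      star (dirMatrix ε (N * Tᴴ) k c))
    {a1 a2 a3 : Matrix (Fin m) Unit ℂ} (ha1 : a1 = of fun α _ => f1 α.castSucc / r)
    (ha2 : a2 = of fun α _ => f2 α.castSucc / r)
    (ha3 : a3 = of fun α _ => f3 α.castSucc / r -
      (f2 α.castSucc * f1 (Fin.last m) + f1 α.castSucc * f2 (Fin.last m)) / r ^ 2)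
    {α β γ η π P Δ : Matrix (Fin (m + 1)) (Fin (m + 1)) ℂ}
    (hα : α = mixedDeriv (dirMatrix ε (N * Tᴴ) k) (third (frameOf T) Φ p))
    (hβ : β = holDeriv (dirMatrix ε (N * Tᴴ) k) (third (frameOf T) Φ p))
    (hγ : γ = of fun a b => dHol (dir N T ε k) (fun z => holHess (frameOf T) Φ z a b) p)
    (hη : η = lineLaplacian (dir N T ε k) (mixedHess (frameOf T) Φ) p)
    (hπ : π = lineLaplacian (dir N T ε k) (holHess (frameOf T) Φ) p)
    (hP : P = holHess (frameOf T) Φ p) (hΔ : Δ = diagonal fun a => (lastWeight m ε a : ℂ))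
    {J1 J2 J3 : Matrix (Fin m) (Fin (m + 1)) ℂ}
    (hJ1 : J1 = -(a1 * lastRow m)) (hJ2 : J2 = -(a2 * lastRow m)) (hJ3 : J3 = -(a3 * lastRow m))
    {A1 A3 B2 B3 : Matrix (Fin m) (Fin m) ℂ}
    (hA1 : A1 = topRows m * α * (topRows m)ᵀ)
    (hA3 : A3 = (J2 * α + J1 * αᴴ + topRows m * η) * (topRows m)ᵀ + (J2 * Δ + topRows m * αᴴ) * J2ᴴ +
      (J1 * Δ + topRows m * α) * J1ᴴ - A1 * A1ᴴ)
    (hB2 : B2 = (J2 * P + topRows m * β) * (topRows m)ᵀ + topRows m * P * J2ᵀ)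
    (hB3 : B3 = (J3 * P + J2 * γ + J1 * β + topRows m * π) * (topRows m)ᵀ +
      (J2 * P + topRows m * β) * J1ᵀ + (J1 * P + topRows m * γ) * J2ᵀ + topRows m * P * J3ᵀ -
      A1 * B2 - B2 * A1ᵀ) :
    B2ᵀ = B2 ∧ ∃ (c : Matrix (Fin m) (Fin m) ℂ) (g0 g1 g2 : ℂ),
      HasJet p (holVec (dir N T ε k)) (conjVec (holVec (dir N T ε k)))
      (toC (traceInv (frameOf S) Φ)) g0 g1 g2
      (((A3 * R).trace + (R * (c * B0ᴴ + B0 * B2ᴴ) * R * (c * B0ᴴ + B0 * B2ᴴ)ᴴ * R).trace +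
        (R * (c * B0ᴴ + B0 * B2ᴴ)ᴴ * R * (c * B0ᴴ + B0 * B2ᴴ) * R).trace -
        (R * A3 * R).trace +
        (R * ((B3 - B0 * A3.map star) * B0ᴴ + B2 * B2ᴴ + c * cᴴ +
          B0 * B3ᴴ) * R).trace).re : ℂ) := by
  obtain ⟨X, hX⟩ : ∃ X, X = holVec (dir N T ε k) := ⟨_, rfl⟩
  have hJ : HasMJet p X (conjVec X) (fun z => tangentMatrix (grad (frameOf T) Φ z)) (topRows m)
      J1 J2 J3 := by
    rw [hJ1, hJ2, hJ3, hX]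
    refine HasMJet.tangentMatrix (fun a => ?_) h0 hr hr0 ha1 ha2 ha3
    rw [hf1, hf2, hf3]
    exact hasJet_grad E.isOpen E.smooth E.mem (frameOf T) (dirMatrix ε (N * Tᴴ) k) a
  have hH : HasMJet p X (conjVec X) (mixedHess (frameOf T) Φ) Δ α αᴴ η := by
    rw [hα, hη, hX, hΔ, ← E.mixedHess_eq]
    exact hasMJet_mixedHess E.isOpen E.smooth E.mem (frameOf T) (dirMatrix ε (N * Tᴴ) k)
  have hF : HasMJet p X (conjVec X) (holHess (frameOf T) Φ) P γ β π := by
    rw [hβ, hγ, hπ, hX, hP]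
    exact hasMJet_holHess E.isOpen E.smooth E.mem (frameOf T) (dirMatrix ε (N * Tᴴ) k)
  have hA := hJ.mixed_congruence hH hΔ hJ1 hJ2 hJ3
  obtain ⟨B1, hB⟩ := hJ.hol_congruence hF
  rw [← hA1] at hA
  rw [← hB2, hP, ← hB0] at hB
  rw [← hP] at hB
  rw [hX] at hA hB
  obtain ⟨g, c, hg, hA', hB'⟩ := exists_hasMJet_gauge (E.dir_ne_zero hN hε k) hA hB
  rw [← hA3] at hA'
  rw [← hB3] at hB'
  have hΩ : ∀ᶠ z in nhds p, z ∈ Ω := E.isOpen.mem_nhds E.mem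
  obtain ⟨s0, s1, s2, s3⟩ := hB'.isSymm (by
    filter_upwards [hΩ] with z hz
    simp only [transpose_mul, transpose_transpose, holHess_isSymm E.isOpen E.smooth hz,
      Matrix.mul_assoc])
  refine ⟨s2, c, ?_⟩
  obtain ⟨g0, g1, g2, h⟩ := exists_hasJet_trace_mul_inv hA' hB' s0 s1 s2 s3 hdet hR
  have hre := h.re
  refine ⟨_, _, _, hre.congr ?_⟩
  have hne (M : Matrix (Fin (m + 1)) (Fin (m + 1)) ℂ) (hM : grad (frameOf M) Φ p (Fin.last m) ≠ 0) :
      ∀ᶠ z in nhds p, grad (frameOf M) Φ z (Fin.last m) ≠ 0 :=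
    ((contDiffOn_grad E.isOpen E.smooth (frameOf M) (Fin.last m)).contDiffAt_two E.isOpen
      E.mem).continuousAt.eventually_ne hM
  have hdA : ∀ᶠ z in nhds p, (g z * (tangentMatrix (grad (frameOf T) Φ z) *
      mixedHess (frameOf T) Φ z * (tangentMatrix (grad (frameOf T) Φ z))ᴴ) * (g z)ᴴ).det ≠ 0 := by
    have h := (HasMJet.contDiffAt_det fun i j => (hA' i j).smooth).continuousAt
    refine h.eventually_ne ?_
    have h0 : (g p * (tangentMatrix (grad (frameOf T) Φ p) *
      mixedHess (frameOf T) Φ p * (tangentMatrix (grad (frameOf T) Φ p))ᴴ) * (g p)ᴴ) = 1 := by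
      ext i j; exact (hA' i j).val
    simp only [h0]
    simp
  -- Near p, the change from the given frame to the adapted one and then the gauge both act by
  -- congruence, so the trace is the one whose jet was computed.
  filter_upwards [hΩ, hg, hne S hSl, hne T (by rw [hr]; exact hr0), hdA] with z hz hgz hSz hTz hAz
  obtain ⟨u, hu, hAu, hBu⟩ := exists_Amat_Bmat_congruence E.isOpen E.smooth hz hS E.det_frame hSz hTz
  rw [toC, toC, traceInv_eq, hAu, hBu, trace_inv_one_sub_kOf_congruence hu,
    ← trace_inv_one_sub_kOf_congruence hgz, trace_inv_one_sub_kOf (by rwa [Amat_eq]), Amat_eq, Bmat_eq]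

end EquationAt
end

/-! ### The linearized operator on tr(I - 𝓚)⁻¹ -/

noncomputable section
open Matrix

section
attribute [local instance] Matrix.frobeniusNormedAddCommGroup Matrix.frobeniusNormedSpace

namespace EquationAt
variable {m : ℕ} {N T : Matrix (Fin (m + 1)) (Fin (m + 1)) ℂ} {ε Λ κ : ℝ} {Ω : Set (Cn (m + 1))}
  {Φ : Cn (m + 1) → ℝ} {p : Cn (m + 1)}

/-- `∑ |∂_ξ Φ_{a b}|²` over the adapted directions `ξ`. -/
def holEnergy (N T : Matrix (Fin (m + 1)) (Fin (m + 1)) ℂ) (ε : ℝ) (Φ : Cn (m + 1) → ℝ)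
    (p : Cn (m + 1)) : ℝ :=
  ∑ k, ∑ a, ∑ b, ‖dHol (dir N T ε k) (fun z => holHess (frameOf T) Φ z a b) p‖ ^ 2

lemma holEnergy_nonneg : 0 ≤ holEnergy N T ε Φ p := by
  unfold holEnergy; positivity

/-- In the adapted frame 𝓐 = I and 𝓑 = B₀ is a strict contraction, which gives the pointwise claims
and a bound on (I - B₀B₀*)⁻¹. Summing the error estimates over directions, where the defects of the
differentiated equation cancel, puts the jets within reach of `sum_trace_jet_ge`. -/
lemma exists_traceInv_jets (E : EquationAt N ε Ω Φ p T)
    (A : IsAdaptedFrame N Λ κ ε (mixedHess (stdFrame (m + 1)) Φ p) (holHess (stdFrame (m + 1)) Φ p)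
      (grad (stdFrame (m + 1)) Φ p) T)
    (hN : N.det ≠ 0) (hε : 0 < ε) (hε1 : ε ≤ 1) (hΛ : 1 ≤ Λ) (hκ : 0 < κ) {K : ℝ}
    (hKΛ : 2 * ((m + 1) * Λ) ^ 7 ≤ K) (hKκ : (m + 1) * κ⁻¹ ≤ K)
    {S : Matrix (Fin (m + 1)) (Fin (m + 1)) ℂ} (hS : S.det ≠ 0)
    (hSl : grad (frameOf S) Φ p (Fin.last m) ≠ 0) :
    (Amat (frameOf S) Φ p).PosDef ∧ IsUnit (1 - Kmat (frameOf S) Φ p) ∧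
    ∃ f0 f1 f2 f3 : Fin (m + 1) → ℂ,
      (∀ k, HasJet p (holVec (dir N T ε k)) (conjVec (holVec (dir N T ε k)))
        (toC (traceInv (frameOf S) Φ)) (f0 k) (f1 k) (f2 k) (f3 k)) ∧
      -(100 * K ^ 15 * (ε * (1 + thirdEnergy ε (N * Tᴴ) (third (frameOf T) Φ p) +
        holEnergy N T ε Φ p))) ≤ ∑ k, (f3 k).re := by
  obtain ⟨Γ, hΓ⟩ : ∃ Γ : ℝ, Γ = (m + 1) * Λ := ⟨_, rfl⟩
  have hm1 : (1 : ℝ) ≤ m + 1 := by linarith [(Nat.cast_nonneg m : (0 : ℝ) ≤ m)]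
  have hΛΓ : Λ ≤ Γ := hΓ ▸ le_mul_of_one_le_left (by linarith) hm1
  have hmΓ : (m + 1 : ℝ) ≤ Γ := hΓ ▸ le_mul_of_one_le_right (by linarith) hΛ
  have hΓ1 : 1 ≤ Γ := hΛ.trans hΛΓ
  rw [← hΓ] at hKΛ
  have hΓK (j : ℕ) (hj : j ≤ 7) : 2 * Γ ^ j ≤ K :=
    le_trans (by have := pow_le_pow_right₀ hΓ1 hj; linarith) hKΛ
  have hΓK' (j : ℕ) (hj : j ≤ 7) : Γ ^ j ≤ K :=
    le_trans (by have := pow_nonneg (zero_le_one.trans hΓ1) j; linarith) (hΓK j hj)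
  have hK1 : 1 ≤ K := by simpa using hΓK' 0 (by norm_num)
  have hmK : (m + 1 : ℝ) ≤ K := hmΓ.trans (by simpa using hΓK' 1 (by norm_num))
  have hB := E.det_metric_ne hN
  obtain ⟨Θ, hΘ⟩ : ∃ Θ, Θ = third (frameOf T) Φ p := ⟨_, rfl⟩
  obtain ⟨Y, hY⟩ : ∃ Y, Y = thirdEnergy ε (N * Tᴴ) (third (frameOf T) Φ p) := ⟨_, rfl⟩
  obtain ⟨Z, hZ⟩ : ∃ Z, Z = holEnergy N T ε Φ p := ⟨_, rfl⟩
  have hY0 : 0 ≤ Y := hY ▸ thirdEnergy_nonneg hε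
  have hZ0 : 0 ≤ Z := hZ ▸ holEnergy_nonneg
  have hg : grad (frameOf T) Φ p = T *ᵥ grad (stdFrame (m + 1)) Φ p := grad_frameOf _ _ _
  obtain ⟨r, hr⟩ : ∃ r, grad (frameOf T) Φ p (Fin.last m) = r := ⟨_, rfl⟩
  have hrge : 1 ≤ Λ * ‖r‖ := by rw [← hr, hg]; exact A.grad_ge
  have hr0 : r ≠ 0 := by
    rintro rfl
    rw [norm_zero] at hrge
    linarith
  have hri : ‖r‖⁻¹ ≤ Λ := by
    rw [inv_le_iff_one_le_mul₀ (norm_pos_iff.2 hr0)]; exact hrge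
  have h0 (α : Fin m) : grad (frameOf T) Φ p α.castSucc = 0 := by rw [hg]; exact A.grad_castSucc α
  have hdir (k b) : ‖dirMatrix ε (N * Tᴴ) k b‖ ≤ Λ := by
    rw [dirMatrix_apply, norm_mul, Complex.norm_of_nonneg (dirWeight_pos hε b).le]
    calc _ ≤ Λ * 1 := mul_le_mul (A.metric_le k b) (dirWeight_le_one hε1 b)
          (dirWeight_pos hε b).le (by linarith)
      _ = Λ := mul_one _
  obtain ⟨P, hP⟩ : ∃ P, P = holHess (frameOf T) Φ p := ⟨_, rfl⟩
  have hPe (a b) : ‖P a b‖ ≤ Λ := by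
    rw [hP, holHess_frameOf E.isOpen E.smooth E.mem]; exact A.hol_le a b
  have hPs : Pᵀ = P := hP ▸ holHess_isSymm E.isOpen E.smooth E.mem _
  have hcm : (Fintype.card (Fin m) : ℝ) ≤ m + 1 := by rw [Fintype.card_fin]; linarith
  have hcm1 : (Fintype.card (Fin (m + 1)) : ℝ) ≤ m + 1 := by rw [Fintype.card_fin]; push_cast; rfl
  have hcu : (Fintype.card Unit : ℝ) ≤ m + 1 := by simp
  -- the contraction
  obtain ⟨B0, hB0⟩ : ∃ B0, B0 = topRows m * P * (topRows m)ᵀ := ⟨_, rfl⟩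
  have hB0s : B0ᵀ = B0 := by
    rw [hB0]; simp only [transpose_mul, transpose_transpose, hPs, Matrix.mul_assoc]
  have hB0e (α β) : B0 α β = P α.castSucc β.castSucc := by
    rw [hB0, mul_topRows_transpose_apply, topRows_mul_apply]
  -- The bound on the quadratic form of B₀ becomes an operator bound because B₀ is symmetric.
  have hcon := sum_norm_sq_mulVec_le hB0s hκ (fun x => by
    have := A.contraction x
    rw [← holHess_frameOf E.isOpen E.smooth E.mem, ← hP] at this
    simpa only [hB0e] using this)
  have hQ := posDef_one_sub hκ hcon
  have hcon' := norm_sq_conjTranspose_mulVec_le hB0s hcon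
  have hRp : (1 - B0 * B0ᴴ).PosDef := by
    have := posDef_one_sub hκ hcon'
    rwa [conjTranspose_conjTranspose] at this
  obtain ⟨R, hR⟩ : ∃ R, R = (1 - B0 * B0ᴴ)⁻¹ := ⟨_, rfl⟩
  have hRe (i j) : ‖R i j‖ ≤ κ⁻¹ := by
    have := norm_inv_one_sub_apply_le hκ hcon' i j
    rwa [conjTranspose_conjTranspose, ← hR] at this
  have hRK : ‖R‖ ≤ K :=
    (frobenius_le_of_apply_le (inv_nonneg.2 hκ.le) hRe hcm hcm).trans hKκ
  have hB0K : ‖B0‖ ≤ K :=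
    (frobenius_le_of_apply_le (c := Λ) (by linarith) (fun i j => by rw [hB0e]; exact hPe _ _) hcm hcm).trans
      (by rw [← hΓ]; simpa using hΓK' 1 (by norm_num))
  have hdet := (isUnit_det_of_posDef hRp).ne_zero
  -- pointwise conclusions
  obtain ⟨u, hu, hAu, hBu⟩ := exists_Amat_Bmat_congruence E.isOpen E.smooth E.mem hS E.det_frame hSl
    (by rw [hr]; exact hr0)
  -- The first m frame vectors annihilate the gradient, so all slopes vanish at p.
  have hJ : tangentMatrix (grad (frameOf T) Φ p) = topRows m := by
    have : slopeCol (grad (frameOf T) Φ p) = 0 := by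
      ext α i; simp [slopeCol, h0]
    rw [tangentMatrix, this, Matrix.zero_mul, sub_zero]
  have hA1 : Amat (frameOf T) Φ p = 1 := by
    rw [Amat_eq, hJ, E.mixedHess_eq, topRows_conjTranspose, topRows_mul_diagonal_mul]
  have hBT : Bmat (frameOf T) Φ p = B0 := by rw [Bmat_eq, hJ, ← hP, hB0]
  rw [hA1, Matrix.mul_one] at hAu
  refine ⟨?_, ?_, ?_⟩
  · rw [hAu]
    refine PosDef.mul_conjTranspose_self u ?_
    exact Matrix.vecMul_injective_of_isUnit ((Matrix.isUnit_iff_isUnit_det _).2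
      (isUnit_iff_ne_zero.2 hu))
  · have h1 : Kmat (frameOf S) Φ p = u * (B0 * B0ᴴ) * u⁻¹ := by
      have := kOf_congruence (A := 1) (B := B0) hu
      rw [Matrix.mul_one] at this
      rw [show Kmat (frameOf S) Φ p = kOf (Amat (frameOf S) Φ p) (Bmat (frameOf S) Φ p) from rfl,
        hAu, hBu, hBT, this, kOf, inv_one, Matrix.mul_one,
        Matrix.map_one _ (star_zero ℂ) (star_one ℂ), Matrix.mul_one, ← conjTranspose_eq_map_star hB0s]
    rw [h1, one_sub_conj hu, Matrix.isUnit_iff_isUnit_det, det_mul, det_mul, isUnit_iff_ne_zero]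
    refine mul_ne_zero (mul_ne_zero hu hdet) ?_
    exact ((Matrix.isUnit_nonsing_inv_det u (isUnit_iff_ne_zero.2 hu))).ne_zero
  -- jets
  obtain ⟨f1, hf1⟩ : ∃ f1 : Fin (m + 1) → Fin (m + 1) → ℂ, f1 = fun k a =>
    ∑ b, dirMatrix ε (N * Tᴴ) k b * holHess (frameOf T) Φ p b a := ⟨_, rfl⟩
  obtain ⟨f2, hf2⟩ : ∃ f2 : Fin (m + 1) → Fin (m + 1) → ℂ, f2 = fun k a =>
    ∑ b, star (dirMatrix ε (N * Tᴴ) k b) * mixedHess (frameOf T) Φ p a b := ⟨_, rfl⟩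
  obtain ⟨f3, hf3⟩ : ∃ f3 : Fin (m + 1) → Fin (m + 1) → ℂ, f3 = fun k a =>
    ∑ b, ∑ c, dirMatrix ε (N * Tᴴ) k b * third (frameOf T) Φ p a b c *
      star (dirMatrix ε (N * Tᴴ) k c) := ⟨_, rfl⟩
  have hf1n (k a) : ‖f1 k a‖ ≤ Γ ^ 2 := by
    rw [hf1]
    refine (norm_sum_mul_le (C := Λ) (D := Λ) (by linarith) (hdir k)
      (fun b => hP ▸ hPe b a)).trans ?_
    rw [Fintype.card_fin, hΓ]
    push_cast
    have h2 : (m + 1 : ℝ) ≤ (m + 1) ^ 2 := le_self_pow₀ hm1 (by norm_num)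
    calc (m + 1 : ℝ) * (Λ * Λ) ≤ (m + 1) ^ 2 * (Λ * Λ) := by gcongr
      _ = ((m + 1) * Λ) ^ 2 := by ring
  have hf2n (k a) : ‖f2 k a‖ ≤ ε * Λ := by
    rw [hf2]
    simp only [E.mixedHess_eq, diagonal_apply, mul_ite, mul_zero]
    rw [Finset.sum_ite_eq, if_pos (Finset.mem_univ a), norm_mul, norm_star, dirMatrix_apply,
      norm_mul, Complex.norm_of_nonneg (dirWeight_pos hε a).le,
      Complex.norm_of_nonneg (lastWeight_pos hε a).le, dirWeight_eq hε.ne', mul_assoc,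
      inv_mul_cancel_right₀ (lastWeight_pos hε a).ne', mul_comm]
    exact mul_le_mul_of_nonneg_left (A.metric_le k a) hε.le
  have hf3s (a) : ∑ k, f3 k a = 0 := by rw [hf3]; exact E.first_order a
  obtain ⟨a1, ha1⟩ : ∃ a1 : Fin (m + 1) → Matrix (Fin m) Unit ℂ, a1 = fun k => of fun α _ =>
    f1 k α.castSucc / r := ⟨_, rfl⟩
  obtain ⟨a2, ha2⟩ : ∃ a2 : Fin (m + 1) → Matrix (Fin m) Unit ℂ, a2 = fun k => of fun α _ =>
    f2 k α.castSucc / r := ⟨_, rfl⟩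
  obtain ⟨a3, ha3⟩ : ∃ a3 : Fin (m + 1) → Matrix (Fin m) Unit ℂ, a3 = fun k => of fun α _ =>
    f3 k α.castSucc / r - (f2 k α.castSucc * f1 k (Fin.last m) +
      f1 k α.castSucc * f2 k (Fin.last m)) / r ^ 2 := ⟨_, rfl⟩
  obtain ⟨α, hα⟩ : ∃ α, α = fun k => mixedDeriv (dirMatrix ε (N * Tᴴ) k) (third (frameOf T) Φ p) :=
    ⟨_, rfl⟩
  obtain ⟨β, hβ⟩ : ∃ β, β = fun k => holDeriv (dirMatrix ε (N * Tᴴ) k) (third (frameOf T) Φ p) :=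
    ⟨_, rfl⟩
  obtain ⟨γ, hγ⟩ : ∃ γ : Fin (m + 1) → Matrix (Fin (m + 1)) (Fin (m + 1)) ℂ, γ = fun k =>
    of fun a b => dHol (dir N T ε k) (fun z => holHess (frameOf T) Φ z a b) p := ⟨_, rfl⟩
  obtain ⟨η, hη⟩ : ∃ η, η = fun k => lineLaplacian (dir N T ε k) (mixedHess (frameOf T) Φ) p :=
    ⟨_, rfl⟩
  obtain ⟨π, hπ⟩ : ∃ π, π = fun k => lineLaplacian (dir N T ε k) (holHess (frameOf T) Φ) p :=
    ⟨_, rfl⟩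
  obtain ⟨Δ, hΔ⟩ : ∃ Δ : Matrix (Fin (m + 1)) (Fin (m + 1)) ℂ,
    Δ = diagonal fun a => (lastWeight m ε a : ℂ) := ⟨_, rfl⟩
  obtain ⟨J1, hJ1⟩ : ∃ J, J = fun k => -(a1 k * lastRow m) := ⟨_, rfl⟩
  obtain ⟨J2, hJ2⟩ : ∃ J, J = fun k => -(a2 k * lastRow m) := ⟨_, rfl⟩
  obtain ⟨J3, hJ3⟩ : ∃ J, J = fun k => -(a3 k * lastRow m) := ⟨_, rfl⟩
  obtain ⟨A1, hA1⟩ : ∃ A1, A1 = fun k => topRows m * α k * (topRows m)ᵀ := ⟨_, rfl⟩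
  obtain ⟨A3, hA3⟩ : ∃ A3, A3 = fun k => (J2 k * α k + J1 k * (α k)ᴴ + topRows m * η k) * (topRows m)ᵀ +
    (J2 k * Δ + topRows m * (α k)ᴴ) * (J2 k)ᴴ + (J1 k * Δ + topRows m * α k) * (J1 k)ᴴ -
      A1 k * (A1 k)ᴴ := ⟨_, rfl⟩
  obtain ⟨B2, hB2⟩ : ∃ B2, B2 = fun k => (J2 k * P + topRows m * β k) * (topRows m)ᵀ +
    topRows m * P * (J2 k)ᵀ := ⟨_, rfl⟩
  obtain ⟨B3, hB3⟩ : ∃ B3, B3 = fun k => (J3 k * P + J2 k * γ k + J1 k * β k + topRows m * π k) *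
      (topRows m)ᵀ + (J2 k * P + topRows m * β k) * (J1 k)ᵀ +
      (J1 k * P + topRows m * γ k) * (J2 k)ᵀ + topRows m * P * (J3 k)ᵀ -
      A1 k * B2 k - B2 k * (A1 k)ᵀ := ⟨_, rfl⟩
  have hjet (k) := E.exists_hasJet_traceInv hN hε hS hSl h0 hr hr0 (hP ▸ hB0) hdet hR k
    (congrFun hf1 k) (congrFun hf2 k) (congrFun hf3 k) (congrFun ha1 k) (congrFun ha2 k)
    (congrFun ha3 k) (congrFun hα k) (congrFun hβ k) (congrFun hγ k) (congrFun hη k) (congrFun hπ k)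
    hP hΔ (congrFun hJ1 k) (congrFun hJ2 k) (congrFun hJ3 k) (congrFun hA1 k) (congrFun hA3 k)
    (congrFun hB2 k) (congrFun hB3 k)
  choose hB2s c g0 g1 g2 hg' using hjet
  refine ⟨g0, g1, g2, _, hg', ?_⟩
  simp only [Complex.ofReal_re]
  -- sizes
  have hsize (k) : JetSizes K ε (√Y) (√Z) (α k) (β k) (γ k) P (a1 k) (a2 k) := by
    have hy := Real.sqrt_nonneg Y
    have hd (a c) := norm_deriv_le (B := N * Tᴴ) (Θ := third (frameOf T) Φ p) hε hε1 k a c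
    have hl (a) := norm_deriv_last_le hε hε1 hΛ hB A.metric_le A.metric_inv_le E.first_order k a
    rw [← hY, ← hΓ] at hl
    rw [← hY] at hd
    refine ⟨hK1, hε, hε1, hy, Real.sqrt_nonneg Z, ?_, ?_, ?_, ?_, ?_, ?_, ?_, ?_, ?_, ?_⟩
    · refine (frobenius_le_of_apply_le zero_le_one (fun a b => ?_) hcm hcm1).trans (by linarith)
      rw [topRows, of_apply]; split_ifs <;> simp
    · refine (frobenius_le_of_apply_le zero_le_one (fun a b => ?_) hcu hcm1).trans (by linarith)
      rw [lastRow, of_apply]; split_ifs <;> simp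
    · refine (frobenius_le_of_apply_le (by linarith) hPe hcm1 hcm1).trans ?_
      rw [← hΓ]; simpa using hΓK' 1 (by norm_num)
    · refine (frobenius_le_of_apply_le hy (fun a b => ?_) hcm1 hcm1).trans
        (mul_le_mul_of_nonneg_right hmK hy)
      rw [hα]; exact (hd a b).1
    · refine (frobenius_le_of_apply_le hy (fun a b => ?_) hcm1 hcm1).trans
        (mul_le_mul_of_nonneg_right hmK hy)
      rw [hβ]; exact (hd a b).2
    · have h1 : ‖γ k‖ ≤ √Z := by
        refine Real.le_sqrt_of_sq_le ?_
        rw [frobenius_sq, hZ, holEnergy, hγ]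
        exact Finset.single_le_sum (f := fun k => ∑ a, ∑ b,
          ‖dHol (dir N T ε k) (fun z => holHess (frameOf T) Φ z a b) p‖ ^ 2)
          (fun _ _ => by positivity) (Finset.mem_univ k)
      exact h1.trans (le_mul_of_one_le_left (Real.sqrt_nonneg Z) hK1)
    · refine (frobenius_le_of_apply_le (c := Γ ^ 6 * ε * √Y) (by positivity)
        (fun a b => ?_) hcm1 hcu).trans ?_
      · rw [mul_lastRow_transpose_apply, hα]; exact (hl a).1
      · calc (m + 1 : ℝ) * (Γ ^ 6 * ε * √Y) ≤ Γ * (Γ ^ 6 * ε * √Y) := by gcongr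
          _ = Γ ^ 7 * (ε * √Y) := by ring
          _ ≤ _ := mul_le_mul_of_nonneg_right (hΓK' 7 le_rfl) (by positivity)
    · refine (frobenius_le_of_apply_le (c := Γ ^ 6 * ε * √Y) (by positivity)
        (fun a b => ?_) hcm1 hcu).trans ?_
      · rw [mul_lastRow_transpose_apply, hβ]; exact (hl a).2
      · calc (m + 1 : ℝ) * (Γ ^ 6 * ε * √Y) ≤ Γ * (Γ ^ 6 * ε * √Y) := by gcongr
          _ = Γ ^ 7 * (ε * √Y) := by ring
          _ ≤ _ := mul_le_mul_of_nonneg_right (hΓK' 7 le_rfl) (by positivity)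
    · refine (frobenius_le_of_apply_le (c := Γ ^ 2 * Λ) (by positivity)
        (fun a b => ?_) hcm hcu).trans ?_
      · rw [ha1]
        simp only [of_apply]
        rw [div_eq_mul_inv, norm_mul, norm_inv]
        exact mul_le_mul (hf1n _ _) hri (by positivity) (by positivity)
      · calc (m + 1 : ℝ) * (Γ ^ 2 * Λ) ≤ Γ * (Γ ^ 2 * Γ) := by gcongr
          _ = Γ ^ 4 := by ring
          _ ≤ _ := hΓK' 4 (by norm_num)
    · refine (frobenius_le_of_apply_le (c := ε * Λ * Λ) (by positivity)
        (fun a b => ?_) hcm hcu).trans ?_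
      · rw [ha2]
        simp only [of_apply]
        rw [div_eq_mul_inv, norm_mul, norm_inv]
        exact mul_le_mul (hf2n _ _) hri (by positivity) (by positivity)
      · calc (m + 1 : ℝ) * (ε * Λ * Λ) ≤ Γ * (ε * Γ * Γ) := by gcongr
          _ = Γ ^ 3 * ε := by ring
          _ ≤ _ := mul_le_mul_of_nonneg_right (hΓK' 3 (by norm_num)) hε.le
  -- The third derivatives in a₃ sum to zero by the first order equation; each remaining product
  -- contains f₂ = O(ε).
  have ha3n : ‖∑ k, a3 k‖ ≤ K * ε := by
    refine (frobenius_le_of_apply_le (c := 2 * (Γ ^ 6 * ε)) (by positivity)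
      (fun a b => ?_) hcm hcu).trans ?_
    · have h1 : (∑ k, a3 k) a b = -∑ k, (f2 k a.castSucc * f1 k (Fin.last m) +
          f1 k a.castSucc * f2 k (Fin.last m)) * (r⁻¹ * r⁻¹) := by
        rw [Matrix.sum_apply, ha3]
        simp only [of_apply, Finset.sum_sub_distrib]
        rw [← Finset.sum_div, hf3s, zero_div, zero_sub]
        congr 1
        exact Finset.sum_congr rfl fun k _ => by rw [div_eq_mul_inv, pow_two, mul_inv]
      rw [h1, norm_neg]
      refine (norm_sum_le _ _).trans ?_
      have h2 (k) : ‖(f2 k a.castSucc * f1 k (Fin.last m) +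
          f1 k a.castSucc * f2 k (Fin.last m)) * (r⁻¹ * r⁻¹)‖ ≤
          (ε * Λ * Γ ^ 2 + Γ ^ 2 * (ε * Λ)) * (Λ * Λ) := by
        rw [norm_mul, norm_mul, norm_inv]
        refine mul_le_mul ((norm_add_le _ _).trans (add_le_add ?_ ?_))
          (mul_le_mul hri hri (by positivity) (by linarith)) (by positivity) (by positivity)
        · rw [norm_mul]; exact mul_le_mul (hf2n _ _) (hf1n _ _) (norm_nonneg _) (by positivity)
        · rw [norm_mul]; exact mul_le_mul (hf1n _ _) (hf2n _ _) (norm_nonneg _) (by positivity)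
      refine (Finset.sum_le_sum fun k _ => h2 k).trans ?_
      rw [Finset.sum_const, nsmul_eq_mul, Finset.card_univ, Fintype.card_fin]
      push_cast
      calc (m + 1 : ℝ) * ((ε * Λ * Γ ^ 2 + Γ ^ 2 * (ε * Λ)) * (Λ * Λ)) ≤
          Γ * ((ε * Γ * Γ ^ 2 + Γ ^ 2 * (ε * Γ)) * (Γ * Γ)) := by gcongr
        _ = 2 * (Γ ^ 6 * ε) := by ring
    · calc (m + 1 : ℝ) * (2 * (Γ ^ 6 * ε)) ≤ Γ * (2 * (Γ ^ 6 * ε)) := by gcongr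
        _ = 2 * Γ ^ 7 * ε := by ring
        _ ≤ _ := mul_le_mul_of_nonneg_right (hΓK 7 le_rfl) hε.le
  obtain ⟨M, hM⟩ : ∃ M, M = 1 + Y + Z := ⟨_, rfl⟩
  have hM' : M = 1 + √Y ^ 2 + √Z ^ 2 := by rw [Real.sq_sqrt hY0, Real.sq_sqrt hZ0, hM]
  have hM1 : 1 ≤ M := by rw [hM]; linarith
  have hβs (k) : (β k)ᵀ = β k := by
    rw [hβ]; ext a b
    simp only [transpose_apply, holDeriv, of_apply]
    exact Finset.sum_congr rfl fun c _ => by rw [third_symm E.isOpen E.smooth E.mem]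
  have hX : 0 ≤ K ^ 9 * (ε * M) := by positivity
  have hsum16 : ∑ _k : Fin (m + 1), 16 * (K ^ 9 * (ε * M)) ≤ 16 * (K ^ 10 * (ε * M)) := by
    rw [Finset.sum_const, nsmul_eq_mul, Finset.card_univ, Fintype.card_fin]
    push_cast
    calc _ ≤ K * (16 * (K ^ 9 * (ε * M))) := by gcongr
      _ = _ := by ring
  have hE1 : ‖∑ k, (A3 k - B2 k * (B2 k)ᴴ)‖ ≤ 20 * (K ^ 10 * (ε * M)) := by
    -- The subtracted defect sums to zero by the second order equation, so it may be inserted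
    -- freely.
    have h1 : ∑ k, (A3 k - B2 k * (B2 k)ᴴ) = ∑ k, (A3 k - B2 k * (B2 k)ᴴ -
        topRows m * (η k - (α k * hInv m ε * (α k)ᴴ + β k * hInv m ε * (β k)ᴴ)) * (topRows m)ᵀ) := by
      rw [Finset.sum_sub_distrib _ (fun k => topRows m * (η k - _) * _), ← Matrix.sum_mul,
        ← Matrix.mul_sum, Finset.sum_sub_distrib η]
      have := E.second_order_mixed
      rw [hη, hα, hβ]
      rw [show ∑ k, (fun k => lineLaplacian (dir N T ε k) (mixedHess (frameOf T) Φ) p) k = _ from this,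
        sub_self, Matrix.mul_zero, Matrix.zero_mul, sub_zero]
    rw [h1]
    refine (norm_sum_le _ _).trans ((Finset.sum_le_sum fun k _ => (hsize k).mixed_error_le hM' hΔ
      (congrFun hJ1 k) (congrFun hJ2 k) (congrFun hA1 k) (congrFun hA3 k) (congrFun hB2 k)).trans
      (hsum16.trans ?_))
    have : 0 ≤ K ^ 10 * (ε * M) := by positivity
    linarith
  have hE2 : ‖∑ k, B3 k‖ ≤ 20 * (K ^ 10 * (ε * M)) := by
    obtain ⟨s, hs⟩ : ∃ s, s = ∑ k, a3 k := ⟨_, rfl⟩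
    -- As above, with the a₃-terms added and subtracted; after summation they depend only on ∑ a₃.
    have h1 : ∑ k, B3 k = ∑ k, (B3 k -
        topRows m * (π k - (α k * hInv m ε * β k + β k * hInv m ε * (α k)ᵀ)) * (topRows m)ᵀ +
        (a3 k * lastRow m * P * (topRows m)ᵀ + topRows m * P * (a3 k * lastRow m)ᵀ)) -
        (s * lastRow m * P * (topRows m)ᵀ + topRows m * P * (s * lastRow m)ᵀ) := by
      have e2 : ∑ k, (π k - (α k * hInv m ε * β k + β k * hInv m ε * (α k)ᵀ)) = 0 := by
        have := E.second_order_hol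
        rw [Finset.sum_sub_distrib π, hπ, hα, hβ]
        rw [show ∑ k, (fun k => lineLaplacian (dir N T ε k) (holHess (frameOf T) Φ) p) k = _ from this,
          sub_self]
      have e3 : ∑ k, (a3 k * lastRow m * P * (topRows m)ᵀ + topRows m * P * (a3 k * lastRow m)ᵀ) =
          s * lastRow m * P * (topRows m)ᵀ + topRows m * P * (s * lastRow m)ᵀ := by
        rw [Finset.sum_add_distrib, hs, ← Matrix.sum_mul, ← Matrix.sum_mul, ← Matrix.sum_mul,
          ← Matrix.mul_sum, ← transpose_sum, ← Matrix.sum_mul]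
      rw [Finset.sum_add_distrib, e3, add_sub_cancel_right, Finset.sum_sub_distrib B3, ← Matrix.sum_mul,
        ← Matrix.mul_sum, e2, Matrix.mul_zero, Matrix.zero_mul, sub_zero]
    rw [h1]
    have z0 := hsize 0
    have hs1 : ‖s‖ ≤ K * ε := hs ▸ ha3n
    have b1 := frobenius_mul_le (frobenius_mul_le (frobenius_mul_le hs1 z0.last_le) z0.P_le)
      (JetSizes.tr_le z0.top_le)
    have b2 := frobenius_mul_le (frobenius_mul_le z0.top_le z0.P_le)
      (JetSizes.tr_le (frobenius_mul_le hs1 z0.last_le))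
    refine (norm_sub_le_of ((norm_sum_le _ _).trans ((Finset.sum_le_sum fun k _ =>
      (hsize k).hol_error_le hM' (hβs k) hPs (congrFun hJ1 k) (congrFun hJ2 k) (congrFun hJ3 k)
        (congrFun hA1 k) (congrFun hB2 k) (congrFun hB3 k)).trans hsum16))
      (norm_add_le_of b1 b2)).trans ?_
    have h4 : K ^ 4 * (ε * 1) ≤ K ^ 10 * (ε * M) := by
      have := pow_le_pow_right₀ hK1 (show 4 ≤ 10 by norm_num)
      gcongr
    have : 0 ≤ K ^ 10 * (ε * M) := by positivity
    calc _ = 16 * (K ^ 10 * (ε * M)) + 2 * (K ^ 4 * (ε * 1)) := by ring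
      _ ≤ _ := by linarith
  have hfin := sum_trace_jet_ge hRp hQ hR hK1 (by linarith) hRK hB0K (c := c) hB2s hE1 hE2
  refine le_trans (le_of_eq ?_) hfin
  rw [← hY, ← hZ, ← hM]
  ring

end EquationAt
end
end

noncomputable section
open Matrix

/-! ## Conclusion -/

namespace EquationAt
variable {m : ℕ} {N T : Matrix (Fin (m + 1)) (Fin (m + 1)) ℂ} {ε Λ κ : ℝ} {Ω : Set (Cn (m + 1))}
  {Φ : Cn (m + 1) → ℝ} {p : Cn (m + 1)}

lemma Lop_eq (E : EquationAt N ε Ω Φ p T) {f : Cn (m + 1) → ℝ} {F0 F1 F2 F3 : Fin (m + 1) → ℂ}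
    (h : ∀ k, HasJet p (holVec (dir N T ε k)) (conjVec (holVec (dir N T ε k))) (toC f)
      (F0 k) (F1 k) (F2 k) (F3 k)) : Lop (Nᴴ * N) ε Φ f p = ∑ k, (F3 k).re :=
  Lop_eq_of_hasJet rfl (mixedHess_isHermitian E.isOpen E.smooth E.mem _)
    (frameOf_dirMatrix E.eps_ne E.det_frame E.diag) (h 0).smooth h

lemma posDef_mixedHess (E : EquationAt N ε Ω Φ p T) (hε : 0 < ε) :
    (mixedHess (stdFrame (m + 1)) Φ p).PosDef := by
  have hu : IsUnit T.det := isUnit_iff_ne_zero.2 E.det_frame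
  rw [E.frame_eq E.mem, E.mixedHess_eq]
  refine PosDef.mul_mul_conjTranspose_same (PosDef.diagonal fun a => ?_) ?_
  · exact_mod_cast lastWeight_pos hε a
  · exact Matrix.vecMul_injective_of_isUnit ((Matrix.isUnit_iff_isUnit_det _).2
      (Matrix.isUnit_nonsing_inv_det T hu))

/-- W contributes the third derivative energy Y and |z|² the constant 1. -/
lemma exists_Wfun_jets (E : EquationAt N ε Ω Φ p T)
    (A : IsAdaptedFrame N Λ κ ε (mixedHess (stdFrame (m + 1)) Φ p) (holHess (stdFrame (m + 1)) Φ p)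
      (grad (stdFrame (m + 1)) Φ p) T) (hN : N.det ≠ 0) (hε : 0 < ε) (hΛ : 1 ≤ Λ) :
    ∃ f0 f1 f2 f3 : Fin (m + 1) → ℂ,
      (∀ k, HasJet p (holVec (dir N T ε k)) (conjVec (holVec (dir N T ε k)))
        (toC fun z => Wfun (Nᴴ * N) Φ z + normSqG (Nᴴ * N) z) (f0 k) (f1 k) (f2 k) (f3 k)) ∧
      1 + thirdEnergy ε (N * Tᴴ) (third (frameOf T) Φ p) ≤
        ((m + 1) * Λ) ^ 4 * ∑ k, (f3 k).re := by
  have hB := E.det_metric_ne hN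
  have hY := thirdEnergy_nonneg (B := N * Tᴴ) (Θ := third (frameOf T) Φ p) hε
  have hm1 : (1 : ℝ) ≤ m + 1 := by linarith [(Nat.cast_nonneg m : (0 : ℝ) ≤ m)]
  have hΓ1 : 1 ≤ (m + 1) * Λ := one_le_mul_of_one_le_of_one_le hm1 hΛ
  choose u0 u1 u2 hu using fun k => E.exists_hasJet_Wfun k
  choose v0 v1 v2 hv using fun k => exists_hasJet_normSqG (Nᴴ * N) p (dir N T ε k)
  have hadd (k) := (hu k).add (hv k)
  have e : (fun z => toC (Wfun (Nᴴ * N) Φ) z + toC (normSqG (Nᴴ * N)) z) =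
      toC fun z => Wfun (Nᴴ * N) Φ z + normSqG (Nᴴ * N) z := by
    funext z; simp [toC]
  simp only [e] at hadd
  refine ⟨_, _, _, _, hadd, ?_⟩
  have h1 := thirdEnergy_le (Θ := third (frameOf T) Φ p) hε hB A.metric_le
    (η := fun k => lineLaplacian (dir N T ε k) (mixedHess (frameOf T) Φ) p) E.second_order_mixed
  have h2 := E.one_le_sum_normSqG hN A.metric_inv_le
  simp only [Complex.add_re, Complex.ofReal_re, Finset.sum_add_distrib, mul_add]
  obtain ⟨a, ha⟩ : ∃ a, a = ∑ k, ((lineLaplacian (dir N T ε k) (mixedHess (frameOf T) Φ) p) *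
        ((N * Tᴴ)⁻¹ * (N * Tᴴ)⁻¹ᴴ)).trace.re := ⟨_, rfl⟩
  obtain ⟨b, hb⟩ : ∃ b, b = ∑ k, normSqG (Nᴴ * N) (dir N T ε k) := ⟨_, rfl⟩
  rw [← ha] at h1 ⊢
  rw [← hb] at h2 ⊢
  obtain ⟨Γ, hΓ⟩ : ∃ Γ, Γ = (m + 1) * Λ := ⟨_, rfl⟩
  rw [← hΓ] at h1 hΓ1 ⊢
  have ha0 : 0 ≤ a := nonneg_of_mul_nonneg_right (hY.trans h1) (by positivity)
  have hb0 : 0 ≤ b := nonneg_of_mul_nonneg_right (zero_le_one.trans h2) (by positivity)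
  have h3 : Γ ^ 2 * a ≤ Γ ^ 4 * a :=
    mul_le_mul_of_nonneg_right (pow_le_pow_right₀ hΓ1 (by norm_num)) ha0
  have h4 : ((m + 1) * Λ ^ 2) ^ 2 * b ≤ Γ ^ 4 * b := by
    refine mul_le_mul_of_nonneg_right ?_ hb0
    rw [hΓ, show ((m + 1 : ℝ) * Λ) ^ 4 = ((m + 1) ^ 2 * Λ ^ 2) ^ 2 by ring]
    have : (m + 1 : ℝ) ≤ (m + 1) ^ 2 := le_self_pow₀ hm1 (by norm_num)
    gcongr
  linarith

/-- V yields the purely holomorphic energy Z, at the price of a multiple of Y coming from the second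
derivatives of P. -/
lemma exists_Vfun_jets (E : EquationAt N ε Ω Φ p T)
    (A : IsAdaptedFrame N Λ κ ε (mixedHess (stdFrame (m + 1)) Φ p) (holHess (stdFrame (m + 1)) Φ p)
      (grad (stdFrame (m + 1)) Φ p) T) (hN : N.det ≠ 0) (hε : 0 < ε) (hΛ : 1 ≤ Λ) :
    ∃ f0 f1 f2 f3 : Fin (m + 1) → ℂ,
      (∀ k, HasJet p (holVec (dir N T ε k)) (conjVec (holVec (dir N T ε k)))
        (toC (Vfun (Nᴴ * N) Φ)) (f0 k) (f1 k) (f2 k) (f3 k)) ∧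
      holEnergy N T ε Φ p ≤ ((m + 1) * Λ) ^ 4 * (∑ k, (f3 k).re +
        4 * ((m + 1) * Λ) ^ 6 * thirdEnergy ε (N * Tᴴ) (third (frameOf T) Φ p)) := by
  have hB := E.det_metric_ne hN
  choose u0 u1 u2 hu using fun k => E.exists_hasJet_Vfun k rfl rfl
  refine ⟨_, _, _, _, hu, ?_⟩
  have h := sum_norm_sq_le_of_frobenius_jet hΛ hB A.metric_le A.metric_inv_le A.hol_le
    (γ := fun k => of fun a b => dHol (dir N T ε k) (fun z => holHess (frameOf T) Φ z a b) p)
    (β := fun k => holDeriv (dirMatrix ε (N * Tᴴ) k) (third (frameOf T) Φ p))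
    (π := fun k => lineLaplacian (dir N T ε k) (holHess (frameOf T) Φ) p)
    (thirdEnergy_nonneg (B := N * Tᴴ) (Θ := third (frameOf T) Φ p) hε)
    (norm_sum_hol_le hε (third_symm E.isOpen E.smooth E.mem _) E.second_order_hol) rfl
  rw [← holHess_frameOf E.isOpen E.smooth E.mem] at h
  simp only [Complex.ofReal_re]
  exact h

end EquationAt

/-- Adapted frames exist at every point. -/
lemma exists_equationAt (m : ℕ) {G : Matrix (Fin (m + 1)) (Fin (m + 1)) ℂ} (hG : G.PosDef) {δ : ℝ}
    (hδ : 0 < δ) (D C : ℝ) :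
    ∃ (N : Matrix (Fin (m + 1)) (Fin (m + 1)) ℂ) (ε₀ Λ κ : ℝ), N.det ≠ 0 ∧ G = Nᴴ * N ∧ 0 < ε₀ ∧
      1 ≤ Λ ∧ 0 < κ ∧ ∀ ε : ℝ, 0 < ε → ε < ε₀ → ∀ (Ω : Set (Cn (m + 1))) (Φ : Cn (m + 1) → ℝ),
        IsOpen Ω → Bornology.IsBounded Ω → Metric.diam Ω ≤ D →
        ContDiffOn ℝ (⊤ : ℕ∞) Φ Ω →
        (∀ z ∈ Ω, ‖fderiv ℝ Φ z‖ ≤ C ∧ ‖fderiv ℝ (fderiv ℝ Φ) z‖ ≤ C) →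
        SolvesHessianQuotient G ε Ω Φ → RobustnessGT G Ω Φ δ → ∀ p ∈ Ω,
          ∃ T, EquationAt N ε Ω Φ p T ∧ IsAdaptedFrame N Λ κ ε (mixedHess (stdFrame (m + 1)) Φ p)
            (holHess (stdFrame (m + 1)) Φ p) (grad (stdFrame (m + 1)) Φ p) T := by
  obtain ⟨N, hN, hGN⟩ := hG.exists_eq_conjTranspose_mul
  obtain ⟨c, hc, hpt⟩ := pointwise_of_robustness G hδ D
  obtain ⟨ε₀, Λ, κ, hε₀, hΛ, hκ, hfr⟩ := exists_adapted_frame m hN hGN hc C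
  refine ⟨N, ε₀, Λ, κ, hN, hGN, hε₀, hΛ, hκ, fun ε hε hε' Ω Φ hΩ hb hD hΦ hC hq hrob => ?_⟩
  have heq (z) (hz : z ∈ Ω) := det_eq_of_formOf_eq (hq z hz)
  have hframe (z) (hz : z ∈ Ω) : ∃ T, IsAdaptedFrame N Λ κ ε (mixedHess (stdFrame (m + 1)) Φ z)
      (holHess (stdFrame (m + 1)) Φ z) (grad (stdFrame (m + 1)) Φ z) T := by
    have hΦz : ContDiffAt ℝ 2 Φ z := by
      exact_mod_cast contDiffAt_infty.1 (hΦ.contDiffAt (hΩ.mem_nhds hz)) 2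
    have hn (i j) := norm_derivatives_le hΦz (hC z hz).1 (hC z hz).2 i j
    obtain ⟨h1, h2⟩ := hpt Ω Φ hΩ hb hD hΦ hrob z hz
    exact hfr ε hε hε' _ _ _ (mixedHess_isHermitian hΩ hΦ hz _) (fun i j => (hn i j).2.1)
      (fun i j => (hn i j).2.2) (fun i => (hn i i).1) h1 h2 (heq z hz)
  intro p hp
  obtain ⟨T, hT⟩ := hframe p hp
  refine ⟨T, ⟨hΩ, hΦ, hp, hε.ne', fun z hz h0 => ?_, fun z hz => hGN ▸ heq z hz, hT.det_ne, hT.diag⟩, hT⟩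
  -- Nondegeneracy of H at z comes from an adapted frame at z itself, where H is congruent to
  -- diag(1, …, 1, ε).
  obtain ⟨S, hS⟩ := hframe z hz
  have h := congrArg det hS.diag
  rw [det_mul, det_mul, h0, mul_zero, zero_mul] at h
  exact det_diagonal_lastWeight hε.ne' h.symm

end


/-- Here q = ε^{1/4}. The errors q⁴C(1 + Y) and q³DY are beaten by q²g(1 + Y), and q⁴CZ by q³gZ,
each with a spare factor q. The power ε^{3/4} of V is chosen strictly between √ε and ε for this
reason. -/
lemma absorb_energies_nonneg {q g C D Y Z : ℝ} (hq : 0 ≤ q) (hq1 : q ≤ 1) (hC : 0 ≤ C) (hD : 0 ≤ D)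
    (hY : 0 ≤ Y) (hZ : 0 ≤ Z) (h : q * (C + D) ≤ g) :
    0 ≤ -(C * (q ^ 4 * (1 + Y + Z))) + q ^ 2 * (g * (1 + Y)) + q ^ 3 * (g * Z - D * Y) := by
  have h2 : q ^ 2 * C ≤ q * C := mul_le_mul_of_nonneg_right (pow_le_of_le_one hq hq1 two_ne_zero) hC
  have hz : q * C ≤ g := by linarith [mul_nonneg hq hD]
  have hy : q ^ 2 * C + q * D ≤ g := by linarith
  have i1 : 0 ≤ q ^ 3 * Z := by positivity
  have i2 : 0 ≤ q ^ 2 * (1 + Y) := by positivity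
  have i3 : 0 ≤ q ^ 3 * D := by positivity
  linarith [mul_le_mul_of_nonneg_right hz i1, mul_le_mul_of_nonneg_right hy i2]

theorem proposition3p1 (m : ℕ) (hm : 1 ≤ m)
    (G : Matrix (Fin (m + 1)) (Fin (m + 1)) ℂ) (hG : G.PosDef)
    (δ : ℝ) (hδ : 0 < δ) (D C₂ : ℝ) :
    ∃ ε₀ : ℝ, 0 < ε₀ ∧ ∀ ε : ℝ, 0 < ε → ε < ε₀ →
      ∀ (Ω : Set (Cn (m + 1))) (Φ : Cn (m + 1) → ℝ),
        IsOpen Ω → Bornology.IsBounded Ω → Metric.diam Ω ≤ D →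
        ContDiffOn ℝ (⊤ : ℕ∞) Φ Ω →
        (∀ z ∈ Ω, ‖fderiv ℝ Φ z‖ ≤ C₂ ∧ ‖fderiv ℝ (fderiv ℝ Φ) z‖ ≤ C₂) →
        SolvesHessianQuotient G ε Ω Φ →
        RobustnessGT G Ω Φ δ →
        ∀ p ∈ Ω,
          ((mixedHess (stdFrame (m + 1)) Φ p).PosDef ∧ 0 < Sfun ε Φ p ∧
            0 ≤ Lop G ε Φ
              (fun z => -Real.log (Sfun ε Φ z) + Real.sqrt ε * (Wfun G Φ z + normSqG G z)) p) ∧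
          ∀ t : Module.Basis (Fin (m + 1)) ℂ (Cn (m + 1)), grad t Φ p (Fin.last m) ≠ 0 →
            (Amat t Φ p).PosDef ∧ IsUnit (1 - Kmat t Φ p) ∧
            0 ≤ Lop G ε Φ
              (fun z => traceInv t Φ z + Real.sqrt ε * (Wfun G Φ z + normSqG G z)
                + ε ^ (3 / 4 : ℝ) * Vfun G Φ z) p := by
  obtain ⟨N, ε₁, Λ, κ, hN, hGN, hε₁, hΛ, hκ, hE⟩ := exists_equationAt m hG hδ D C₂
  subst hGN
  -- K dominates the sizes required by `exists_traceInv_jets`. Q is Γ⁴ times the sum of all error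
  -- constants, so ε ≤ Q⁻⁴ gives q·(errors) ≤ Γ⁻⁴, the coercivity constant of W and V.
  obtain ⟨Γ, hΓ⟩ : ∃ Γ : ℝ, Γ = (m + 1) * Λ := ⟨_, rfl⟩
  obtain ⟨K, hK⟩ : ∃ K : ℝ, K = 2 * Γ ^ 7 + (m + 1) * κ⁻¹ := ⟨_, rfl⟩
  obtain ⟨Q, hQ⟩ : ∃ Q : ℝ, Q = Γ ^ 4 * (100 * K ^ 15 + 4 * Γ ^ 6 + 16 * Γ ^ 18) := ⟨_, rfl⟩
  have hm1 : (1 : ℝ) ≤ m + 1 := by linarith [(Nat.cast_nonneg m : (0 : ℝ) ≤ m)]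
  have hΓ1 : 1 ≤ Γ := hΓ ▸ one_le_mul_of_one_le_of_one_le hm1 hΛ
  have hΓ0 : 0 < Γ := by linarith
  have hK0 : 0 < K := by rw [hK]; positivity
  have hQ0 : 0 < Q := by rw [hQ]; positivity
  refine ⟨min (min ε₁ 1) (Q⁻¹ ^ 4), by positivity, fun ε hε hε' Ω Φ hΩ hb hD hΦ hC hq hrob p hp => ?_⟩
  have hεε₁ : ε < ε₁ := hε'.trans_le ((min_le_left _ _).trans (min_le_left _ _))
  have hε1 : ε ≤ 1 := hε'.le.trans ((min_le_left _ _).trans (min_le_right _ _))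
  have hεQ : ε ≤ Q⁻¹ ^ 4 := hε'.le.trans (min_le_right _ _)
  obtain ⟨T, E, A⟩ := hE ε hε hεε₁ Ω Φ hΩ hb hD hΦ hC hq hrob p hp
  -- the small parameter
  obtain ⟨q, hqe⟩ : ∃ q : ℝ, q = ε ^ (1 / 4 : ℝ) := ⟨_, rfl⟩
  have hq0 : 0 < q := hqe ▸ Real.rpow_pos_of_pos hε _
  have hq4 : q ^ 4 = ε := by
    rw [hqe, ← Real.rpow_natCast, ← Real.rpow_mul hε.le]; norm_num
  have hq3 : ε ^ (3 / 4 : ℝ) = q ^ 3 := by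
    rw [hqe, ← Real.rpow_natCast, ← Real.rpow_mul hε.le]; norm_num
  have hq2 : √ε = q ^ 2 := by
    rw [← hq4, show q ^ 4 = (q ^ 2) ^ 2 by ring, Real.sqrt_sq (by positivity)]
  have hqQ : q ≤ Q⁻¹ := by
    rw [← hq4] at hεQ
    exact le_of_pow_le_pow_left₀ (by norm_num) (by positivity) hεQ
  have hqQ1 : q * Q ≤ 1 := by
    have := mul_le_mul_of_nonneg_right hqQ hQ0.le
    rwa [inv_mul_cancel₀ hQ0.ne'] at this
  have hq1 : q ≤ 1 := by
    rw [← hq4] at hε1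
    exact (pow_le_one_iff_of_nonneg hq0.le (by norm_num)).1 hε1
  have hY0 := thirdEnergy_nonneg (B := N * T.conjTranspose) (Θ := third (frameOf T) Φ p) hε
  have hZ0 := EquationAt.holEnergy_nonneg (N := N) (T := T) (ε := ε) (Φ := Φ) (p := p)
  obtain ⟨w0, w1, w2, w3, hw, hwb⟩ := E.exists_Wfun_jets A hN hε hΛ
  obtain ⟨v0, v1, v2, v3, hv, hvb⟩ := E.exists_Vfun_jets A hN hε hΛ
  rw [← hΓ] at hwb hvb
  obtain ⟨Y, hY⟩ : ∃ Y, Y = thirdEnergy ε (N * T.conjTranspose) (third (frameOf T) Φ p) := ⟨_, rfl⟩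
  obtain ⟨Z, hZ⟩ : ∃ Z, Z = EquationAt.holEnergy N T ε Φ p := ⟨_, rfl⟩
  obtain ⟨w, hws⟩ : ∃ w, w = ∑ k, (w3 k).re := ⟨_, rfl⟩
  obtain ⟨v, hvs⟩ : ∃ v, v = ∑ k, (v3 k).re := ⟨_, rfl⟩
  rw [← hY] at hwb hvb hY0
  rw [← hZ] at hvb hZ0
  rw [← hws] at hwb
  rw [← hvs] at hvb
  have hw' : Γ⁻¹ ^ 4 * (1 + Y) ≤ w := by
    rw [inv_pow, inv_mul_le_iff₀ (by positivity)]; exact hwb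
  have hv' : Γ⁻¹ ^ 4 * Z - 4 * Γ ^ 6 * Y ≤ v := by
    rw [sub_le_iff_le_add, inv_pow, inv_mul_le_iff₀ (by positivity)]; exact hvb
  have hΓΓ : Γ⁻¹ ^ 4 * Γ ^ 4 = 1 := by rw [← mul_pow, inv_mul_cancel₀ hΓ0.ne', one_pow]
  have hqc : q * (100 * K ^ 15 + 4 * Γ ^ 6 + 16 * Γ ^ 18) ≤ Γ⁻¹ ^ 4 := by
    have h : 0 ≤ Γ⁻¹ ^ 4 := by positivity
    have := mul_le_mul_of_nonneg_left hqQ1 h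
    rw [mul_one] at this
    refine le_trans (le_of_eq ?_) this
    rw [hQ]
    linear_combination -(q * (100 * K ^ 15 + 4 * Γ ^ 6 + 16 * Γ ^ 18)) * hΓΓ
  have hsum (f g : Cn (m + 1) → ℝ) (s : ℝ) :
      (fun z => toC f z + (s : ℂ) * toC g z) = toC fun z => f z + s * g z := by
    funext z; simp [toC]
  refine ⟨⟨E.posDef_mixedHess hε, ?_⟩, fun t ht => ?_⟩
  · obtain ⟨hS, -, f0, f1, f2, f3, hf, hfb⟩ := E.exists_hasJet_neg_log_Sfun A hN hε hε1 hΛ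
    refine ⟨hS, ?_⟩
    have hj (k) := (hf k).add ((hw k).const_mul (√ε : ℂ))
    simp only [hsum] at hj
    rw [E.Lop_eq hj]
    simp only [Complex.add_re, Complex.re_ofReal_mul, Finset.sum_add_distrib, ← Finset.mul_sum]
    rw [← hws]
    rw [← hY, ← hΓ] at hfb
    refine le_trans ?_ (add_le_add hfb (mul_le_mul_of_nonneg_left hw' (Real.sqrt_nonneg ε)))
    rw [hq2, ← hq4]
    -- No purely holomorphic third derivatives occur for -log S, so Z = 0, D = 0 and V is not
    -- needed.
    have h := absorb_energies_nonneg (C := 16 * Γ ^ 18) (D := 0) hq0.le hq1 (by positivity) le_rfl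
      hY0 le_rfl (le_trans (mul_le_mul_of_nonneg_left (by
        rw [add_zero]; exact le_add_of_nonneg_left (by positivity)) hq0.le) hqc)
    rw [add_zero, mul_zero, zero_mul, sub_zero, mul_zero, add_zero] at h
    exact h.trans (le_of_eq (by ring))
  · obtain ⟨S, hS, hSt⟩ := exists_frameOf_eq t
    rw [← hSt] at ht ⊢
    obtain ⟨hA, hKu, f0, f1, f2, f3, hf, hfb⟩ := E.exists_traceInv_jets A hN hε hε1 hΛ hκ
      (K := K) (by rw [← hΓ, hK]; have : 0 ≤ (m + 1) * κ⁻¹ := by positivity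
                   linarith)
      (by rw [hK]; have : 0 ≤ 2 * Γ ^ 7 := by positivity
          linarith) hS ht
    refine ⟨hA, hKu, ?_⟩
    have hj' (k) := (hf k).add ((hw k).const_mul (√ε : ℂ))
    simp only [hsum] at hj'
    have hj (k) := (hj' k).add ((hv k).const_mul ((ε ^ (3 / 4 : ℝ) : ℝ) : ℂ))
    simp only [hsum] at hj
    rw [E.Lop_eq hj]
    simp only [Complex.add_re, Complex.re_ofReal_mul, Finset.sum_add_distrib, ← Finset.mul_sum]
    rw [← hws, ← hvs]
    rw [← hY, ← hZ] at hfb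
    refine le_trans ?_ (add_le_add (add_le_add hfb (mul_le_mul_of_nonneg_left hw'
      (Real.sqrt_nonneg ε))) (mul_le_mul_of_nonneg_left hv' (Real.rpow_nonneg hε.le _)))
    rw [hq2, hq3, ← hq4]
    exact absorb_energies_nonneg hq0.le hq1 (by positivity) (by positivity) hY0 hZ0
      (le_trans (mul_le_mul_of_nonneg_left (le_add_of_nonneg_right (by positivity)) hq0.le) hqc)
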